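/- **Notation.** $\mathcal P_{d,\ell}$ is the set of real polynomials in $d$ variables of degree at most $\ell$; $\mathcal U(S)$ is the uniform distribution on a finite multiset $S$; $d_{\mathrm{TV}}(\mathcal D,\mathcal D')=\sup_E|\mathcal D(E)-\mathcal D'(E)|$. For $A\ge 1$, a probability distribution $\mathcal D$ on $\mathbb R^d$ is *$A$-hypercontractive* if every coordinate has finite absolute expectation under $\mathcal D$ and $\mathbb E_{\mathcal D}|p|^t\le (At)^{t\deg p}\,(\mathbb E_{\mathcal D}|p|)^t$ for all polynomials $p$ and all real $t\ge2$. **Algorithm (Iterative Chow Filtering, ICF).** Input: functions $f_1,\dots,f_k:\mathbb R^d\to\{0,1\}$ (the family $\mathcal F$), finite nonempty multisets $S,S'\subset\mathbb R^d$, $\ell\ge1$, $R>1$, $\beta>0$, $\epsilon\in(0,1)$. Let $B=2\sqrt{2R(d+1)^\ell\beta/\epsilon}$, $\Delta=\epsilon^2/(B(2R+\epsilon))$, and for $f\in\mathcal F$ $$\mathcal P(f)=\Big\{p\in\mathcal P_{d,\ell}:\ \mathbb E_{\mathcal U(S)}[p^2]\le2\beta,\ \mathbb E_{\mathcal U(S)}[f|p|]\le\tfrac{2\epsilon}{2R+\epsilon}\Big\}.$$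 Call $x$ *tame* if $f(x)|p(x)|\le B$ for all $f\in\mathcal F$, $p\in\mathcal P(f)$, and let $S_0$ be the multiset of tame points of $S'$. For $i=1,2,\dots,|S_0|+1$: let $(f_i^\star,p_i^\star)$ be any maximizer, and $\mu_i^\star$ the maximum, of $\frac1{|S'|}\sum_{x\in S_{i-1}}f(x)p(x)$ over $f\in\mathcal F$, $p\in\mathcal P(f)$. If $\mu_i^\star\le\epsilon$, set $t=i-1$ and leave the loop. Otherwise let $\tau_i^\star$ be the least $\tau\ge0$ with $$\tfrac1{|S'|}\big|\{x\in S_{i-1}:f_i^\star(x)|p_i^\star(x)|>\tau\}\big|\ \ge\ R\Pr_{x\sim\mathcal U(S)}\big[f_i^\star(x)|p_i^\star(x)|>\tau\big]+\Delta,$$ and let $S_i=\{x\in S_{i-1}: f_i^\star(x)|p_i^\star(x)|\le\tau_i^\star\}$. Output the selector $s:\mathbb R^d\to\{0,1\}$ with $s(x)=1$ if and only if $x$ is tame and $f_i^\star(x)|p_i^\star(x)|\le\tau_i^\star$ for $i=1,\dots,t$. **Theorem.** *Running time.* Consider a real RAM with exact arithmetic $+,-,\times,/,\sqrt{\ }$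 on reals and comparisons, in which an evaluation of some $f_i$ at a point costs $d+1$ steps and the exact solution of a convex program (maximize a linear function under linear inequalities and one convex quadratic inequality) that is described by $N$ real numbers costs $N^e$ steps, for a fixed exponent $e$, with an arbitrary choice among the optimal solutions. There are two fixed programs such that, for all $d,\ell,k\ge1$ and all inputs as above, the first one implements ICF in time $k\cdot\mathrm{poly}(|S|,|S'|,(d+1)^\ell)$; in particular the loop is always left within $|S_0|+1$ iterations. It outputs a description of a selector $s$ returned by ICF, which consists of at most $k\,(1+\sqrt{\beta R^3/\epsilon^5})\,\mathrm{poly}(|S|,(d+1)^\ell)$ numbers and from which the second program computes $s(x)$, for every $x\in\mathbb R^d$, in time $k\,(1+\sqrt{\beta R^3/\epsilon^5})\,\mathrm{poly}(|S|,(d+1)^\ell)$. The polynomials depend only on $e$. *Guarantees.* There is a universal polynomial such that the following holds. Let $d,\ell,k\ge1$, $A\ge1$, $R>1$, $\beta>0$, $\epsilon,\delta\in(0,1)$, let $f_1,\dots,f_k:\mathbb R^d\to\{0,1\}$ be measurable, let $\mathcal D$ be an $A$-hypercontractive distribution on $\mathbb R^d$ and $\mathcal D'$ any distribution on $\mathbb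 R^d$. Let $S$ and $S'$ be independent multisets of i.i.d. samples from $\mathcal D$ and $\mathcal D'$ respectively, with $$|S|,|S'|\ \ge\ \mathrm{poly}\big(R,\beta,A^\ell,(d+1)^\ell,1/\epsilon,\log(k/\delta)^\ell\big).$$ 1. For any fixed $p_1,\dots,p_k\in\mathcal P_{d,\ell}$ with $\max_i\mathbb E_{\mathcal D}[p_i^2]\le\beta$, with probability at least $1-\delta$ over $S,S'$, every selector $s$ that ICF can return satisfies, for all $i\le k$, that $f_ip_is$ is $\mathcal D'$-integrable and $$\mathbb E_{\mathcal D'}[f_ip_is]\le(R+\epsilon)(1+\epsilon)\,\mathbb E_{\mathcal D}[f_i|p_i|]+2\epsilon.$$ 2. With probability at least $1-\delta$ over $S,S'$, every selector $s$ that ICF can return satisfies $$\Pr_{x\sim\mathcal D}[s(x)=0]\le\min\Big\{\frac{1+\epsilon}{R},\ \frac{d_{\mathrm{TV}}(\mathcal D,\mathcal D')+\epsilon}{R-1}\Big\}.$$ -/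

import Mathlib

open MeasureTheory

namespace ICF

noncomputable section

/-- The points of `ℝ^d`. -/
abbrev Pt (d : ℕ) : Type := Fin d → ℝ

/-- The value in `{0, 1} ⊆ ℝ` of a Boolean. -/
def bval (b : Bool) : ℝ := if b then 1 else 0

/-! ### Distributions -/

/-- `A`-hypercontractivity with respect to polynomials. The expectations are taken in `[0, ∞]`,
so that no integrability is presupposed in the moment inequality. -/
def Hypercontractive {d : ℕ} (A : ℝ) (D : Measure (Pt d)) : Prop :=
  (∀ (p : MvPolynomial (Fin d) ℝ) (t : ℝ), 2 ≤ t →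
    ∫⁻ x, ENNReal.ofReal (|MvPolynomial.eval x p| ^ t) ∂D ≤
      ENNReal.ofReal ((A * t) ^ (t * (p.totalDegree : ℝ))) *
        (∫⁻ x, ENNReal.ofReal |MvPolynomial.eval x p| ∂D) ^ t) ∧
  ∀ i : Fin d, Integrable (fun x : Pt d => x i) D

/-- Total variation distance: the supremum of `|D(E) - D'(E)|` over measurable sets `E`. -/
def tvDist {d : ℕ} (D D' : Measure (Pt d)) : ℝ :=
  ⨆ E : {E : Set (Pt d) // MeasurableSet E}, |D.real E.1 - D'.real E.1|

/-! ### The algorithm Iterative Chow Filtering -/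

/-- An input of the algorithm. The multisets `S`, `S'` are indexed families of points. -/
structure Input (d : ℕ) where
  /-- maximum polynomial degree -/
  deg : ℕ
  /-- number of classifiers -/
  k : ℕ
  /-- size of the reference sample -/
  m : ℕ
  /-- size of the test sample -/
  n : ℕ
  /-- multiplicative slack -/
  R : ℝ
  /-- polynomial variance bound -/
  β : ℝ
  /-- additive error -/
  ε : ℝ
  /-- the classifiers -/
  f : Fin k → Pt d → Bool
  /-- the reference sample -/
  S : Fin m → Pt d
  /-- the test sample -/
  S' : Fin n → Pt d

namespace Input

variable {d : ℕ} (I : Input d)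

/-- The range of parameters of the algorithm (with nonempty samples). -/
def Admissible : Prop :=
  1 ≤ d ∧ 1 ≤ I.deg ∧ 1 ≤ I.k ∧ 1 ≤ I.m ∧ 1 ≤ I.n ∧
    1 < I.R ∧ 0 < I.β ∧ 0 < I.ε ∧ I.ε < 1

/-- The bound `B`. -/
def B : ℝ := 2 * √(2 * I.R * ((d : ℝ) + 1) ^ I.deg * I.β / I.ε)

/-- The gap `Δ`. -/
def Δ : ℝ := I.ε ^ 2 / (I.B * (2 * I.R + I.ε))

/-- `f_i(x) p(x)`. -/
def chow (i : Fin I.k) (p : MvPolynomial (Fin d) ℝ) (x : Pt d) : ℝ :=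
  bval (I.f i x) * MvPolynomial.eval x p

/-- `f_i(x) |p(x)|`. -/
def absChow (i : Fin I.k) (p : MvPolynomial (Fin d) ℝ) (x : Pt d) : ℝ :=
  bval (I.f i x) * |MvPolynomial.eval x p|

/-- The set `𝒫(f_i)` of feasible polynomials. -/
def feasible (i : Fin I.k) : Set (MvPolynomial (Fin d) ℝ) :=
  {p | p.totalDegree ≤ I.deg ∧
    (∑ j, MvPolynomial.eval (I.S j) p ^ 2) / I.m ≤ 2 * I.β ∧
    (∑ j, I.absChow i p (I.S j)) / I.m ≤ 2 * I.ε / (2 * I.R + I.ε)}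

/-- `max_{f ∈ ℱ} max_{p ∈ 𝒫(f)} f(x) |p(x)| ≤ B`. -/
def Tame (x : Pt d) : Prop :=
  ∀ (i : Fin I.k), ∀ p ∈ I.feasible i, I.absChow i p x ≤ I.B

open Classical in
/-- `S_0`, as a set of indices of elements of the multiset `S'`. -/
def S₀ : Finset (Fin I.n) := {j | I.Tame (I.S' j)}

/-- The objective `(1/|S'|) ∑_{x ∈ T} f_i(x) p(x)`. -/
def objective (T : Finset (Fin I.n)) (i : Fin I.k) (p : MvPolynomial (Fin d) ℝ) : ℝ :=
  (∑ j ∈ T, I.chow i p (I.S' j)) / I.n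

/-- `(f_i, p)` solves the optimization problem for the current set `T`. -/
def IsSolution (T : Finset (Fin I.n)) (i : Fin I.k) (p : MvPolynomial (Fin d) ℝ) : Prop :=
  p ∈ I.feasible i ∧ ∀ (i' : Fin I.k), ∀ q ∈ I.feasible i', I.objective T i' q ≤ I.objective T i p

open Classical in
/-- What survives the filtering step with threshold `τ`. -/
def filtered (T : Finset (Fin I.n)) (i : Fin I.k) (p : MvPolynomial (Fin d) ℝ) (τ : ℝ) :
    Finset (Fin I.n) :=
  {j ∈ T | I.absChow i p (I.S' j) ≤ τ}

open Classical in
/-- `τ` is the minimum nonnegative number with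
`|T|/|S'| * Pr_{x ∼ U(T)} [f_i(x)|p(x)| > τ] ≥ R * Pr_{x ∼ U(S)} [f_i(x)|p(x)| > τ] + Δ`;
the left-hand side is the number of `x ∈ T` with `f_i(x)|p(x)| > τ`, over `|S'|`. -/
def IsThreshold (T : Finset (Fin I.n)) (i : Fin I.k) (p : MvPolynomial (Fin d) ℝ) (τ : ℝ) :
    Prop :=
  IsLeast {θ : ℝ | 0 ≤ θ ∧
    I.R * (((Finset.univ.filter fun j => θ < I.absChow i p (I.S j)).card : ℝ) / I.m) + I.Δ ≤
      ((T.filter fun j => θ < I.absChow i p (I.S' j)).card : ℝ) / I.n} τ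

/-- `I.Loop T L`: started from the current set `T`, the loop can perform exactly the filtering
steps `(f_i, p, τ)` listed in `L` and then break. Ties between maximizers may be broken in any
way. -/
inductive Loop : Finset (Fin I.n) → List (Fin I.k × MvPolynomial (Fin d) ℝ × ℝ) → Prop
  | halt (T : Finset (Fin I.n)) (i : Fin I.k) (p : MvPolynomial (Fin d) ℝ)
      (hsol : I.IsSolution T i p) (hle : I.objective T i p ≤ I.ε) : Loop T []
  | step (T : Finset (Fin I.n)) (i : Fin I.k) (p : MvPolynomial (Fin d) ℝ) (τ : ℝ)
      (L : List (Fin I.k × MvPolynomial (Fin d) ℝ × ℝ))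
      (hsol : I.IsSolution T i p) (hgt : I.ε < I.objective T i p)
      (hτ : I.IsThreshold T i p τ) (hrest : Loop (I.filtered T i p τ) L) :
      Loop T ((i, p, τ) :: L)

/-- `s` is a selector that the algorithm can return: the loop breaks within its `|S_0| + 1`
iterations, after the `t` filtering steps `L`, and `s` is the product of the indicators. -/
def IsOutput (s : Pt d → Bool) : Prop :=
  ∃ L : List (Fin I.k × MvPolynomial (Fin d) ℝ × ℝ),
    I.Loop I.S₀ L ∧ L.length ≤ I.S₀.card ∧
    ∀ x, s x = true ↔ I.Tame x ∧ ∀ q ∈ L, I.absChow q.1 q.2.1 x ≤ q.2.2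

end Input

/-! ### Convex programs -/

/-- Maximize `c · y` subject to `A y ≤ b` and `yᵀ Q y ≤ γ`. -/
structure ConvexProgram where
  nv : ℕ
  nc : ℕ
  A : Matrix (Fin nc) (Fin nv) ℝ
  b : Fin nc → ℝ
  Q : Matrix (Fin nv) (Fin nv) ℝ
  γ : ℝ
  c : Fin nv → ℝ

namespace ConvexProgram

/-- The feasible region. -/
def Feasible (P : ConvexProgram) (y : Fin P.nv → ℝ) : Prop :=
  (∀ r, ∑ j, P.A r j * y j ≤ P.b r) ∧ ∑ i, ∑ j, y i * P.Q i j * y j ≤ P.γ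

/-- `y` is an optimal solution. -/
def IsOptimal (P : ConvexProgram) (y : Fin P.nv → ℝ) : Prop :=
  P.Feasible y ∧ ∀ z, P.Feasible z → ∑ j, P.c j * z j ≤ ∑ j, P.c j * y j

/-- The number of reals that describe the program. -/
def size (P : ConvexProgram) : ℕ := P.nc * P.nv + P.nc + P.nv * P.nv + 1 + P.nv

end ConvexProgram

/-- A tie-breaking rule for convex programs: if `Q` is positive semidefinite, so that the program
is convex, it returns an optimal solution if there is one, and otherwise reports that there is
none. Nothing is known about its answer if `Q` is not positive semidefinite. -/
structure Solver where
  answer : (P : ConvexProgram) → Option (Fin P.nv → ℝ)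
  optimal : ∀ P y, P.Q.PosSemidef → answer P = some y → P.IsOptimal y
  complete : ∀ P, P.Q.PosSemidef → answer P = none → ∀ y, ¬ P.IsOptimal y

open Classical in
theorem Solver.nonempty : Nonempty Solver :=
  ⟨{ answer := fun P => if h : ∃ y, P.IsOptimal y then some h.choose else none
     optimal := by
      intro P y _ h
      by_cases hy : ∃ y, P.IsOptimal y
      · rw [dif_pos hy] at h
        rw [← Option.some.inj h]
        exact hy.choose_spec
      · rw [dif_neg hy] at h
        exact absurd h (by simp)
     complete := by
      intro P _ h y hy
      rw [dif_pos ⟨y, hy⟩] at h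
      exact absurd h (by simp) }⟩

/-! ### The machine model

A real RAM with finitely many unbounded two-dimensional arrays of natural numbers and of reals,
exact real arithmetic with square roots, addition and truncated subtraction of naturals,
evaluation of the given classifiers, and convex programming. -/

/-- Memory: `N a i j` and `Q a i j` are the cells `(i, j)` of the `a`-th arrays of naturals and
of reals. -/
structure Mem where
  N : ℕ → ℕ → ℕ → ℕ
  Q : ℕ → ℕ → ℕ → ℝ

namespace Mem

/-- Overwrite one cell of naturals. -/
def setN (σ : Mem) (a i j v : ℕ) : Mem :=
  { σ with N := fun a' i' j' => if a' = a ∧ i' = i ∧ j' = j then v else σ.N a' i' j' }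

/-- Overwrite one cell of reals. -/
def setQ (σ : Mem) (a i j : ℕ) (v : ℝ) : Mem :=
  { σ with Q := fun a' i' j' => if a' = a ∧ i' = i ∧ j' = j then v else σ.Q a' i' j' }

/-- Overwrite the first `r` cells of row `0` of an array of reals. -/
def setRow (σ : Mem) (a : ℕ) {r : ℕ} (y : Fin r → ℝ) : Mem :=
  { σ with Q := fun a' i' j' =>
      if h : a' = a ∧ i' = 0 ∧ j' < r then y ⟨j', h.2.2⟩ else σ.Q a' i' j' }

end Mem

/-- Expressions with natural values; `get a i j` reads the cell `(i, j)` of array `a`. -/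
inductive NExp
  | lit (v : ℕ)
  | get (a : ℕ) (i j : NExp)
  | add (x y : NExp)
  | sub (x y : NExp)

namespace NExp

/-- Value. -/
def val (σ : Mem) : NExp → ℕ
  | lit v => v
  | get a i j => σ.N a (i.val σ) (j.val σ)
  | add x y => x.val σ + y.val σ
  | sub x y => x.val σ - y.val σ

/-- Number of elementary operations. -/
def cost : NExp → ℕ
  | lit _ => 1
  | get _ i j => i.cost + j.cost + 1
  | add x y => x.cost + y.cost + 1
  | sub x y => x.cost + y.cost + 1

end NExp

/-- Expressions with real values. -/
inductive RExp
  | lit (v : ℚ)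
  | ofN (x : NExp)
  | get (a : ℕ) (i j : NExp)
  | add (x y : RExp)
  | sub (x y : RExp)
  | mul (x y : RExp)
  | div (x y : RExp)
  | sqrt (x : RExp)

namespace RExp

/-- Value. -/
def val (σ : Mem) : RExp → ℝ
  | lit v => (v : ℝ)
  | ofN x => (x.val σ : ℝ)
  | get a i j => σ.Q a (i.val σ) (j.val σ)
  | add x y => x.val σ + y.val σ
  | sub x y => x.val σ - y.val σ
  | mul x y => x.val σ * y.val σ
  | div x y => x.val σ / y.val σ
  | sqrt x => √(x.val σ)

/-- Number of elementary operations. -/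
def cost : RExp → ℕ
  | lit _ => 1
  | ofN x => x.cost + 1
  | get _ i j => i.cost + j.cost + 1
  | add x y => x.cost + y.cost + 1
  | sub x y => x.cost + y.cost + 1
  | mul x y => x.cost + y.cost + 1
  | div x y => x.cost + y.cost + 1
  | sqrt x => x.cost + 1

end RExp

/-- Tests. -/
inductive Test
  | leN (x y : NExp)
  | leR (x y : RExp)
  | neg (b : Test)
  | conj (b c : Test)

namespace Test

/-- The test succeeds. -/
def Holds (σ : Mem) : Test → Prop
  | leN x y => x.val σ ≤ y.val σ
  | leR x y => x.val σ ≤ y.val σ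
  | neg b => ¬ b.Holds σ
  | conj b c => b.Holds σ ∧ c.Holds σ

/-- Number of elementary operations. -/
def cost : Test → ℕ
  | leN x y => x.cost + y.cost + 1
  | leR x y => x.cost + y.cost + 1
  | neg b => b.cost + 1
  | conj b c => b.cost + c.cost + 1

end Test

/-- Programs. -/
inductive Prog
  | skip
  /-- store a natural in cell `(i, j)` of array `a` -/
  | putN (a : ℕ) (i j e : NExp)
  /-- store a real in cell `(i, j)` of array `a` -/
  | putR (a : ℕ) (i j : NExp) (e : RExp)
  /-- store in cell `(0, 0)` of the array `out` of naturals the value of the classifier number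
  `i` at the point that stands in row `r` of the array `a` of reals -/
  | classify (out : ℕ) (i : NExp) (a : ℕ) (r : NExp)
  /-- solve the convex program with `nv` variables and `nc` linear constraints whose data stand in
  the given arrays of reals (vectors in row `0`, `γ` in cell `(0, 0)`); the solution goes to row
  `0` of the array `out` of reals, and cell `(0, 0)` of the array `flag` of naturals tells whether
  there is one -/
  | solve (nv nc : NExp) (A b Q γ c out flag : ℕ)
  | seq (P₁ P₂ : Prog)
  | ite (t : Test) (P₁ P₂ : Prog)
  | loop (t : Test) (P : Prog)

/-- What a machine is equipped with: the classifiers, the tie-breaking rule for convex programs,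
and the exponent `e` of their price: a program described by `N` reals costs `N ^ e` steps. -/
structure Equipment (d : ℕ) where
  k : ℕ
  f : Fin k → Pt d → Bool
  solver : Solver
  e : ℕ

namespace Equipment

variable {d : ℕ} (M : Equipment d)

/-- Value in `{0, 1}` of classifier number `i` (zero beyond the last one). -/
def query (i : ℕ) (x : Pt d) : ℕ :=
  if h : i < M.k then (if M.f ⟨i, h⟩ x then 1 else 0) else 0

/-- The convex program that stands in memory. -/
def programAt (σ : Mem) (nv nc A b Q γ c : ℕ) : ConvexProgram where
  nv := nv
  nc := nc
  A := fun i j => σ.Q A i j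
  b := fun i => σ.Q b 0 i
  Q := fun i j => σ.Q Q i j
  γ := σ.Q γ 0 0
  c := fun j => σ.Q c 0 j

/-- The effect of solving `P`. -/
def afterSolve (σ : Mem) (P : ConvexProgram) (out flag : ℕ) : Mem :=
  match M.solver.answer P with
  | some y => (σ.setRow out y).setN flag 0 0 1
  | none => σ.setN flag 0 0 0

/-- `M.Exec P σ T σ'`: started in `σ`, the program `P` halts after `T` steps in `σ'`. -/
inductive Exec : Prog → Mem → ℕ → Mem → Prop
  | skip (σ : Mem) : Exec Prog.skip σ 1 σ
  | putN (σ : Mem) (a : ℕ) (i j e : NExp) :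
      Exec (Prog.putN a i j e) σ (i.cost + j.cost + e.cost + 1)
        (σ.setN a (i.val σ) (j.val σ) (e.val σ))
  | putR (σ : Mem) (a : ℕ) (i j : NExp) (e : RExp) :
      Exec (Prog.putR a i j e) σ (i.cost + j.cost + e.cost + 1)
        (σ.setQ a (i.val σ) (j.val σ) (e.val σ))
  | classify (σ : Mem) (out : ℕ) (i : NExp) (a : ℕ) (r : NExp) :
      Exec (Prog.classify out i a r) σ (i.cost + r.cost + d + 1)
        (σ.setN out 0 0 (M.query (i.val σ) fun j : Fin d => σ.Q a (r.val σ) j))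
  | solve (σ : Mem) (nv nc : NExp) (A b Q γ c out flag : ℕ) :
      Exec (Prog.solve nv nc A b Q γ c out flag) σ
        (nv.cost + nc.cost + (programAt σ (nv.val σ) (nc.val σ) A b Q γ c).size ^ M.e + 1)
        (M.afterSolve σ (programAt σ (nv.val σ) (nc.val σ) A b Q γ c) out flag)
  | seq (P₁ P₂ : Prog) (σ σ₁ σ₂ : Mem) (T₁ T₂ : ℕ)
      (h₁ : Exec P₁ σ T₁ σ₁) (h₂ : Exec P₂ σ₁ T₂ σ₂) :
      Exec (Prog.seq P₁ P₂) σ (T₁ + T₂) σ₂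
  | iteTrue (t : Test) (P₁ P₂ : Prog) (σ σ' : Mem) (T : ℕ)
      (ht : t.Holds σ) (h : Exec P₁ σ T σ') :
      Exec (Prog.ite t P₁ P₂) σ (t.cost + T) σ'
  | iteFalse (t : Test) (P₁ P₂ : Prog) (σ σ' : Mem) (T : ℕ)
      (ht : ¬ t.Holds σ) (h : Exec P₂ σ T σ') :
      Exec (Prog.ite t P₁ P₂) σ (t.cost + T) σ'
  | loopStop (t : Test) (P : Prog) (σ : Mem) (ht : ¬ t.Holds σ) :
      Exec (Prog.loop t P) σ t.cost σ
  | loopStep (t : Test) (P : Prog) (σ σ₁ σ₂ : Mem) (T₁ T₂ : ℕ)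
      (ht : t.Holds σ) (h₁ : Exec P σ T₁ σ₁) (h₂ : Exec (Prog.loop t P) σ₁ T₂ σ₂) :
      Exec (Prog.loop t P) σ (t.cost + T₁ + T₂) σ₂

end Equipment

/-! ### Input and output conventions -/

/-- The initial memory of the filtering program: row `0` of the array `0` of naturals holds
`d, ℓ, k, |S|, |S'|`, row `0` of the array `0` of reals holds `R, β, ε`, and the arrays `1` and `2`
of reals hold `S` and `S'`, one point per row. All other cells are zero. -/
def Input.mem {d : ℕ} (I : Input d) : Mem where
  N := fun a i j =>
    if a = 0 ∧ i = 0 then ([d, I.deg, I.k, I.m, I.n] : List ℕ).getD j 0 else 0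
  Q := fun a i j =>
    if a = 0 ∧ i = 0 then ([I.R, I.β, I.ε] : List ℝ).getD j 0
    else if a = 1 then
      (if h : i < I.m ∧ j < d then I.S ⟨i, h.1⟩ ⟨j, h.2⟩ else 0)
    else if a = 2 then
      (if h : i < I.n ∧ j < d then I.S' ⟨i, h.1⟩ ⟨j, h.2⟩ else 0)
    else 0

/-- The equipment for an input. -/
def Input.equip {d : ℕ} (I : Input d) (solver : Solver) (e : ℕ) : Equipment d :=
  ⟨I.k, I.f, solver, e⟩

/-- A description of a function: finitely many naturals and finitely many reals. -/
structure Desc where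
  nats : List ℕ
  reals : List ℝ

/-- Length of a description. -/
def Desc.length (D : Desc) : ℕ := D.nats.length + D.reals.length

/-- The description that a program leaves in memory: the cells `(0, 0)` and `(0, 1)` of the array
`0` of naturals tell how many naturals and reals it has, and they stand in row `0` of the arrays
`1` of naturals and of reals. -/
def Mem.desc (σ : Mem) : Desc where
  nats := List.ofFn fun j : Fin (σ.N 0 0 0) => σ.N 1 0 j
  reals := List.ofFn fun j : Fin (σ.N 0 0 1) => σ.Q 1 0 j

/-- The initial memory of the evaluation program: the description in the same format, and the
point `x` in row `0` of the array `0` of reals. All other cells are zero. -/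
def Desc.mem {d : ℕ} (D : Desc) (x : Pt d) : Mem where
  N := fun a i j =>
    if a = 0 ∧ i = 0 then ([D.nats.length, D.reals.length] : List ℕ).getD j 0
    else if a = 1 ∧ i = 0 then D.nats.getD j 0 else 0
  Q := fun a i j =>
    if a = 0 ∧ i = 0 then (if h : j < d then x ⟨j, h⟩ else 0)
    else if a = 1 ∧ i = 0 then D.reals.getD j 0 else 0

/-- The program `ev`, started on the description `D` and a point `x`, outputs `s x` in cell
`(0, 0)` of the array `0` of naturals, within `bound` steps. -/
def Computes {d : ℕ} (M : Equipment d) (ev : Prog) (D : Desc) (s : Pt d → Bool) (bound : ℝ) :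
    Prop :=
  ∀ x : Pt d, ∃ (T : ℕ) (σ : Mem), M.Exec ev (D.mem x) T σ ∧ (T : ℝ) ≤ bound ∧
    σ.N 0 0 0 = if s x then 1 else 0

end

end ICF

namespace ICF

/-! ### Monomials indexed by base-`(d+1)` words -/

/-! The loop looks for a classifier `f` and a feasible polynomial `p` whose mean over the surviving
test points exceeds `ε`, and then cuts off an upper tail of `f|p|` that weighs at least `R` times as
much on the test sample as on the reference sample. Feasibility bounds the reference mean of `f|p|`
by `2ε/(2R+ε)`, and tameness bounds `f|p|` by `B`. If no tail were too heavy, integrating the tail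
inequalities over the levels in `[0, B]` would bound the objective by `R · 2ε/(2R+ε) + BΔ = ε`
(`sum_le_of_tails`, `Input.thresholdSet_nonempty`). Hence a threshold exists, each cut removes at
least `Δ|S'|` points, and there are at most `1/Δ` filters, a bound free of the sample sizes
(`Input.Loop.length_le_inv`). When the loop is left, no feasible polynomial has objective above `ε`
on the survivors (`Input.Loop.objective_survivors`). Adding the threshold inequalities of all cuts
shows that the fraction of `S` rejected by the filters is at most `1/R` times the fraction of `S'`
that is tame and rejected (`Input.Loop.rejected_le`).

These empirical statements are transferred to the distributions by uniform convergence. Tameness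
depends on `S` alone and so is independent of `S'`. The filters depend on both samples, but each one
is a classifier bit combined with two halfspaces in feature space; a Radon argument and Sauer–Shelah
bound the number of patterns that a tuple of filters cuts out of a finite set
(`exists_accept_patterns`). Symmetrization with exponential moments gives one-sided uniform
convergence for countable classes (`uniform_convergence`); strict violations survive a passage to
rational filters (`exists_rat_violation`), and Fubini allows the integrand to depend on `S`
(`uniform_convergence_sel_prod`).

On the reference side, hypercontractivity controls moments of order `4 + log(k/δ)`, so that
truncation and Hoeffding's inequality give concentration of polynomial means (`concentration`,
`concentration_poly`). Applied to products of an orthogonal family, this makes all empirical second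
moments accurate up to a factor, the property `CovGood` (`measure_not_covGood_le`). It implies that
most points are tame, by Markov's inequality for `∑ ψ²/λ` (`measure_not_tame_le`), and that each
target `p_i`, divided by a suitable `ν ≥ 1`, is feasible. The guarantees then follow in `chow_bound`
and `rejection_bound`.

For the running time, polynomials are coefficient vectors indexed by words in base `d+1`, and
maximizing a linear function over feasible ones is a convex program with slack variables for the
absolute values on `S`. Coefficients may be unbounded, but a linear function that is bounded above
factors through the values on `S`, which range over a compact set (`exists_max_of_bounded`); the
loop objective is bounded since the points are tame. In the tameness test, absence of an optimum
means unboundedness and hence a point that is not tame. Thresholds are found among finitely many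
sample values (`Input.exists_candidate`). The machine programs are verified by Hoare-style rules
(`Runs`, `Runs.forN`), with costs measured as powers of one size parameter (`budget`). The
description stores `S` and the filters but not `S'`, so evaluation does not depend on `|S'|`. -/

/-- The homogenized variables: `1, X_0, …, X_{d-1}`. -/
noncomputable def homVar (d b : ℕ) : MvPolynomial (Fin d) ℝ :=
  if h : b - 1 < d ∧ b ≠ 0 then MvPolynomial.X ⟨b - 1, h.1⟩ else 1

/-- The monomial whose factors are given by the base-`(d+1)` digits of `w`. -/
noncomputable def mono (d w : ℕ) : MvPolynomial (Fin d) ℝ :=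
  ((Nat.digits (d + 1) w).map (homVar d)).prod

/-- The polynomial with coefficient vector `c`. -/
noncomputable def polyOf (d N : ℕ) (c : ℕ → ℝ) : MvPolynomial (Fin d) ℝ :=
  ∑ w ∈ Finset.range N, MvPolynomial.C (c w) * mono d w

/-- The value of the monomial number `w`. -/
noncomputable def feature {d : ℕ} (x : Pt d) (w : ℕ) : ℝ := MvPolynomial.eval x (mono d w)

lemma homVar_totalDegree (d b : ℕ) : (homVar d b).totalDegree ≤ 1 := by
  unfold homVar
  split_ifs
  · simp
  · simp

lemma mono_zero (d : ℕ) : mono d 0 = 1 := by simp [mono]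

lemma mono_rec {d w : ℕ} (hd : 1 ≤ d) :
    mono d w = mono d (w / (d + 1)) * homVar d (w % (d + 1)) := by
  rcases Nat.eq_zero_or_pos w with rfl | hw
  · simp [mono_zero, homVar]
  · rw [mono, Nat.digits_def' (by omega) hw, List.map_cons, List.prod_cons, mul_comm]
    rfl

lemma list_prod_totalDegree_le {d : ℕ} (l : List ℕ) :
    ((l.map (homVar d)).prod).totalDegree ≤ l.length := by
  induction l with
  | nil => simp
  | cons a l ih =>
    rw [List.map_cons, List.prod_cons, List.length_cons]
    refine (MvPolynomial.totalDegree_mul _ _).trans ?_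
    have := homVar_totalDegree d a
    omega

lemma mono_totalDegree {d w l : ℕ} (hd : 1 ≤ d) (hw : w < (d + 1) ^ l) :
    (mono d w).totalDegree ≤ l :=
  (list_prod_totalDegree_le _).trans ((Nat.digits_length_le_iff (by omega) w).2 hw)

lemma polyOf_totalDegree {d l : ℕ} (hd : 1 ≤ d) (c : ℕ → ℝ) :
    (polyOf d ((d + 1) ^ l) c).totalDegree ≤ l := by
  refine (MvPolynomial.totalDegree_finsetSum _ _).trans (Finset.sup_le fun w hw => ?_)
  refine (MvPolynomial.totalDegree_mul _ _).trans ?_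
  rw [MvPolynomial.totalDegree_C, zero_add]
  exact mono_totalDegree hd (Finset.mem_range.1 hw)

lemma eval_polyOf {d N : ℕ} (c : ℕ → ℝ) (x : Pt d) :
    MvPolynomial.eval x (polyOf d N c) = ∑ w ∈ Finset.range N, c w * feature x w := by
  simp [polyOf, feature]

lemma feature_zero {d : ℕ} (x : Pt d) : feature x 0 = 1 := by simp [feature, mono_zero]

/-- Deleting the lowest digit of the word removes one factor. The machine fills its feature table by
this recursion, with at most one multiplication per entry. -/
lemma feature_rec {d : ℕ} (hd : 1 ≤ d) (x : Pt d) (w : ℕ) :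
    feature x w = feature x (w / (d + 1)) *
      (if h : w % (d + 1) - 1 < d ∧ w % (d + 1) ≠ 0 then x ⟨w % (d + 1) - 1, h.1⟩ else 1) := by
  rw [feature, mono_rec hd, map_mul, feature, homVar]
  split_ifs <;> simp

/-- Induction on the length of words: a variable that occurs in the monomial is split off and
appended as the digit `i + 1`. The digit `0` stands for the factor `1`, so words below `(d+1)^l`
also cover monomials of degree less than `l`. -/
lemma monomial_eq_mono {d : ℕ} (hd : 1 ≤ d) (l : ℕ) (s : Fin d →₀ ℕ)
    (hs : (s.sum fun _ e => e) ≤ l) :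
    ∃ w < (d + 1) ^ l, MvPolynomial.monomial s (1 : ℝ) = mono d w := by
  induction l generalizing s with
  | zero =>
    have h0 : s = 0 := by
      ext i
      by_contra h
      have hi : i ∈ s.support := by simpa using h
      have := Finset.single_le_sum (f := fun i => s i) (fun _ _ => Nat.zero_le _) hi
      rw [Finsupp.sum] at hs
      simp only [Finsupp.coe_zero, Pi.zero_apply] at h
      omega
    refine ⟨0, by simp, ?_⟩
    rw [h0, mono_zero]; rfl
  | succ l ih =>
    by_cases h0 : s = 0
    · refine ⟨0, by positivity, ?_⟩
      rw [h0, mono_zero]; rfl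
    · obtain ⟨i, hi⟩ := Finsupp.ne_iff.1 h0
      simp only [Finsupp.coe_zero, Pi.zero_apply] at hi
      have hsub : Finsupp.single i 1 ≤ s := by
        intro j
        by_cases hj : i = j
        · subst hj; simp; omega
        · simp [hj]
      have hadd : s = (s - Finsupp.single i 1) + Finsupp.single i 1 :=
        (tsub_add_cancel_of_le hsub).symm
      have hsum : ((s - Finsupp.single i 1).sum fun _ e => e) + 1 = s.sum fun _ e => e := by
        conv_rhs => rw [hadd]
        rw [Finsupp.sum_add_index' (by simp) (by simp), Finsupp.sum_single_index rfl]
      obtain ⟨w, hw, hmw⟩ := ih (s - Finsupp.single i 1) (by omega)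
      have hi' := i.2
      have hdiv : (w * (d + 1) + (i + 1)) / (d + 1) = w := by
        rw [mul_comm, Nat.mul_add_div (by omega), Nat.div_eq_of_lt (by omega), add_zero]
      have hmod : (w * (d + 1) + (i + 1)) % (d + 1) = i + 1 := by
        rw [mul_comm, Nat.mul_add_mod, Nat.mod_eq_of_lt (by omega)]
      refine ⟨w * (d + 1) + (i + 1), ?_, ?_⟩
      · rw [pow_succ]
        calc w * (d + 1) + (i + 1) < w * (d + 1) + (d + 1) := by omega
          _ = (w + 1) * (d + 1) := by ring
          _ ≤ _ := Nat.mul_le_mul_right _ hw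
      · rw [mono_rec hd, hdiv, hmod, ← hmw]
        conv_lhs => rw [hadd]
        have : homVar d (i + 1) = MvPolynomial.monomial (Finsupp.single i 1) (1 : ℝ) := by
          rw [homVar, dif_pos ⟨by omega, by omega⟩]
          rfl
        rw [this, MvPolynomial.monomial_mul, one_mul]

/-- Different words can give the same monomial, so the coefficient vector is not unique; one word is
chosen for each monomial of the support. Summing over the fibre of a word avoids a proof that the
choice is injective. -/
lemma exists_polyOf {d l : ℕ} (hd : 1 ≤ d) (p : MvPolynomial (Fin d) ℝ)
    (hp : p.totalDegree ≤ l) : ∃ c : ℕ → ℝ, p = polyOf d ((d + 1) ^ l) c := by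
  have key : ∀ s ∈ p.support, ∃ w < (d + 1) ^ l,
      MvPolynomial.monomial s (1 : ℝ) = mono d w := fun s hs =>
    monomial_eq_mono hd l s ((MvPolynomial.le_totalDegree hs).trans hp)
  choose! w hw hmw using key
  refine ⟨fun v => ∑ s ∈ p.support with w s = v, p.coeff s, ?_⟩
  rw [polyOf]
  conv_lhs => rw [MvPolynomial.as_sum p]
  have hmaps : ∀ s ∈ p.support, w s ∈ Finset.range ((d + 1) ^ l) := fun s hs =>
    Finset.mem_range.2 (hw s hs)
  rw [← Finset.sum_fiberwise_of_maps_to hmaps]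
  refine Finset.sum_congr rfl fun v _ => ?_
  rw [map_sum, Finset.sum_mul]
  refine Finset.sum_congr rfl fun s hs => ?_
  obtain ⟨hs1, rfl⟩ := Finset.mem_filter.1 hs
  rw [← hmw s hs1, MvPolynomial.C_mul_monomial, mul_one]

/-! ### Elementary facts on inputs -/

namespace Input

variable {d : ℕ} {I : Input d}

lemma B_pos (h : I.Admissible) : 0 < I.B := by
  obtain ⟨hd, h1, h2, h3, h4, h5, h6, h7, h8⟩ := h
  unfold B
  have : 0 < I.R := by linarith
  positivity

lemma Δ_pos (h : I.Admissible) : 0 < I.Δ := by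
  have hB := B_pos h
  obtain ⟨hd, h1, h2, h3, h4, h5, h6, h7, h8⟩ := h
  unfold Δ
  have : 0 < I.R := by linarith
  positivity

/-- This is why `Δ` has its form: the product fills exactly the gap between `R · 2ε/(2R+ε)` and `ε`.
-/
lemma B_mul_Δ (h : I.Admissible) : I.B * I.Δ = I.ε ^ 2 / (2 * I.R + I.ε) := by
  have hB := B_pos h
  unfold Δ
  field_simp

lemma absChow_nonneg (i : Fin I.k) (p : MvPolynomial (Fin d) ℝ) (x : Pt d) :
    0 ≤ I.absChow i p x := by
  unfold absChow bval
  split_ifs <;> simp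

lemma chow_le_absChow (i : Fin I.k) (p : MvPolynomial (Fin d) ℝ) (x : Pt d) :
    I.chow i p x ≤ I.absChow i p x := by
  unfold absChow chow bval
  split_ifs
  · simpa using le_abs_self _
  · simp

lemma zero_mem_feasible (h : I.Admissible) (i : Fin I.k) : 0 ∈ I.feasible i := by
  obtain ⟨hd, h1, h2, h3, h4, h5, h6, h7, h8⟩ := h
  have : 0 < I.R := by linarith
  refine ⟨by simp, ?_, ?_⟩
  · simp; positivity
  · simp [absChow]; positivity

end Input
end ICF

namespace ICF

/-! ### Layer cake inequality and deterministic properties of the loop -/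

lemma integral_ite_lt {g B : ℝ} (hg : 0 ≤ g) (hB : 0 ≤ B) :
    ∫ θ in (0 : ℝ)..B, (if θ < g then (1 : ℝ) else 0) = min g B := by
  have h1 : (fun θ : ℝ => if θ < g then (1 : ℝ) else 0) = (Set.Iio g).indicator 1 := by
    ext θ; simp [Set.indicator_apply]
  rw [h1, intervalIntegral.integral_of_le hB, setIntegral_indicator measurableSet_Iio]
  rcases le_total g B with h | h
  · have : Set.Ioc 0 B ∩ Set.Iio g = Set.Ioo 0 g := by
      ext θ
      simp only [Set.mem_inter_iff, Set.mem_Ioc, Set.mem_Iio, Set.mem_Ioo]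
      exact ⟨fun h => ⟨h.1.1, h.2⟩, fun h' => ⟨⟨h'.1, h'.2.le.trans h⟩, h'.2⟩⟩
    rw [this, min_eq_left h]
    simp [hg]
  · have : (Set.Ioc 0 B ∩ Set.Iio g : Set ℝ) =ᵐ[volume] Set.Ioc 0 B := by
      have hb : ∀ᵐ θ : ℝ, θ ≠ B := by simp [ae_iff, measure_singleton]
      filter_upwards [hb] with θ hθ
      refine propext ⟨fun h => h.1, fun h' => ⟨h', ?_⟩⟩
      exact (lt_of_le_of_ne h'.2 hθ).trans_le h
    rw [setIntegral_congr_set this, min_eq_right h]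
    simp [hB]

lemma intervalIntegrable_ite_lt (g a b : ℝ) :
    IntervalIntegrable (fun θ : ℝ => if θ < g then (1 : ℝ) else 0) volume a b := by
  have h1 : (fun θ : ℝ => if θ < g then (1 : ℝ) else 0) = (Set.Iio g).indicator 1 := by
    ext θ; simp [Set.indicator_apply]
  rw [h1, intervalIntegrable_iff]
  exact IntegrableOn.indicator (by simp [Pi.one_def]) measurableSet_Iio

/-- If every upper tail of the weighted values `a` is dominated by the corresponding tail of `b` up
to `Δ`, the sums differ by at most `B Δ`. -/
lemma sum_le_of_tails {ι κ : Type*} (T : Finset ι) (U : Finset κ) (a : ι → ℝ) (b : κ → ℝ)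
    (u v Δ B : ℝ) (hB : 0 ≤ B) (hv : 0 ≤ v) (ha : ∀ j ∈ T, 0 ≤ a j ∧ a j ≤ B)
    (hb : ∀ j ∈ U, 0 ≤ b j)
    (h : ∀ θ, 0 ≤ θ → u * ((T.filter fun j => θ < a j).card : ℝ) ≤
      v * ((U.filter fun j => θ < b j).card : ℝ) + Δ) :
    u * ∑ j ∈ T, a j ≤ v * ∑ j ∈ U, b j + B * Δ := by
  -- Layer cake on `[0, B]`: the values `a j` lie below `B` and are recovered exactly, while the `b
  -- j` may exceed `B`, where truncation only lowers them, in the favourable direction.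
  have e1 : ∀ j ∈ T, ∫ θ in (0 : ℝ)..B, (if θ < a j then (1 : ℝ) else 0) = a j := fun j hj => by
    rw [integral_ite_lt (ha j hj).1 hB, min_eq_left (ha j hj).2]
  have e2 : ∀ j ∈ U, ∫ θ in (0 : ℝ)..B, (if θ < b j then (1 : ℝ) else 0) ≤ b j := fun j hj => by
    rw [integral_ite_lt (hb j hj) hB]; exact min_le_left _ _
  have i1 : IntervalIntegrable
      (fun θ : ℝ => u * ∑ j ∈ T, if θ < a j then (1 : ℝ) else 0) volume 0 B := by
    refine IntervalIntegrable.const_mul ?_ u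
    have hs := IntervalIntegrable.sum T (fun j _ => intervalIntegrable_ite_lt (a j) 0 B)
    rwa [Finset.sum_fn] at hs
  have i2 : IntervalIntegrable
      (fun θ : ℝ => v * ∑ j ∈ U, if θ < b j then (1 : ℝ) else 0) volume 0 B := by
    refine IntervalIntegrable.const_mul ?_ v
    have hs := IntervalIntegrable.sum U (fun j _ => intervalIntegrable_ite_lt (b j) 0 B)
    rwa [Finset.sum_fn] at hs
  have key : ∫ θ in (0 : ℝ)..B, (u * ∑ j ∈ T, if θ < a j then (1 : ℝ) else 0) ≤
      ∫ θ in (0 : ℝ)..B, (v * (∑ j ∈ U, if θ < b j then (1 : ℝ) else 0) + Δ) := by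
    refine intervalIntegral.integral_mono_on hB i1 (i2.add (by simp)) fun θ hθ => ?_
    have := h θ hθ.1
    simpa only [Finset.sum_boole] using this
  rw [intervalIntegral.integral_add i2 (by simp), intervalIntegral.integral_const_mul,
    intervalIntegral.integral_const_mul,
    intervalIntegral.integral_finsetSum (fun j _ => intervalIntegrable_ite_lt (a j) 0 B),
    intervalIntegral.integral_finsetSum (fun j _ => intervalIntegrable_ite_lt (b j) 0 B),
    Finset.sum_congr rfl e1, intervalIntegral.integral_const, sub_zero, smul_eq_mul] at key
  refine key.trans ?_
  gcongr with j hj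
  exact e2 j hj

namespace Input

variable {d : ℕ} {I : Input d}

open Classical in
/-- The numbers among which the threshold is the least one. -/
noncomputable def thresholdSet (I : Input d) (T : Finset (Fin I.n)) (i : Fin I.k)
    (p : MvPolynomial (Fin d) ℝ) : Set ℝ :=
  {θ : ℝ | 0 ≤ θ ∧
    I.R * (((Finset.univ.filter fun j => θ < I.absChow i p (I.S j)).card : ℝ) / I.m) + I.Δ ≤
      ((T.filter fun j => θ < I.absChow i p (I.S' j)).card : ℝ) / I.n}

lemma objective_le_B (h : I.Admissible) {T : Finset (Fin I.n)} (hT : T ⊆ I.S₀) {i : Fin I.k}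
    {p : MvPolynomial (Fin d) ℝ} (hp : p ∈ I.feasible i) : I.objective T i p ≤ I.B := by
  have hn : (0 : ℝ) < I.n := by exact_mod_cast h.2.2.2.2.1
  have hB := B_pos h
  rw [objective, div_le_iff₀ hn]
  calc ∑ j ∈ T, I.chow i p (I.S' j) ≤ ∑ j ∈ T, I.B := by
        refine Finset.sum_le_sum fun j hj => (chow_le_absChow i p _).trans ?_
        have := hT hj
        simp only [S₀, Finset.mem_filter] at this
        exact this.2 i p hp
    _ = T.card * I.B := by simp
    _ ≤ I.n * I.B := by
        gcongr
        simpa using Finset.card_le_univ T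
    _ = I.B * I.n := mul_comm _ _

/-- If the inequality failed at every level, `sum_le_of_tails` would bound the objective by `R`
times the reference mean plus `BΔ`, that is by `ε`. Tameness of the points of `T` supplies the bound
`B`, feasibility of `p` the bound on the reference mean. -/
lemma thresholdSet_nonempty (h : I.Admissible) {T : Finset (Fin I.n)} (hT : T ⊆ I.S₀)
    {i : Fin I.k} {p : MvPolynomial (Fin d) ℝ} (hp : p ∈ I.feasible i)
    (hgt : I.ε < I.objective T i p) : (I.thresholdSet T i p).Nonempty := by
  classical
  by_contra hne
  have hB := B_pos h
  have hBΔ := B_mul_Δ h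
  obtain ⟨hd, h1, h2, h3, h4, h5, h6, h7, h8⟩ := h
  have hn : (0 : ℝ) < I.n := by exact_mod_cast h4
  have hm : (0 : ℝ) < I.m := by exact_mod_cast h3
  have key := sum_le_of_tails T Finset.univ (fun j => I.absChow i p (I.S' j))
    (fun j => I.absChow i p (I.S j)) (1 / I.n) (I.R / I.m) I.Δ I.B hB.le (by positivity)
    (fun j hj => ⟨absChow_nonneg _ _ _, by
      have := hT hj
      simp only [S₀, Finset.mem_filter] at this
      exact this.2 i p hp⟩) (fun j _ => absChow_nonneg _ _ _) (fun θ hθ => by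
      by_contra hlt
      refine hne ⟨θ, hθ, ?_⟩
      push Not at hlt
      rw [div_mul_eq_mul_div, div_mul_eq_mul_div, one_mul, mul_div_assoc] at hlt
      exact hlt.le)
  rw [hBΔ] at key
  have hS := hp.2.2
  have hobj : I.objective T i p ≤ 1 / I.n * ∑ j ∈ T, I.absChow i p (I.S' j) := by
    rw [objective, div_eq_mul_inv, mul_comm, one_div]
    gcongr with j hj
    exact chow_le_absChow i p _
  have e1 : I.R / I.m * ∑ j, I.absChow i p (I.S j) ≤ I.R * (2 * I.ε / (2 * I.R + I.ε)) := by
    calc _ = I.R * ((∑ j, I.absChow i p (I.S j)) / I.m) := by ring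
      _ ≤ _ := by gcongr
  have e2 : I.R * (2 * I.ε / (2 * I.R + I.ε)) + I.ε ^ 2 / (2 * I.R + I.ε) = I.ε := by
    have : 0 < 2 * I.R + I.ε := by positivity
    field_simp
  linarith

open Classical in
/-- The values of `f_i |p|` on the two samples, and zero. -/
noncomputable def candidates (I : Input d) (i : Fin I.k) (p : MvPolynomial (Fin d) ℝ) : Finset ℝ :=
  insert 0 (Finset.univ.image (fun j => I.absChow i p (I.S j)) ∪
    Finset.univ.image (fun j => I.absChow i p (I.S' j)))

/-- Tail counts jump only at sample values. Rounding `θ` down to the largest sample value below it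
(or to zero) changes no strict inequality with a sample value, hence no count. So the least
threshold exists and can be found by a finite search. -/
lemma exists_candidate {T : Finset (Fin I.n)} {i : Fin I.k} {p : MvPolynomial (Fin d) ℝ} {θ : ℝ}
    (hθ : θ ∈ I.thresholdSet T i p) :
    ∃ c ∈ I.candidates i p, c ≤ θ ∧ c ∈ I.thresholdSet T i p := by
  classical
  have hne : ((I.candidates i p).filter fun c => c ≤ θ).Nonempty :=
    ⟨0, Finset.mem_filter.2 ⟨Finset.mem_insert_self _ _, hθ.1⟩⟩
  set c := ((I.candidates i p).filter fun c => c ≤ θ).max' hne with hc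
  have hmem := Finset.max'_mem _ hne
  rw [← hc, Finset.mem_filter] at hmem
  have hmax : ∀ v ∈ I.candidates i p, v ≤ θ → v ≤ c := fun v hv hvθ =>
    Finset.le_max' _ _ (Finset.mem_filter.2 ⟨hv, hvθ⟩)
  have hlt : ∀ v ∈ I.candidates i p, (c < v ↔ θ < v) := fun v hv =>
    ⟨fun h => by_contra fun h' => absurd (hmax v hv (not_lt.1 h')) (not_le.2 h),
      fun h => hmem.2.trans_lt h⟩
  refine ⟨c, hmem.1, hmem.2, hmax 0 (Finset.mem_insert_self _ _) hθ.1, ?_⟩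
  have e1 : (Finset.univ.filter fun j => c < I.absChow i p (I.S j)) =
      Finset.univ.filter fun j => θ < I.absChow i p (I.S j) :=
    Finset.filter_congr fun j _ => hlt _ (by simp [candidates])
  have e2 : (T.filter fun j => c < I.absChow i p (I.S' j)) =
      T.filter fun j => θ < I.absChow i p (I.S' j) :=
    Finset.filter_congr fun j _ => hlt _ (by simp [candidates])
  rw [e1, e2]
  exact hθ.2

/-- The term with `R` in the threshold inequality is nonnegative, so the removed tail has relative
size at least `Δ`. -/
lemma filtered_card (h : I.Admissible) {T : Finset (Fin I.n)} {i : Fin I.k}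
    {p : MvPolynomial (Fin d) ℝ} {τ : ℝ} (hτ : I.IsThreshold T i p τ) :
    ((I.filtered T i p τ).card : ℝ) + I.n * I.Δ ≤ T.card := by
  classical
  have hn : (0 : ℝ) < I.n := by exact_mod_cast h.2.2.2.2.1
  have h1 := hτ.1.2
  have hR : 0 < I.R := by have := h.2.2.2.2.2.1; linarith
  have h0 : 0 ≤ I.R * (((Finset.univ.filter fun j => τ < I.absChow i p (I.S j)).card : ℝ) / I.m) :=
    by positivity
  have h2 : I.Δ ≤ ((T.filter fun j => τ < I.absChow i p (I.S' j)).card : ℝ) / I.n := by linarith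
  rw [le_div_iff₀ hn] at h2
  have h3 := Finset.card_filter_add_card_filter_not (s := T)
    (fun j => I.absChow i p (I.S' j) ≤ τ)
  simp only [not_le] at h3
  have h3' : ((I.filtered T i p τ).card : ℝ) +
      ((T.filter fun j => τ < I.absChow i p (I.S' j)).card : ℝ) = T.card := by
    rw [filtered]; exact_mod_cast h3
  linarith

lemma filtered_card_lt (h : I.Admissible) {T : Finset (Fin I.n)} {i : Fin I.k}
    {p : MvPolynomial (Fin d) ℝ} {τ : ℝ} (hτ : I.IsThreshold T i p τ) :
    (I.filtered T i p τ).card < T.card := by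
  have h1 := filtered_card h hτ
  have h2 := Δ_pos h
  have hn : (0 : ℝ) < I.n := by exact_mod_cast h.2.2.2.2.1
  have : 0 < I.n * I.Δ := by positivity
  have h3 : ((I.filtered T i p τ).card : ℝ) < T.card := by linarith
  exact_mod_cast h3

lemma Loop.length_mul_le (h : I.Admissible) {T : Finset (Fin I.n)}
    {L : List (Fin I.k × MvPolynomial (Fin d) ℝ × ℝ)} (hL : I.Loop T L) :
    L.length * (I.n * I.Δ) ≤ T.card := by
  induction hL with
  | halt => simp
  | step T i p τ L hsol hgt hτ hrest ih =>
    have := filtered_card h hτ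
    push_cast [List.length_cons]
    linarith

lemma Loop.length_le_card (h : I.Admissible) {T : Finset (Fin I.n)}
    {L : List (Fin I.k × MvPolynomial (Fin d) ℝ × ℝ)} (hL : I.Loop T L) :
    L.length ≤ T.card := by
  induction hL with
  | halt => simp
  | step T i p τ L hsol hgt hτ hrest ih =>
    have := filtered_card_lt h hτ
    rw [List.length_cons]
    omega

/-- In contrast to the bound by the number of points, this one does not involve the samples. It
allows a fixed number of filters in the uniform convergence argument and bounds the length of the
description. -/
lemma Loop.length_le_inv (h : I.Admissible) {T : Finset (Fin I.n)}
    {L : List (Fin I.k × MvPolynomial (Fin d) ℝ × ℝ)} (hL : I.Loop T L) :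
    (L.length : ℝ) ≤ 1 / I.Δ := by
  have h1 := hL.length_mul_le h
  have h2 := Δ_pos h
  have hn : (0 : ℝ) < I.n := by exact_mod_cast h.2.2.2.2.1
  have h3 : (T.card : ℝ) ≤ I.n := by exact_mod_cast (by simpa using Finset.card_le_univ T)
  rw [le_div_iff₀ h2]
  have : I.n * (L.length * I.Δ) ≤ I.n * 1 := by nlinarith
  exact le_of_mul_le_mul_left this hn

open Classical in
/-- The points that survive the filters `L`. -/
noncomputable def survivors (I : Input d) (T : Finset (Fin I.n))
    (L : List (Fin I.k × MvPolynomial (Fin d) ℝ × ℝ)) : Finset (Fin I.n) :=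
  T.filter fun j => ∀ q ∈ L, I.absChow q.1 q.2.1 (I.S' j) ≤ q.2.2

/-- The points that survive all filters form exactly the set on which the last maximization was
performed, and that maximum is at most `ε`. -/
lemma Loop.objective_survivors {T : Finset (Fin I.n)}
    {L : List (Fin I.k × MvPolynomial (Fin d) ℝ × ℝ)} (hL : I.Loop T L) (i : Fin I.k)
    {p : MvPolynomial (Fin d) ℝ} (hp : p ∈ I.feasible i) :
    I.objective (I.survivors T L) i p ≤ I.ε := by
  classical
  induction hL with
  | halt T i' p' hsol hle =>
    have : I.survivors T [] = T := by simp [survivors]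
    rw [this]
    exact (hsol.2 i p hp).trans hle
  | step T i' p' τ L hsol hgt hτ hrest ih =>
    have : I.survivors T ((i', p', τ) :: L) = I.survivors (I.filtered T i' p' τ) L := by
      ext j
      simp [survivors, filtered, and_assoc]
    rwa [this]

-- The threshold inequalities are added up. On the test sample each cut is taken from points that
-- are still present, so the removed sets are disjoint and their sizes add; on the reference sample
-- they may overlap, and there a union bound goes in the right direction. The gaps `Δ` are
-- discarded.
open Classical in
lemma Loop.rejected_le (h : I.Admissible) {T : Finset (Fin I.n)}
    {L : List (Fin I.k × MvPolynomial (Fin d) ℝ × ℝ)} (hL : I.Loop T L) :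
    I.R * (((Finset.univ.filter fun j => ∃ q ∈ L, q.2.2 < I.absChow q.1 q.2.1 (I.S j)).card : ℝ)
      / I.m) ≤
      ((T.filter fun j => ∃ q ∈ L, q.2.2 < I.absChow q.1 q.2.1 (I.S' j)).card : ℝ) / I.n := by
  have hn : (0 : ℝ) < I.n := by exact_mod_cast h.2.2.2.2.1
  have hm : (0 : ℝ) < I.m := by exact_mod_cast h.2.2.2.1
  have hR : 0 < I.R := by have := h.2.2.2.2.2.1; linarith
  induction hL with
  | halt => simp
  | step T i p τ L hsol hgt hτ hrest ih =>
    have h1 := hτ.1.2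
    have hΔ := Δ_pos h
    have e1 : (Finset.univ.filter fun j => ∃ q ∈ (i, p, τ) :: L,
        q.2.2 < I.absChow q.1 q.2.1 (I.S j)) =
        (Finset.univ.filter fun j => τ < I.absChow i p (I.S j)) ∪
        (Finset.univ.filter fun j => ∃ q ∈ L, q.2.2 < I.absChow q.1 q.2.1 (I.S j)) := by
      ext j; simp
    have e2 : (T.filter fun j => ∃ q ∈ (i, p, τ) :: L, q.2.2 < I.absChow q.1 q.2.1 (I.S' j)) =
        (T.filter fun j => τ < I.absChow i p (I.S' j)) ∪
        ((I.filtered T i p τ).filter fun j => ∃ q ∈ L, q.2.2 < I.absChow q.1 q.2.1 (I.S' j)) := by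
      ext j
      simp only [List.mem_cons, exists_eq_or_imp, Finset.mem_filter, Finset.mem_union, filtered]
      by_cases hj : τ < I.absChow i p (I.S' j)
      · simp [hj]
      · simp [hj, not_lt.1 hj]
    have hdisj : Disjoint (T.filter fun j => τ < I.absChow i p (I.S' j))
        ((I.filtered T i p τ).filter fun j => ∃ q ∈ L, q.2.2 < I.absChow q.1 q.2.1 (I.S' j)) := by
      rw [Finset.disjoint_left]
      intro j hj hj'
      simp only [Finset.mem_filter, filtered] at hj hj'
      exact absurd hj.2 (not_lt.2 hj'.1.2)
    rw [e1, e2, Finset.card_union_of_disjoint hdisj]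
    have h2 : (((Finset.univ.filter fun j => τ < I.absChow i p (I.S j)) ∪
        (Finset.univ.filter fun j => ∃ q ∈ L, q.2.2 < I.absChow q.1 q.2.1 (I.S j))).card : ℝ) ≤
        ((Finset.univ.filter fun j => τ < I.absChow i p (I.S j)).card : ℝ) +
        ((Finset.univ.filter fun j => ∃ q ∈ L, q.2.2 < I.absChow q.1 q.2.1 (I.S j)).card : ℝ) := by
      exact_mod_cast Finset.card_union_le _ _
    push_cast
    rw [add_div]
    refine le_trans ?_ (add_le_add (le_trans (le_add_of_nonneg_right hΔ.le) h1) ih)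
    rw [← mul_add, ← add_div]
    gcongr

end Input
end ICF

namespace ICF

/-! ### Uniform convergence -/

section UniformConvergence

variable {X ι : Type*} [MeasurableSpace X]

/-- The sum over signs factors into hyperbolic cosines, each below the exponential of half the
square. The bound `2 * b` is that of a difference of two values of a function bounded by `b`. -/
lemma sum_exp_signs {n : ℕ} (s b : ℝ) (v : Fin n → ℝ) (hv : ∀ j, |v j| ≤ 2 * b) :
    ∑ σ : Fin n → Bool, Real.exp (s * ∑ j, (if σ j then v j else -v j)) ≤
      2 ^ n * Real.exp (n * (2 * b ^ 2 * s ^ 2)) := by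
  have h1 : ∀ σ : Fin n → Bool, Real.exp (s * ∑ j, (if σ j then v j else -v j)) =
      ∏ j, Real.exp (s * (if σ j then v j else -v j)) := fun σ => by
    rw [Finset.mul_sum, Real.exp_sum]
  have h2 := Finset.prod_univ_sum (fun _ : Fin n => (Finset.univ : Finset Bool))
    (fun j (c : Bool) => Real.exp (s * (if c then v j else -v j)))
  rw [Fintype.piFinset_univ] at h2
  simp_rw [h1]
  rw [← h2]
  have h3 : ∀ j, ∑ c : Bool, Real.exp (s * (if c then v j else -v j)) ≤
      2 * Real.exp (2 * b ^ 2 * s ^ 2) := fun j => by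
    have e : ∑ c : Bool, Real.exp (s * (if c then v j else -v j)) = 2 * Real.cosh (s * v j) := by
      rw [Real.cosh_eq]
      simp
      ring
    rw [e]
    gcongr
    refine (Real.cosh_le_exp_half_sq _).trans (Real.exp_le_exp.2 ?_)
    have : (v j) ^ 2 ≤ (2 * b) ^ 2 := sq_le_sq.2 ((hv j).trans (le_abs_self _))
    nlinarith [mul_le_mul_of_nonneg_left this (sq_nonneg s)]
  refine (Finset.prod_le_prod (fun j _ => Finset.sum_nonneg fun _ _ => (Real.exp_pos _).le)
    (fun j _ => h3 j)).trans (le_of_eq ?_)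
  rw [Finset.prod_const, Finset.card_univ, Fintype.card_fin, mul_pow, ← Real.exp_nat_mul]

/-- The exponential moment of the supremum of the symmetrized process. -/
lemma lintegral_sup_exp_le [Countable ι] (D : Measure X) [IsProbabilityMeasure D] {n : ℕ}
    (g : ι → X → ℝ) (hg : ∀ i, Measurable (g i)) (b s : ℝ) (hb : ∀ i x, |g i x| ≤ b) (K : ℕ)
    (hK : ∀ z : Fin n → X × X, ∃ V : Finset (Fin n → ℝ), V.card ≤ K ∧
      ∀ i, (fun j => g i (z j).2 - g i (z j).1) ∈ V) :
    ∫⁻ z, ⨆ i, ENNReal.ofReal (Real.exp (s * ∑ j, (g i (z j).2 - g i (z j).1)))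
      ∂(Measure.pi fun _ : Fin n => D.prod D) ≤
      ENNReal.ofReal (K * Real.exp (n * (2 * b ^ 2 * s ^ 2))) := by
  set M : (Fin n → X × X) → ENNReal :=
    fun z => ⨆ i, ENNReal.ofReal (Real.exp (s * ∑ j, (g i (z j).2 - g i (z j).1))) with hM
  have hMm : Measurable M := by
    refine Measurable.iSup fun i => ENNReal.measurable_ofReal.comp (Real.measurable_exp.comp ?_)
    refine measurable_const.mul (Finset.measurable_sum _ fun j _ => ?_)
    exact ((hg i).comp (measurable_snd.comp (measurable_pi_apply j))).sub
      ((hg i).comp (measurable_fst.comp (measurable_pi_apply j)))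
  -- Symmetrization: exchanging the two points of any subset of the pairs preserves the law of the
  -- double sample, so the integral may be replaced by its average over all `2 ^ n` exchanges. For
  -- fixed `z` this average is a sum over random signs, to which the union bound over patterns
  -- applies.
  let sw : (Fin n → Bool) → (Fin n → X × X) → (Fin n → X × X) :=
    fun σ z j => (if σ j then id else Prod.swap) (z j)
  have hsw : ∀ σ, MeasurePreserving (sw σ) (Measure.pi fun _ : Fin n => D.prod D)
      (Measure.pi fun _ : Fin n => D.prod D) := fun σ => by
    refine measurePreserving_pi (f := fun j => (if σ j then id else Prod.swap)) _ _ fun j => ?_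
    by_cases h : σ j
    · simpa [h] using MeasurePreserving.id _
    · simpa [h] using Measure.measurePreserving_swap
  have h1 : ∀ σ, ∫⁻ z, M (sw σ z) ∂(Measure.pi fun _ : Fin n => D.prod D) =
      ∫⁻ z, M z ∂(Measure.pi fun _ : Fin n => D.prod D) := fun σ => (hsw σ).lintegral_comp hMm
  have h2 : (2 ^ n : ENNReal) * ∫⁻ z, M z ∂(Measure.pi fun _ : Fin n => D.prod D) =
      ∫⁻ z, ∑ σ : Fin n → Bool, M (sw σ z) ∂(Measure.pi fun _ : Fin n => D.prod D) := by
    rw [lintegral_finsetSum (f := fun σ z => M (sw σ z)) _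
      fun σ _ => hMm.comp (hsw σ).measurable, Finset.sum_congr rfl fun σ _ => h1 σ]
    simp
  have h3 : ∀ z, ∑ σ : Fin n → Bool, M (sw σ z) ≤
      2 ^ n * ENNReal.ofReal (K * Real.exp (n * (2 * b ^ 2 * s ^ 2))) := fun z => by
    classical
    obtain ⟨V₀, hV₀, hV₁⟩ := hK z
    -- The given pattern set may contain vectors that no function of the class realizes. Only those
    -- bounded by `2 * b` are kept, as the estimate over signs needs this bound.
    set V := V₀.filter fun v => ∀ j, |v j| ≤ 2 * b with hV
    have hmem : ∀ i, (fun j => g i (z j).2 - g i (z j).1) ∈ V := fun i => by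
      refine Finset.mem_filter.2 ⟨hV₁ i, fun j => ?_⟩
      refine (abs_sub _ _).trans ?_
      linarith [hb i (z j).2, hb i (z j).1]
    have hcard : V.card ≤ K := (Finset.card_filter_le _ _).trans hV₀
    have hle : ∀ σ, M (sw σ z) ≤
        ∑ v ∈ V, ENNReal.ofReal (Real.exp (s * ∑ j, (if σ j then v j else -v j))) := fun σ => by
      refine iSup_le fun i => ?_
      have e : (∑ j, (g i (sw σ z j).2 - g i (sw σ z j).1)) =
          ∑ j, (if σ j then (fun j => g i (z j).2 - g i (z j).1) j
            else -(fun j => g i (z j).2 - g i (z j).1) j) := by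
        refine Finset.sum_congr rfl fun j _ => ?_
        by_cases h : σ j
        · simp [sw, h]
        · simp [sw, h]
      rw [e]
      exact Finset.single_le_sum
        (f := fun v : Fin n → ℝ => ENNReal.ofReal (Real.exp (s * ∑ j, (if σ j then v j else -v j))))
        (fun _ _ => zero_le) (hmem i)
    calc ∑ σ : Fin n → Bool, M (sw σ z)
        ≤ ∑ σ : Fin n → Bool,
          ∑ v ∈ V, ENNReal.ofReal (Real.exp (s * ∑ j, (if σ j then v j else -v j))) :=
          Finset.sum_le_sum fun σ _ => hle σ
      _ = ∑ v ∈ V, ENNReal.ofReal (∑ σ : Fin n → Bool,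
            Real.exp (s * ∑ j, (if σ j then v j else -v j))) := by
          rw [Finset.sum_comm]
          refine Finset.sum_congr rfl fun v _ => ?_
          rw [ENNReal.ofReal_sum_of_nonneg fun _ _ => (Real.exp_pos _).le]
      _ ≤ ∑ v ∈ V, ENNReal.ofReal (2 ^ n * Real.exp (n * (2 * b ^ 2 * s ^ 2))) :=
          Finset.sum_le_sum fun v hv => ENNReal.ofReal_le_ofReal
            (sum_exp_signs s b v (Finset.mem_filter.1 hv).2)
      _ = V.card * ENNReal.ofReal (2 ^ n * Real.exp (n * (2 * b ^ 2 * s ^ 2))) := by simp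
      _ ≤ K * ENNReal.ofReal (2 ^ n * Real.exp (n * (2 * b ^ 2 * s ^ 2))) := by
          gcongr
      _ = _ := by
          rw [ENNReal.ofReal_mul (by positivity), ENNReal.ofReal_mul (by positivity),
            ENNReal.ofReal_natCast, ENNReal.ofReal_pow (by norm_num), ENNReal.ofReal_ofNat]
          ring
  have h4 : (2 ^ n : ENNReal) * ∫⁻ z, M z ∂(Measure.pi fun _ : Fin n => D.prod D) ≤
      2 ^ n * ENNReal.ofReal (K * Real.exp (n * (2 * b ^ 2 * s ^ 2))) := by
    rw [h2]
    refine (lintegral_mono h3).trans ?_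
    simp
  exact (ENNReal.mul_le_mul_iff_right (by simp) (by simp)).1 h4

/-- One-sided uniform convergence for a countable class with few patterns. -/
theorem uniform_convergence [Countable ι] (D : Measure X) [IsProbabilityMeasure D] {n : ℕ}
    (hn : 1 ≤ n) (g : ι → X → ℝ) (hg : ∀ i, Measurable (g i)) (b ε : ℝ) (hb0 : 0 < b) (hε : 0 < ε)
    (hb : ∀ i x, |g i x| ≤ b) (K : ℕ)
    (hK : ∀ z : Fin n → X × X, ∃ V : Finset (Fin n → ℝ), V.card ≤ K ∧
      ∀ i, (fun j => g i (z j).2 - g i (z j).1) ∈ V) :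
    (Measure.pi fun _ : Fin n => D) {x | ∃ i, ε < ∫ y, g i y ∂D - (∑ j, g i (x j)) / n} ≤
      ENNReal.ofReal (K * Real.exp (-(n * ε ^ 2 / (8 * b ^ 2)))) := by
  set μ := Measure.pi fun _ : Fin n => D with hμ
  have hn0 : (0 : ℝ) < n := by exact_mod_cast hn
  -- This value maximizes `s n ε - 2 n b² s²`, and the maximum `n ε² / (8 b²)` is the final
  -- exponent.
  set s : ℝ := ε / (4 * b ^ 2) with hs
  have hs0 : 0 < s := by positivity
  set F : (Fin n → X) × (Fin n → X) → ENNReal :=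
    fun q => ⨆ i, ENNReal.ofReal (Real.exp (s * ∑ j, (g i (q.2 j) - g i (q.1 j)))) with hF
  have hFm : Measurable F := by
    refine Measurable.iSup fun i => ENNReal.measurable_ofReal.comp (Real.measurable_exp.comp ?_)
    refine measurable_const.mul (Finset.measurable_sum _ fun j _ => ?_)
    exact ((hg i).comp ((measurable_pi_apply j).comp measurable_snd)).sub
      ((hg i).comp ((measurable_pi_apply j).comp measurable_fst))
  have hintegrable : ∀ i, Integrable (g i) D := fun i =>
    Integrable.of_bound (hg i).aestronglyMeasurable b (Filter.Eventually.of_forall (hb i))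
  have hJ : ∀ (x : Fin n → X) (i : ι),
      ENNReal.ofReal (Real.exp (s * (n * ∫ y, g i y ∂D - ∑ j, g i (x j)))) ≤ ∫⁻ y, F (x, y) ∂μ := by
    intro x i
    have hmeas : Measurable fun y : Fin n → X => s * ∑ j, (g i (y j) - g i (x j)) :=
      measurable_const.mul (Finset.measurable_sum _ fun j _ =>
        ((hg i).comp (measurable_pi_apply j)).sub measurable_const)
    have hbd : ∀ y : Fin n → X, |s * ∑ j, (g i (y j) - g i (x j))| ≤ s * (n * (2 * b)) := fun y => by
      rw [abs_mul, abs_of_pos hs0]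
      gcongr
      refine (Finset.abs_sum_le_sum_abs _ _).trans ?_
      refine (Finset.sum_le_sum (g := fun _ => 2 * b) fun j _ => ?_).trans (by simp)
      refine (abs_sub _ _).trans ?_
      linarith [hb i (y j), hb i (x j)]
    have hI : Integrable (fun y : Fin n → X => s * ∑ j, (g i (y j) - g i (x j))) μ :=
      Integrable.of_bound hmeas.aestronglyMeasurable _ (Filter.Eventually.of_forall hbd)
    have hE : Integrable (Real.exp ∘ fun y : Fin n → X => s * ∑ j, (g i (y j) - g i (x j))) μ := by
      refine Integrable.of_bound (Real.measurable_exp.comp hmeas).aestronglyMeasurable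
        (Real.exp (s * (n * (2 * b)))) (Filter.Eventually.of_forall fun y => ?_)
      rw [Function.comp_apply, Real.norm_eq_abs, Real.abs_exp]
      exact Real.exp_le_exp.2 ((le_abs_self _).trans (hbd y))
    -- Jensen's inequality over the ghost sample `y` replaces its empirical mean by the true mean
    -- inside the exponential; no separate concentration of the ghost sample is needed.
    have hjen := convexOn_exp.map_integral_le Real.continuous_exp.continuousOn isClosed_univ
      (by simp) hI hE
    have hcomp : ∀ j : Fin n, Integrable (fun y : Fin n → X => g i (y j)) μ := fun j =>
      (measurePreserving_eval (fun _ : Fin n => D) j).integrable_comp_of_integrable (hintegrable i)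
    have hval : ∫ y, s * ∑ j, (g i (y j) - g i (x j)) ∂μ =
        s * (n * ∫ y, g i y ∂D - ∑ j, g i (x j)) := by
      rw [integral_const_mul, integral_finsetSum]
      · have : ∀ j : Fin n, ∫ y, (g i (y j) - g i (x j)) ∂μ = ∫ y, g i y ∂D - g i (x j) := by
          intro j
          rw [integral_sub _ (integrable_const _), integral_const]
          · have e := integral_comp_eval (μ := fun _ : Fin n => D) (i := j)
              (hg i).aestronglyMeasurable
            rw [e]; simp
          · exact hcomp j
        rw [Finset.sum_congr rfl fun j _ => this j, Finset.sum_sub_distrib]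
        simp
      · intro j _
        exact (hcomp j).sub (integrable_const _)
    rw [hval] at hjen
    calc _ ≤ ENNReal.ofReal (∫ y, Real.exp (s * ∑ j, (g i (y j) - g i (x j))) ∂μ) :=
          ENNReal.ofReal_le_ofReal hjen
      _ = ∫⁻ y, ENNReal.ofReal (Real.exp (s * ∑ j, (g i (y j) - g i (x j)))) ∂μ :=
          ofReal_integral_eq_lintegral_ofReal hE
            (Filter.Eventually.of_forall fun _ => (Real.exp_pos _).le)
      _ ≤ ∫⁻ y, F (x, y) ∂μ := lintegral_mono fun y =>
          le_iSup (fun i => ENNReal.ofReal (Real.exp (s * ∑ j, (g i (y j) - g i (x j))))) i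
  have hsub : {x : Fin n → X | ∃ i, ε < ∫ y, g i y ∂D - (∑ j, g i (x j)) / n} ⊆
      {x | ENNReal.ofReal (Real.exp (s * (n * ε))) ≤ ∫⁻ y, F (x, y) ∂μ} := by
    rintro x ⟨i, hi⟩
    refine le_trans (ENNReal.ofReal_le_ofReal (Real.exp_le_exp.2 ?_)) (hJ x i)
    gcongr
    have : (n : ℝ) * (∫ y, g i y ∂D - (∑ j, g i (x j)) / n) =
        n * ∫ y, g i y ∂D - ∑ j, g i (x j) := by field_simp
    rw [← this]
    gcongr
  have hmark := mul_meas_ge_le_lintegral (μ := μ) (hFm.lintegral_prod_right' (ν := μ))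
    (ENNReal.ofReal (Real.exp (s * (n * ε))))
  rw [← lintegral_prod _ hFm.aemeasurable] at hmark
  -- Two independent samples are regarded as one sample of pairs, the form in which symmetrization
  -- was carried out.
  have hchg : ∫⁻ q, F q ∂(μ.prod μ) = ∫⁻ z, ⨆ i, ENNReal.ofReal
      (Real.exp (s * ∑ j, (g i (z j).2 - g i (z j).1)))
      ∂(Measure.pi fun _ : Fin n => D.prod D) :=
    ((measurePreserving_arrowProdEquivProdArrow X X (Fin n) (fun _ => D)
      (fun _ => D)).lintegral_comp hFm).symm
  have hbound := lintegral_sup_exp_le D g hg b s hb K hK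
  rw [← hchg] at hbound
  have h5 := (mul_le_mul_right (measure_mono (μ := μ) hsub)
    (ENNReal.ofReal (Real.exp (s * (n * ε))))).trans (hmark.trans hbound)
  have h6 : ENNReal.ofReal (K * Real.exp (n * (2 * b ^ 2 * s ^ 2))) =
      ENNReal.ofReal (Real.exp (s * (n * ε))) *
        ENNReal.ofReal (K * Real.exp (-(n * ε ^ 2 / (8 * b ^ 2)))) := by
    rw [← ENNReal.ofReal_mul (Real.exp_pos _).le]
    congr 1
    rw [mul_left_comm (Real.exp _), ← Real.exp_add]
    congr 2
    rw [hs]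
    field_simp
    ring
  rw [h6] at h5
  exact (ENNReal.mul_le_mul_iff_right (by simp [Real.exp_pos]) (by simp)).1 h5

end UniformConvergence
end ICF

namespace ICF

/-! ### Growth of the class of filters -/

lemma sum_choose_le (M r : ℕ) : ∑ k ∈ Finset.Iic r, M.choose k ≤ (M + 1) ^ r := by
  rw [add_pow, Nat.range_succ_eq_Iic]
  refine Finset.sum_le_sum fun k hk => ?_
  have hk' : k ≤ r := Finset.mem_Iic.1 hk
  rw [one_pow, mul_one]
  calc M.choose k ≤ M ^ k := Nat.choose_le_pow M k
    _ ≤ M ^ k * r.choose k := Nat.le_mul_of_pos_right _ (Nat.choose_pos hk')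

/-- Radon's argument. With more than `|ι| + 1` points there is a nontrivial dependence `a` with `∑
a_j = 0` and `∑ a_j φ_j = 0`. A halfspace that contains exactly the points with `a_j > 0` makes
every term `a_j (⟨c, φ_j⟩ - τ)` nonpositive, strictly so where `a_j < 0`. The terms sum to zero, so
no coefficient is negative, and then all vanish. -/
lemma card_le_of_shatters_halfspaces {α ι : Type*} [Fintype α] [DecidableEq α] [Fintype ι]
    (φ : α → ι → ℝ) (s : Finset α)
    (hs : ∀ t ⊆ s, ∃ (c : ι → ℝ) (τ : ℝ), ∀ j ∈ s, (∑ w, c w * φ j w ≤ τ ↔ j ∈ t)) :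
    s.card ≤ Fintype.card ι + 1 := by
  by_contra hlt
  push Not at hlt
  let f : (s → ℝ) →ₗ[ℝ] (Option ι → ℝ) :=
    { toFun := fun a o => ∑ j : s, a j * (o.elim 1 (φ j))
      map_add' := fun a b => by
        ext o; simp [add_mul, Finset.sum_add_distrib]
      map_smul' := fun r a => by
        ext o; simp [Finset.mul_sum, mul_assoc] }
  have hker := f.ker_ne_bot_of_finrank_lt (by simpa using hlt)
  obtain ⟨a, ha, hane⟩ := (Submodule.ne_bot_iff _).1 hker
  rw [LinearMap.mem_ker] at ha
  have h0 : ∑ j : s, a j = 0 := by simpa [f] using congrFun ha none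
  have hw : ∀ w, ∑ j : s, a j * φ j w = 0 := fun w => by simpa [f] using congrFun ha (some w)
  obtain ⟨c, τ, hc⟩ := hs ((Finset.univ.filter fun j : s => 0 < a j).image Subtype.val) (by
    intro j hj
    obtain ⟨j', -, rfl⟩ := Finset.mem_image.1 hj
    exact j'.2)
  have hc' : ∀ j : s, (∑ w, c w * φ j w ≤ τ ↔ 0 < a j) := fun j => by
    rw [hc j j.2]
    simp
  have hsum : ∑ j : s, a j * (∑ w, c w * φ j w - τ) = 0 := by
    have e : ∑ j : s, a j * (∑ w, c w * φ j w) = ∑ w, c w * ∑ j : s, a j * φ j w := by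
      simp_rw [Finset.mul_sum]
      rw [Finset.sum_comm]
      refine Finset.sum_congr rfl fun w _ => Finset.sum_congr rfl fun j _ => by ring
    simp_rw [mul_sub]
    rw [Finset.sum_sub_distrib, e, ← Finset.sum_mul, h0]
    rw [Finset.sum_eq_zero fun w _ => by rw [hw w, mul_zero]]
    ring
  have hle : ∀ j : s, a j * (∑ w, c w * φ j w - τ) ≤ 0 := fun j => by
    by_cases hj : 0 < a j
    · exact mul_nonpos_of_nonneg_of_nonpos hj.le (sub_nonpos.2 ((hc' j).2 hj))
    · have := mt (hc' j).1 hj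
      exact mul_nonpos_of_nonpos_of_nonneg (not_lt.1 hj) (sub_nonneg.2 (not_le.1 this).le)
  have hz := (Finset.sum_eq_zero_iff_of_nonpos fun j _ => hle j).1 hsum
  have hnn : ∀ j : s, 0 ≤ a j := fun j => by
    by_contra hj
    push Not at hj
    have h1 := mt (hc' j).1 (not_lt.2 hj.le)
    have h2 := hz j (Finset.mem_univ _)
    have : a j * (∑ w, c w * φ j w - τ) < 0 :=
      mul_neg_of_neg_of_pos hj (sub_pos.2 (not_le.1 h1))
    linarith
  refine hane (funext fun j => ?_)
  exact (Finset.sum_eq_zero_iff_of_nonneg fun j _ => hnn j).1 h0 j (Finset.mem_univ _)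

/-- Sauer–Shelah turns the bound on shattered sets into a polynomial bound on the number of
patterns. -/
lemma exists_halfspace_patterns {α ι : Type*} [Fintype α] [DecidableEq α] [Fintype ι]
    (φ : α → ι → ℝ) : ∃ 𝒜 : Finset (Finset α),
      𝒜.card ≤ (Fintype.card α + 1) ^ (Fintype.card ι + 1) ∧
      ∀ (c : ι → ℝ) (τ : ℝ), (Finset.univ.filter fun j => ∑ w, c w * φ j w ≤ τ) ∈ 𝒜 := by
  classical
  refine ⟨Finset.univ.filter fun A => ∃ (c : ι → ℝ) (τ : ℝ),
    (Finset.univ.filter fun j => ∑ w, c w * φ j w ≤ τ) = A, ?_, fun c τ => by simp⟩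
  set 𝒜 : Finset (Finset α) := Finset.univ.filter fun A => ∃ (c : ι → ℝ) (τ : ℝ),
    (Finset.univ.filter fun j => ∑ w, c w * φ j w ≤ τ) = A with h𝒜
  have hvc : 𝒜.vcDim ≤ Fintype.card ι + 1 := by
    refine Finset.sup_le fun s hs => card_le_of_shatters_halfspaces φ s fun t ht => ?_
    obtain ⟨u, hu, hut⟩ := (Finset.mem_shatterer.1 hs) ht
    obtain ⟨c, τ, rfl⟩ := (Finset.mem_filter.1 hu).2
    refine ⟨c, τ, fun j hj => ?_⟩
    rw [← hut]
    simp [hj]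
  calc 𝒜.card ≤ 𝒜.shatterer.card := Finset.card_le_card_shatterer 𝒜
    _ ≤ ∑ k ∈ Finset.Iic 𝒜.vcDim, (Fintype.card α).choose k :=
        Finset.card_shatterer_le_sum_vcDim
    _ ≤ (Fintype.card α + 1) ^ 𝒜.vcDim := sum_choose_le _ _
    _ ≤ _ := Nat.pow_le_pow_right (by omega) hvc

/-- A filter with classifier, coefficient vector and threshold. -/
abbrev Filt (k N : ℕ) (𝕂 : Type) : Type := Fin k × (Fin N → 𝕂) × 𝕂

/-- The filter lets the point pass. -/
def Passes {d k N : ℕ} (f : Fin k → Pt d → Bool) (q : Filt k N ℝ) (x : Pt d) : Prop :=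
  bval (f q.1 x) * |∑ w, q.2.1 w * feature x w| ≤ q.2.2

/-- Where the classifier vanishes, only the sign of the threshold matters; elsewhere the absolute
value is an intersection of two halfspaces, with coefficients `c` and `-c`. -/
lemma passes_iff {d k N : ℕ} (f : Fin k → Pt d → Bool) (q : Filt k N ℝ) (x : Pt d) :
    Passes f q x ↔ (f q.1 x = false ∧ 0 ≤ q.2.2) ∨
      (f q.1 x = true ∧ ∑ w, q.2.1 w * feature x w ≤ q.2.2 ∧
        ∑ w, -q.2.1 w * feature x w ≤ q.2.2) := by
  unfold Passes bval
  cases h : f q.1 x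
  · simp
  · simp [abs_le, Finset.sum_neg_distrib]
    constructor
    · rintro ⟨h1, h2⟩; exact ⟨h2, by linarith⟩
    · rintro ⟨h1, h2⟩; exact ⟨by linarith, h1⟩

-- A pattern is determined by the classifier (`k` choices), the sign of the threshold (two choices)
-- and two halfspace patterns, which accounts for the factor `2` and the square.
open Classical in
lemma exists_filter_patterns {d k N : ℕ} (f : Fin k → Pt d → Bool) {α : Type*} [Fintype α]
    (z : α → Pt d) : ∃ 𝒜 : Finset (Finset α),
      𝒜.card ≤ k * (2 * ((Fintype.card α + 1) ^ (N + 1)) ^ 2) ∧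
      ∀ q : Filt k N ℝ, (Finset.univ.filter fun j => Passes f q (z j)) ∈ 𝒜 := by
  obtain ⟨ℋ, hℋ, hmem⟩ := exists_halfspace_patterns (α := α) (ι := Fin N)
    (fun j w => feature (z j) w)
  rw [Fintype.card_fin] at hℋ
  refine ⟨Finset.image (fun t : Fin k × Bool × Finset α × Finset α => Finset.univ.filter fun j =>
    (f t.1 (z j) = false ∧ t.2.1 = true) ∨ (f t.1 (z j) = true ∧ j ∈ t.2.2.1 ∧ j ∈ t.2.2.2))
    (Finset.univ ×ˢ Finset.univ ×ˢ ℋ ×ˢ ℋ), ?_, fun q => ?_⟩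
  · refine Finset.card_image_le.trans ?_
    rw [Finset.card_product, Finset.card_product, Finset.card_product, Finset.card_univ,
      Finset.card_univ, Fintype.card_fin, Fintype.card_bool, sq]
    gcongr
  · refine Finset.mem_image.2 ⟨(q.1, decide (0 ≤ q.2.2),
      Finset.univ.filter fun j => ∑ w, q.2.1 w * feature (z j) w ≤ q.2.2,
      Finset.univ.filter fun j => ∑ w, -q.2.1 w * feature (z j) w ≤ q.2.2),
      Finset.mem_product.2 ⟨Finset.mem_univ _, Finset.mem_product.2 ⟨Finset.mem_univ _,
        Finset.mem_product.2 ⟨hmem q.2.1 q.2.2, hmem (fun w => -q.2.1 w) q.2.2⟩⟩⟩, ?_⟩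
    ext j
    simp only [Finset.mem_filter, Finset.mem_univ, true_and, passes_iff, decide_eq_true_eq]

/-- All filters of the tuple let the point pass. -/
def Accepts {d k N t : ℕ} (f : Fin k → Pt d → Bool) (θ : Fin t → Filt k N ℝ) (x : Pt d) : Prop :=
  ∀ r, Passes f (θ r) x

/-- The number of patterns that `t` filters can produce on `M` points. -/
def growth (k N t M : ℕ) : ℕ := (k * (2 * ((M + 1) ^ (N + 1)) ^ 2)) ^ t

-- The acceptance set of a tuple is the intersection of the sets that pass its filters, so the
-- counts multiply.
open Classical in
lemma exists_accept_patterns {d k N : ℕ} (t : ℕ) (f : Fin k → Pt d → Bool) {α : Type*} [Fintype α]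
    (z : α → Pt d) : ∃ 𝒜 : Finset (Finset α),
      𝒜.card ≤ growth k N t (Fintype.card α) ∧
      ∀ θ : Fin t → Filt k N ℝ, (Finset.univ.filter fun j => Accepts f θ (z j)) ∈ 𝒜 := by
  obtain ⟨𝒜, hcard, hmem⟩ := exists_filter_patterns (N := N) f z
  refine ⟨(Fintype.piFinset fun _ : Fin t => 𝒜).image
    fun A => Finset.univ.filter fun j => ∀ r, j ∈ A r, ?_, fun θ => ?_⟩
  · refine Finset.card_image_le.trans ?_
    rw [Fintype.card_piFinset_const, growth]
    gcongr
  · refine Finset.mem_image.2 ⟨fun r => Finset.univ.filter fun j => Passes f (θ r) (z j),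
      Fintype.mem_piFinset.2 fun r => hmem (θ r), ?_⟩
    ext j
    simp only [Finset.mem_filter, Finset.mem_univ, true_and]
    rfl

end ICF

namespace ICF

open Filter Topology

/-! ### Uniform convergence for tuples of filters -/

lemma measurable_bval : Measurable bval := measurable_of_finite _

lemma measurable_eval {d : ℕ} (p : MvPolynomial (Fin d) ℝ) :
    Measurable fun x : Pt d => MvPolynomial.eval x p :=
  (MvPolynomial.continuous_eval p).measurable

lemma measurable_feature {d : ℕ} (w : ℕ) : Measurable fun x : Pt d => feature x w :=
  measurable_eval _

lemma abs_bval (b : Bool) : |bval b| ≤ 1 := by unfold bval; split_ifs <;> simp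

lemma bval_nonneg (b : Bool) : 0 ≤ bval b := by unfold bval; split_ifs <;> simp

lemma bval_le_one (b : Bool) : bval b ≤ 1 := by unfold bval; split_ifs <;> simp

lemma measurableSet_accepts {d k N t : ℕ} {f : Fin k → Pt d → Bool} (hf : ∀ i, Measurable (f i))
    (θ : Fin t → Filt k N ℝ) : MeasurableSet {x | Accepts f θ x} := by
  have : {x | Accepts f θ x} = ⋂ r, {x | Passes f (θ r) x} := by
    ext x; simp [Accepts]
  rw [this]
  refine MeasurableSet.iInter fun r => measurableSet_le ?_ measurable_const
  refine (measurable_bval.comp (hf _)).mul (Measurable.abs ?_)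
  exact Finset.measurable_sum _ fun w _ => measurable_const.mul (measurable_feature _)

/-- Coercion of rational filters. -/
noncomputable def castFilt {k N : ℕ} (q : Filt k N ℚ) : Filt k N ℝ :=
  (q.1, fun w => (q.2.1 w : ℝ), (q.2.2 : ℝ))

/-- Coefficients are approximated up to `1/(n+1)²`, while the threshold is raised by more than
`1/(n+1)`. For large `n` the raise dominates the error in the value of the polynomial, so even a
point that passes with equality keeps passing. A point that fails does so strictly, and both
perturbations tend to zero. How large `n` must be depends on the point. -/
lemma exists_rat_filt {d k N : ℕ} (f : Fin k → Pt d → Bool) (q : Filt k N ℝ) :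
    ∃ qn : ℕ → Filt k N ℚ, ∀ x, ∀ᶠ n in atTop, (Passes f (castFilt (qn n)) x ↔ Passes f q x) := by
  have h1 : ∀ (n : ℕ) (w : Fin N), ∃ r : ℚ, q.2.1 w < r ∧ (r : ℝ) < q.2.1 w + (1 / ((n : ℝ) + 1)) ^ 2 :=
    fun n w => exists_rat_btwn (by have : 0 < (1 / ((n : ℝ) + 1)) ^ 2 := by positivity
                                   linarith)
  have h2 : ∀ n : ℕ, ∃ r : ℚ, q.2.2 + 1 / ((n : ℝ) + 1) < r ∧
      (r : ℝ) < q.2.2 + 2 * (1 / ((n : ℝ) + 1)) :=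
    fun n => exists_rat_btwn (by have : 0 < 1 / ((n : ℝ) + 1) := by positivity
                                 linarith)
  choose c hc1 hc2 using h1
  choose τ hτ1 hτ2 using h2
  refine ⟨fun n => (q.1, c n, τ n), fun x => ?_⟩
  have hlim : Tendsto (fun n : ℕ => 1 / ((n : ℝ) + 1)) atTop (𝓝 0) :=
    tendsto_one_div_add_atTop_nhds_zero_nat
  set a := bval (f q.1 x) with ha
  set P := ∑ w, q.2.1 w * feature x w with hP
  set C := ∑ w : Fin N, |feature x w| with hC
  have hdiff : ∀ n : ℕ, |a * |∑ w, (c n w : ℝ) * feature x w| - a * (|P|)| ≤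
      (1 / ((n : ℝ) + 1)) ^ 2 * C := fun n => by
    rw [← mul_sub, abs_mul]
    calc |a| * |(|∑ w, (c n w : ℝ) * feature x w| - |P|)|
        ≤ 1 * |∑ w, (c n w : ℝ) * feature x w - P| := by
          exact mul_le_mul (abs_bval _) (abs_abs_sub_abs_le _ _) (abs_nonneg _) zero_le_one
      _ = |∑ w, ((c n w : ℝ) - q.2.1 w) * feature x w| := by
          rw [one_mul, hP, ← Finset.sum_sub_distrib]
          simp_rw [sub_mul]
      _ ≤ ∑ w, |((c n w : ℝ) - q.2.1 w) * feature x w| := Finset.abs_sum_le_sum_abs _ _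
      _ ≤ ∑ w : Fin N, (1 / ((n : ℝ) + 1)) ^ 2 * |feature x w| := by
          refine Finset.sum_le_sum fun w _ => ?_
          rw [abs_mul]
          gcongr
          rw [abs_of_pos (by linarith [hc1 n w])]
          linarith [hc2 n w]
      _ = _ := by rw [hC, Finset.mul_sum]
  by_cases hpass : a * |P| ≤ q.2.2
  · have hev : ∀ᶠ n : ℕ in atTop, C ≤ (n : ℝ) :=
      tendsto_natCast_atTop_atTop.eventually (eventually_ge_atTop C)
    filter_upwards [hev] with n hn
    refine iff_of_true ?_ hpass
    change a * |∑ w, (c n w : ℝ) * feature x w| ≤ (τ n : ℝ)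
    have h3 := (abs_le.1 (hdiff n)).2
    have h4 : (1 / ((n : ℝ) + 1)) ^ 2 * C ≤ 1 / ((n : ℝ) + 1) := by
      have h5 : 0 < (n : ℝ) + 1 := by positivity
      calc (1 / ((n : ℝ) + 1)) ^ 2 * C ≤ (1 / ((n : ℝ) + 1)) ^ 2 * ((n : ℝ) + 1) := by
            gcongr; linarith
        _ = 1 / ((n : ℝ) + 1) := by field_simp
    linarith [hτ1 n]
  · push Not at hpass
    have hlim1 : Tendsto (fun n : ℕ => a * |P| - (1 / ((n : ℝ) + 1)) ^ 2 * C) atTop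
        (𝓝 (a * |P| - 0 ^ 2 * C)) := ((hlim.pow 2).mul_const C).const_sub _
    have hlim2 : Tendsto (fun n : ℕ => q.2.2 + 2 * (1 / ((n : ℝ) + 1))) atTop
        (𝓝 (q.2.2 + 2 * 0)) := (hlim.const_mul 2).const_add _
    have hev := hlim2.eventually_lt hlim1 (by simpa using hpass)
    filter_upwards [hev] with n hn
    refine iff_of_false ?_ (not_le.2 hpass)
    change ¬ a * |∑ w, (c n w : ℝ) * feature x w| ≤ (τ n : ℝ)
    have h3 := (abs_le.1 (hdiff n)).1
    have := hτ2 n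
    rw [not_le]
    linarith

lemma exists_rat_tuple {d k N t : ℕ} (f : Fin k → Pt d → Bool) (θ : Fin t → Filt k N ℝ) :
    ∃ θn : ℕ → Fin t → Filt k N ℚ, ∀ x, ∀ᶠ n in atTop,
      (Accepts f (fun r => castFilt (θn n r)) x ↔ Accepts f θ x) := by
  choose q hq using fun r => exists_rat_filt f (θ r)
  refine ⟨fun n r => q r n, fun x => ?_⟩
  filter_upwards [eventually_all.2 fun r => hq r x] with n hn
  exact forall_congr' hn

open Classical in
/-- The function equal to `u` where the filters accept and to `v` elsewhere. -/
noncomputable def sel {d k N t : ℕ} (f : Fin k → Pt d → Bool) (θ : Fin t → Filt k N ℝ)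
    (u v : Pt d → ℝ) (x : Pt d) : ℝ :=
  if Accepts f θ x then u x else v x

lemma abs_sel_le {d k N t : ℕ} (f : Fin k → Pt d → Bool) (θ : Fin t → Filt k N ℝ)
    {u v : Pt d → ℝ} {b : ℝ} (hu : ∀ x, |u x| ≤ b) (hv : ∀ x, |v x| ≤ b) (x : Pt d) :
    |sel f θ u v x| ≤ b := by
  unfold sel
  split_ifs
  · exact hu x
  · exact hv x

lemma measurable_sel {d k N t : ℕ} {f : Fin k → Pt d → Bool} (hf : ∀ i, Measurable (f i))
    (θ : Fin t → Filt k N ℝ) {u v : Pt d → ℝ} (hu : Measurable u) (hv : Measurable v) :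
    Measurable (sel f θ u v) := by
  classical
  exact Measurable.ite (measurableSet_accepts hf θ) hu hv

/-- The violation is strict. Rational approximations eventually agree with the given tuple on the
finitely many sample points, and the integral converges by dominated convergence, so some
approximation is violated too. This reduces the supremum to a countable class. -/
lemma exists_rat_violation {d k N t n : ℕ} {f : Fin k → Pt d → Bool} (hf : ∀ i, Measurable (f i))
    (D : Measure (Pt d)) [IsProbabilityMeasure D] {u v : Pt d → ℝ} (hu : Measurable u)
    (hv : Measurable v) {b : ℝ} (hub : ∀ x, |u x| ≤ b) (hvb : ∀ x, |v x| ≤ b) {ε : ℝ}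
    (x : Fin n → Pt d) (θ : Fin t → Filt k N ℝ)
    (h : ε < ∫ y, sel f θ u v y ∂D - (∑ j, sel f θ u v (x j)) / n) :
    ∃ θ' : Fin t → Filt k N ℚ, ε < ∫ y, sel f (fun r => castFilt (θ' r)) u v y ∂D -
      (∑ j, sel f (fun r => castFilt (θ' r)) u v (x j)) / n := by
  obtain ⟨θn, hθn⟩ := exists_rat_tuple f θ
  have hpt : ∀ y, ∀ᶠ n in atTop, sel f (fun r => castFilt (θn n r)) u v y = sel f θ u v y := by
    intro y
    filter_upwards [hθn y] with n hn
    unfold sel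
    by_cases h : Accepts f θ y
    · rw [if_pos h, if_pos (hn.2 h)]
    · rw [if_neg h, if_neg (mt hn.1 h)]
  have hlim1 : Tendsto (fun n => ∫ y, sel f (fun r => castFilt (θn n r)) u v y ∂D) atTop
      (𝓝 (∫ y, sel f θ u v y ∂D)) := by
    refine tendsto_integral_of_dominated_convergence (fun _ => b)
      (fun n => (measurable_sel hf _ hu hv).aestronglyMeasurable) (integrable_const _)
      (fun n => Eventually.of_forall fun y => abs_sel_le f _ hub hvb y)
      (Eventually.of_forall fun y => ?_)
    exact tendsto_const_nhds.congr' ((hpt y).mono fun n hn => hn.symm)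
  have hev : ∀ᶠ i in atTop, (∑ j, sel f (fun r => castFilt (θn i r)) u v (x j)) / n =
      (∑ j, sel f θ u v (x j)) / n := by
    filter_upwards [eventually_all.2 fun j => hpt (x j)] with i hi
    rw [Finset.sum_congr rfl fun j _ => hi j]
  have hlim2 := (hlim1.sub_const ((∑ j, sel f θ u v (x j)) / n)).eventually (lt_mem_nhds h)
  obtain ⟨i, hi1, hi2⟩ := (hev.and hlim2).exists
  exact ⟨θn i, by rw [hi1]; exact hi2⟩

/-- The differences depend on the tuple only through the set of accepted points among the `2 * n`
points of the double sample. -/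
lemma sel_patterns {d k N t n : ℕ} (f : Fin k → Pt d → Bool) (u v : Pt d → ℝ)
    (z : Fin n → Pt d × Pt d) : ∃ V : Finset (Fin n → ℝ), V.card ≤ growth k N t (2 * n) ∧
      ∀ θ : Fin t → Filt k N ℝ, (fun j => sel f θ u v (z j).2 - sel f θ u v (z j).1) ∈ V := by
  classical
  obtain ⟨𝒜, hcard, hmem⟩ := exists_accept_patterns (N := N) t f
    (fun a : Fin n ⊕ Fin n => a.elim (fun j => (z j).1) (fun j => (z j).2))
  have e : Fintype.card (Fin n ⊕ Fin n) = 2 * n := by simp; ring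
  rw [e] at hcard
  refine ⟨𝒜.image fun A j => (if Sum.inr j ∈ A then u (z j).2 else v (z j).2) -
    (if Sum.inl j ∈ A then u (z j).1 else v (z j).1), Finset.card_image_le.trans hcard,
    fun θ => Finset.mem_image.2 ⟨_, hmem θ, ?_⟩⟩
  ext j
  simp only [Finset.mem_filter, Finset.mem_univ, true_and, Sum.elim_inr, Sum.elim_inl, sel]

/-- The probability bound in the uniform convergence theorem for `t` filters. -/
noncomputable def ucBound (k N t n : ℕ) (b ε : ℝ) : ℝ :=
  growth k N t (2 * n) * Real.exp (-(n * ε ^ 2 / (8 * b ^ 2)))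

theorem uniform_convergence_sel {d k N t n : ℕ} {f : Fin k → Pt d → Bool}
    (hf : ∀ i, Measurable (f i)) (hn : 1 ≤ n)
    (D : Measure (Pt d)) [IsProbabilityMeasure D] {u v : Pt d → ℝ} (hu : Measurable u)
    (hv : Measurable v) {b ε : ℝ} (hb : 0 < b) (hε : 0 < ε) (hub : ∀ x, |u x| ≤ b)
    (hvb : ∀ x, |v x| ≤ b) :
    (Measure.pi fun _ : Fin n => D) {x | ∃ θ : Fin t → Filt k N ℝ,
        ε < ∫ y, sel f θ u v y ∂D - (∑ j, sel f θ u v (x j)) / n} ≤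
      ENNReal.ofReal (ucBound k N t n b ε) := by
  refine (measure_mono ?_).trans (uniform_convergence (ι := Fin t → Filt k N ℚ) D hn
    (fun θ => sel f (fun r => castFilt (θ r)) u v) (fun θ => measurable_sel hf _ hu hv) b ε hb hε
    (fun θ => abs_sel_le f _ hub hvb) (growth k N t (2 * n)) (fun z => ?_))
  · rintro x ⟨θ, hθ⟩
    exact exists_rat_violation hf D hu hv hub hvb x θ hθ
  · obtain ⟨V, hV, hm⟩ := sel_patterns (N := N) (t := t) f u v z
    exact ⟨V, hV, fun θ => hm _⟩

/-- Uniform convergence for functions that depend on an independent random element. -/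
theorem uniform_convergence_sel_prod {d k N t n : ℕ} {f : Fin k → Pt d → Bool}
    (hf : ∀ i, Measurable (f i)) (hn : 1 ≤ n) {Y : Type*} [MeasurableSpace Y] (μ : Measure Y)
    [IsProbabilityMeasure μ]
    (D : Measure (Pt d)) [IsProbabilityMeasure D] {u v : Y → Pt d → ℝ}
    (hu : Measurable (Function.uncurry u)) (hv : Measurable (Function.uncurry v)) {b ε : ℝ}
    (hb : 0 < b) (hε : 0 < ε) (hub : ∀ y x, |u y x| ≤ b) (hvb : ∀ y x, |v y x| ≤ b) :
    (μ.prod (Measure.pi fun _ : Fin n => D)) {ω | ∃ θ : Fin t → Filt k N ℝ,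
        ε < ∫ y, sel f θ (u ω.1) (v ω.1) y ∂D - (∑ j, sel f θ (u ω.1) (v ω.1) (ω.2 j)) / n} ≤
      ENNReal.ofReal (ucBound k N t n b ε) := by
  classical
  have hu1 : ∀ y, Measurable (u y) := fun y => hu.comp measurable_prodMk_left
  have hv1 : ∀ y, Measurable (v y) := fun y => hv.comp measurable_prodMk_left
  -- The countable union over rational tuples is measurable and contains the event in question.
  -- Fubini reduces its measure to sections, on which `u` and `v` are fixed.
  set Bad : Set (Y × (Fin n → Pt d)) := ⋃ θ : Fin t → Filt k N ℚ,
    {ω | ε < ∫ y, sel f (fun r => castFilt (θ r)) (u ω.1) (v ω.1) y ∂D -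
      (∑ j, sel f (fun r => castFilt (θ r)) (u ω.1) (v ω.1) (ω.2 j)) / n} with hBad
  have hmeas : MeasurableSet Bad := by
    refine MeasurableSet.iUnion fun θ => measurableSet_lt measurable_const ?_
    have hsel : Measurable fun q : Y × Pt d =>
        sel f (fun r => castFilt (θ r)) (u q.1) (v q.1) q.2 :=
      Measurable.ite (measurable_snd (measurableSet_accepts hf _)) hu hv
    refine Measurable.sub ?_ ((Finset.measurable_sum _ fun j _ => ?_).div_const _)
    · exact (hsel.stronglyMeasurable.integral_prod_right' (ν := D)).measurable.comp measurable_fst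
    · exact hsel.comp (measurable_fst.prodMk ((measurable_pi_apply j).comp measurable_snd))
  refine (measure_mono (t := Bad) ?_).trans ?_
  · rintro ω ⟨θ, hθ⟩
    obtain ⟨θ', h'⟩ := exists_rat_violation hf D (hu1 ω.1) (hv1 ω.1) (hub ω.1) (hvb ω.1) ω.2 θ hθ
    exact Set.mem_iUnion.2 ⟨θ', h'⟩
  · rw [Measure.prod_apply hmeas]
    calc _ ≤ ∫⁻ _, ENNReal.ofReal (ucBound k N t n b ε) ∂μ := by
          refine lintegral_mono fun y => (measure_mono ?_).trans (uniform_convergence_sel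
            (t := t) (N := N) hf hn D (hu1 y) (hv1 y) hb hε (hub y) (hvb y))
          intro x hx
          obtain ⟨θ, hθ⟩ := Set.mem_iUnion.1 hx
          exact ⟨_, hθ⟩
      _ = _ := by simp

end ICF

namespace ICF

open Filter Topology

/-! ### Moments and concentration -/

/-- For exponents from two on, the moment inequality is applied to the polynomial `X i`; its right
side is finite because the coordinate has finite mean. The hypothesis on coordinates enters here. -/
lemma integrable_coord_pow {d : ℕ} {A : ℝ} {D : Measure (Pt d)} [IsProbabilityMeasure D]
    (h : Hypercontractive A D) (i : Fin d) (r : ℕ) : Integrable (fun x : Pt d => |x i| ^ r) D := by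
  rcases Nat.lt_or_ge r 2 with hr | hr
  · interval_cases r
    · simp
    · simpa using (h.2 i).abs
  · have h1 := h.1 (MvPolynomial.X i) r (by exact_mod_cast hr)
    simp only [MvPolynomial.eval_X, Real.rpow_natCast, ENNReal.rpow_natCast] at h1
    refine ⟨((measurable_pi_apply i).abs.pow_const r).aestronglyMeasurable, ?_⟩
    rw [hasFiniteIntegral_iff_ofReal (Eventually.of_forall fun x => by positivity)]
    refine h1.trans_lt (ENNReal.mul_lt_top ENNReal.ofReal_lt_top (ENNReal.pow_lt_top ?_))
    have := (h.2 i).abs.2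
    rwa [hasFiniteIntegral_iff_ofReal (Eventually.of_forall fun x => abs_nonneg _)] at this

/-- All powers are treated at once in the induction on the polynomial: multiplication by a variable
is handled by `uv ≤ u² + v²`, which doubles the exponent. -/
lemma integrable_eval_pow {d : ℕ} {A : ℝ} {D : Measure (Pt d)} [IsProbabilityMeasure D]
    (h : Hypercontractive A D) (p : MvPolynomial (Fin d) ℝ) :
    ∀ r : ℕ, Integrable (fun x : Pt d => |MvPolynomial.eval x p| ^ r) D := by
  induction p using MvPolynomial.induction_on with
  | C a => intro r; simp
  | add p q hp hq =>
    intro r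
    refine (((hp r).add (hq r)).const_mul (2 ^ (r - 1))).mono'
      ((measurable_eval _).abs.pow_const r).aestronglyMeasurable (Eventually.of_forall fun x => ?_)
    rw [Real.norm_eq_abs, abs_of_nonneg (by positivity), map_add]
    calc |MvPolynomial.eval x p + MvPolynomial.eval x q| ^ r
        ≤ (|MvPolynomial.eval x p| + |MvPolynomial.eval x q|) ^ r := by
          gcongr; exact abs_add_le _ _
      _ ≤ _ := add_pow_le (abs_nonneg _) (abs_nonneg _) r
  | mul_X p i hp =>
    intro r
    refine ((hp (2 * r)).add (integrable_coord_pow h i (2 * r))).mono'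
      ((measurable_eval _).abs.pow_const r).aestronglyMeasurable (Eventually.of_forall fun x => ?_)
    rw [Real.norm_eq_abs, abs_of_nonneg (by positivity), map_mul, MvPolynomial.eval_X, abs_mul,
      mul_pow, Pi.add_apply, pow_mul', pow_mul']
    nlinarith [sq_nonneg (|MvPolynomial.eval x p| ^ r - |x i| ^ r),
      sq_nonneg (|MvPolynomial.eval x p| ^ r), sq_nonneg (|x i| ^ r)]

lemma integrable_eval {d : ℕ} {A : ℝ} {D : Measure (Pt d)} [IsProbabilityMeasure D]
    (h : Hypercontractive A D) (p : MvPolynomial (Fin d) ℝ) :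
    Integrable (fun x : Pt d => MvPolynomial.eval x p) D := by
  have := integrable_eval_pow h p 1
  simp only [pow_one] at this
  exact (integrable_norm_iff (measurable_eval p).aestronglyMeasurable).1 this

/-- The moments of a polynomial in terms of its mean absolute value. -/
lemma Hypercontractive.moment_le {d : ℕ} {A : ℝ} {D : Measure (Pt d)} [IsProbabilityMeasure D]
    (h : Hypercontractive A D) (hA : 1 ≤ A) {p : MvPolynomial (Fin d) ℝ} {l : ℕ}
    (hp : p.totalDegree ≤ l) {M : ℝ} (hM : ∫ x, |MvPolynomial.eval x p| ∂D ≤ M) {t : ℝ}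
    (ht : 2 ≤ t) :
    ∫⁻ x, ENNReal.ofReal (|MvPolynomial.eval x p| ^ t) ∂D ≤
      ENNReal.ofReal (((A * t) ^ l * M) ^ t) := by
  have hM0 : 0 ≤ M := le_trans (integral_nonneg fun _ => abs_nonneg _) hM
  have hAt : 1 ≤ A * t := by nlinarith
  refine (h.1 p t ht).trans ?_
  rw [← ofReal_integral_eq_lintegral_ofReal (integrable_eval h p).abs
    (Eventually.of_forall fun _ => abs_nonneg _),
    ENNReal.ofReal_rpow_of_nonneg (integral_nonneg fun _ => abs_nonneg _) (by linarith),
    ← ENNReal.ofReal_mul (by positivity)]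
  refine ENNReal.ofReal_le_ofReal ?_
  rw [Real.mul_rpow (by positivity) hM0]
  refine mul_le_mul ?_ (Real.rpow_le_rpow (integral_nonneg fun _ => abs_nonneg _) hM
    (by linarith)) (Real.rpow_nonneg (integral_nonneg fun _ => abs_nonneg _) _) (by positivity)
  rw [← Real.rpow_natCast, ← Real.rpow_mul (by positivity)]
  -- Because `A * t ≥ 1`, the degree may be replaced by its upper bound `l`.
  refine Real.rpow_le_rpow_of_exponent_le hAt ?_
  rw [mul_comm]
  gcongr

/-- Hoeffding's inequality, one-sided. -/
lemma hoeffding {X : Type*} [MeasurableSpace X] (D : Measure X) [IsProbabilityMeasure D] {m : ℕ}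
    (hm : 1 ≤ m) {g : X → ℝ} (hg : Measurable g) {b ε : ℝ} (hb0 : 0 < b) (hε : 0 < ε)
    (hb : ∀ x, |g x| ≤ b) :
    (Measure.pi fun _ : Fin m => D) {x | ε < ∫ y, g y ∂D - (∑ j, g (x j)) / m} ≤
      ENNReal.ofReal (Real.exp (-(m * ε ^ 2 / (8 * b ^ 2)))) := by
  have := uniform_convergence (ι := Unit) D hm (fun _ => g) (fun _ => hg) b ε hb0 hε
    (fun _ => hb) 1 (fun z => ⟨{fun j => g (z j).2 - g (z j).1}, by simp, by simp⟩)
  simpa using this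

/-- Concentration of an empirical mean by truncation. -/
lemma concentration {X : Type*} [MeasurableSpace X] (D : Measure X) [IsProbabilityMeasure D]
    {m : ℕ} (hm : 1 ≤ m) {h q : X → ℝ} (hh : Measurable h) (hq : Measurable q)
    (hhq : ∀ x, |h x| ≤ |q x|) (hi : Integrable q D) {K t b η : ℝ} (hK : 0 ≤ K) (ht : 1 ≤ t)
    (hb : 0 < b) (hη : 0 < η)
    (hmom : ∫⁻ x, ENNReal.ofReal (|q x| ^ t) ∂D ≤ ENNReal.ofReal (K ^ t))
    (hbias : K ^ t / b ^ (t - 1) ≤ η / 2) :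
    (Measure.pi fun _ : Fin m => D) {x | η < |∫ y, h y ∂D - (∑ j, h (x j)) / m|} ≤
      ENNReal.ofReal (m * (K / b) ^ t + 2 * Real.exp (-(m * η ^ 2 / (32 * b ^ 2)))) := by
  classical
  have hm0 : (0 : ℝ) < m := by exact_mod_cast hm
  have hih : Integrable h D := hi.mono hh.aestronglyMeasurable (Eventually.of_forall hhq)
  have hset : MeasurableSet {x | |q x| ≤ b} := measurableSet_le hq.abs measurable_const
  -- The truncation is governed by the dominating function `q`, whose moments are known, and not by
  -- `h` itself.
  set g : X → ℝ := fun x => if |q x| ≤ b then h x else 0 with hg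
  have hgm : Measurable g := Measurable.ite hset hh measurable_const
  have hgb : ∀ x, |g x| ≤ b := fun x => by
    simp only [hg]
    split_ifs with hx
    · exact (hhq x).trans hx
    · simpa using hb.le
  have hgi : Integrable g D :=
    Integrable.of_bound hgm.aestronglyMeasurable b (Eventually.of_forall hgb)
  -- the bias of the truncation
  have hmomI : Integrable (fun x => |q x| ^ t) D := by
    refine ⟨(hq.abs.pow_const t).aestronglyMeasurable, ?_⟩
    rw [hasFiniteIntegral_iff_ofReal (Eventually.of_forall fun x => by positivity)]
    exact hmom.trans_lt ENNReal.ofReal_lt_top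
  have hmomR : ∫ x, |q x| ^ t ∂D ≤ K ^ t := by
    rw [integral_eq_lintegral_of_nonneg_ae (Eventually.of_forall fun x => by positivity)
      hmomI.1]
    exact ENNReal.toReal_le_of_le_ofReal (by positivity) hmom
  have hdiff : |∫ y, h y ∂D - ∫ y, g y ∂D| ≤ η / 2 := by
    rw [← integral_sub hih hgi]
    -- Where `|q| > b`, one has `|q| ≤ |q|^t / b^(t-1)`, so the bias of the truncation is controlled
    -- by the `t`-th moment.
    calc |∫ y, (h y - g y) ∂D| ≤ ∫ y, |q y| ^ t / b ^ (t - 1) ∂D := by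
          rw [← Real.norm_eq_abs]
          refine norm_integral_le_of_norm_le (hmomI.div_const _) (Eventually.of_forall fun y => ?_)
          simp only [hg]
          split_ifs with hy
          · simp; positivity
          · push Not at hy
            rw [sub_zero, Real.norm_eq_abs]
            refine (hhq y).trans ?_
            rw [le_div_iff₀ (by positivity)]
            have h0 : 0 < |q y| := hb.trans hy
            calc |q y| * b ^ (t - 1) ≤ |q y| * |q y| ^ (t - 1) := by
                  gcongr
              _ = |q y| ^ t := by
                  nth_rewrite 1 [← Real.rpow_one (|q y|)]
                  rw [← Real.rpow_add h0]
                  ring_nf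
      _ = (∫ y, |q y| ^ t ∂D) / b ^ (t - 1) := integral_div _ _
      _ ≤ K ^ t / b ^ (t - 1) := by gcongr
      _ ≤ η / 2 := hbias
  -- Either some sample point exceeds the truncation level, which Markov's inequality makes
  -- unlikely, or the truncated mean is off by more than `η / 2`, the other half having been spent
  -- on the bias; this is Hoeffding's inequality for `g` and for `-g`.
  have hsub : {x : Fin m → X | η < |∫ y, h y ∂D - (∑ j, h (x j)) / m|} ⊆
      (⋃ j, {x | b < |q (x j)|}) ∪ ({x | η / 2 < ∫ y, g y ∂D - (∑ j, g (x j)) / m} ∪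
        {x | η / 2 < ∫ y, -g y ∂D - (∑ j, -g (x j)) / m}) := by
    intro x hx
    by_cases hxb : ∃ j, b < |q (x j)|
    · exact Or.inl (Set.mem_iUnion.2 hxb)
    · push Not at hxb
      right
      have e : ∑ j, g (x j) = ∑ j, h (x j) :=
        Finset.sum_congr rfl fun j _ => by simp only [hg]; rw [if_pos (hxb j)]
      have e1 : |∫ y, h y ∂D - (∑ j, h (x j)) / m| ≤ η / 2 +
          |∫ y, g y ∂D - (∑ j, g (x j)) / m| := by
        rw [e]
        have := abs_add_le (∫ y, h y ∂D - ∫ y, g y ∂D) (∫ y, g y ∂D - (∑ j, h (x j)) / m)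
        rw [sub_add_sub_cancel] at this
        linarith
      have hx' : η < |∫ y, h y ∂D - (∑ j, h (x j)) / m| := hx
      have e2 : η / 2 < |∫ y, g y ∂D - (∑ j, g (x j)) / m| := by linarith
      rcases lt_abs.1 e2 with h3 | h3
      · exact Or.inl h3
      · right
        change η / 2 < ∫ y, -g y ∂D - (∑ j, -g (x j)) / m
        rw [integral_neg, Finset.sum_neg_distrib]
        rwa [neg_div, sub_neg_eq_add, neg_add_eq_sub, ← neg_sub]
  have htail : ∀ j : Fin m, (Measure.pi fun _ : Fin m => D) {x | b < |q (x j)|} ≤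
      ENNReal.ofReal ((K / b) ^ t) := fun j => by
    have e : (Measure.pi fun _ : Fin m => D) {x | b < |q (x j)|} = D {y | b < |q y|} :=
      (measurePreserving_eval (fun _ : Fin m => D) j).measure_preimage
        (measurableSet_lt measurable_const hq.abs).nullMeasurableSet
    rw [e]
    have hmk := mul_meas_ge_le_lintegral (μ := D)
      (ENNReal.measurable_ofReal.comp (hq.abs.pow_const t)) (ENNReal.ofReal (b ^ t))
    have h2 : ENNReal.ofReal (b ^ t) * D {y | b < |q y|} ≤
        ENNReal.ofReal (b ^ t) * ENNReal.ofReal ((K / b) ^ t) := by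
      calc _ ≤ ENNReal.ofReal (b ^ t) *
            D {y | ENNReal.ofReal (b ^ t) ≤ (ENNReal.ofReal ∘ fun y => |q y| ^ t) y} := by
            gcongr with y
            intro hy
            refine ENNReal.ofReal_le_ofReal ?_
            exact Real.rpow_le_rpow hb.le hy.le (by linarith)
        _ ≤ _ := hmk.trans hmom
        _ = _ := by
            rw [← ENNReal.ofReal_mul (by positivity), Real.div_rpow hK hb.le]
            congr 1
            field_simp
    exact (ENNReal.mul_le_mul_iff_right
      (by simpa using Real.rpow_pos_of_pos hb t) (by simp)).1 h2
  have hη2 : (0 : ℝ) < η / 2 := by positivity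
  have hH1 := hoeffding D hm hgm hb hη2 hgb
  have hH2 := hoeffding D hm hgm.neg hb hη2 (fun x => by simpa using hgb x)
  have eexp : (m : ℝ) * (η / 2) ^ 2 / (8 * b ^ 2) = m * η ^ 2 / (32 * b ^ 2) := by
    field_simp; ring
  rw [eexp] at hH1 hH2
  calc _ ≤ _ := measure_mono hsub
    _ ≤ _ := measure_union_le _ _
    _ ≤ ∑ j : Fin m, ENNReal.ofReal ((K / b) ^ t) +
        (ENNReal.ofReal (Real.exp (-(m * η ^ 2 / (32 * b ^ 2)))) +
          ENNReal.ofReal (Real.exp (-(m * η ^ 2 / (32 * b ^ 2))))) := by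
        refine add_le_add ((measure_iUnion_fintype_le _ _).trans
          (Finset.sum_le_sum fun j _ => htail j))
          ((measure_union_le _ _).trans (add_le_add hH1 hH2))
    _ = _ := by
        rw [ENNReal.ofReal_add (by positivity) (by positivity), ENNReal.ofReal_mul hm0.le,
          two_mul, ENNReal.ofReal_add (Real.exp_pos _).le (Real.exp_pos _).le]
        simp

end ICF

namespace ICF

open Filter Topology

/-! ### All parameters in terms of one number, and concentration of polynomials -/

/-- Bounds of all parameters by a single number `Q`. -/
structure Scale (d l k : ℕ) (A R β ε δ Q : ℝ) : Prop where
  one_le_d : 1 ≤ d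
  one_le_l : 1 ≤ l
  one_le_k : 1 ≤ k
  one_le_A : 1 ≤ A
  one_lt_R : 1 < R
  β_pos : 0 < β
  ε_pos : 0 < ε
  ε_lt : ε < 1
  δ_pos : 0 < δ
  δ_lt : δ < 1
  five_le : 5 ≤ Q
  R_le : R ≤ Q
  β_le : β ≤ Q
  A_le : A ^ l ≤ Q
  dim_le : ((d : ℝ) + 1) ^ l ≤ Q
  inv_ε_le : 1 / ε ≤ Q
  log_le : Real.log (k / δ) ^ l ≤ Q

namespace Scale

variable {d l k : ℕ} {A R β ε δ Q : ℝ}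

lemma log_pos (h : Scale d l k A R β ε δ Q) : 0 < Real.log (k / δ) := by
  refine Real.log_pos ?_
  rw [one_lt_div h.δ_pos]
  have : (1 : ℝ) ≤ k := by exact_mod_cast h.one_le_k
  linarith [h.δ_lt]

lemma exp_neg_log (h : Scale d l k A R β ε δ Q) : Real.exp (-Real.log (k / δ)) = δ / k := by
  have hk : (0 : ℝ) < k := by exact_mod_cast h.one_le_k
  rw [Real.exp_neg, Real.exp_log (div_pos hk h.δ_pos), inv_div]

lemma max_log_pow_le (h : Scale d l k A R β ε δ Q) : (max 1 (Real.log (k / δ))) ^ l ≤ Q := by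
  rcases le_total 1 (Real.log (k / δ)) with h1 | h1
  · rw [max_eq_right h1]; exact h.log_le
  · rw [max_eq_left h1, one_pow]; linarith [h.five_le]

lemma log_le_self (h : Scale d l k A R β ε δ Q) : Real.log (k / δ) ≤ Q := by
  calc Real.log (k / δ) ≤ max 1 (Real.log (k / δ)) := le_max_right _ _
    _ ≤ (max 1 (Real.log (k / δ))) ^ l :=
        le_self_pow₀ (le_max_left _ _) (by have := h.one_le_l; omega)
    _ ≤ Q := h.max_log_pow_le

/-- Factors exponential in `l` are absorbed by `(d+1)^l`: one has `4 + log(k/δ) ≤ 8 max(1,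
log(k/δ))`, and `8^l = (2^l)^3 ≤ Q^3`. The exponent `2 * l` is the degree of a product of two
polynomials of degree `l`. -/
lemma moment_factor_le (h : Scale d l k A R β ε δ Q) : (A * (4 + Real.log (k / δ))) ^ (2 * l) ≤ Q ^ 10 := by
  have hΛ := h.log_pos
  have hQ := h.five_le
  have h1 : (4 + Real.log (k / δ)) ^ l ≤ Q ^ 4 := by
    calc (4 + Real.log (k / δ)) ^ l ≤ (2 ^ 3 * max 1 (Real.log (k / δ))) ^ l := by
          gcongr
          have := le_max_left 1 (Real.log (k / δ))
          have := le_max_right 1 (Real.log (k / δ))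
          linarith
      _ = (2 ^ l) ^ 3 * (max 1 (Real.log (k / δ))) ^ l := by
          rw [mul_pow, ← pow_mul, ← pow_mul, mul_comm 3 l]
      _ ≤ Q ^ 3 * Q := by
          have hd : (1 : ℝ) ≤ d := by exact_mod_cast h.one_le_d
          gcongr
          · refine le_trans ?_ h.dim_le
            gcongr
            linarith
          · exact h.max_log_pow_le
      _ = Q ^ 4 := by ring
  have hA := h.one_le_A
  calc _ = (A ^ l) ^ 2 * ((4 + Real.log (k / δ)) ^ l) ^ 2 := by
        rw [mul_pow]; ring
    _ ≤ Q ^ 2 * (Q ^ 4) ^ 2 := by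
        gcongr
        exact h.A_le
    _ = Q ^ 10 := by ring

end Scale

/-- The truncation level will grow like `r = m^(1/4)`: then the fourth power in the tail bound
cancels the union bound over `m` points, while the Hoeffding exponent, of order `m / r² = r²`, still
grows. -/
lemma exists_fourth_root {Q : ℝ} {m : ℕ} (hm : Q ^ 80 ≤ (m : ℝ)) :
    ∃ r : ℝ, Q ^ 20 ≤ r ∧ r ^ 4 = m := by
  refine ⟨√√(m : ℝ), ?_, ?_⟩
  · refine Real.le_sqrt_of_sq_le (Real.le_sqrt_of_sq_le ?_)
    rw [← pow_mul, ← pow_mul]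
    exact hm
  · rw [show (4 : ℕ) = 2 * 2 by rfl, pow_mul, Real.sq_sqrt (Real.sqrt_nonneg _),
      Real.sq_sqrt (Nat.cast_nonneg m)]

/-- Empirical means of functions dominated by a polynomial concentrate. -/
lemma concentration_poly {d l k : ℕ} {A R β ε δ Q : ℝ} (h : Scale d l k A R β ε δ Q)
    {D : Measure (Pt d)} [IsProbabilityMeasure D] (hD : Hypercontractive A D) {m : ℕ}
    (hm : Q ^ 80 ≤ (m : ℝ)) {q : MvPolynomial (Fin d) ℝ} (hq : q.totalDegree ≤ 2 * l) {M : ℝ}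
    (hM : ∫ x, |MvPolynomial.eval x q| ∂D ≤ M) {g : Pt d → ℝ} (hg : Measurable g)
    (hgq : ∀ x, |g x| ≤ |MvPolynomial.eval x q|) :
    (Measure.pi fun _ : Fin m => D) {x | M / Q ^ 4 < |∫ y, g y ∂D - (∑ j, g (x j)) / m|} ≤
      ENNReal.ofReal (δ / (8 * k * Q ^ 2)) := by
  have hM0 : 0 ≤ M := le_trans (integral_nonneg fun _ => abs_nonneg _) hM
  have hQ := h.five_le
  have hQ0 : (0 : ℝ) < Q := by linarith
  have hm0 : (0 : ℝ) < m := lt_of_lt_of_le (by positivity) hm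
  have hm1 : 1 ≤ m := by exact_mod_cast hm0
  have hk : (0 : ℝ) < k := by exact_mod_cast h.one_le_k
  have hδ := h.δ_pos
  -- For `M = 0` the truncation level below would be zero; in that case `g` vanishes almost surely.
  rcases hM0.eq_or_lt with rfl | hMpos
  · have hz : ∀ᵐ x ∂D, g x = 0 := by
      have h1 : ∫ x, |MvPolynomial.eval x q| ∂D = 0 :=
        le_antisymm hM (integral_nonneg fun _ => abs_nonneg _)
      rw [integral_eq_zero_iff_of_nonneg (fun _ => abs_nonneg _) (integrable_eval hD q).abs] at h1
      filter_upwards [h1] with x hx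
      have := hgq x
      simp only [Pi.zero_apply] at hx
      rw [hx] at this
      exact abs_nonpos_iff.1 this
    have hI : ∫ y, g y ∂D = 0 := integral_eq_zero_of_ae hz
    have hall : ∀ᵐ x ∂(Measure.pi fun _ : Fin m => D), ∀ j, g (x j) = 0 := by
      rw [ae_all_iff]
      exact fun j => (measurePreserving_eval (fun _ : Fin m => D) j).quasiMeasurePreserving.ae hz
    have : (Measure.pi fun _ : Fin m => D)
        {x | 0 / Q ^ 4 < |∫ y, g y ∂D - (∑ j, g (x j)) / m|} = 0 := by
      refine measure_mono_null (fun x hx => ?_) (ae_iff.1 hall)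
      intro hx'
      have hx2 : 0 / Q ^ 4 < |∫ y, g y ∂D - (∑ j, g (x j)) / m| := hx
      rw [hI, Finset.sum_eq_zero fun j _ => hx' j] at hx2
      simp at hx2
    rw [this]; exact zero_le
  · obtain ⟨r, hr, hrm⟩ := exists_fourth_root hm
    have hr0 : 0 < r := lt_of_lt_of_le (by positivity) hr
    have hΛ := h.log_pos
    set Λ := Real.log (k / δ) with hΛd
    -- Of the order `4 + Λ`, the `4` pays for the union bound over the sample and the `Λ` produces
    -- the factor `exp (-Λ) = δ / k`.
    have hmom := hD.moment_le h.one_le_A hq hM (t := 4 + Λ) (by linarith)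
    have hmom' : ∫⁻ x, ENNReal.ofReal (|MvPolynomial.eval x q| ^ (4 + Λ)) ∂D ≤
        ENNReal.ofReal ((Q ^ 10 * M) ^ (4 + Λ)) := by
      have hA := h.one_le_A
      refine hmom.trans (ENNReal.ofReal_le_ofReal (Real.rpow_le_rpow (by positivity) ?_
        (by linarith)))
      exact mul_le_mul_of_nonneg_right h.moment_factor_le hM0
    -- The truncation level exceeds the moment scale `Q ^ 10 * M` by the factor `Q ^ 3 * r`.
    have hb : 0 < Q ^ 13 * r * M := by positivity
    have hratio : Q ^ 10 * M / (Q ^ 13 * r * M) = 1 / (Q ^ 3 * r) := by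
      field_simp
    have hQr : 1 ≤ Q ^ 3 * r := by
      have : (1 : ℝ) ≤ Q ^ 20 := one_le_pow₀ (by linarith)
      have : (1 : ℝ) ≤ Q ^ 3 := one_le_pow₀ (by linarith)
      nlinarith
    have hconc := concentration D hm1 hg (measurable_eval q) hgq (integrable_eval hD q)
      (K := Q ^ 10 * M) (t := 4 + Λ) (b := Q ^ 13 * r * M) (η := M / Q ^ 4) (by positivity)
      (by linarith) hb (by positivity) hmom' (by
        have e : (Q ^ 10 * M) ^ (4 + Λ) / (Q ^ 13 * r * M) ^ (4 + Λ - 1) =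
            Q ^ 10 * M * (1 / (Q ^ 3 * r)) ^ (4 + Λ - 1) := by
          rw [← hratio, Real.div_rpow (by positivity) hb.le, Real.rpow_sub_one hb.ne',
            Real.rpow_sub_one (by positivity)]
          field_simp
        rw [e]
        have e2 : (1 / (Q ^ 3 * r)) ^ (4 + Λ - 1) ≤ 1 / (Q ^ 3 * r) := by
          nth_rewrite 2 [← Real.rpow_one (1 / (Q ^ 3 * r))]
          refine Real.rpow_le_rpow_of_exponent_ge (by positivity) ?_ (by linarith)
          rw [div_le_one (by positivity)]
          exact hQr
        calc Q ^ 10 * M * (1 / (Q ^ 3 * r)) ^ (4 + Λ - 1) ≤ Q ^ 10 * M * (1 / (Q ^ 3 * r)) := by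
              gcongr
          _ ≤ Q ^ 10 * M * (1 / (Q ^ 3 * Q ^ 20)) := by gcongr
          _ = M * (1 / Q ^ 13) := by field_simp
          _ ≤ M * (1 / (Q ^ 4 * 2)) := by
              gcongr
              calc Q ^ 4 * 2 ≤ Q ^ 4 * Q ^ 9 := by
                    gcongr
                    calc (2 : ℝ) ≤ Q := by linarith
                      _ ≤ Q ^ 9 := le_self_pow₀ (by linarith) (by norm_num)
                _ = Q ^ 13 := by ring
          _ = M / Q ^ 4 / 2 := by field_simp)
    refine hconc.trans (ENNReal.ofReal_le_ofReal ?_)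
    -- A base of at least `e` is what makes its `Λ`-th power at least `k / δ`.
    have hexp1 : Real.exp 1 ≤ Q ^ 3 * r := by
      have h1 := Real.exp_one_lt_d9
      have h2 : (1 : ℝ) ≤ Q ^ 20 := one_le_pow₀ (by linarith)
      have h3 : Q ≤ Q ^ 3 := le_self_pow₀ (by linarith) (by norm_num)
      nlinarith
    have t1 : (m : ℝ) * (Q ^ 10 * M / (Q ^ 13 * r * M)) ^ (4 + Λ) ≤ δ / (16 * k * Q ^ 2) := by
      rw [hratio, Real.rpow_add (by positivity)]
      have e1 : (1 / (Q ^ 3 * r)) ^ Λ ≤ δ / k := by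
        rw [← h.exp_neg_log, ← hΛd]
        calc (1 / (Q ^ 3 * r)) ^ Λ ≤ (1 / Real.exp 1) ^ Λ := by
              refine Real.rpow_le_rpow (by positivity) ?_ hΛ.le
              exact one_div_le_one_div_of_le (Real.exp_pos _) hexp1
          _ = Real.exp (-Λ) := by
              rw [one_div, ← Real.exp_neg, ← Real.exp_mul]; ring_nf
      have e2 : (1 / (Q ^ 3 * r)) ^ (4 : ℝ) = 1 / (Q ^ 12 * m) := by
        rw [show (4 : ℝ) = ((4 : ℕ) : ℝ) by norm_num, Real.rpow_natCast, div_pow, one_pow, mul_pow,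
          hrm, ← pow_mul]
      rw [e2]
      calc (m : ℝ) * (1 / (Q ^ 12 * m) * (1 / (Q ^ 3 * r)) ^ Λ) ≤
            m * (1 / (Q ^ 12 * m) * (δ / k)) := by gcongr
        _ = δ / (Q ^ 10 * k * Q ^ 2) := by field_simp
        _ ≤ δ / (16 * k * Q ^ 2) := by
            gcongr
            calc (16 : ℝ) ≤ 5 ^ 10 := by norm_num
              _ ≤ Q ^ 10 := by gcongr
    have t2 : Real.exp (-((m : ℝ) * (M / Q ^ 4) ^ 2 / (32 * (Q ^ 13 * r * M) ^ 2))) ≤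
        δ / (32 * k * Q ^ 2) := by
      -- The scale `M` cancels. With `r ≥ Q ^ 20` the remaining exponent is at least `Q ^ 6 / 32`,
      -- enough to beat `log 32 + Λ + 2 log Q ≤ 10 Q`.
      have e1 : (m : ℝ) * (M / Q ^ 4) ^ 2 / (32 * (Q ^ 13 * r * M) ^ 2) = r ^ 2 / (32 * Q ^ 34) := by
        rw [← hrm]; field_simp
      have e2 : δ / (32 * k * Q ^ 2) = Real.exp (-(Real.log 32 + Λ + 2 * Real.log Q)) := by
        rw [neg_add, neg_add, Real.exp_add, Real.exp_add, h.exp_neg_log, Real.exp_neg,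
          Real.exp_log (by norm_num), Real.exp_neg, two_mul, Real.exp_add, Real.exp_log hQ0]
        field_simp
      rw [e1, e2]
      refine Real.exp_le_exp.2 (neg_le_neg ?_)
      have l1 : Real.log 32 ≤ 31 := by
        have := Real.log_le_sub_one_of_pos (show (0 : ℝ) < 32 by norm_num)
        linarith
      have l2 := Real.log_le_sub_one_of_pos hQ0
      have l3 := h.log_le_self
      rw [le_div_iff₀ (by positivity)]
      calc (Real.log 32 + Λ + 2 * Real.log Q) * (32 * Q ^ 34) ≤ (10 * Q) * (32 * Q ^ 34) := by
            gcongr; linarith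
        _ = 320 * Q ^ 35 := by ring
        _ ≤ Q ^ 5 * Q ^ 35 := by
            gcongr
            calc (320 : ℝ) ≤ 5 ^ 5 := by norm_num
              _ ≤ Q ^ 5 := by gcongr
        _ = (Q ^ 20) ^ 2 := by ring
        _ ≤ r ^ 2 := by gcongr
    calc _ ≤ δ / (16 * k * Q ^ 2) + 2 * (δ / (32 * k * Q ^ 2)) := by gcongr
      _ = δ / (8 * k * Q ^ 2) := by field_simp; norm_num

/-! ### The empirical covariance -/

/-- A family of polynomials that is orthogonal under `D` and spans degree `l`. -/
lemma exists_orthogonal {d l N : ℕ} (hd : 1 ≤ d) (hN : N = (d + 1) ^ l) {A : ℝ}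
    {D : Measure (Pt d)} [IsProbabilityMeasure D] (hD : Hypercontractive A D) :
    ∃ (ψ : Fin N → MvPolynomial (Fin d) ℝ) (lam : Fin N → ℝ),
      (∀ a, (ψ a).totalDegree ≤ l) ∧
      (∀ a b, ∫ x, MvPolynomial.eval x (ψ a) * MvPolynomial.eval x (ψ b) ∂D =
        if a = b then lam a else 0) ∧
      ∀ p : MvPolynomial (Fin d) ℝ, p.totalDegree ≤ l → ∃ c : Fin N → ℝ,
        ∀ x, MvPolynomial.eval x p = ∑ a, c a * MvPolynomial.eval x (ψ a) := by
  let G : Matrix (Fin N) (Fin N) ℝ :=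
    Matrix.of fun a b => ∫ x, feature x a * feature x b ∂D
  have hG : G.IsHermitian := by
    ext a b
    simp only [Matrix.conjTranspose_apply, star_trivial, G, Matrix.of_apply]
    exact integral_congr_ae (Eventually.of_forall fun x => mul_comm _ _)
  -- The family comes from the eigenvectors of the Gram matrix of the features. Nothing is
  -- normalized or inverted: eigenvalues may be zero, as when several words give the same monomial.
  set U : Matrix (Fin N) (Fin N) ℝ := hG.eigenvectorUnitary.1 with hU
  have hdiag : U.transpose * G * U = Matrix.diagonal hG.eigenvalues := by
    have := hG.conjStarAlgAut_star_eigenvectorUnitary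
    rw [Unitary.conjStarAlgAut_apply] at this
    simpa [Matrix.star_eq_conjTranspose] using this
  have hUU : U * U.transpose = 1 := by
    have := Unitary.mul_star_self_of_mem hG.eigenvectorUnitary.2
    simpa [Matrix.star_eq_conjTranspose] using this
  have hev : ∀ (a : Fin N) (x : Pt d), MvPolynomial.eval x
      (∑ b : Fin N, MvPolynomial.C (U b a) * mono d b) = ∑ b : Fin N, U b a * feature x b :=
    fun a x => by simp [feature]
  refine ⟨fun a => ∑ b : Fin N, MvPolynomial.C (U b a) * mono d b, hG.eigenvalues, fun a => ?_,
    fun a b => ?_, fun p hp => ?_⟩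
  · refine (MvPolynomial.totalDegree_finsetSum _ _).trans (Finset.sup_le fun w _ => ?_)
    refine (MvPolynomial.totalDegree_mul _ _).trans ?_
    rw [MvPolynomial.totalDegree_C, zero_add]
    exact mono_totalDegree hd (hN ▸ w.2)
  · have h1 := congrFun (congrFun hdiag a) b
    rw [Matrix.diagonal_apply] at h1
    rw [← h1, Matrix.mul_apply]
    simp_rw [hev, Finset.sum_mul_sum, Matrix.mul_apply, Matrix.transpose_apply, Finset.sum_mul]
    have hintegrable : ∀ c e : Fin N, Integrable
        (fun x : Pt d => U c a * feature x c * (U e b * feature x e)) D := fun c e => by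
      have := (integrable_eval hD (mono d c * mono d e)).const_mul (U c a * U e b)
      refine this.congr (Eventually.of_forall fun x => ?_)
      simp only [feature, map_mul]
      ring
    rw [integral_finsetSum _ fun c _ => integrable_finsetSum _ fun e _ => hintegrable c e]
    refine Eq.trans ?_ Finset.sum_comm
    refine Finset.sum_congr rfl fun c _ => ?_
    rw [integral_finsetSum _ fun e _ => hintegrable c e]
    refine Finset.sum_congr rfl fun e _ => ?_
    simp only [G, Matrix.of_apply]
    rw [← integral_const_mul, ← integral_mul_const]
    refine integral_congr_ae (Eventually.of_forall fun x => ?_)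
    simp only
    ring
  · obtain ⟨c, rfl⟩ := exists_polyOf hd p hp
    refine ⟨fun a => ∑ b : Fin N, U b a * c b, fun x => ?_⟩
    rw [eval_polyOf, ← hN, ← Fin.sum_univ_eq_sum_range (fun w => c w * feature x w)]
    simp_rw [hev, Finset.sum_mul_sum]
    have h2 : ∀ b e : Fin N, ∑ a, U b a * U e a = if b = e then 1 else 0 := fun b e => by
      have := congrFun (congrFun hUU b) e
      rw [Matrix.mul_apply, Matrix.one_apply] at this
      simpa [Matrix.transpose_apply] using this
    calc ∑ b : Fin N, c b * feature x b
        = ∑ b : Fin N, ∑ e : Fin N, (c b * feature x e) * ∑ a, U b a * U e a := by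
          simp_rw [h2]
          simp
      _ = ∑ a, ∑ b : Fin N, ∑ e : Fin N, U b a * c b * (U e a * feature x e) := by
          simp_rw [Finset.mul_sum]
          rw [Finset.sum_congr rfl fun b _ => Finset.sum_comm, Finset.sum_comm]
          refine Finset.sum_congr rfl fun a _ => Finset.sum_congr rfl fun b _ =>
            Finset.sum_congr rfl fun e _ => by ring

end ICF

namespace ICF

open Filter Topology

/-- Cauchy–Schwarz, from the discriminant of the nonnegative quadratic `s ↦ ∫ (|a| - s|b|)²`. -/
lemma sq_integral_abs_mul_le {X : Type*} [MeasurableSpace X] (D : Measure X) {a b : X → ℝ}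
    (ha : Integrable (fun x => a x ^ 2) D) (hb : Integrable (fun x => b x ^ 2) D)
    (hab : Integrable (fun x => |a x * b x|) D) :
    (∫ x, |a x * b x| ∂D) ^ 2 ≤ (∫ x, a x ^ 2 ∂D) * ∫ x, b x ^ 2 ∂D := by
  have key : ∀ s : ℝ, 0 ≤ (∫ x, b x ^ 2 ∂D) * (s * s) + (-2 * ∫ x, |a x * b x| ∂D) * s +
      ∫ x, a x ^ 2 ∂D := fun s => by
    have h0 : 0 ≤ ∫ x, (|a x| - s * |b x|) ^ 2 ∂D := integral_nonneg fun x => sq_nonneg _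
    have e : ∀ x, (|a x| - s * |b x|) ^ 2 = (b x ^ 2 * (s * s) + |a x * b x| * (-2 * s)) +
        a x ^ 2 := fun x => by
      rw [abs_mul, ← sq_abs (a x), ← sq_abs (b x)]; ring
    simp_rw [e] at h0
    have i1 := hb.mul_const (s * s)
    have i2 := hab.mul_const (-2 * s)
    have i3 : Integrable (fun x => b x ^ 2 * (s * s) + |a x * b x| * (-2 * s)) D := i1.add i2
    rw [integral_add i3 ha, integral_add i1 i2, integral_mul_const,
      integral_mul_const] at h0
    linarith
  have := discrim_le_zero key
  rw [discrim] at this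
  nlinarith

/-- Empirical second moments of polynomials of degree at most `l` are close to the true ones. -/
def CovGood {d : ℕ} (l : ℕ) (D : Measure (Pt d)) {m : ℕ} (S : Fin m → Pt d) : Prop :=
  ∀ p : MvPolynomial (Fin d) ℝ, p.totalDegree ≤ l →
    |∫ x, MvPolynomial.eval x p ^ 2 ∂D - (∑ j, MvPolynomial.eval (S j) p ^ 2) / m| ≤
      (∫ x, MvPolynomial.eval x p ^ 2 ∂D) / 2

lemma integrable_eval_sq {d : ℕ} {A : ℝ} {D : Measure (Pt d)} [IsProbabilityMeasure D]
    (h : Hypercontractive A D) (p : MvPolynomial (Fin d) ℝ) :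
    Integrable (fun x : Pt d => MvPolynomial.eval x p ^ 2) D := by
  simpa using integrable_eval_pow h p 2

lemma sum_mul_sum_sq {ι : Type*} (s : Finset ι) (c v : ι → ℝ) :
    (∑ a ∈ s, c a * v a) ^ 2 = ∑ a ∈ s, ∑ b ∈ s, c a * c b * (v a * v b) := by
  rw [sq, Finset.sum_mul_sum]
  exact Finset.sum_congr rfl fun a _ => Finset.sum_congr rfl fun b _ => by ring

section Orthogonal

variable {d N : ℕ} {A : ℝ} {D : Measure (Pt d)}
  {ψ : Fin N → MvPolynomial (Fin d) ℝ} {lam : Fin N → ℝ}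

lemma orthogonal_nonneg (horth : ∀ a b, ∫ x, MvPolynomial.eval x (ψ a) * MvPolynomial.eval x (ψ b)
      ∂D = if a = b then lam a else 0) (a : Fin N) : 0 ≤ lam a := by
  have := horth a a
  rw [if_pos rfl] at this
  rw [← this]
  exact integral_nonneg fun x => mul_self_nonneg _

lemma integral_sq_eq [IsProbabilityMeasure D] (hD : Hypercontractive A D)
    (horth : ∀ a b, ∫ x, MvPolynomial.eval x (ψ a) * MvPolynomial.eval x (ψ b)
      ∂D = if a = b then lam a else 0) {p : MvPolynomial (Fin d) ℝ} {c : Fin N → ℝ}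
    (hc : ∀ x, MvPolynomial.eval x p = ∑ a, c a * MvPolynomial.eval x (ψ a)) :
    ∫ x, MvPolynomial.eval x p ^ 2 ∂D = ∑ a, c a ^ 2 * lam a := by
  have hintegrable : ∀ a b, Integrable (fun x : Pt d => c a * c b *
      (MvPolynomial.eval x (ψ a) * MvPolynomial.eval x (ψ b))) D := fun a b => by
    have := (integrable_eval hD (ψ a * ψ b)).const_mul (c a * c b)
    simpa using this
  simp_rw [hc, sum_mul_sum_sq]
  rw [integral_finsetSum _ fun a _ => integrable_finsetSum _ fun b _ => hintegrable a b]
  refine Finset.sum_congr rfl fun a _ => ?_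
  rw [integral_finsetSum _ fun b _ => hintegrable a b]
  simp_rw [integral_const_mul, horth]
  simp [sq]

end Orthogonal

/-- Each product `ψ_a ψ_b` has mean absolute value at most `√λ_a √λ_b`, and its empirical mean is
within `Q ^ (-4)` of that scale except on a small event; there are `N² ≤ Q²` products. For `p = ∑
c_a ψ_a` the error is then at most `(∑ |c_a| √λ_a)² / Q⁴ ≤ N E[p²] / Q⁴`. The accuracy is relative,
so small eigenvalues do no harm. -/
lemma measure_not_covGood_le {d l k : ℕ} {A R β ε δ Q : ℝ} (h : Scale d l k A R β ε δ Q)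
    {D : Measure (Pt d)} [IsProbabilityMeasure D] (hD : Hypercontractive A D) {m : ℕ}
    (hm : Q ^ 80 ≤ (m : ℝ)) :
    (Measure.pi fun _ : Fin m => D) {S | ¬ CovGood l D S} ≤ ENNReal.ofReal (δ / 8) := by
  obtain ⟨N, hN⟩ : ∃ N, N = (d + 1) ^ l := ⟨_, rfl⟩
  obtain ⟨ψ, lam, hdeg, horth, hspan⟩ := exists_orthogonal h.one_le_d hN hD
  have hQ := h.five_le
  have hQ0 : (0 : ℝ) < Q := by linarith
  have hδ := h.δ_pos
  have hk : (1 : ℝ) ≤ k := by exact_mod_cast h.one_le_k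
  have hNQ : (N : ℝ) ≤ Q := by have := h.dim_le; rw [hN]; push_cast; exact this
  have hlam := orthogonal_nonneg horth
  set v : Fin N → Fin N → Pt d → ℝ :=
    fun a b x => MvPolynomial.eval x (ψ a) * MvPolynomial.eval x (ψ b) with hv
  have hvm : ∀ a b, Measurable (v a b) := fun a b => (measurable_eval _).mul (measurable_eval _)
  have hM : ∀ a b, ∫ x, |MvPolynomial.eval x (ψ a * ψ b)| ∂D ≤ √(lam a) * √(lam b) := fun a b => by
    have h1 := sq_integral_abs_mul_le D (integrable_eval_sq hD (ψ a)) (integrable_eval_sq hD (ψ b))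
      (by simpa using (integrable_eval hD (ψ a * ψ b)).abs)
    have h2 : ∀ a, ∫ x, MvPolynomial.eval x (ψ a) ^ 2 ∂D = lam a := fun a => by
      simp_rw [sq]; rw [horth, if_pos rfl]
    rw [h2, h2] at h1
    rw [← Real.sqrt_mul (hlam a)]
    simp_rw [map_mul]
    exact Real.le_sqrt_of_sq_le h1
  have hsub : {S : Fin m → Pt d | ¬ CovGood l D S} ⊆ ⋃ a, ⋃ b,
      {S | √(lam a) * √(lam b) / Q ^ 4 < |∫ x, v a b x ∂D - (∑ j, v a b (S j)) / m|} := by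
    intro S hS
    by_contra hcon
    simp only [Set.mem_iUnion, Set.mem_ofPred_eq, not_exists, not_lt] at hcon
    refine hS fun p hp => ?_
    obtain ⟨c, hc⟩ := hspan p hp
    have hsq := integral_sq_eq hD horth hc
    have e1 : ∫ x, MvPolynomial.eval x p ^ 2 ∂D = ∑ a, ∑ b, c a * c b * ∫ x, v a b x ∂D := by
      rw [hsq]
      refine Finset.sum_congr rfl fun a _ => ?_
      simp_rw [hv, horth]
      simp [sq]
    have e2 : (∑ j, MvPolynomial.eval (S j) p ^ 2) / m =
        ∑ a, ∑ b, c a * c b * ((∑ j, v a b (S j)) / m) := by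
      simp_rw [hc, sum_mul_sum_sq]
      rw [Finset.sum_comm, Finset.sum_div]
      refine Finset.sum_congr rfl fun a _ => ?_
      rw [Finset.sum_comm, Finset.sum_div]
      refine Finset.sum_congr rfl fun b _ => ?_
      rw [← Finset.mul_sum, mul_div_assoc]
    calc |∫ x, MvPolynomial.eval x p ^ 2 ∂D - (∑ j, MvPolynomial.eval (S j) p ^ 2) / m|
        = |∑ a, ∑ b, c a * c b * (∫ x, v a b x ∂D - (∑ j, v a b (S j)) / m)| := by
          rw [e1, e2, ← Finset.sum_sub_distrib]
          simp_rw [← Finset.sum_sub_distrib, mul_sub]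
      _ ≤ ∑ a, ∑ b, |c a| * |c b| * (√(lam a) * √(lam b) / Q ^ 4) := by
          refine (Finset.abs_sum_le_sum_abs _ _).trans (Finset.sum_le_sum fun a _ => ?_)
          refine (Finset.abs_sum_le_sum_abs _ _).trans (Finset.sum_le_sum fun b _ => ?_)
          rw [abs_mul, abs_mul]
          gcongr
          exact hcon a b
      _ = (∑ a, |c a| * √(lam a)) ^ 2 / Q ^ 4 := by
          rw [sum_mul_sum_sq, Finset.sum_div]
          refine Finset.sum_congr rfl fun a _ => ?_
          rw [Finset.sum_div]
          exact Finset.sum_congr rfl fun b _ => by ring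
      _ ≤ (N * ∑ a, (|c a| * √(lam a)) ^ 2) / Q ^ 4 := by
          gcongr
          have := sq_sum_le_card_mul_sum_sq (s := Finset.univ) (f := fun a => |c a| * √(lam a))
          simpa using this
      _ = N * (∫ x, MvPolynomial.eval x p ^ 2 ∂D) / Q ^ 4 := by
          rw [hsq]
          congr 2
          refine Finset.sum_congr rfl fun a _ => ?_
          rw [mul_pow, sq_abs, Real.sq_sqrt (hlam a)]
      _ ≤ (∫ x, MvPolynomial.eval x p ^ 2 ∂D) / 2 := by
          have h0 : 0 ≤ ∫ x, MvPolynomial.eval x p ^ 2 ∂D := integral_nonneg fun _ => sq_nonneg _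
          rw [div_le_div_iff₀ (by positivity) (by norm_num)]
          have : (N : ℝ) * 2 ≤ Q ^ 4 := by
            calc (N : ℝ) * 2 ≤ Q * Q := by gcongr; linarith
              _ = Q ^ 2 := by ring
              _ ≤ Q ^ 4 := pow_le_pow_right₀ (by linarith) (by norm_num)
          nlinarith
  calc _ ≤ _ := measure_mono hsub
    _ ≤ ∑ a : Fin N, ∑ b : Fin N, ENNReal.ofReal (δ / (8 * k * Q ^ 2)) := by
        refine (measure_iUnion_fintype_le _ _).trans (Finset.sum_le_sum fun a _ => ?_)
        refine (measure_iUnion_fintype_le _ _).trans (Finset.sum_le_sum fun b _ => ?_)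
        refine concentration_poly h hD hm (q := ψ a * ψ b) ?_ (hM a b) (hvm a b) fun x => ?_
        · refine (MvPolynomial.totalDegree_mul _ _).trans ?_
          have := hdeg a
          have := hdeg b
          omega
        · simp [hv]
    _ = ENNReal.ofReal (N * (N * (δ / (8 * k * Q ^ 2)))) := by
        rw [ENNReal.ofReal_mul (by positivity), ENNReal.ofReal_mul (by positivity)]
        simp
    _ ≤ ENNReal.ofReal (δ / 8) := by
        refine ENNReal.ofReal_le_ofReal ?_
        calc (N : ℝ) * (N * (δ / (8 * k * Q ^ 2))) ≤ Q * (Q * (δ / (8 * 1 * Q ^ 2))) := by gcongr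
          _ = δ / 8 := by field_simp

/-- Most points are tame. -/
lemma measure_not_tame_le {d : ℕ} (I : Input d) (hI : I.Admissible) {A : ℝ} {D : Measure (Pt d)}
    [IsProbabilityMeasure D] (hD : Hypercontractive A D) (hS : CovGood I.deg D I.S) :
    D.real {x | ¬ I.Tame x} ≤ I.ε / (2 * I.R) := by
  obtain ⟨hd, h1, h2, h3, h4, h5, h6, h7, h8⟩ := hI
  obtain ⟨N, hN⟩ : ∃ N, N = (d + 1) ^ I.deg := ⟨_, rfl⟩
  obtain ⟨ψ, lam, hdeg, horth, hspan⟩ := exists_orthogonal hd hN hD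
  have hR : 0 < I.R := by linarith
  have hN0 : (0 : ℝ) < N := by rw [hN]; positivity
  have hlam := orthogonal_nonneg horth
  -- The level serves two purposes: Markov's inequality with mean at most `N` gives `ε / (2R)`, and
  -- `4 β T = B²`.
  set T : ℝ := 2 * I.R * N / I.ε with hT
  have hT0 : 0 < T := by positivity
  set K : Pt d → ℝ := fun x => ∑ a, MvPolynomial.eval x (ψ a) ^ 2 / lam a with hK
  -- Directions with eigenvalue zero are invisible to `K`, where division by zero gives zero; but
  -- such `ψ a` vanish almost surely.
  have hnull : ∀ᵐ x ∂D, ∀ a, lam a = 0 → MvPolynomial.eval x (ψ a) = 0 := by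
    rw [ae_all_iff]
    intro a
    by_cases ha : lam a = 0
    · have e := horth a a
      rw [if_pos rfl, ha] at e
      simp_rw [← sq] at e
      rw [integral_eq_zero_iff_of_nonneg (fun _ => sq_nonneg _) (integrable_eval_sq hD _)] at e
      filter_upwards [e] with x hx _
      simpa using hx
    · exact Eventually.of_forall fun x hx => absurd hx ha
  have hKi : Integrable K D := integrable_finsetSum _ fun a _ =>
    (integrable_eval_sq hD (ψ a)).div_const _
  have hKle : ∫ x, K x ∂D ≤ N := by
    rw [hK, integral_finsetSum _ fun a _ => (integrable_eval_sq hD (ψ a)).div_const _]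
    calc _ ≤ ∑ a : Fin N, (1 : ℝ) := by
          refine Finset.sum_le_sum fun a _ => ?_
          rw [integral_div]
          simp_rw [sq]
          rw [horth, if_pos rfl]
          -- An inequality and not an equality, since the quotient is zero for a zero eigenvalue.
          exact div_self_le_one _
      _ = N := by simp
  have hsub : ∀ᵐ x ∂D, x ∈ {x | ¬ I.Tame x} → x ∈ {x | T ≤ K x} := by
    filter_upwards [hnull] with x hx hxt
    by_contra hlt
    have hlt' : K x < T := not_le.1 hlt
    refine hxt fun i p hp => ?_
    obtain ⟨c, hc⟩ := hspan p hp.1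
    have hcov := (abs_le.1 (hS p hp.1)).2
    -- The true second moment is at most twice the empirical one, and feasibility bounds the latter
    -- by `2β`.
    have hpD : ∫ x, MvPolynomial.eval x p ^ 2 ∂D ≤ 4 * I.β := by linarith [hp.2.1]
    rw [integral_sq_eq hD horth hc] at hpD
    have e1 : ∀ a, c a * MvPolynomial.eval x (ψ a) =
        (c a * √(lam a)) * (MvPolynomial.eval x (ψ a) / √(lam a)) := fun a => by
      rcases (hlam a).eq_or_lt with h0 | h0
      · rw [hx a h0.symm]; simp
      · have : √(lam a) ≠ 0 := (Real.sqrt_pos.2 h0).ne'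
        field_simp
    -- Cauchy–Schwarz with weights `√λ_a`: the square `p(x)²` is at most `E[p²] · K(x)`.
    have e2 : MvPolynomial.eval x p ^ 2 ≤ I.B ^ 2 := by
      rw [hc, Finset.sum_congr rfl fun a _ => e1 a]
      refine (Finset.sum_mul_sq_le_sq_mul_sq _ _ _).trans ?_
      have e3 : ∑ a, (c a * √(lam a)) ^ 2 = ∑ a, c a ^ 2 * lam a :=
        Finset.sum_congr rfl fun a _ => by rw [mul_pow, Real.sq_sqrt (hlam a)]
      have e4 : ∑ a, (MvPolynomial.eval x (ψ a) / √(lam a)) ^ 2 = K x :=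
        Finset.sum_congr rfl fun a _ => by rw [div_pow, Real.sq_sqrt (hlam a)]
      rw [e3, e4]
      calc _ ≤ 4 * I.β * T := by
            refine mul_le_mul hpD hlt'.le ?_ (by positivity)
            exact Finset.sum_nonneg fun a _ => div_nonneg (sq_nonneg _) (hlam a)
        _ = I.B ^ 2 := by
            rw [Input.B, mul_pow, Real.sq_sqrt (by positivity), hT, hN]
            push_cast
            ring
    have e3 : |MvPolynomial.eval x p| ≤ I.B := by
      refine abs_le_of_sq_le_sq e2 ?_
      rw [Input.B]; positivity
    rw [Input.absChow]
    calc _ ≤ 1 * |MvPolynomial.eval x p| := by gcongr; exact bval_le_one _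
      _ ≤ _ := by rw [one_mul]; exact e3
  have hmk := mul_meas_ge_le_integral_of_nonneg (μ := D)
    (Eventually.of_forall fun x => Finset.sum_nonneg fun a _ => div_nonneg (sq_nonneg _) (hlam a))
    hKi T
  have h9 : D.real {x | ¬ I.Tame x} ≤ D.real {x | T ≤ K x} := by
    refine ENNReal.toReal_mono (measure_ne_top _ _) (measure_mono_ae hsub)
  calc _ ≤ D.real {x | T ≤ K x} := h9
    _ ≤ N / T := by
        rw [le_div_iff₀ hT0, mul_comm]
        exact hmk.trans hKle
    _ = _ := by rw [hT]; field_simp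

end ICF

namespace ICF

open Filter Topology

/-! ### Tameness in terms of coefficients -/

/-- The value at `x` of the polynomial with coefficients `c`. -/
noncomputable def lin {d N : ℕ} (c : Fin N → ℝ) (x : Pt d) : ℝ := ∑ w, c w * feature x w

/-- The constraints of `𝒫(f)` on coefficients, for the reference sample `S`. -/
def CoefFeasible {d N m : ℕ} (R β ε : ℝ) (g : Pt d → Bool) (S : Fin m → Pt d) (c : Fin N → ℝ) :
    Prop :=
  (∑ j, lin c (S j) ^ 2) / m ≤ 2 * β ∧
    (∑ j, bval (g (S j)) * |lin c (S j)|) / m ≤ 2 * ε / (2 * R + ε)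

/-- Extension of a coefficient vector by zero. -/
noncomputable def extend {N : ℕ} (c : Fin N → ℝ) (w : ℕ) : ℝ := if h : w < N then c ⟨w, h⟩ else 0

lemma eval_polyOf_eq_lin {d N : ℕ} (c : ℕ → ℝ) (x : Pt d) :
    MvPolynomial.eval x (polyOf d N c) = lin (fun w : Fin N => c w) x := by
  rw [eval_polyOf, lin, ← Fin.sum_univ_eq_sum_range (fun w => c w * feature x w)]

lemma eval_polyOf_extend {d N : ℕ} (c : Fin N → ℝ) (x : Pt d) :
    MvPolynomial.eval x (polyOf d N (extend c)) = lin c x := by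
  rw [eval_polyOf_eq_lin]
  congr 1
  ext w
  simp [extend]

namespace Input

variable {d : ℕ} {I : Input d}

lemma mem_feasible_iff_coef (i : Fin I.k) (p : MvPolynomial (Fin d) ℝ) {N : ℕ} (c : Fin N → ℝ)
    (hdeg : p.totalDegree ≤ I.deg) (hc : ∀ x, MvPolynomial.eval x p = lin c x) :
    p ∈ I.feasible i ↔ CoefFeasible I.R I.β I.ε (I.f i) I.S c := by
  unfold feasible CoefFeasible absChow
  simp only [Set.mem_ofPred_eq, hdeg, true_and, hc]

lemma exists_coef (hd : 1 ≤ d) {l N : ℕ} (hN : N = (d + 1) ^ l) {p : MvPolynomial (Fin d) ℝ}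
    (hp : p.totalDegree ≤ l) : ∃ c : Fin N → ℝ, ∀ x, MvPolynomial.eval x p = lin c x := by
  subst hN
  obtain ⟨c, rfl⟩ := exists_polyOf hd p hp
  exact ⟨fun w => c w, fun x => eval_polyOf_eq_lin c x⟩

lemma tame_iff_coef (hd : 1 ≤ d) {N : ℕ} (hN : N = (d + 1) ^ I.deg) (x : Pt d) :
    I.Tame x ↔ ∀ (i : Fin I.k) (c : Fin N → ℝ), CoefFeasible I.R I.β I.ε (I.f i) I.S c →
      bval (I.f i x) * |lin c x| ≤ I.B := by
  constructor
  · intro h i c hc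
    have hdeg : ∀ e : ℕ → ℝ, (polyOf d N e).totalDegree ≤ I.deg := fun e => by
      rw [hN]; exact polyOf_totalDegree hd _
    have := h i _ ((mem_feasible_iff_coef i _ c (hdeg _) (eval_polyOf_extend c)).2 hc)
    rwa [absChow, eval_polyOf_extend] at this
  · intro h i p hp
    obtain ⟨c, hc⟩ := exists_coef hd hN hp.1
    rw [absChow, hc]
    exact h i c ((mem_feasible_iff_coef i p c hp.1 hc).1 hp)

end Input

lemma continuous_lin {d N : ℕ} (x : Pt d) : Continuous fun c : Fin N → ℝ => lin c x :=
  continuous_finsetSum _ fun w _ => (continuous_apply w).mul continuous_const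

lemma lin_smul {d N : ℕ} (s : ℝ) (c : Fin N → ℝ) (x : Pt d) : lin (s • c) x = s * lin c x := by
  simp [lin, Finset.mul_sum, mul_assoc]

/-- Shrinking a feasible real counterexample by a factor `s < 1` makes both constraints strict, as
their right sides are positive, while for `s` near `1` it remains a counterexample. The strict
conditions define an open set, which contains a rational vector. -/
lemma tame_rat {d N m : ℕ} {R β ε B : ℝ} (hR : 0 < R) (hβ : 0 < β) (hε : 0 < ε) (g : Pt d → Bool)
    (S : Fin m → Pt d) (x : Pt d)
    (h : ∀ c : Fin N → ℚ, CoefFeasible R β ε g S (fun w => (c w : ℝ)) →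
      bval (g x) * |lin (fun w => (c w : ℝ)) x| ≤ B) (c : Fin N → ℝ)
    (hc : CoefFeasible R β ε g S c) : bval (g x) * |lin c x| ≤ B := by
  by_contra hlt
  push Not at hlt
  have hlim : Tendsto (fun s : ℝ => bval (g x) * |lin (s • c) x|) (𝓝[<] 1)
      (𝓝 (bval (g x) * |lin ((1 : ℝ) • c) x|)) := by
    have hcont : Continuous fun s : ℝ => bval (g x) * |lin (s • c) x| := by
      simp_rw [lin_smul]; fun_prop
    exact hcont.continuousAt.mono_left nhdsWithin_le_nhds
  rw [one_smul] at hlim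
  have hev := hlim.eventually (lt_mem_nhds hlt)
  have hpos : ∀ᶠ s : ℝ in 𝓝[<] 1, 0 < s :=
    nhdsWithin_le_nhds (lt_mem_nhds (show (0 : ℝ) < 1 by norm_num))
  obtain ⟨s, hs1, hs0, hs2⟩ := (hev.and (hpos.and self_mem_nhdsWithin)).exists
  have hs2' : s < 1 := hs2
  let O : Set (Fin N → ℝ) := {e | (∑ j, lin e (S j) ^ 2) / m < 2 * β ∧
    (∑ j, bval (g (S j)) * |lin e (S j)|) / m < 2 * ε / (2 * R + ε) ∧ B < bval (g x) * |lin e x|}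
  have hO : IsOpen O := by
    have o1 : IsOpen {e : Fin N → ℝ | (∑ j, lin e (S j) ^ 2) / m < 2 * β} := isOpen_lt
      ((continuous_finsetSum _ fun j _ => (continuous_lin _).pow 2).div_const _) continuous_const
    have o2 : IsOpen {e : Fin N → ℝ | (∑ j, bval (g (S j)) * |lin e (S j)|) / m <
        2 * ε / (2 * R + ε)} := isOpen_lt ((continuous_finsetSum _ fun j _ =>
        continuous_const.mul (continuous_lin _).abs).div_const _) continuous_const
    have o3 : IsOpen {e : Fin N → ℝ | B < bval (g x) * |lin e x|} :=
      isOpen_lt continuous_const (continuous_const.mul (continuous_lin _).abs)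
    exact o1.inter (o2.inter o3)
  have hmem : s • c ∈ O := by
    refine ⟨?_, ?_, hs1⟩
    · have e : (∑ j, lin (s • c) (S j) ^ 2) / m = s ^ 2 * ((∑ j, lin c (S j) ^ 2) / m) := by
        simp_rw [lin_smul, mul_pow, ← Finset.mul_sum, mul_div_assoc]
      rw [e]
      have : s ^ 2 < 1 := by nlinarith
      have h0 : 0 ≤ (∑ j, lin c (S j) ^ 2) / (m : ℝ) := by positivity
      nlinarith [hc.1]
    · have e : (∑ j, bval (g (S j)) * |lin (s • c) (S j)|) / m =
          s * ((∑ j, bval (g (S j)) * |lin c (S j)|) / m) := by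
        simp_rw [lin_smul, abs_mul, abs_of_pos hs0, mul_left_comm _ s, ← Finset.mul_sum,
          mul_div_assoc]
      rw [e]
      have h1 : 0 < 2 * ε / (2 * R + ε) := by positivity
      have h0 : 0 ≤ (∑ j, bval (g (S j)) * |lin c (S j)|) / (m : ℝ) :=
        div_nonneg (Finset.sum_nonneg fun j _ => mul_nonneg (bval_nonneg _) (abs_nonneg _))
          (Nat.cast_nonneg _)
      nlinarith [hc.2]
  have hdense : DenseRange (fun (c : Fin N → ℚ) (w : Fin N) => (c w : ℝ)) :=
    DenseRange.piMap fun _ => Rat.denseRange_cast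
  obtain ⟨e, he⟩ := hdense.exists_mem_open hO ⟨_, hmem⟩
  exact absurd (h e ⟨he.1.le, he.2.1.le⟩) (not_le.2 he.2.2)

/-- Joint measurability in the reference sample and the point is needed, because the tame set varies
with `S` when Fubini is applied. Testing rational coefficient vectors suffices, so the set is a
countable intersection. -/
lemma measurableSet_tame {d l k m n : ℕ} {R β ε : ℝ} (hd : 1 ≤ d) (hR : 0 < R) (hβ : 0 < β)
    (hε : 0 < ε) {f : Fin k → Pt d → Bool} (hf : ∀ i, Measurable (f i)) (S' : Fin n → Pt d) :
    MeasurableSet {q : (Fin m → Pt d) × Pt d | (Input.mk l k m n R β ε f q.1 S').Tame q.2} := by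
  obtain ⟨N, hN⟩ : ∃ N, N = (d + 1) ^ l := ⟨_, rfl⟩
  obtain ⟨B, hB⟩ : ∃ B : ℝ, ∀ S : Fin m → Pt d, (Input.mk l k m n R β ε f S S').B = B :=
    ⟨(Input.mk l k m n R β ε f (fun _ => 0) S').B, fun S => rfl⟩
  have e : {q : (Fin m → Pt d) × Pt d | (Input.mk l k m n R β ε f q.1 S').Tame q.2} =
      ⋂ i : Fin k, ⋂ c : Fin N → ℚ,
        {q | (∑ j, lin (fun w => (c w : ℝ)) (q.1 j) ^ 2) / m ≤ 2 * β ∧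
          (∑ j, bval (f i (q.1 j)) * |lin (fun w => (c w : ℝ)) (q.1 j)|) / m ≤
            2 * ε / (2 * R + ε)}ᶜ ∪ {q | bval (f i q.2) * |lin (fun w => (c w : ℝ)) q.2| ≤ B} := by
    ext ⟨S, x⟩
    simp only [Set.mem_ofPred_eq, Set.mem_iInter, Set.mem_union, Set.mem_compl_iff]
    rw [Input.tame_iff_coef hd hN, hB]
    constructor
    · intro h i c
      exact or_iff_not_imp_left.2 fun hc => h i _ (not_not.1 hc)
    · intro h i
      refine tame_rat hR hβ hε (f i) S x fun c hc => ?_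
      exact (h i c).resolve_left (not_not.2 hc)
  rw [e]
  have hlin : ∀ c : Fin N → ℝ, Measurable fun x : Pt d => lin c x := fun c =>
    Finset.measurable_sum _ fun w _ => measurable_const.mul (measurable_feature _)
  refine MeasurableSet.iInter fun i => MeasurableSet.iInter fun c => ?_
  have o1 : MeasurableSet {q : (Fin m → Pt d) × Pt d |
      (∑ j, lin (fun w => (c w : ℝ)) (q.1 j) ^ 2) / m ≤ 2 * β} := by
    refine measurableSet_le (Measurable.div_const
      (Finset.measurable_sum _ fun j _ => Measurable.pow_const ?_ 2) _) measurable_const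
    exact (hlin _).comp ((measurable_pi_apply j).comp measurable_fst)
  have o2 : MeasurableSet {q : (Fin m → Pt d) × Pt d |
      (∑ j, bval (f i (q.1 j)) * |lin (fun w => (c w : ℝ)) (q.1 j)|) / m ≤
        2 * ε / (2 * R + ε)} := by
    refine measurableSet_le (Measurable.div_const
      (Finset.measurable_sum _ fun j _ => Measurable.mul ?_ ?_) _) measurable_const
    · exact measurable_bval.comp ((hf i).comp ((measurable_pi_apply j).comp measurable_fst))
    · exact ((hlin _).comp ((measurable_pi_apply j).comp measurable_fst)).abs
  have o3 : MeasurableSet {q : (Fin m → Pt d) × Pt d |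
      bval (f i q.2) * |lin (fun w => (c w : ℝ)) q.2| ≤ B} :=
    measurableSet_le ((measurable_bval.comp ((hf i).comp measurable_snd)).mul
      ((hlin _).comp measurable_snd).abs) measurable_const
  exact (o1.inter o2).compl.union o3

/-! ### Lists of filters as tuples -/

namespace Input

variable {d : ℕ} {I : Input d}

lemma Loop.mem_feasible {T : Finset (Fin I.n)}
    {L : List (Fin I.k × MvPolynomial (Fin d) ℝ × ℝ)} (hL : I.Loop T L) :
    ∀ q ∈ L, q.2.1 ∈ I.feasible q.1 := by
  induction hL with
  | halt => simp
  | step T i p τ L hsol hgt hτ hrest ih =>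
    intro q hq
    rcases List.mem_cons.1 hq with rfl | hq
    · exact hsol.1
    · exact ih q hq

/-- Runs of the loop have varying length. A list is padded to length `t` with the filter `0 ≤ 0`,
which every point passes, so that uniform convergence for tuples of one fixed length covers all
runs. -/
lemma exists_tuple (hd : 1 ≤ d) (hk : 1 ≤ I.k) {N : ℕ} (hN : N = (d + 1) ^ I.deg) {t : ℕ}
    (L : List (Fin I.k × MvPolynomial (Fin d) ℝ × ℝ)) (hL : ∀ q ∈ L, q.2.1.totalDegree ≤ I.deg)
    (ht : L.length ≤ t) :
    ∃ θ : Fin t → Filt I.k N ℝ, ∀ x, Accepts I.f θ x ↔ ∀ q ∈ L, I.absChow q.1 q.2.1 x ≤ q.2.2 := by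
  have hc : ∀ q : Fin I.k × MvPolynomial (Fin d) ℝ × ℝ, q ∈ L →
      ∃ c : Fin N → ℝ, ∀ x, MvPolynomial.eval x q.2.1 = lin c x := fun q hq =>
    exists_coef hd hN (hL q hq)
  choose! c hc using hc
  obtain ⟨θ, hθ1, hθ2⟩ : ∃ θ : Fin t → Filt I.k N ℝ,
      (∀ (r : Fin t) (h : (r : ℕ) < L.length), θ r = (L[r].1, c L[r], L[r].2.2)) ∧
      ∀ r : Fin t, ¬ (r : ℕ) < L.length → θ r = (⟨0, hk⟩, 0, 0) :=
    ⟨fun r => if h : (r : ℕ) < L.length then (L[r].1, c L[r], L[r].2.2) else (⟨0, hk⟩, 0, 0),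
      fun r h => dif_pos h, fun r h => dif_neg h⟩
  refine ⟨θ, fun x => ⟨fun h q hq => ?_, fun h r => ?_⟩⟩
  · obtain ⟨r, hr, rfl⟩ := List.mem_iff_getElem.1 hq
    have := h ⟨r, by omega⟩
    rw [Passes, hθ1 _ hr] at this
    rw [absChow, hc _ hq]
    exact this
  · rw [Passes]
    by_cases hr : (r : ℕ) < L.length
    · rw [hθ1 r hr]
      have := h _ (List.getElem_mem hr)
      rw [absChow, hc _ (List.getElem_mem hr)] at this
      exact this
    · rw [hθ2 r hr]
      simp

end Input
end ICF

namespace ICF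

open Filter Topology

/-! ### Size of the parameters -/

namespace Scale

variable {d l k : ℕ} {A R β ε δ Q : ℝ}

lemma Q_pos (h : Scale d l k A R β ε δ Q) : 0 < Q := by linarith [h.five_le]

lemma inv_le_ε (h : Scale d l k A R β ε δ Q) : 1 / Q ≤ ε := by
  rw [one_div_le h.Q_pos h.ε_pos]
  exact h.inv_ε_le

lemma admissible (h : Scale d l k A R β ε δ Q) {m n : ℕ} (hm : 1 ≤ m) (hn : 1 ≤ n) (f : Fin k → Pt d → Bool)
    (S : Fin m → Pt d) (S' : Fin n → Pt d) : (Input.mk l k m n R β ε f S S').Admissible :=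
  ⟨h.one_le_d, h.one_le_l, h.one_le_k, hm, hn, h.one_lt_R, h.β_pos, h.ε_pos, h.ε_lt⟩

lemma B_le (h : Scale d l k A R β ε δ Q) {m n : ℕ} (f : Fin k → Pt d → Bool) (S : Fin m → Pt d) (S' : Fin n → Pt d) :
    (Input.mk l k m n R β ε f S S').B ≤ Q ^ 3 := by
  have hQ := h.five_le
  have hQ0 := h.Q_pos
  have hR := h.one_lt_R
  have hβ := h.β_pos
  have hε := h.ε_pos
  have hdim := h.dim_le
  have key : 2 * R * ((d : ℝ) + 1) ^ l * β / ε ≤ (Q ^ 3 / 2) ^ 2 := by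
    calc 2 * R * ((d : ℝ) + 1) ^ l * β / ε = 2 * R * ((d : ℝ) + 1) ^ l * β * (1 / ε) := by ring
      _ ≤ 2 * Q * Q * Q * Q := by
          gcongr
          · exact h.R_le
          · exact h.β_le
          · exact h.inv_ε_le
      _ = 2 * Q ^ 4 := by ring
      _ ≤ (Q ^ 2 / 4) * Q ^ 4 := by gcongr; nlinarith
      _ = _ := by ring
  have : √(2 * R * ((d : ℝ) + 1) ^ l * β / ε) ≤ Q ^ 3 / 2 := by
    rw [Real.sqrt_le_left (by positivity)]
    exact key
  unfold Input.B
  simp only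
  linarith

lemma inv_Δ_le (h : Scale d l k A R β ε δ Q) {m n : ℕ} (hm : 1 ≤ m) (hn : 1 ≤ n) (f : Fin k → Pt d → Bool) (S : Fin m → Pt d)
    (S' : Fin n → Pt d) : 1 / (Input.mk l k m n R β ε f S S').Δ ≤ Q ^ 7 := by
  have hB := h.B_le f S S'
  have hB0 := Input.B_pos (h.admissible hm hn f S S')
  have hQ := h.five_le
  have hQ0 := h.Q_pos
  have hR := h.one_lt_R
  have hε := h.ε_pos
  have hε1 := h.ε_lt
  unfold Input.Δ
  rw [one_div_div]
  simp only
  calc _ = (Input.mk l k m n R β ε f S S').B * (2 * R + ε) * (1 / ε) ^ 2 := by field_simp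
    _ ≤ Q ^ 3 * (3 * Q) * Q ^ 2 := by
        gcongr
        · linarith [h.R_le]
        · exact h.inv_ε_le
    _ = 3 * Q ^ 6 := by ring
    _ ≤ Q * Q ^ 6 := by gcongr; linarith
    _ = Q ^ 7 := by ring

/-- The logarithm of the growth function is at most `t (log(k/δ) + 1 + 8 (N+1) r)`, because `log
(2n+1) ≤ 4 r` for `n = r ^ 4`. It is linear in `r`, whereas the exponent of the deviation bound is
of order `r ^ 4`. -/
lemma growth_le (h : Scale d l k A R β ε δ Q) {N t n : ℕ} {r : ℝ} (hr : Q ^ 20 ≤ r) (hrn : r ^ 4 = n) (hN : (N : ℝ) ≤ Q)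
    (ht : (t : ℝ) ≤ Q ^ 7) : (growth k N t (2 * n) : ℝ) ≤ Real.exp (Q ^ 10 * r) := by
  have hQ := h.five_le
  have hQ0 := h.Q_pos
  have hr1 : 1 ≤ r := le_trans (one_le_pow₀ (by linarith)) hr
  have hk : (0 : ℝ) < k := by exact_mod_cast h.one_le_k
  have hΛ := h.log_pos
  have b1 : (k : ℝ) ≤ Real.exp (Real.log (k / δ)) := by
    rw [Real.exp_log (div_pos hk h.δ_pos), le_div_iff₀ h.δ_pos]
    nlinarith [h.δ_lt]
  have b2 : (2 : ℝ) ≤ Real.exp 1 := by have := Real.add_one_le_exp (1 : ℝ); linarith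
  have b3 : ((2 * n : ℕ) + 1 : ℝ) ≤ Real.exp (4 * r) := by
    push_cast
    rw [← hrn]
    have e1 : r ≤ Real.exp (r - 1) := by have := Real.add_one_le_exp (r - 1); linarith
    have e2 : (3 : ℝ) ≤ Real.exp 2 := by have := Real.add_one_le_exp (2 : ℝ); linarith
    have e3 : (1 : ℝ) ≤ r ^ 4 := one_le_pow₀ hr1
    calc 2 * r ^ 4 + 1 ≤ 3 * r ^ 4 := by linarith
      _ ≤ Real.exp 2 * Real.exp (r - 1) ^ 4 := by gcongr
      _ = Real.exp (4 * r - 2) := by rw [← Real.exp_nat_mul, ← Real.exp_add]; push_cast; ring_nf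
      _ ≤ _ := Real.exp_le_exp.2 (by linarith)
  have b4 : ((k * (2 * (((2 * n) + 1) ^ (N + 1)) ^ 2) : ℕ) : ℝ) ≤
      Real.exp (Real.log (k / δ) + (1 + 2 * ((N + 1) * (4 * r)))) := by
    push_cast at b3 ⊢
    rw [Real.exp_add, Real.exp_add]
    have e1 : (2 * (n : ℝ) + 1) ^ (N + 1) ≤ Real.exp ((N + 1) * (4 * r)) := by
      calc _ ≤ Real.exp (4 * r) ^ (N + 1) := by gcongr
        _ = _ := by rw [← Real.exp_nat_mul]; push_cast; ring_nf
    have e2 : ((2 * (n : ℝ) + 1) ^ (N + 1)) ^ 2 ≤ Real.exp (2 * ((N + 1) * (4 * r))) := by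
      calc _ ≤ Real.exp ((N + 1) * (4 * r)) ^ 2 := by gcongr
        _ = _ := by rw [← Real.exp_nat_mul]; push_cast; ring_nf
    gcongr
  rw [growth, Nat.cast_pow]
  calc _ ≤ Real.exp (Real.log (k / δ) + (1 + 2 * ((N + 1) * (4 * r)))) ^ t := by gcongr
    _ = Real.exp (t * (Real.log (k / δ) + (1 + 2 * ((N + 1) * (4 * r))))) := by
        rw [← Real.exp_nat_mul]
    _ ≤ _ := by
        refine Real.exp_le_exp.2 ?_
        have e1 : Real.log (k / δ) + (1 + 2 * ((N + 1) * (4 * r))) ≤ Q ^ 3 * r := by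
          have l1 := h.log_le_self
          have l2 : Q ≤ Q * r := by nlinarith
          have l3 : ((N : ℝ) + 1) * (4 * r) ≤ (Q + 1) * (4 * r) := by gcongr
          have l4 : (18 : ℝ) * Q ≤ Q ^ 3 := by
            calc (18 : ℝ) * Q ≤ Q ^ 2 * Q := by gcongr; nlinarith
              _ = Q ^ 3 := by ring
          have l5 : 18 * Q * r ≤ Q ^ 3 * r := by gcongr
          nlinarith
        calc _ ≤ Q ^ 7 * (Q ^ 3 * r) := by gcongr
          _ = Q ^ 10 * r := by ring

/-- The choice of the power `80` is tested here: with `r ^ 3 ≥ Q ^ 60`, range at most `Q ^ 7` and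
accuracy at least `Q ^ (-4)`, the exponent is at least `Q ^ 36 * r`. This exceeds the logarithm `Q ^
10 * r` of the growth function and `log (4 k / δ)` together. -/
lemma ucBound_le (h : Scale d l k A R β ε δ Q) {N t n : ℕ} (hn : Q ^ 80 ≤ (n : ℝ)) (hN : (N : ℝ) ≤ Q) (ht : (t : ℝ) ≤ Q ^ 7)
    {b e : ℝ} (hb : 0 < b) (hbQ : b ≤ Q ^ 7) (he : 1 / Q ^ 4 ≤ e) :
    ucBound k N t n b e ≤ δ / (4 * k) := by
  obtain ⟨r, hr, hrn⟩ := exists_fourth_root hn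
  have hQ := h.five_le
  have hQ0 := h.Q_pos
  have hr1 : 1 ≤ r := le_trans (one_le_pow₀ (by linarith)) hr
  have hk : (0 : ℝ) < k := by exact_mod_cast h.one_le_k
  have e2 : δ / (4 * k) = Real.exp (-(Real.log 4 + Real.log (k / δ))) := by
    rw [neg_add, Real.exp_add, h.exp_neg_log, Real.exp_neg, Real.exp_log (by norm_num)]
    field_simp
  rw [ucBound, e2]
  refine (mul_le_mul_of_nonneg_right (h.growth_le hr hrn hN ht) (Real.exp_pos _).le).trans ?_
  rw [← Real.exp_add]
  refine Real.exp_le_exp.2 ?_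
  have l1 : Real.log 4 ≤ 3 := by
    have := Real.log_le_sub_one_of_pos (show (0 : ℝ) < 4 by norm_num)
    linarith
  have l2 := h.log_le_self
  have main : Q ^ 36 * r ≤ n * e ^ 2 / (8 * b ^ 2) := by
    rw [le_div_iff₀ (by positivity), ← hrn]
    calc Q ^ 36 * r * (8 * b ^ 2) ≤ Q ^ 36 * r * (Q ^ 2 * (Q ^ 7) ^ 2) := by
          gcongr
          nlinarith
      _ = r * (Q ^ 20) ^ 3 * (1 / Q ^ 4) ^ 2 := by field_simp
      _ ≤ r * r ^ 3 * e ^ 2 := by gcongr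
      _ = r ^ 4 * e ^ 2 := by ring
  have l3 : Q ^ 10 * r + 2 * Q * r ≤ Q ^ 36 * r := by
    have : Q ^ 10 + 2 * Q ≤ Q ^ 36 := by
      calc Q ^ 10 + 2 * Q ≤ Q ^ 10 + 2 * Q ^ 10 := by
            gcongr
            exact le_self_pow₀ (by linarith) (by norm_num)
        _ = 3 * Q ^ 10 := by ring
        _ ≤ Q ^ 26 * Q ^ 10 := by
            gcongr
            calc (3 : ℝ) ≤ Q := by linarith
              _ ≤ Q ^ 26 := le_self_pow₀ (by linarith) (by norm_num)
        _ = Q ^ 36 := by ring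
    nlinarith
  have l4 : 2 * Q ≤ 2 * Q * r := by nlinarith
  linarith

end Scale

/-- No measurability of `s` is required, because the product formula for rectangles holds for
arbitrary sets. -/
lemma prod_fst_le {Y Z : Type*} [MeasurableSpace Y] [MeasurableSpace Z] (μ : Measure Y)
    (ν : Measure Z) [SigmaFinite ν] [IsProbabilityMeasure ν] (s : Set Y) :
    (μ.prod ν) {ω | ω.1 ∈ s} ≤ μ s := by
  have : {ω : Y × Z | ω.1 ∈ s} = s ×ˢ Set.univ := by ext; simp
  rw [this, Measure.prod_prod]
  simp

/-! ### Closeness guarantee -/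

section Guarantees

variable {d l k : ℕ} {A R β ε δ Q : ℝ} {D D' : Measure (Pt d)}
  [IsProbabilityMeasure D] [IsProbabilityMeasure D'] {m n : ℕ} {f : Fin k → Pt d → Bool}

open Classical in
/-- `f p`, cut off outside of the tame points and above `b`. -/
noncomputable def cutoff (l : ℕ) (R β ε : ℝ) (f : Fin k → Pt d → Bool) (n : ℕ) (b : ℝ) (i : Fin k)
    (p : MvPolynomial (Fin d) ℝ) (S : Fin m → Pt d) (x : Pt d) : ℝ :=
  -- The `0` is an arbitrary test sample, which tameness does not read. The function thus depends on
  -- `S` only and is independent of the sample `S'`.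
  if (Input.mk l k m n R β ε f S 0).Tame x ∧ |bval (f i x) * MvPolynomial.eval x p| ≤ b then
    bval (f i x) * MvPolynomial.eval x p else 0

lemma measurable_cutoff (hd : 1 ≤ d) (hR : 0 < R) (hβ : 0 < β) (hε : 0 < ε)
    (hf : ∀ i, Measurable (f i)) (b : ℝ) (i : Fin k) (p : MvPolynomial (Fin d) ℝ) :
    Measurable (Function.uncurry (cutoff (m := m) l R β ε f n b i p)) := by
  have h1 : Measurable fun x : Pt d => bval (f i x) * MvPolynomial.eval x p :=
    (measurable_bval.comp (hf i)).mul (measurable_eval p)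
  have hs := (measurableSet_tame (m := m) (l := l) hd hR hβ hε hf (0 : Fin n → Pt d)).inter
    (measurableSet_le (h1.comp (measurable_snd (α := Fin m → Pt d))).abs
      (measurable_const (a := b)))
  exact Measurable.ite hs (h1.comp measurable_snd) measurable_const

lemma measurable_cutoff_right (hd : 1 ≤ d) (hR : 0 < R) (hβ : 0 < β) (hε : 0 < ε)
    (hf : ∀ i, Measurable (f i)) (b : ℝ) (i : Fin k) (p : MvPolynomial (Fin d) ℝ)
    (S : Fin m → Pt d) : Measurable (cutoff l R β ε f n b i p S) :=
  Measurable.of_uncurry_left (measurable_cutoff hd hR hβ hε hf b i p)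

lemma abs_cutoff_le {b : ℝ} (hb : 0 ≤ b) (i : Fin k) (p : MvPolynomial (Fin d) ℝ)
    (S : Fin m → Pt d) (x : Pt d) : |cutoff l R β ε f n b i p S x| ≤ b := by
  unfold cutoff
  split_ifs with h
  · exact h.2
  · simpa using hb

/-- The constraint on the first moment is homogeneous, so division by `ν` repairs it; the one on the
second moment can only improve, since `ν ≥ 1`. -/
lemma Input.scaled_mem_feasible {I : Input d} (i : Fin I.k)
    {p : MvPolynomial (Fin d) ℝ} (hp : p.totalDegree ≤ I.deg)
    (hβ : (∑ j, MvPolynomial.eval (I.S j) p ^ 2) / I.m ≤ 2 * I.β) {ν : ℝ} (hν : 1 ≤ ν)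
    (ha : (∑ j, I.absChow i p (I.S j)) / I.m ≤ ν * (2 * I.ε / (2 * I.R + I.ε))) :
    MvPolynomial.C (1 / ν) * p ∈ I.feasible i := by
  have hν0 : 0 < ν := by linarith
  have hev : ∀ x, MvPolynomial.eval x (MvPolynomial.C (1 / ν) * p) =
      1 / ν * MvPolynomial.eval x p := fun x => by simp
  refine ⟨?_, ?_, ?_⟩
  · refine (MvPolynomial.totalDegree_mul _ _).trans ?_
    rw [MvPolynomial.totalDegree_C, zero_add]
    exact hp
  · simp_rw [hev, mul_pow]
    rw [← Finset.mul_sum, mul_div_assoc]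
    have h3 : (1 / ν) ^ 2 ≤ 1 := by
      rw [div_pow, one_pow, div_le_one (by positivity)]
      exact one_le_pow₀ hν
    have h4 : 0 ≤ (∑ j, MvPolynomial.eval (I.S j) p ^ 2) / (I.m : ℝ) := by positivity
    calc _ ≤ 1 * ((∑ j, MvPolynomial.eval (I.S j) p ^ 2) / (I.m : ℝ)) :=
          mul_le_mul_of_nonneg_right h3 h4
      _ ≤ 2 * I.β := by linarith
  · have e1 : (∑ j, I.absChow i (MvPolynomial.C (1 / ν) * p) (I.S j)) / I.m =
        1 / ν * ((∑ j, I.absChow i p (I.S j)) / I.m) := by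
      rw [← mul_div_assoc, Finset.mul_sum]
      congr 1
      refine Finset.sum_congr rfl fun j _ => ?_
      rw [Input.absChow, hev, abs_mul, abs_of_pos (show 0 < 1 / ν by positivity), Input.absChow]
      ring
    rw [e1, one_div, inv_mul_le_iff₀ hν0]
    exact ha

lemma Input.abs_chow_le_of_scaled {I : Input d} {i : Fin I.k} {p : MvPolynomial (Fin d) ℝ} {ν : ℝ}
    (hν : 0 < ν) (hp : MvPolynomial.C (1 / ν) * p ∈ I.feasible i) {x : Pt d} (hx : I.Tame x) :
    |I.chow i p x| ≤ ν * I.B := by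
  have h1 := hx i _ hp
  rw [Input.absChow, map_mul, MvPolynomial.eval_C, abs_mul,
    abs_of_pos (show 0 < 1 / ν by positivity)] at h1
  rw [Input.chow, abs_mul, abs_of_nonneg (bval_nonneg _)]
  have h2 : bval (I.f i x) * |MvPolynomial.eval x p| =
      ν * (bval (I.f i x) * (1 / ν * |MvPolynomial.eval x p|)) := by field_simp
  rw [h2]
  exact mul_le_mul_of_nonneg_left h1 hν.le

lemma Input.objective_scaled {I : Input d} (T : Finset (Fin I.n)) (i : Fin I.k)
    (p : MvPolynomial (Fin d) ℝ) (r : ℝ) :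
    I.objective T i (MvPolynomial.C r * p) = r * I.objective T i p := by
  simp only [Input.objective, Input.chow, map_mul, MvPolynomial.eval_C, ← mul_div_assoc,
    Finset.mul_sum]
  congr 1
  exact Finset.sum_congr rfl fun j _ => by ring

open Classical in
lemma Input.objective_survivors_eq {I : Input d} {s : Pt d → Bool}
    {L : List (Fin I.k × MvPolynomial (Fin d) ℝ × ℝ)}
    (hs : ∀ x, s x = true ↔ I.Tame x ∧ ∀ q ∈ L, I.absChow q.1 q.2.1 x ≤ q.2.2) (i : Fin I.k)
    (p : MvPolynomial (Fin d) ℝ) :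
    I.objective (I.survivors I.S₀ L) i p =
      (∑ j, I.chow i p (I.S' j) * bval (s (I.S' j))) / I.n := by
  rw [Input.objective, Input.survivors, Input.S₀, Finset.filter_filter, Finset.sum_filter]
  congr 1
  refine Finset.sum_congr rfl fun j _ => ?_
  have hsj := hs (I.S' j)
  by_cases h1 : s (I.S' j) = true
  · rw [if_pos (hsj.1 h1), h1]
    simp [bval]
  · rw [if_neg (fun h2 => h1 (hsj.2 h2))]
    simp [bval, h1]

/-- This separates the randomness: the cutoff depends on `S` alone, and `S'` enters only through the
tuple of filters. The truncation at `b` has no effect under `hb`, but it keeps the cutoff bounded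
for every `S`, as uniform convergence demands. -/
lemma chow_mul_selector {N t : ℕ} {S : Fin m → Pt d} {S' : Fin n → Pt d} {i : Fin k}
    {p : MvPolynomial (Fin d) ℝ} {b : ℝ}
    (hb : ∀ x, (Input.mk l k m n R β ε f S S').Tame x →
      |bval (f i x) * MvPolynomial.eval x p| ≤ b)
    {s : Pt d → Bool} {L : List (Fin k × MvPolynomial (Fin d) ℝ × ℝ)}
    (hs : ∀ x, s x = true ↔ (Input.mk l k m n R β ε f S S').Tame x ∧
      ∀ q ∈ L, (Input.mk l k m n R β ε f S S').absChow q.1 q.2.1 x ≤ q.2.2)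
    {θ : Fin t → Filt k N ℝ}
    (hθ : ∀ x, Accepts f θ x ↔
      ∀ q ∈ L, (Input.mk l k m n R β ε f S S').absChow q.1 q.2.1 x ≤ q.2.2) (x : Pt d) :
    bval (f i x) * MvPolynomial.eval x p * bval (s x) =
      sel f θ (cutoff l R β ε f n b i p S) 0 x := by
  have hacc := hθ x
  have hsx := hs x
  unfold sel cutoff
  by_cases h1 : Accepts f θ x
  · rw [if_pos h1]
    by_cases h2 : (Input.mk l k m n R β ε f S S').Tame x
    · have h3 : s x = true := hsx.2 ⟨h2, hacc.1 h1⟩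
      rw [if_pos ⟨h2, hb x h2⟩, h3]
      simp [bval]
    · have h3 : ¬ s x = true := fun h3 => h2 (hsx.1 h3).1
      rw [if_neg fun h4 => h2 h4.1]
      simp [bval, h3]
  · rw [if_neg h1]
    have h3 : ¬ s x = true := fun h3 => h1 (hacc.2 (hsx.1 h3).2)
    simp [bval, h3]

lemma Scale.integral_le (h : Scale d l k A R β ε δ Q) (hD : Hypercontractive A D)
    {p : MvPolynomial (Fin d) ℝ} (hpβ : ∫ x, MvPolynomial.eval x p ^ 2 ∂D ≤ β) :
    ∫ x, |MvPolynomial.eval x p| ∂D ≤ Q := by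
  have h2 := sq_integral_abs_mul_le D (integrable_eval_sq hD p)
    (b := fun _ => 1) (by simp) (by simpa using (integrable_eval hD p).abs)
  simp only [mul_one, one_pow, integral_const, probReal_univ, smul_eq_mul] at h2
  have h3 : (∫ x, |MvPolynomial.eval x p| ∂D) ^ 2 ≤ Q ^ 2 := by
    have := h.β_le
    have := h.five_le
    nlinarith
  exact (abs_le_of_sq_le_sq' h3 h.Q_pos.le).2

lemma Scale.scaling_le (h : Scale d l k A R β ε δ Q) {a : ℝ} (ha : a ≤ Q + 1) :
    max 1 (a / (2 * ε / (2 * R + ε))) ≤ 2 * Q ^ 3 := by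
  have hQ := h.five_le
  have hQ0 := h.Q_pos
  have hR := h.one_lt_R
  have hε := h.ε_pos
  have hε1 := h.ε_lt
  refine max_le ?_ ?_
  · have : (1 : ℝ) ≤ Q ^ 3 := one_le_pow₀ (by linarith)
    linarith
  · have h1 : Q + 1 ≤ 6 / 5 * Q := by linarith
    calc a / (2 * ε / (2 * R + ε)) = a * ((2 * R + ε) * (1 / ε) / 2) := by field_simp
      _ ≤ (6 / 5 * Q) * ((3 * Q) * Q / 2) := by
          gcongr
          · linarith
          · linarith [h.R_le]
          · exact h.inv_ε_le
      _ = 9 / 5 * Q ^ 3 := by ring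
      _ ≤ 2 * Q ^ 3 := by gcongr; norm_num

/-- Since `ε / (2ε/(2R+ε)) = R + ε/2`, the first term is `max(ε, (R + ε/2) a)`. In the first case
`2ε` suffices; in the second the sampling error contributes at most `(R + ε/2)/Q³ ≤ ε`. -/
lemma Scale.chow_slack (h : Scale d l k A R β ε δ Q) {a H : ℝ} (hH : 0 ≤ H)
    (haH : a ≤ H + 1 / Q ^ 3) :
    max 1 (a / (2 * ε / (2 * R + ε))) * ε + ε / 2 ≤ (R + ε) * (1 + ε) * H + 2 * ε := by
  have hQ := h.five_le
  have hQ0 := h.Q_pos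
  have hR := h.one_lt_R
  have hε := h.ε_pos
  have e1 : max 1 (a / (2 * ε / (2 * R + ε))) * ε = max ε ((R + ε / 2) * a) := by
    rw [max_mul_of_nonneg _ _ hε.le, one_mul]
    congr 1
    field_simp
  rw [e1, ← max_add_add_right]
  refine max_le ?_ ?_
  · have : 0 ≤ (R + ε) * (1 + ε) * H := by positivity
    linarith
  · have h1 : (R + ε / 2) * a ≤ (R + ε / 2) * (H + 1 / Q ^ 3) := by gcongr
    have h2 : (R + ε / 2) * (1 / Q ^ 3) ≤ ε := by
      calc (R + ε / 2) * (1 / Q ^ 3) ≤ (2 * Q) * (1 / Q ^ 3) := by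
            gcongr
            linarith [h.R_le, h.ε_lt]
        _ = (2 / Q) * (1 / Q) := by field_simp
        _ ≤ 1 * ε := by
            gcongr
            · rw [div_le_one hQ0]; linarith
            · exact h.inv_le_ε
        _ = ε := one_mul _
    have h3 : (R + ε / 2) * H ≤ (R + ε) * (1 + ε) * H := by
      gcongr
      nlinarith
    linarith [mul_add (R + ε / 2) H (1 / Q ^ 3)]

/-- The deterministic part of the bound on the Chow parameters. -/
lemma chow_bound (h : Scale d l k A R β ε δ Q) (hm : 1 ≤ m) (hn : 1 ≤ n)
    (hf : ∀ i, Measurable (f i)) (hD : Hypercontractive A D) {N t : ℕ} (hN : N = (d + 1) ^ l)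
    {S : Fin m → Pt d} {S' : Fin n → Pt d}
    (ht : ∀ L T, (Input.mk l k m n R β ε f S S').Loop T L → L.length ≤ t) (i : Fin k)
    {p : MvPolynomial (Fin d) ℝ} (hp : p.totalDegree ≤ l)
    (hpβ : ∫ x, MvPolynomial.eval x p ^ 2 ∂D ≤ β)
    (hcov : CovGood l D S)
    (hconc : |∫ y, bval (f i y) * |MvPolynomial.eval y p| ∂D -
      (∑ j, bval (f i (S j)) * |MvPolynomial.eval (S j) p|) / m| ≤ Q / Q ^ 4)
    (huc : ∀ θ : Fin t → Filt k N ℝ,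
      ∫ y, sel f θ (cutoff l R β ε f n (Q ^ 7) i p S) 0 y ∂D' -
        (∑ j, sel f θ (cutoff l R β ε f n (Q ^ 7) i p S) 0 (S' j)) / n ≤ ε / 2)
    {s : Pt d → Bool} (hs : (Input.mk l k m n R β ε f S S').IsOutput s) :
    Integrable (fun x => bval (f i x) * MvPolynomial.eval x p * bval (s x)) D' ∧
      ∫ x, bval (f i x) * MvPolynomial.eval x p * bval (s x) ∂D' ≤
        (R + ε) * (1 + ε) * (∫ x, bval (f i x) * |MvPolynomial.eval x p| ∂D) + 2 * ε := by
  have hadm := h.admissible hm hn f S S'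
  have hQ := h.five_le
  have hQ0 := h.Q_pos
  have hR0 : 0 < R := by linarith [h.one_lt_R]
  have hβ := h.β_pos
  have hε := h.ε_pos
  obtain ⟨H, hH⟩ : ∃ H, H = ∫ x, bval (f i x) * |MvPolynomial.eval x p| ∂D := ⟨_, rfl⟩
  obtain ⟨a, ha⟩ : ∃ a, a = (∑ j, bval (f i (S j)) * |MvPolynomial.eval (S j) p|) / m := ⟨_, rfl⟩
  rw [← hH, ← ha] at hconc
  have hH0 : 0 ≤ H := by
    rw [hH]
    exact integral_nonneg fun x => mul_nonneg (bval_nonneg _) (abs_nonneg _)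
  have hHQ : H ≤ Q := by
    refine le_trans ?_ (h.integral_le hD hpβ)
    rw [hH]
    refine integral_mono_of_nonneg (Eventually.of_forall fun x =>
      mul_nonneg (bval_nonneg _) (abs_nonneg _)) (integrable_eval hD p).abs
      (Eventually.of_forall fun x => ?_)
    exact mul_le_of_le_one_left (abs_nonneg _) (bval_le_one _)
  have haH : a ≤ H + 1 / Q ^ 3 := by
    have h1 := (abs_le.1 hconc).1
    have h2 : Q / Q ^ 4 = 1 / Q ^ 3 := by field_simp
    linarith
  have hQ3 : 1 / Q ^ 3 ≤ 1 := by
    rw [div_le_one (by positivity)]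
    exact one_le_pow₀ (by linarith)
  -- The least scaling at or above `1` for which `p / ν` meets the constraint on the empirical mean
  -- of `f|p|`.
  obtain ⟨ν, hν⟩ : ∃ ν, ν = max 1 (a / (2 * ε / (2 * R + ε))) := ⟨_, rfl⟩
  have hν1 : 1 ≤ ν := hν ▸ le_max_left _ _
  have hν0 : 0 < ν := by linarith
  have hνQ : ν ≤ 2 * Q ^ 3 := hν ▸ h.scaling_le (by linarith)
  have hfeas : MvPolynomial.C (1 / ν) * p ∈ (Input.mk l k m n R β ε f S S').feasible i := by
    -- By `CovGood` the empirical second moment of `p` is at most `3/2` of the true one, below `2β`.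
    refine Input.scaled_mem_feasible (I := Input.mk l k m n R β ε f S S') i hp ?_ hν1 ?_
    · have h1 := (abs_le.1 (hcov p hp)).1
      simp only
      linarith
    · change (∑ j, bval (f i (S j)) * |MvPolynomial.eval (S j) p|) / m ≤
        ν * (2 * ε / (2 * R + ε))
      rw [← ha, ← div_le_iff₀ (by positivity), hν]
      exact le_max_right _ _
  obtain ⟨L, hL, -, hsL⟩ := hs
  obtain ⟨θ, hθ⟩ := Input.exists_tuple (I := Input.mk l k m n R β ε f S S') h.one_le_d h.one_le_k
    hN L (fun q hq => (hL.mem_feasible q hq).1) (ht L _ hL)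
  -- As `p / ν` is feasible, tame points satisfy `f|p| ≤ ν B ≤ 2 Q^3 · Q^3`; hence the cutoff at `Q
  -- ^ 7` does not act.
  have hbQ : ∀ x, (Input.mk l k m n R β ε f S S').Tame x →
      |bval (f i x) * MvPolynomial.eval x p| ≤ Q ^ 7 := fun x hx => by
    refine (Input.abs_chow_le_of_scaled hν0 hfeas hx).trans ?_
    calc _ ≤ 2 * Q ^ 3 * Q ^ 3 :=
          mul_le_mul hνQ (h.B_le f S S') (Input.B_pos hadm).le (by positivity)
      _ ≤ Q * (Q ^ 3 * Q ^ 3) := by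
          rw [mul_assoc]
          gcongr
          linarith
      _ = Q ^ 7 := by ring
  have hsel := chow_mul_selector (p := p) hbQ hsL hθ
  have hmeas : Measurable (sel f θ (cutoff l R β ε f n (Q ^ 7) i p S) 0) :=
    measurable_sel hf θ (measurable_cutoff_right h.one_le_d hR0 hβ hε hf (Q ^ 7) i p S)
      measurable_zero
  -- The halting criterion holds for `p / ν`; multiplied by `ν` it bounds the filtered empirical
  -- mean of `f p` by `ν ε`.
  have hobj := hL.objective_survivors i hfeas
  rw [Input.objective_scaled, Input.objective_survivors_eq hsL, one_div,
    inv_mul_le_iff₀ hν0] at hobj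
  have hfin := huc θ
  have hslack := h.chow_slack hH0 haH
  rw [← hν] at hslack
  have hsum : (∑ j, sel f θ (cutoff l R β ε f n (Q ^ 7) i p S) 0 (S' j)) / n ≤ ν * ε := by
    refine le_trans (le_of_eq ?_) hobj
    congr 1
    exact Finset.sum_congr rfl fun j _ => (hsel (S' j)).symm
  rw [← hH, show (fun x => bval (f i x) * MvPolynomial.eval x p * bval (s x)) =
    sel f θ (cutoff l R β ε f n (Q ^ 7) i p S) 0 from funext hsel]
  refine ⟨Integrable.of_bound hmeas.aestronglyMeasurable (Q ^ 7) (Eventually.of_forall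
    (abs_sel_le f θ (abs_cutoff_le (by positivity) i p S) ?_)), by linarith⟩
  intro x
  simp only [Pi.zero_apply, abs_zero]
  positivity

end Guarantees
end ICF

namespace ICF

open Filter Topology

section Guarantees

variable {d l k : ℕ} {A R β ε δ Q : ℝ} {D D' : Measure (Pt d)}
  [IsProbabilityMeasure D] [IsProbabilityMeasure D'] {m n : ℕ} {f : Fin k → Pt d → Bool}

lemma Scale.length_le (h : Scale d l k A R β ε δ Q) (hm : 1 ≤ m) (hn : 1 ≤ n)
    (S : Fin m → Pt d) (S' : Fin n → Pt d) (L) (T)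
    (hL : (Input.mk l k m n R β ε f S S').Loop T L) : L.length ≤ ⌊Q ^ 7⌋₊ :=
  Nat.le_floor ((hL.length_le_inv (h.admissible hm hn f S S')).trans (h.inv_Δ_le hm hn f S S'))

lemma Scale.one_le_of_pow_le (h : Scale d l k A R β ε δ Q) (hm : Q ^ 80 ≤ (m : ℝ)) : 1 ≤ m := by
  have h1 : (1 : ℝ) ≤ Q ^ 80 := one_le_pow₀ (by linarith [h.five_le])
  exact_mod_cast h1.trans hm

lemma Scale.floor_le (h : Scale d l k A R β ε δ Q) : ((⌊Q ^ 7⌋₊ : ℕ) : ℝ) ≤ Q ^ 7 :=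
  Nat.floor_le (pow_nonneg h.Q_pos.le 7)

lemma Scale.inv_pow_four_le (h : Scale d l k A R β ε δ Q) : 1 / Q ^ 4 ≤ ε / (4 * R) := by
  have hQ := h.five_le
  have hQ0 := h.Q_pos
  have hR : 0 < R := by linarith [h.one_lt_R]
  rw [div_le_div_iff₀ (by positivity) (by positivity), one_mul]
  have h1 : 1 ≤ ε * Q := by
    have := h.inv_ε_le
    rw [div_le_iff₀ h.ε_pos] at this
    linarith
  calc 4 * R ≤ 4 * Q := by linarith [h.R_le]
    _ ≤ Q ^ 3 := by
        calc 4 * Q ≤ Q ^ 2 * Q := by gcongr; nlinarith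
          _ = Q ^ 3 := by ring
    _ ≤ (ε * Q) * Q ^ 3 := by
        have : 0 < Q ^ 3 := by positivity
        nlinarith
    _ = ε * Q ^ 4 := by ring

lemma measure_iUnion_fin_le {Y : Type*} [MeasurableSpace Y] (μ : Measure Y) {k : ℕ} (hk : 1 ≤ k)
    (s : Fin k → Set Y) {a : ℝ} (ha : 0 ≤ a) (hs : ∀ i, μ (s i) ≤ ENNReal.ofReal (a / k)) :
    μ (⋃ i, s i) ≤ ENNReal.ofReal a := by
  have hk0 : (0 : ℝ) < k := by exact_mod_cast hk
  calc μ (⋃ i, s i) ≤ ∑ i, μ (s i) := measure_iUnion_fintype_le μ s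
    _ ≤ ∑ _i : Fin k, ENNReal.ofReal (a / k) := Finset.sum_le_sum fun i _ => hs i
    _ = ENNReal.ofReal a := by
        rw [← ENNReal.ofReal_sum_of_nonneg fun _ _ => by positivity]
        congr 1
        simp
        field_simp

/-- With high probability the Chow parameters of the filtered test distribution are controlled. -/
theorem chow_guarantee (h : Scale d l k A R β ε δ Q) (hm : Q ^ 80 ≤ (m : ℝ))
    (hn : Q ^ 80 ≤ (n : ℝ)) (hf : ∀ i, Measurable (f i)) (hD : Hypercontractive A D)
    (p : Fin k → MvPolynomial (Fin d) ℝ) (hp : ∀ i, (p i).totalDegree ≤ l)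
    (hpβ : ∀ i, ∫ x, MvPolynomial.eval x (p i) ^ 2 ∂D ≤ β) :
    ((Measure.pi fun _ : Fin m => D).prod (Measure.pi fun _ : Fin n => D'))
      {ω | ¬ ∀ s : Pt d → Bool, (Input.mk l k m n R β ε f ω.1 ω.2).IsOutput s →
        ∀ i, Integrable (fun x => bval (f i x) * MvPolynomial.eval x (p i) * bval (s x)) D' ∧
          ∫ x, bval (f i x) * MvPolynomial.eval x (p i) * bval (s x) ∂D' ≤
            (R + ε) * (1 + ε) * (∫ x, bval (f i x) * |MvPolynomial.eval x (p i)| ∂D) + 2 * ε}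
      ≤ ENNReal.ofReal δ := by
  obtain ⟨N, hN⟩ : ∃ N, N = (d + 1) ^ l := ⟨_, rfl⟩
  have hm1 := h.one_le_of_pow_le hm
  have hn1 := h.one_le_of_pow_le hn
  have hk : (0 : ℝ) < k := by exact_mod_cast h.one_le_k
  have hδ := h.δ_pos
  have hε := h.ε_pos
  have hQ := h.five_le
  have hQ0 := h.Q_pos
  have hR0 : 0 < R := by linarith [h.one_lt_R]
  have hNQ : (N : ℝ) ≤ Q := by rw [hN]; push_cast; exact h.dim_le
  -- Three sources of failure: the second moments on `S`, the means of `f_i|p_i|` on `S`, and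
  -- uniform convergence on `S'` given `S`. Their probabilities `δ/8`, `δ/8` and `δ/4` leave room.
  obtain ⟨Bcov, hBcov⟩ : ∃ s : Set ((Fin m → Pt d) × (Fin n → Pt d)),
      s = {ω | ω.1 ∈ {S | ¬ CovGood l D S}} := ⟨_, rfl⟩
  obtain ⟨Bconc, hBconc⟩ : ∃ s : Fin k → Set ((Fin m → Pt d) × (Fin n → Pt d)), s = fun i =>
      {ω | ω.1 ∈ {S | Q / Q ^ 4 < |∫ y, bval (f i y) * |MvPolynomial.eval y (p i)| ∂D -
        (∑ j, bval (f i (S j)) * |MvPolynomial.eval (S j) (p i)|) / m|}} := ⟨_, rfl⟩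
  obtain ⟨Buc, hBuc⟩ : ∃ s : Fin k → Set ((Fin m → Pt d) × (Fin n → Pt d)), s = fun i =>
      {ω | ∃ θ : Fin ⌊Q ^ 7⌋₊ → Filt k N ℝ,
        ε / 2 < ∫ y, sel f θ (cutoff l R β ε f n (Q ^ 7) i (p i) ω.1) 0 y ∂D' -
          (∑ j, sel f θ (cutoff l R β ε f n (Q ^ 7) i (p i) ω.1) 0 (ω.2 j)) / n} := ⟨_, rfl⟩
  have h1 : ((Measure.pi fun _ : Fin m => D).prod (Measure.pi fun _ : Fin n => D')) Bcov ≤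
      ENNReal.ofReal (δ / 8) := by
    rw [hBcov]
    exact (prod_fst_le _ _ _).trans (measure_not_covGood_le h hD hm)
  have h2 : ((Measure.pi fun _ : Fin m => D).prod (Measure.pi fun _ : Fin n => D'))
      (⋃ i, Bconc i) ≤ ENNReal.ofReal (δ / 8) := by
    refine measure_iUnion_fin_le _ h.one_le_k _ (by positivity) fun i => ?_
    rw [hBconc]
    refine (prod_fst_le _ _ _).trans ((concentration_poly h hD hm ((hp i).trans (by omega))
      (h.integral_le hD (hpβ i)) (g := fun x => bval (f i x) * |MvPolynomial.eval x (p i)|)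
      ((measurable_bval.comp (hf i)).mul (measurable_eval (p i)).abs)
      fun x => ?_).trans (ENNReal.ofReal_le_ofReal ?_))
    · rw [abs_mul, abs_abs]
      exact mul_le_of_le_one_left (abs_nonneg _) (abs_bval _)
    · rw [div_div]
      have : (1 : ℝ) ≤ Q ^ 2 := one_le_pow₀ (by linarith)
      exact div_le_div_of_nonneg_left hδ.le (by positivity)
        (le_mul_of_one_le_right (by positivity) this)
  have h3 : ((Measure.pi fun _ : Fin m => D).prod (Measure.pi fun _ : Fin n => D'))
      (⋃ i, Buc i) ≤ ENNReal.ofReal (δ / 4) := by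
    refine measure_iUnion_fin_le _ h.one_le_k _ (by positivity) fun i => ?_
    rw [hBuc]
    refine (uniform_convergence_sel_prod hf hn1 _ D'
      (v := fun _ => 0) (b := Q ^ 7)
      (measurable_cutoff h.one_le_d hR0 h.β_pos hε hf (Q ^ 7) i (p i)) measurable_const
      (by positivity) (by positivity) (fun y x => abs_cutoff_le (by positivity) i (p i) y x)
      (fun y x => by simp only [Pi.zero_apply, abs_zero]; positivity)).trans
      (ENNReal.ofReal_le_ofReal ?_)
    rw [div_div]
    refine h.ucBound_le hn hNQ h.floor_le (by positivity) le_rfl (h.inv_pow_four_le.trans ?_)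
    have := h.one_lt_R
    gcongr
    linarith
  refine (measure_mono (t := Bcov ∪ ((⋃ i, Bconc i) ∪ ⋃ i, Buc i)) fun ω hω => ?_).trans ?_
  · by_contra hb
    apply hω
    simp only [Set.mem_union, Set.mem_iUnion, not_or, not_exists] at hb
    obtain ⟨hb1, hb2, hb3⟩ := hb
    intro s hs i
    refine chow_bound h hm1 hn1 hf hD hN (h.length_le hm1 hn1 ω.1 ω.2) i (hp i) (hpβ i) ?_ ?_ ?_ hs
    · by_contra hc
      exact hb1 (by rw [hBcov]; exact hc)
    · by_contra hc
      exact hb2 i (by rw [hBconc]; exact not_le.1 hc)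
    · intro θ
      by_contra hc
      exact hb3 i (by rw [hBuc]; exact ⟨θ, not_le.1 hc⟩)
  · refine (measure_union_le _ _).trans ((add_le_add h1 ((measure_union_le _ _).trans
      (add_le_add h2 h3))).trans ?_)
    rw [← ENNReal.ofReal_add (by positivity) (by positivity),
      ← ENNReal.ofReal_add (by positivity) (by positivity)]
    exact ENNReal.ofReal_le_ofReal (by linarith)

/-! ### Rejection guarantee -/

open Classical in
/-- Minus the indicator of the tame points. -/
noncomputable def negTame (l : ℕ) (R β ε : ℝ) (f : Fin k → Pt d → Bool) (n : ℕ)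
    (S : Fin m → Pt d) (x : Pt d) : ℝ :=
  -- Uniform convergence is one-sided and bounds true means by empirical ones. The minus sign turns
  -- it into a bound on the empirical frequency among test points by the true probability.
  if (Input.mk l k m n R β ε f S 0).Tame x then -1 else 0

lemma measurable_negTame (hd : 1 ≤ d) (hR : 0 < R) (hβ : 0 < β) (hε : 0 < ε)
    (hf : ∀ i, Measurable (f i)) :
    Measurable (Function.uncurry (negTame (m := m) l R β ε f n)) :=
  Measurable.ite (measurableSet_tame (m := m) (l := l) hd hR hβ hε hf (0 : Fin n → Pt d))
    measurable_const measurable_const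

lemma measurableSet_tame_right (hd : 1 ≤ d) (hR : 0 < R) (hβ : 0 < β) (hε : 0 < ε)
    (hf : ∀ i, Measurable (f i)) (S : Fin m → Pt d) (S' : Fin n → Pt d) :
    MeasurableSet {x | (Input.mk l k m n R β ε f S S').Tame x} :=
  measurable_prodMk_left (measurableSet_tame (m := m) (l := l) hd hR hβ hε hf S')

lemma abs_sub_le_tvDist (D D' : Measure (Pt d)) [IsProbabilityMeasure D] [IsProbabilityMeasure D']
    {E : Set (Pt d)} (hE : MeasurableSet E) : |D.real E - D'.real E| ≤ tvDist D D' := by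
  refine le_ciSup (f := fun E : {E : Set (Pt d) // MeasurableSet E} =>
    |D.real E.1 - D'.real E.1|) ⟨1, ?_⟩ ⟨E, hE⟩
  rintro _ ⟨F, rfl⟩
  have h1 : D.real F.1 ≤ 1 := measureReal_le_one
  have h2 : D'.real F.1 ≤ 1 := measureReal_le_one
  have h3 : 0 ≤ D.real F.1 := measureReal_nonneg
  have h4 : 0 ≤ D'.real F.1 := measureReal_nonneg
  exact abs_le.2 ⟨by linarith, by linarith⟩

/-- The deterministic part of the bound on the rejection rate. -/
lemma rejection_bound (h : Scale d l k A R β ε δ Q) (hm : 1 ≤ m) (hn : 1 ≤ n)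
    (hf : ∀ i, Measurable (f i)) (hD : Hypercontractive A D) {N t : ℕ} (hN : N = (d + 1) ^ l)
    {S : Fin m → Pt d} {S' : Fin n → Pt d}
    (ht : ∀ L T, (Input.mk l k m n R β ε f S S').Loop T L → L.length ≤ t)
    (hcov : CovGood l D S)
    (hucS : ∀ θ : Fin t → Filt k N ℝ,
      ∫ y, sel f θ 0 1 y ∂D - (∑ j, sel f θ 0 1 (S j)) / m ≤ ε / (4 * R))
    (hucS' : ∀ θ : Fin t → Filt k N ℝ,
      ∫ y, sel f θ 0 (negTame l R β ε f n S) y ∂D' -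
        (∑ j, sel f θ 0 (negTame l R β ε f n S) (S' j)) / n ≤ ε / 4)
    {s : Pt d → Bool} (hs : (Input.mk l k m n R β ε f S S').IsOutput s) :
    D.real {x | s x = false} ≤ min ((1 + ε) / R) ((tvDist D D' + ε) / (R - 1)) := by
  classical
  have hadm := h.admissible hm hn f S S'
  have hR1 := h.one_lt_R
  have hR0 : 0 < R := by linarith
  have hε := h.ε_pos
  have hmp : (0 : ℝ) < m := by exact_mod_cast hm
  have hnp : (0 : ℝ) < n := by exact_mod_cast hn
  obtain ⟨L, hL, -, hsL⟩ := hs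
  obtain ⟨θ, hθ⟩ := Input.exists_tuple (I := Input.mk l k m n R β ε f S S') h.one_le_d h.one_le_k
    hN L (fun q hq => (hL.mem_feasible q hq).1) (ht L _ hL)
  have hrej := hL.rejected_le hadm
  have htame := measure_not_tame_le _ hadm hD hcov
  simp only at hrej htame
  obtain ⟨Tm, hTm⟩ : ∃ Tm, Tm = {x | (Input.mk l k m n R β ε f S S').Tame x} := ⟨_, rfl⟩
  obtain ⟨E', hE'⟩ : ∃ E', E' = {x | ¬ Accepts f θ x} := ⟨_, rfl⟩
  have hmT : MeasurableSet Tm :=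
    hTm ▸ measurableSet_tame_right h.one_le_d hR0 h.β_pos hε hf S S'
  have hmE' : MeasurableSet E' := hE' ▸ (measurableSet_accepts hf θ).compl
  have hnot : ∀ x, x ∈ E' ↔ ∃ q ∈ L, q.2.2 <
      (Input.mk l k m n R β ε f S S').absChow q.1 q.2.1 x := fun x => by
    rw [hE', Set.mem_ofPred_eq, hθ x]
    push Not
    rfl
  have selS : ∀ x, sel f θ 0 1 x = E'.indicator 1 x := fun x => by
    unfold sel
    by_cases hx : Accepts f θ x
    · rw [if_pos hx, Set.indicator_of_notMem (by rw [hE']; exact fun h => h hx)]; rfl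
    · rw [if_neg hx, Set.indicator_of_mem (by rw [hE']; exact hx)]
  have selS' : ∀ x, sel f θ 0 (negTame l R β ε f n S) x = -(Tm ∩ E').indicator 1 x := fun x => by
    unfold sel negTame
    by_cases hx : Accepts f θ x
    · rw [if_pos hx, Set.indicator_of_notMem (by rw [hE']; exact fun h => h.2 hx)]; simp
    · rw [if_neg hx]
      by_cases hx2 : (Input.mk l k m n R β ε f S (0 : Fin n → Pt d)).Tame x
      · rw [if_pos hx2, Set.indicator_of_mem (by rw [hE', hTm]; exact ⟨hx2, hx⟩)]; rfl
      · rw [if_neg hx2, Set.indicator_of_notMem (by rw [hTm]; exact fun h => hx2 h.1)]; simp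
  have i1 := hucS θ
  have i2 := hucS' θ
  simp only [selS] at i1
  simp only [selS', integral_neg, Finset.sum_neg_distrib, neg_div] at i2
  rw [integral_indicator_one hmE'] at i1
  rw [integral_indicator_one (hmT.inter hmE')] at i2
  have c1 : ∑ j, E'.indicator (1 : Pt d → ℝ) (S j) = ((Finset.univ.filter fun j =>
      ∃ q ∈ L, q.2.2 < (Input.mk l k m n R β ε f S S').absChow q.1 q.2.1 (S j)).card : ℝ) := by
    rw [Finset.card_filter, Nat.cast_sum]
    refine Finset.sum_congr rfl fun j _ => ?_
    simp only [Set.indicator_apply, hnot, Pi.one_apply]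
    split_ifs <;> simp
  have c2 : ∑ j, (Tm ∩ E').indicator (1 : Pt d → ℝ) (S' j) =
      (((Input.mk l k m n R β ε f S S').S₀.filter fun j =>
      ∃ q ∈ L, q.2.2 < (Input.mk l k m n R β ε f S S').absChow q.1 q.2.1 (S' j)).card : ℝ) := by
    rw [Input.S₀, Finset.filter_filter, Finset.card_filter, Nat.cast_sum]
    refine Finset.sum_congr rfl fun j _ => ?_
    simp only [Set.indicator_apply, Set.mem_inter_iff, hnot, hTm, Set.mem_ofPred_eq, Pi.one_apply]
    split_ifs <;> simp
  rw [c1] at i1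
  rw [c2] at i2
  -- The counting inequality between the samples is transferred on both sides. The error `ε/(4R)` on
  -- `S` is multiplied by `R`, so each side costs `ε/4`.
  have key : R * D.real E' ≤ D'.real (Tm ∩ E') + ε / 2 := by
    have : R * D.real E' ≤ R * ((((Finset.univ.filter fun j => ∃ q ∈ L, q.2.2 <
        (Input.mk l k m n R β ε f S S').absChow q.1 q.2.1 (S j)).card : ℝ) / m) + ε / (4 * R)) := by
      gcongr
      linarith
    have e : R * (ε / (4 * R)) = ε / 4 := by field_simp
    rw [mul_add, e] at this
    linarith
  -- A rejected point is not tame or is caught by a filter; the first event has probability at most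
  -- `ε/(2R)`.
  have hs0 : D.real {x | s x = false} ≤ ε / (2 * R) + D.real E' := by
    refine (measureReal_mono (s₂ := {x | ¬ (Input.mk l k m n R β ε f S S').Tame x} ∪ E')
      fun x hx => ?_).trans ((measureReal_union_le _ _).trans (by gcongr))
    by_contra hc
    have hc1 : (Input.mk l k m n R β ε f S S').Tame x := by
      by_contra h0
      exact hc (Or.inl h0)
    have hc2 : Accepts f θ x := by
      by_contra h0
      exact hc (Or.inr (by rw [hE']; exact h0))
    have := (hsL x).2 ⟨hc1, (hθ x).1 hc2⟩
    rw [Set.mem_ofPred_eq, this] at hx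
    exact absurd hx (by simp)
  have hle1 : D'.real (Tm ∩ E') ≤ 1 := measureReal_le_one
  have htv := (abs_le.1 (abs_sub_le_tvDist D D' (hmT.inter hmE'))).1
  have hmono : D.real (Tm ∩ E') ≤ D.real E' := measureReal_mono Set.inter_subset_right
  have hhalf : ε / (2 * R) * R = ε / 2 := by field_simp
  -- For the first bound, `D'(Tm ∩ E') ≤ 1`. For the second, `D'(Tm ∩ E')` is at most `D(E')` plus
  -- the total variation distance, and `D(E')` is moved to the left side, where `R - 1` remains.
  refine le_min ?_ ?_
  · rw [le_div_iff₀ hR0]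
    nlinarith
  · rw [le_div_iff₀ (by linarith)]
    have : 0 ≤ ε / (2 * R) := by positivity
    nlinarith

/-- With high probability the selector rejects little of the reference distribution. -/
theorem rejection_guarantee (h : Scale d l k A R β ε δ Q) (hm : Q ^ 80 ≤ (m : ℝ))
    (hn : Q ^ 80 ≤ (n : ℝ)) (hf : ∀ i, Measurable (f i)) (hD : Hypercontractive A D) :
    ((Measure.pi fun _ : Fin m => D).prod (Measure.pi fun _ : Fin n => D'))
      {ω | ¬ ∀ s : Pt d → Bool, (Input.mk l k m n R β ε f ω.1 ω.2).IsOutput s →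
        D.real {x | s x = false} ≤ min ((1 + ε) / R) ((tvDist D D' + ε) / (R - 1))}
      ≤ ENNReal.ofReal δ := by
  obtain ⟨N, hN⟩ : ∃ N, N = (d + 1) ^ l := ⟨_, rfl⟩
  have hm1 := h.one_le_of_pow_le hm
  have hn1 := h.one_le_of_pow_le hn
  have hk : (1 : ℝ) ≤ k := by exact_mod_cast h.one_le_k
  have hδ := h.δ_pos
  have hε := h.ε_pos
  have hQ := h.five_le
  have hQ0 := h.Q_pos
  have hR0 : 0 < R := by linarith [h.one_lt_R]
  have hNQ : (N : ℝ) ≤ Q := by rw [hN]; push_cast; exact h.dim_le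
  have hQ7 : (1 : ℝ) ≤ Q ^ 7 := one_le_pow₀ (by linarith)
  have hδk : δ / (4 * k) ≤ δ / 4 := by
    gcongr
    linarith
  -- Uniform convergence is needed on both samples here: for all rejections by filters on `S`, and
  -- for rejections of tame points on `S'` given `S`.
  obtain ⟨Bcov, hBcov⟩ : ∃ s : Set ((Fin m → Pt d) × (Fin n → Pt d)),
      s = {ω | ω.1 ∈ {S | ¬ CovGood l D S}} := ⟨_, rfl⟩
  obtain ⟨BS, hBS⟩ : ∃ s : Set ((Fin m → Pt d) × (Fin n → Pt d)),
      s = {ω | ω.1 ∈ {S : Fin m → Pt d | ∃ θ : Fin ⌊Q ^ 7⌋₊ → Filt k N ℝ, ε / (4 * R) <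
        ∫ y, sel f θ 0 1 y ∂D - (∑ j, sel f θ 0 1 (S j)) / m}} := ⟨_, rfl⟩
  obtain ⟨BS', hBS'⟩ : ∃ s : Set ((Fin m → Pt d) × (Fin n → Pt d)),
      s = {ω | ∃ θ : Fin ⌊Q ^ 7⌋₊ → Filt k N ℝ,
        ε / 4 < ∫ y, sel f θ 0 (negTame l R β ε f n ω.1) y ∂D' -
          (∑ j, sel f θ 0 (negTame l R β ε f n ω.1) (ω.2 j)) / n} := ⟨_, rfl⟩
  have h1 : ((Measure.pi fun _ : Fin m => D).prod (Measure.pi fun _ : Fin n => D')) Bcov ≤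
      ENNReal.ofReal (δ / 8) := by
    rw [hBcov]
    exact (prod_fst_le _ _ _).trans (measure_not_covGood_le h hD hm)
  have h2 : ((Measure.pi fun _ : Fin m => D).prod (Measure.pi fun _ : Fin n => D')) BS ≤
      ENNReal.ofReal (δ / 4) := by
    rw [hBS]
    refine (prod_fst_le _ _ _).trans ((uniform_convergence_sel hf hm1 D (u := 0) (v := 1)
      measurable_const measurable_const (b := 1) one_pos (by positivity) (by simp) (by simp)).trans
      (ENNReal.ofReal_le_ofReal ?_))
    exact (h.ucBound_le hm hNQ h.floor_le one_pos hQ7 h.inv_pow_four_le).trans hδk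
  have h3 : ((Measure.pi fun _ : Fin m => D).prod (Measure.pi fun _ : Fin n => D')) BS' ≤
      ENNReal.ofReal (δ / 4) := by
    rw [hBS']
    refine (uniform_convergence_sel_prod hf hn1 _ D'
      (u := fun _ => 0) (b := 1) measurable_const
      (measurable_negTame h.one_le_d hR0 h.β_pos hε hf) one_pos (by positivity) (by simp)
      (fun y x => by unfold negTame; split_ifs <;> simp)).trans
      (ENNReal.ofReal_le_ofReal ?_)
    refine (h.ucBound_le hn hNQ h.floor_le one_pos hQ7 (h.inv_pow_four_le.trans ?_)).trans hδk
    have := h.one_lt_R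
    gcongr
    linarith
  refine (measure_mono (t := Bcov ∪ (BS ∪ BS')) fun ω hω => ?_).trans ?_
  · by_contra hb
    apply hω
    simp only [Set.mem_union, not_or] at hb
    obtain ⟨hb1, hb2, hb3⟩ := hb
    intro s hs
    refine rejection_bound h hm1 hn1 hf hD hN (h.length_le hm1 hn1 ω.1 ω.2) ?_ ?_ ?_ hs
    · by_contra hc
      exact hb1 (by rw [hBcov]; exact hc)
    · intro θ
      by_contra hc
      exact hb2 (by rw [hBS]; exact ⟨θ, not_le.1 hc⟩)
    · intro θ
      by_contra hc
      exact hb3 (by rw [hBS']; exact ⟨θ, not_le.1 hc⟩)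
  · refine (measure_union_le _ _).trans ((add_le_add h1 ((measure_union_le _ _).trans
      (add_le_add h2 h3))).trans ?_)
    rw [← ENNReal.ofReal_add (by positivity) (by positivity),
      ← ENNReal.ofReal_add (by positivity) (by positivity)]
    exact ENNReal.ofReal_le_ofReal (by linarith)

/-- The sum in the sample size bound dominates the parameters. -/
lemma Scale.of_sum (hd : 1 ≤ d) (hl : 1 ≤ l) (hk : 1 ≤ k) (hA : 1 ≤ A) (hR : 1 < R) (hβ : 0 < β)
    (hε : 0 < ε) (hε1 : ε < 1) (hδ : 0 < δ) (hδ1 : δ < 1) :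
    Scale d l k A R β ε δ
      (R + β + A ^ l + ((d : ℝ) + 1) ^ l + 1 / ε + Real.log (k / δ) ^ l) := by
  -- The lower bound `5` on the sum collects `1` from each of `R`, `A ^ l` and `1 / ε`, and `2` from
  -- `(d+1)^l`.
  have h1 : 1 ≤ A ^ l := one_le_pow₀ hA
  have h2 : (2 : ℝ) ≤ ((d : ℝ) + 1) ^ l := by
    have : (1 : ℝ) ≤ d := by exact_mod_cast hd
    calc (2 : ℝ) ≤ d + 1 := by linarith
      _ ≤ ((d : ℝ) + 1) ^ l := le_self_pow₀ (by linarith) (by omega)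
  have h3 : 1 ≤ 1 / ε := by rw [le_div_iff₀ hε]; linarith
  have hk1 : (1 : ℝ) ≤ k := by exact_mod_cast hk
  have h4 : 0 ≤ Real.log (k / δ) ^ l :=
    pow_nonneg (Real.log_nonneg (by rw [le_div_iff₀ hδ]; linarith)) l
  exact ⟨hd, hl, hk, hA, hR, hβ, hε, hε1, hδ, hδ1, by linarith, by linarith, by linarith,
    by linarith, by linarith, by linarith, by linarith⟩

end Guarantees
end ICF

namespace ICF

open Filter Topology

/-! ### The convex program behind the feasible polynomials -/

/-- A linear functional that is bounded on the preimage of a compact set attains its maximum. -/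
lemma exists_max_of_bounded {V : Type*} [AddCommGroup V] [Module ℝ V] {m : ℕ}
    (L : V →ₗ[ℝ] (Fin m → ℝ)) {K : Set (Fin m → ℝ)} (hK : IsCompact K)
    (h0 : (0 : Fin m → ℝ) ∈ K) (g : V →ₗ[ℝ] ℝ) {B : ℝ} (hB : ∀ c, L c ∈ K → g c ≤ B) :
    ∃ c, L c ∈ K ∧ ∀ c', L c' ∈ K → g c' ≤ g c := by
  -- Along the kernel of `L` the constraint does not change, so boundedness forces `g` to vanish
  -- there. Hence `g` factors through `L`, and the maximum is taken over the compact set of values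
  -- in `K` and in the range of `L`.
  have hker : g ∈ L.ker.dualAnnihilator := by
    rw [Submodule.mem_dualAnnihilator]
    intro c hc
    by_contra hne
    have h1 := hB (((B + 1) / g c) • c) (by
      rw [map_smul, LinearMap.mem_ker.1 hc, smul_zero]
      exact h0)
    rw [map_smul, smul_eq_mul, div_mul_cancel₀ _ hne] at h1
    linarith
  rw [← LinearMap.range_dualMap_eq_dualAnnihilator_ker] at hker
  obtain ⟨g', rfl⟩ := hker
  have hcomp : IsCompact (K ∩ (L.range : Set (Fin m → ℝ))) :=
    hK.inter_right L.range.closed_of_finiteDimensional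
  obtain ⟨v, ⟨hv1, c, rfl⟩, hv2⟩ := hcomp.exists_isMaxOn ⟨0, h0, L.range.zero_mem⟩
    (LinearMap.continuous_of_finiteDimensional g').continuousOn
  exact ⟨c, hv1, fun c' hc' => hv2 ⟨hc', c', rfl⟩⟩

/-- The linear constraints: row `a` and row `m + a` say that variable `N + a` bounds the absolute
value of the `a`-th linear form, row `2 m` bounds a weighted sum of these variables. -/
def chowRow (N m : ℕ) (Φ : ℕ → ℕ → ℝ) (g : ℕ → ℝ) (a b : ℕ) : ℝ :=
  if a < m then (if b < N then Φ a b else if b = N + a then -1 else 0)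
  else if a < 2 * m then (if b < N then -Φ (a - m) b else if b = N + (a - m) then -1 else 0)
  else if b < N then 0 else g (b - N)

/-- The quadratic form, the sum of the squares of the variables `N, …, N + m - 1`. -/
def chowQuad (N a b : ℕ) : ℝ := if a = b ∧ N ≤ a then 1 else 0

/-- Maximize a linear function over polynomials with constraints on a sample. -/
def chowProgram (N m : ℕ) (Φ : ℕ → ℕ → ℝ) (g : ℕ → ℝ) (h γ : ℝ) (c : ℕ → ℝ) : ConvexProgram where
  nv := N + m
  nc := 2 * m + 1
  A := fun a b => chowRow N m Φ g a b
  b := fun a => if (a : ℕ) < 2 * m then 0 else h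
  Q := fun a b => chowQuad N a b
  γ := γ
  c := fun b => if (b : ℕ) < N then c b else 0

section ChowProgram

variable {N m : ℕ} {Φ : ℕ → ℕ → ℝ} {g : ℕ → ℝ} {h γ : ℝ} {c : ℕ → ℝ}

lemma chowQuad_sum (y : Fin (N + m) → ℝ) :
    ∑ i : Fin (N + m), ∑ j : Fin (N + m), y i * chowQuad N i j * y j =
      ∑ j, y (Fin.natAdd N j) ^ 2 := by
  have h1 : ∀ i : Fin (N + m), ∑ j : Fin (N + m), y i * chowQuad N i j * y j =
      if N ≤ (i : ℕ) then y i ^ 2 else 0 := fun i => by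
    have : ∀ j : Fin (N + m), y i * chowQuad N i j * y j =
        if i = j then (if N ≤ (i : ℕ) then y i ^ 2 else 0) else 0 := fun j => by
      unfold chowQuad
      by_cases hij : i = j
      · subst hij
        by_cases hN : N ≤ (i : ℕ)
        · simp [hN]; ring
        · simp [hN]
      · have : ¬ (i : ℕ) = j := fun h => hij (Fin.ext h)
        simp [hij, this]
    simp only [this, Finset.sum_ite_eq, Finset.mem_univ, if_true]
  simp only [h1]
  rw [Fin.sum_univ_add]
  have : ∀ w : Fin N, ¬ N ≤ (w : ℕ) := fun w => by omega
  simp [this]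

lemma chowQuad_posSemidef :
    (Matrix.of fun a b : Fin (N + m) => chowQuad N a b).PosSemidef := by
  refine Matrix.PosSemidef.of_dotProduct_mulVec_nonneg ?_ fun y => ?_
  · ext a b
    simp only [Matrix.conjTranspose_apply, Matrix.of_apply, chowQuad, star_trivial]
    by_cases hab : (a : ℕ) = b
    · simp [hab]
    · simp [hab, Ne.symm hab]
  · have e : star y ⬝ᵥ (Matrix.of fun a b : Fin (N + m) => chowQuad N a b).mulVec y =
        ∑ i : Fin (N + m), ∑ j : Fin (N + m), y i * chowQuad N i j * y j := by
      simp only [dotProduct, Matrix.mulVec, Matrix.of_apply, Pi.star_apply, star_trivial,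
        Finset.mul_sum, mul_assoc]
    rw [e, chowQuad_sum]
    positivity

lemma chowRow_sum_pos (y : Fin (N + m) → ℝ) (a : Fin m) :
    ∑ b : Fin (N + m), chowRow N m Φ g a b * y b =
      ∑ w : Fin N, Φ a w * y (Fin.castAdd m w) - y (Fin.natAdd N a) := by
  rw [Fin.sum_univ_add, sub_eq_add_neg]
  congr 1
  · exact Finset.sum_congr rfl fun w _ => by simp [chowRow]
  · have : ∀ j : Fin m, chowRow N m Φ g a (Fin.natAdd N j) * y (Fin.natAdd N j) =
        if j = a then -y (Fin.natAdd N a) else 0 := fun j => by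
      by_cases hj : j = a
      · subst hj; simp [chowRow]
      · have : ¬ (j : ℕ) = a := fun h => hj (Fin.ext h)
        simp [chowRow, hj, this]
    simp only [this, Finset.sum_ite_eq', Finset.mem_univ, if_true]

lemma chowRow_sum_neg (y : Fin (N + m) → ℝ) (a : Fin m) :
    ∑ b : Fin (N + m), chowRow N m Φ g (m + a) b * y b =
      -∑ w : Fin N, Φ a w * y (Fin.castAdd m w) - y (Fin.natAdd N a) := by
  have ha : m + (a : ℕ) < 2 * m := by omega
  rw [Fin.sum_univ_add, sub_eq_add_neg]
  congr 1
  · rw [← Finset.sum_neg_distrib]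
    exact Finset.sum_congr rfl fun w _ => by simp [chowRow, ha]
  · have : ∀ j : Fin m, chowRow N m Φ g (m + a) (Fin.natAdd N j) * y (Fin.natAdd N j) =
        if j = a then -y (Fin.natAdd N a) else 0 := fun j => by
      by_cases hj : j = a
      · subst hj; simp [chowRow, ha]
      · have : ¬ (j : ℕ) = a := fun h => hj (Fin.ext h)
        simp [chowRow, hj, this, ha]
    simp only [this, Finset.sum_ite_eq', Finset.mem_univ, if_true]

lemma chowRow_sum_last (y : Fin (N + m) → ℝ) :
    ∑ b : Fin (N + m), chowRow N m Φ g (2 * m) b * y b = ∑ j : Fin m, g j * y (Fin.natAdd N j) := by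
  have h2 : ¬ 2 * m < m := by omega
  rw [Fin.sum_univ_add, Finset.sum_eq_zero, zero_add]
  · exact Finset.sum_congr rfl fun j _ => by simp [chowRow, h2]
  · intro w _
    simp [chowRow, h2]

lemma chowProgram_objective (y : Fin (N + m) → ℝ) :
    ∑ b : Fin (N + m), (if (b : ℕ) < N then c b else 0) * y b =
      ∑ w : Fin N, c w * y (Fin.castAdd m w) := by
  rw [Fin.sum_univ_add]
  simp

lemma chowProgram_feasible_iff (y : Fin (N + m) → ℝ) :
    (chowProgram N m Φ g h γ c).Feasible y ↔
      (∀ a : Fin m, |∑ w : Fin N, Φ a w * y (Fin.castAdd m w)| ≤ y (Fin.natAdd N a)) ∧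
      ∑ j : Fin m, g j * y (Fin.natAdd N j) ≤ h ∧ ∑ j, y (Fin.natAdd N j) ^ 2 ≤ γ := by
  unfold ConvexProgram.Feasible
  change (∀ r : Fin (2 * m + 1), ∑ b : Fin (N + m), chowRow N m Φ g r b * y b ≤
    if (r : ℕ) < 2 * m then 0 else h) ∧
    ∑ i : Fin (N + m), ∑ j : Fin (N + m), y i * chowQuad N i j * y j ≤ γ ↔ _
  rw [chowQuad_sum, ← and_assoc]
  refine and_congr_left fun _ => ⟨fun H => ⟨fun a => ?_, ?_⟩, fun ⟨H1, H2⟩ r => ?_⟩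
  · have h1 := H ⟨a, by omega⟩
    have h2 := H ⟨m + a, by omega⟩
    simp only at h1 h2
    rw [chowRow_sum_pos, if_pos (by omega)] at h1
    rw [chowRow_sum_neg, if_pos (by omega)] at h2
    exact abs_le.2 ⟨by linarith, by linarith⟩
  · have h1 := H ⟨2 * m, by omega⟩
    simp only at h1
    rwa [chowRow_sum_last, if_neg (by omega)] at h1
  · by_cases hr1 : (r : ℕ) < m
    · have := chowRow_sum_pos (Φ := Φ) (g := g) y ⟨r, hr1⟩
      simp only at this
      rw [this, if_pos (by omega)]
      have := (abs_le.1 (H1 ⟨r, hr1⟩)).2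
      linarith
    · by_cases hr2 : (r : ℕ) < 2 * m
      · have := chowRow_sum_neg (Φ := Φ) (g := g) y ⟨r - m, by omega⟩
        simp only [Nat.add_sub_cancel' (not_lt.1 hr1)] at this
        rw [this, if_pos hr2]
        have := (abs_le.1 (H1 ⟨r - m, by omega⟩)).1
        linarith
      · have hr : (r : ℕ) = 2 * m := by omega
        rw [if_neg hr2, hr, chowRow_sum_last]
        exact H2

/-- The constraints on the coefficients. -/
def ChowFeasible (N m : ℕ) (Φ : ℕ → ℕ → ℝ) (g : ℕ → ℝ) (h γ : ℝ) (e : Fin N → ℝ) : Prop :=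
  ∑ j : Fin m, g j * |∑ w : Fin N, Φ j w * e w| ≤ h ∧
    ∑ j : Fin m, (∑ w : Fin N, Φ j w * e w) ^ 2 ≤ γ

/-- The slack variables dominate the absolute values, and both constraints are monotone in them
because the weights `g` are nonnegative. Conversely the absolute values themselves are admissible
slacks, so the program is an exact reformulation. -/
lemma ChowFeasible.of_feasible (hg : ∀ j, 0 ≤ g j) {y : Fin (N + m) → ℝ}
    (hy : (chowProgram N m Φ g h γ c).Feasible y) :
    ChowFeasible N m Φ g h γ fun w => y (Fin.castAdd m w) := by
  obtain ⟨h1, h2, h3⟩ := (chowProgram_feasible_iff y).1 hy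
  refine ⟨le_trans ?_ h2, le_trans ?_ h3⟩
  · exact Finset.sum_le_sum fun j _ => mul_le_mul_of_nonneg_left (h1 j) (hg j)
  · refine Finset.sum_le_sum fun j _ => ?_
    exact sq_le_sq' (by linarith [(abs_le.1 (h1 j)).1]) (abs_le.1 (h1 j)).2

lemma ChowFeasible.feasible {e : Fin N → ℝ} (he : ChowFeasible N m Φ g h γ e) :
    (chowProgram N m Φ g h γ c).Feasible
      (Fin.append e fun j : Fin m => |∑ w : Fin N, Φ j w * e w|) := by
  rw [chowProgram_feasible_iff]
  simp only [Fin.append_left, Fin.append_right, le_refl, implies_true, true_and, sq_abs]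
  exact he

lemma ChowFeasible.of_isOptimal (hg : ∀ j, 0 ≤ g j) {y : Fin (N + m) → ℝ} :
    (chowProgram N m Φ g h γ c).IsOptimal y →
      (ChowFeasible N m Φ g h γ fun w => y (Fin.castAdd m w)) ∧
      ∀ e, ChowFeasible N m Φ g h γ e →
        ∑ w : Fin N, c w * e w ≤ ∑ w : Fin N, c w * y (Fin.castAdd m w) := by
  rintro ⟨h1, h2⟩
  refine ⟨ChowFeasible.of_feasible hg h1, fun e he => ?_⟩
  have := h2 _ he.feasible
  change ∑ b : Fin (N + m), (if (b : ℕ) < N then c b else 0) * _ ≤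
    ∑ b : Fin (N + m), (if (b : ℕ) < N then c b else 0) * y b at this
  rw [chowProgram_objective, chowProgram_objective] at this
  simpa using this

/-- The coefficients need not be bounded, since they are not determined by the values on the sample.
Compactness is available for the vector of these values, which the quadratic constraint confines to
a ball. -/
lemma exists_chowProgram_isOptimal (hg : ∀ j, 0 ≤ g j) (hh : 0 ≤ h) (hγ : 0 ≤ γ) {B : ℝ}
    (hB : ∀ e, ChowFeasible N m Φ g h γ e → ∑ w : Fin N, c w * e w ≤ B) :
    ∃ y, (chowProgram N m Φ g h γ c).IsOptimal y := by
  let L : (Fin N → ℝ) →ₗ[ℝ] (Fin m → ℝ) :=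
    { toFun := fun e j => ∑ w : Fin N, Φ j w * e w
      map_add' := fun e e' => by ext j; simp [mul_add, Finset.sum_add_distrib]
      map_smul' := fun s e => by ext j; simp [Finset.mul_sum, mul_left_comm] }
  let G : (Fin N → ℝ) →ₗ[ℝ] ℝ :=
    { toFun := fun e => ∑ w : Fin N, c w * e w
      map_add' := fun e e' => by simp [mul_add, Finset.sum_add_distrib]
      map_smul' := fun s e => by simp [Finset.mul_sum, mul_left_comm] }
  let K : Set (Fin m → ℝ) := {v | ∑ j : Fin m, g j * |v j| ≤ h ∧ ∑ j, v j ^ 2 ≤ γ}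
  have hK : IsCompact K := by
    refine Metric.isCompact_of_isClosed_isBounded ?_ ?_
    · have o1 : IsClosed {v : Fin m → ℝ | ∑ j : Fin m, g j * |v j| ≤ h} :=
        isClosed_le (by fun_prop) continuous_const
      have o2 : IsClosed {v : Fin m → ℝ | ∑ j, v j ^ 2 ≤ γ} :=
        isClosed_le (by fun_prop) continuous_const
      exact o1.inter o2
    · refine (Metric.isBounded_iff_subset_closedBall 0).2 ⟨√γ, fun v hv => ?_⟩
      rw [mem_closedBall_zero_iff, pi_norm_le_iff_of_nonneg (Real.sqrt_nonneg _)]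
      intro j
      rw [Real.norm_eq_abs]
      refine Real.abs_le_sqrt (le_trans ?_ hv.2)
      exact Finset.single_le_sum (f := fun j => v j ^ 2) (fun _ _ => sq_nonneg _)
        (Finset.mem_univ j)
  have h0 : (0 : Fin m → ℝ) ∈ K := ⟨by simpa using hh, by simpa using hγ⟩
  obtain ⟨e, he1, he2⟩ := exists_max_of_bounded L hK h0 G (B := B) fun e he => hB e he
  refine ⟨Fin.append e fun j : Fin m => |∑ w : Fin N, Φ j w * e w|,
    ChowFeasible.feasible he1, fun z hz => ?_⟩
  have := he2 _ (ChowFeasible.of_feasible hg hz)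
  refine (chowProgram_objective (c := c) z).le.trans (this.trans (le_of_eq ?_))
  refine Eq.trans ?_ (chowProgram_objective (c := c) _).symm
  simp [G]

lemma Solver.answer_some (s : Solver) (hg : ∀ j, 0 ≤ g j) {y : Fin (N + m) → ℝ}
    (hy : s.answer (chowProgram N m Φ g h γ c) = some y) :
    (ChowFeasible N m Φ g h γ fun w => y (Fin.castAdd m w)) ∧
      ∀ e, ChowFeasible N m Φ g h γ e →
        ∑ w : Fin N, c w * e w ≤ ∑ w : Fin N, c w * y (Fin.castAdd m w) :=
  ChowFeasible.of_isOptimal hg 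
    (s.optimal (chowProgram N m Φ g h γ c) y chowQuad_posSemidef hy)

/-- Contrapositive of the existence of optima: a program without optimal solution has unbounded
objective. The tameness test relies on this to interpret a missing answer. -/
lemma Solver.answer_none (s : Solver) (hg : ∀ j, 0 ≤ g j) (hh : 0 ≤ h) (hγ : 0 ≤ γ)
    (hy : s.answer (chowProgram N m Φ g h γ c) = none) (B : ℝ) :
    ∃ e, ChowFeasible N m Φ g h γ e ∧ B < ∑ w : Fin N, c w * e w := by
  by_contra hB
  push Not at hB
  obtain ⟨y, hy'⟩ := exists_chowProgram_isOptimal hg hh hγ hB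
  exact s.complete _ chowQuad_posSemidef hy y hy'

end ChowProgram
end ICF

namespace ICF

/-! ### Program logic -/

namespace Mem

@[simp] lemma setN_N (σ : Mem) (a i j v b i' j' : ℕ) :
    (σ.setN a i j v).N b i' j' = if b = a ∧ i' = i ∧ j' = j then v else σ.N b i' j' := rfl

@[simp] lemma setN_Q (σ : Mem) (a i j v : ℕ) : (σ.setN a i j v).Q = σ.Q := rfl

@[simp] lemma setQ_N (σ : Mem) (a i j : ℕ) (v : ℝ) : (σ.setQ a i j v).N = σ.N := rfl

@[simp] lemma setQ_Q (σ : Mem) (a i j : ℕ) (v : ℝ) (b i' j' : ℕ) :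
    (σ.setQ a i j v).Q b i' j' = if b = a ∧ i' = i ∧ j' = j then v else σ.Q b i' j' := rfl

end Mem

/-- Outside of the listed arrays of naturals and of reals, the two memories agree. -/
structure Same (w q : List ℕ) (σ τ : Mem) : Prop where
  N : ∀ a, a ∉ w → τ.N a = σ.N a
  Q : ∀ a, a ∉ q → τ.Q a = σ.Q a

namespace Same

variable {w q w' q' : List ℕ} {σ τ υ : Mem}

lemma refl (w q : List ℕ) (σ : Mem) : Same w q σ σ := ⟨fun _ _ => rfl, fun _ _ => rfl⟩

lemma trans (h : Same w q σ τ) (h' : Same w q τ υ) : Same w q σ υ :=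
  ⟨fun a ha => (h'.N a ha).trans (h.N a ha), fun a ha => (h'.Q a ha).trans (h.Q a ha)⟩

lemma mono (h : Same w q σ τ) (hw : w ⊆ w') (hq : q ⊆ q') : Same w' q' σ τ :=
  ⟨fun a ha => h.N a fun h' => ha (hw h'), fun a ha => h.Q a fun h' => ha (hq h')⟩

lemma setN (h : Same w q σ τ) {a : ℕ} (ha : a ∈ w) (i j v : ℕ) : Same w q σ (τ.setN a i j v) := by
  refine ⟨fun b hb => ?_, h.Q⟩
  rw [← h.N b hb]
  funext i' j'
  have : b ≠ a := fun e => hb (e ▸ ha)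
  simp [this]

lemma setQ (h : Same w q σ τ) {a : ℕ} (ha : a ∈ q) (i j : ℕ) (v : ℝ) :
    Same w q σ (τ.setQ a i j v) := by
  refine ⟨h.N, fun b hb => ?_⟩
  rw [← h.Q b hb]
  funext i' j'
  have : b ≠ a := fun e => hb (e ▸ ha)
  simp [this]

lemma setRow (h : Same w q σ τ) {a : ℕ} (ha : a ∈ q) {r : ℕ} (y : Fin r → ℝ) :
    Same w q σ (τ.setRow a y) := by
  refine ⟨h.N, fun b hb => ?_⟩
  rw [← h.Q b hb]
  funext i' j'
  have : b ≠ a := fun e => hb (e ▸ ha)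
  simp [Mem.setRow, this]

end Same

/-- `P`, started in `σ`, halts within `c` steps in a memory with the property `Post`. -/
def Runs {d : ℕ} (M : Equipment d) (P : Prog) (σ : Mem) (c : ℕ) (Post : Mem → Prop) : Prop :=
  ∃ T τ, M.Exec P σ T τ ∧ T ≤ c ∧ Post τ

/-- The scalar `v`, kept in cell `(0, 0)` of an array of naturals. -/
abbrev nv (v : ℕ) : NExp := .get v (.lit 0) (.lit 0)

/-- The scalar `v`, kept in cell `(0, 0)` of an array of reals. -/
abbrev rv (v : ℕ) : RExp := .get v (.lit 0) (.lit 0)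

/-- Assign to a scalar. -/
abbrev setn (v : ℕ) (e : NExp) : Prog := .putN v (.lit 0) (.lit 0) e

/-- Assign to a real scalar. -/
abbrev setr (v : ℕ) (e : RExp) : Prog := .putR v (.lit 0) (.lit 0) e

/-- Run `body` with the scalar `v` equal to `0, 1, …, bd - 1`. -/
def forN (v : ℕ) (bd : NExp) (body : Prog) : Prog :=
  .seq (setn v (.lit 0))
    (.loop (.leN (.add (nv v) (.lit 1)) bd) (.seq body (setn v (.add (nv v) (.lit 1)))))

/-- Execute one program after another. -/
notation:60 P₁:61 ";;" P₂:60 => Prog.seq P₁ P₂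

/-- The unit of time bounds: `X` times a power of a size parameter `U`. -/
def budget (X U a : ℕ) : ℕ := X * U ^ a

/-- Raising the exponent by one pays for `64` items of the previous size. All constants and
sequential compositions are absorbed in this way, and the remaining cost goals are linear. -/
lemma budget_step (X : ℕ) {U : ℕ} (hU : 64 ≤ U) (a : ℕ) :
    64 * budget X U a ≤ budget X U (a + 1) := by
  unfold budget
  calc 64 * (X * U ^ a) ≤ U * (X * U ^ a) := Nat.mul_le_mul_right _ hU
    _ = X * U ^ (a + 1) := by ring

lemma budget_pos {X U : ℕ} (hX : 1 ≤ X) (hU : 64 ≤ U) (a : ℕ) : 1 ≤ budget X U a :=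
  Nat.mul_pos hX (Nat.pow_pos (by omega))

lemma budget_mono {X U a b : ℕ} (hU : 64 ≤ U) (hab : a ≤ b) : budget X U a ≤ budget X U b :=
  Nat.mul_le_mul_left _ (Nat.pow_le_pow_right (by omega) hab)

lemma budget_chain {X U : ℕ} (hX : 1 ≤ X) (hU : 64 ≤ U) (s : ℕ) :
    1 ≤ budget X U s ∧ 64 * budget X U s ≤ budget X U (s + 1) ∧
    64 * budget X U (s + 1) ≤ budget X U (s + 2) ∧ 64 * budget X U (s + 2) ≤ budget X U (s + 3) ∧
    64 * budget X U (s + 3) ≤ budget X U (s + 4) ∧ 64 * budget X U (s + 4) ≤ budget X U (s + 5) ∧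
    64 * budget X U (s + 5) ≤ budget X U (s + 6) ∧ 64 * budget X U (s + 6) ≤ budget X U (s + 7) ∧
    64 * budget X U (s + 7) ≤ budget X U (s + 8) ∧ 64 * budget X U (s + 8) ≤ budget X U (s + 9) :=
  ⟨budget_pos hX hU s, budget_step X hU s, budget_step X hU _, budget_step X hU _,
    budget_step X hU _, budget_step X hU _, budget_step X hU _, budget_step X hU _,
    budget_step X hU _, budget_step X hU _⟩

lemma budget_chain_zero {U : ℕ} (hU : 64 ≤ U) :
    64 ≤ budget 1 U 1 ∧ U ≤ budget 1 U 1 ∧ 64 * budget 1 U 1 ≤ budget 1 U 2 ∧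
    64 * budget 1 U 2 ≤ budget 1 U 3 ∧ 64 * budget 1 U 3 ≤ budget 1 U 4 ∧
    64 * budget 1 U 4 ≤ budget 1 U 5 ∧ 64 * budget 1 U 5 ≤ budget 1 U 6 ∧
    64 * budget 1 U 6 ≤ budget 1 U 7 ∧ 64 * budget 1 U 7 ≤ budget 1 U 8 ∧
    64 * budget 1 U 8 ≤ budget 1 U 9 :=
  ⟨by simpa [budget] using hU, by simp [budget], budget_step 1 hU 1, budget_step 1 hU 2,
    budget_step 1 hU 3, budget_step 1 hU 4, budget_step 1 hU 5, budget_step 1 hU 6,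
    budget_step 1 hU 7, budget_step 1 hU 8⟩

lemma budget_one_le {X U a : ℕ} (hX : 1 ≤ X) : budget 1 U a ≤ budget X U a :=
  Nat.mul_le_mul_right _ hX

namespace Runs

variable {d : ℕ} {M : Equipment d} {P P₁ P₂ : Prog} {σ : Mem} {c c' c₁ c₂ : ℕ}
  {Post Post' : Mem → Prop}

lemma le (h : Runs M P σ c Post) (hc : c ≤ c') : Runs M P σ c' Post := by
  obtain ⟨T, τ, h1, h2, h3⟩ := h
  exact ⟨T, τ, h1, h2.trans hc, h3⟩

lemma post (h : Runs M P σ c Post) (hp : ∀ τ, Post τ → Post' τ) : Runs M P σ c Post' := by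
  obtain ⟨T, τ, h1, h2, h3⟩ := h
  exact ⟨T, τ, h1, h2, hp τ h3⟩

lemma bind (h : Runs M P₁ σ c₁ Post) (h' : ∀ τ, Post τ → Runs M P₂ τ c₂ Post') :
    Runs M (.seq P₁ P₂) σ (c₁ + c₂) Post' := by
  obtain ⟨T, τ, h1, h2, h3⟩ := h
  obtain ⟨T', τ', h1', h2', h3'⟩ := h' τ h3
  exact ⟨_, τ', .seq _ _ _ _ _ _ _ h1 h1', by omega, h3'⟩

lemma skip (h : Post σ) : Runs M .skip σ 1 Post := ⟨_, _, .skip σ, le_rfl, h⟩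

lemma putN {a : ℕ} {i j e : NExp} (h : Post (σ.setN a (i.val σ) (j.val σ) (e.val σ))) :
    Runs M (.putN a i j e) σ (i.cost + j.cost + e.cost + 1) Post :=
  ⟨_, _, .putN σ a i j e, le_rfl, h⟩

lemma putR {a : ℕ} {i j : NExp} {e : RExp} (h : Post (σ.setQ a (i.val σ) (j.val σ) (e.val σ))) :
    Runs M (.putR a i j e) σ (i.cost + j.cost + e.cost + 1) Post :=
  ⟨_, _, .putR σ a i j e, le_rfl, h⟩

lemma classify {out : ℕ} {i : NExp} {a : ℕ} {r : NExp}
    (h : Post (σ.setN out 0 0 (M.query (i.val σ) fun j : Fin d => σ.Q a (r.val σ) j))) :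
    Runs M (.classify out i a r) σ (i.cost + r.cost + d + 1) Post :=
  ⟨_, _, .classify σ out i a r, le_rfl, h⟩

lemma putN_seq {a : ℕ} {i j e : NExp}
    (h : Runs M P (σ.setN a (i.val σ) (j.val σ) (e.val σ)) c Post) :
    Runs M (.seq (.putN a i j e) P) σ (i.cost + j.cost + e.cost + 1 + c) Post :=
  bind (Post := fun τ => τ = σ.setN a (i.val σ) (j.val σ) (e.val σ)) (putN rfl)
    fun _ hτ => hτ ▸ h

lemma putR_seq {a : ℕ} {i j : NExp} {e : RExp}
    (h : Runs M P (σ.setQ a (i.val σ) (j.val σ) (e.val σ)) c Post) :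
    Runs M (.seq (.putR a i j e) P) σ (i.cost + j.cost + e.cost + 1 + c) Post :=
  bind (Post := fun τ => τ = σ.setQ a (i.val σ) (j.val σ) (e.val σ)) (putR rfl)
    fun _ hτ => hτ ▸ h

lemma putR_of_eq {a : ℕ} {i j : NExp} {e : RExp} (i' j' : ℕ) (v : ℝ) (hi : i.val σ = i')
    (hj : j.val σ = j') (hv : e.val σ = v) (h : Post (σ.setQ a i' j' v)) :
    Runs M (.putR a i j e) σ (i.cost + j.cost + e.cost + 1) Post := by
  subst hi hj hv
  exact putR h

lemma putN_of_eq {a : ℕ} {i j e : NExp} (i' j' v : ℕ) (hi : i.val σ = i')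
    (hj : j.val σ = j') (hv : e.val σ = v) (h : Post (σ.setN a i' j' v)) :
    Runs M (.putN a i j e) σ (i.cost + j.cost + e.cost + 1) Post := by
  subst hi hj hv
  exact putN h

lemma putR_seq_of_eq {a : ℕ} {i j : NExp} {e : RExp} (i' j' : ℕ) (v : ℝ) (hi : i.val σ = i')
    (hj : j.val σ = j') (hv : e.val σ = v) (h : Runs M P (σ.setQ a i' j' v) c Post) :
    Runs M (.seq (.putR a i j e) P) σ (i.cost + j.cost + e.cost + 1 + c) Post := by
  subst hi hj hv
  exact putR_seq h

lemma putN_seq_of_eq {a : ℕ} {i j e : NExp} (i' j' v : ℕ) (hi : i.val σ = i')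
    (hj : j.val σ = j') (hv : e.val σ = v) (h : Runs M P (σ.setN a i' j' v) c Post) :
    Runs M (.seq (.putN a i j e) P) σ (i.cost + j.cost + e.cost + 1 + c) Post := by
  subst hi hj hv
  exact putN_seq h

lemma classify_seq {out : ℕ} {i : NExp} {a : ℕ} {r : NExp}
    (h : Runs M P (σ.setN out 0 0 (M.query (i.val σ) fun j : Fin d => σ.Q a (r.val σ) j)) c Post) :
    Runs M (.seq (.classify out i a r) P) σ (i.cost + r.cost + d + 1 + c) Post :=
  bind (Post := fun τ => τ = σ.setN out 0 0 (M.query (i.val σ) fun j : Fin d =>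
    σ.Q a (r.val σ) j)) (classify rfl) fun _ hτ => hτ ▸ h

lemma classify_seq_of_eq {out : ℕ} {i : NExp} {a : ℕ} {r : NExp} (i' : ℕ) (x : Pt d)
    (hi : i.val σ = i') (hx : (fun j : Fin d => σ.Q a (r.val σ) j) = x)
    (h : Runs M P (σ.setN out 0 0 (M.query i' x)) c Post) :
    Runs M (.seq (.classify out i a r) P) σ (i.cost + r.cost + d + 1 + c) Post := by
  subst hi hx
  exact classify_seq h

lemma ite {t : Test} (h₁ : t.Holds σ → Runs M P₁ σ c₁ Post)
    (h₂ : ¬ t.Holds σ → Runs M P₂ σ c₂ Post) :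
    Runs M (.ite t P₁ P₂) σ (t.cost + (c₁ + c₂)) Post := by
  by_cases ht : t.Holds σ
  · obtain ⟨T, τ, h1, h2, h3⟩ := h₁ ht
    exact ⟨_, τ, .iteTrue _ _ _ _ _ _ ht h1, by omega, h3⟩
  · obtain ⟨T, τ, h1, h2, h3⟩ := h₂ ht
    exact ⟨_, τ, .iteFalse _ _ _ _ _ _ ht h1, by omega, h3⟩

lemma loop_succ {t : Test} (ht : t.Holds σ) (h : Runs M P σ c₁ Post)
    (h' : ∀ τ, Post τ → Runs M (.loop t P) τ c₂ Post') :
    Runs M (.loop t P) σ (t.cost + c₁ + c₂) Post' := by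
  obtain ⟨T, τ, h1, h2, h3⟩ := h
  obtain ⟨T', τ', h1', h2', h3'⟩ := h' τ h3
  exact ⟨_, τ', .loopStep _ _ _ _ _ _ _ ht h1 h1', by omega, h3'⟩

lemma loop_exit {t : Test} (ht : ¬ t.Holds σ) (h : Post σ) : Runs M (.loop t P) σ t.cost Post :=
  ⟨_, σ, .loopStop _ _ _ ht, le_rfl, h⟩

/-- The rule for counting loops, with an exact cost. The invariant `J` may not depend on the counter. -/
lemma forN_exact {v : ℕ} {bd : NExp} {body : Prog} {n : ℕ} {w q : List ℕ} (J : ℕ → Mem → Prop)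
    (hv : v ∈ w) (hJ : ∀ i τ x, J i τ → J i (τ.setN v 0 0 x))
    (hbd : ∀ τ, Same w q σ τ → bd.val τ = n) (h0 : J 0 σ)
    (hbody : ∀ i τ, i < n → Same w q σ τ → τ.N v 0 0 = i → J i τ →
      Runs M body τ c fun τ' => Same w q τ τ' ∧ τ'.N v 0 0 = i ∧ J (i + 1) τ') :
    Runs M (forN v bd body) σ (n * (c + bd.cost + 14) + bd.cost + 10)
      fun τ => Same w q σ τ ∧ J n τ := by
  -- Induction on the number `r` of rounds that remain. The bound `bd` is evaluated anew in every
  -- round, so its value must be stable under the changes listed in `w` and `q`.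
  have key : ∀ r i τ, i + r = n → Same w q σ τ → τ.N v 0 0 = i → J i τ →
      Runs M (.loop (.leN (.add (nv v) (.lit 1)) bd) (.seq body (setn v (.add (nv v) (.lit 1)))))
        τ (r * (c + bd.cost + 14) + bd.cost + 6) fun τ => Same w q σ τ ∧ J n τ := by
    intro r
    induction r with
    | zero =>
      intro i τ hi hs hτ hJi
      refine (loop_exit ?_ ⟨hs, by rw [← hi, add_zero]; exact hJi⟩).le ?_
      · simp only [Test.Holds, NExp.val, hτ, hbd τ hs]
        omega
      · simp only [Test.cost, NExp.cost]
        omega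
    | succ r ih =>
      intro i τ hi hs hτ hJi
      refine (loop_succ (c₂ := r * (c + bd.cost + 14) + bd.cost + 6)
        (Post := fun τ' => Same w q σ τ' ∧ τ'.N v 0 0 = i + 1 ∧ J (i + 1) τ')
        ?_ (bind (hbody i τ (by omega) hs hτ hJi) fun τ' h => putN ?_) ?_).le ?_
      · simp only [Test.Holds, NExp.val, hτ, hbd τ hs]
        omega
      · obtain ⟨h1, h2, h3⟩ := h
        refine ⟨(hs.trans h1).setN hv _ _ _, ?_, hJ _ _ _ h3⟩
        simp [NExp.val, h2]
      · rintro τ' ⟨h1, h2, h3⟩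
        exact ih (i + 1) τ' (by omega) h1 h2 h3
      · simp only [Test.cost, NExp.cost]
        have : (r + 1) * (c + bd.cost + 14) = r * (c + bd.cost + 14) + (c + bd.cost + 14) := by
          ring
        omega
  refine (putN_seq (key n 0 _ (by omega) ?_ ?_ ?_)).le ?_
  · exact (Same.refl _ _ _).setN hv _ _ _
  · simp [NExp.val]
  · exact hJ _ _ _ h0
  · simp only [NExp.cost]
    omega

/-- The rule for counting loops. The invariant `J` may not depend on the counter. -/
lemma forN {v : ℕ} {bd : NExp} {body : Prog} {n U X Y a b : ℕ} {w q : List ℕ}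
    (J : ℕ → Mem → Prop) (hv : v ∈ w) (hab : a + 2 ≤ b) (hU : 64 ≤ U) (hX : 1 ≤ X) (hY : 1 ≤ Y)
    (hn : n * Y ≤ X * U) (hJ : ∀ i τ x, J i τ → J i (τ.setN v 0 0 x))
    (hbd : ∀ τ, Same w q σ τ → bd.val τ = n) (h0 : J 0 σ) (hcost : bd.cost ≤ 16)
    (hbody : ∀ i τ, i < n → Same w q σ τ → τ.N v 0 0 = i → J i τ →
      Runs M body τ (budget Y U a) fun τ' => Same w q τ τ' ∧ τ'.N v 0 0 = i ∧ J (i + 1) τ') :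
    Runs M (ICF.forN v bd body) σ (budget X U b) fun τ => Same w q σ τ ∧ J n τ := by
  -- The exponent rises by two: one for the number of rounds, through `n * Y ≤ X * U`, and one for
  -- the constants. Taking `X = n` and `Y = 1` instead charges the rounds to the prefactor, as is
  -- done for loops over classifiers.
  refine (forN_exact J hv hJ hbd h0 hbody).le ?_
  have h1 : budget Y U a + bd.cost + 14 ≤ 31 * budget Y U a := by
    have := budget_pos hY hU a
    omega
  have h2 : n * budget Y U a ≤ budget X U (a + 1) := by
    unfold budget
    calc n * (Y * U ^ a) = n * Y * U ^ a := by ring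
      _ ≤ X * U * U ^ a := Nat.mul_le_mul_right _ hn
      _ = X * U ^ (a + 1) := by ring
  have h3 : 64 * budget X U (a + 1) ≤ budget X U (a + 2) := budget_step X hU (a + 1)
  have h4 := budget_pos hX hU (a + 1)
  calc _ ≤ n * (31 * budget Y U a) + 26 := by
        have := Nat.mul_le_mul_left n h1
        omega
    _ = 31 * (n * budget Y U a) + 26 := by ring
    _ ≤ budget X U (a + 2) := by omega
    _ ≤ budget X U b := budget_mono hU hab

end Runs

/-- The scalar product of the first `len` entries of two rows goes to the real scalar `14`. -/
def dot (a : ℕ) (i : NExp) (b : ℕ) (j : NExp) (len : NExp) : Prog :=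
  setr 14 (.lit 0) ;;
  forN 11 len (setr 14 (.add (rv 14) (.mul (.get a i (nv 11)) (.get b j (nv 11)))))

lemma runs_dot {d : ℕ} {M : Equipment d} {σ : Mem} {a b : ℕ} {i j len : NExp} {n U : ℕ}
    (hU : 64 ≤ U) (hn : n ≤ U) (ha : a ≠ 14) (hb14 : b ≠ 14)
    (hi : ∀ τ, Same [11] [14] σ τ → i.val τ = i.val σ)
    (hj : ∀ τ, Same [11] [14] σ τ → j.val τ = j.val σ)
    (hlen : ∀ τ, Same [11] [14] σ τ → len.val τ = n) (hc : len.cost ≤ 16)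
    (hc' : i.cost + j.cost ≤ 40) :
    Runs M (dot a i b j len) σ (budget 1 U 4) fun τ => Same [11] [14] σ τ ∧
      τ.Q 14 0 0 = ∑ x ∈ Finset.range n, σ.Q a (i.val σ) x * σ.Q b (j.val σ) x := by
  have hb := budget_chain_zero hU
  apply Runs.le
  · apply Runs.putR_seq
    refine (Runs.forN (w := [11]) (q := [14]) (n := n) (U := U) (X := 1) (Y := 1) (a := 1) (b := 3)
      (fun x τ => τ.Q 14 0 0 = ∑ x ∈ Finset.range x, σ.Q a (i.val σ) x * σ.Q b (j.val σ) x)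
      (by decide) le_rfl hU le_rfl le_rfl (by omega) (fun _ _ _ h => h) ?_ ?_ hc ?_).post ?_
    · intro τ hs
      exact hlen τ (((Same.refl _ _ σ).setQ (by decide) _ _ _).trans hs)
    · simp [RExp.val, NExp.val]
    · intro x τ hx hs hτ hJ
      have hs' : Same [11] [14] σ τ := ((Same.refl _ _ σ).setQ (by decide) _ _ _).trans hs
      apply Runs.le
      · refine Runs.putR ⟨(Same.refl _ _ _).setQ (by decide) _ _ _, hτ, ?_⟩
        simp [RExp.val, NExp.val, hJ, hτ, hi τ hs', hj τ hs', Finset.sum_range_succ,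
          hs'.Q a (by simpa using ha), hs'.Q b (by simpa using hb14)]
      · simp only [RExp.cost, NExp.cost]
        omega
    · rintro τ ⟨h1, h2⟩
      exact ⟨((Same.refl _ _ σ).setQ (by decide) _ _ _).trans h1, h2⟩
  · simp only [RExp.cost, NExp.cost]
    omega

end ICF

namespace ICF

/-! ### Feature table -/

/-- The number of monomials. -/
def Input.dim {d : ℕ} (I : Input d) : ℕ := (d + 1) ^ I.deg

/-- The parameters stand in the scalars `20, …, 24`, and the points `X r`, of which those with
`o ≤ r` form the reference sample, in the array `3` of reals. -/
structure Loaded {d : ℕ} (I : Input d) (o : ℕ) (X : ℕ → Pt d) (σ : Mem) : Prop where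
  d_eq : σ.N 20 0 0 = d
  dim_eq : σ.N 21 0 0 = I.dim
  k_eq : σ.N 22 0 0 = I.k
  m_eq : σ.N 23 0 0 = I.m
  o_eq : σ.N 24 0 0 = o
  R_eq : σ.Q 20 0 0 = I.R
  β_eq : σ.Q 21 0 0 = I.β
  ε_eq : σ.Q 22 0 0 = I.ε
  pts : ∀ r < o + I.m, ∀ j : Fin d, σ.Q 3 r j = X r j

/-- A number that bounds all sizes but the number of classifiers. -/
structure Bounded {d : ℕ} (I : Input d) (o U : ℕ) : Prop where
  one_le_d : 1 ≤ d
  U_le : 64 ≤ U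
  d_le : d + 1 ≤ U
  deg_le : I.deg ≤ U
  dim_le : I.dim + I.m + 1 ≤ U
  m_le : 2 * I.m + 1 ≤ U
  o_le : o + I.m + 1 ≤ U

section

variable {d : ℕ} {I : Input d} {o U : ℕ} {X : ℕ → Pt d} {σ τ : Mem} {M : Equipment d}

lemma Loaded.same (h : Loaded I o X σ) {w q : List ℕ} (hs : Same w q σ τ)
    (hw : ∀ a ∈ ([20, 21, 22, 23, 24] : List ℕ), a ∉ w)
    (hq : ∀ a ∈ ([3, 20, 21, 22] : List ℕ), a ∉ q) : Loaded I o X τ := by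
  obtain ⟨h1, h2, h3, h4, h5, h6, h7, h8, h9⟩ := h
  constructor
  · rw [hs.N _ (hw _ (by decide))]; exact h1
  · rw [hs.N _ (hw _ (by decide))]; exact h2
  · rw [hs.N _ (hw _ (by decide))]; exact h3
  · rw [hs.N _ (hw _ (by decide))]; exact h4
  · rw [hs.N _ (hw _ (by decide))]; exact h5
  · rw [hs.Q _ (hq _ (by decide))]; exact h6
  · rw [hs.Q _ (hq _ (by decide))]; exact h7
  · rw [hs.Q _ (hq _ (by decide))]; exact h8
  · rw [hs.Q _ (hq _ (by decide))]; exact h9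

/-- Fill row `10` of the array `4` with the features of the point in the same row of the array
`3`. -/
def featureRow : Prog :=
  -- Scalars `14` and `15` carry the quotient and the remainder of the column number by `d + 1`;
  -- they are updated by carrying, since the machine does not divide naturals. Column `0` is set to
  -- `1` beforehand because the recursion for word `0` reads its own cell.
  .putR 4 (nv 10) (.lit 0) (.lit 1) ;; setn 14 (.lit 0) ;; setn 15 (.lit 0) ;;
  forN 11 (nv 21)
    (.ite (.leN (nv 15) (.lit 0))
      (.putR 4 (nv 10) (nv 11) (.get 4 (nv 10) (nv 14)))
      (.putR 4 (nv 10) (nv 11)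
        (.mul (.get 4 (nv 10) (nv 14)) (.get 3 (nv 10) (.sub (nv 15) (.lit 1))))) ;;
    .ite (.leN (nv 20) (nv 15))
      (setn 15 (.lit 0) ;; setn 14 (.add (nv 14) (.lit 1)))
      (setn 15 (.add (nv 15) (.lit 1))))

/-- The feature table. -/
def featureTable : Prog := forN 10 (.add (nv 24) (nv 23)) featureRow

lemma div_mod_succ {w e : ℕ} (h : e ≤ w % (e + 1)) :
    (w + 1) % (e + 1) = 0 ∧ (w + 1) / (e + 1) = w / (e + 1) + 1 := by
  have h1 : w % (e + 1) = e := le_antisymm (Nat.lt_succ_iff.1 (Nat.mod_lt _ (by omega))) h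
  have h2 := Nat.div_add_mod w (e + 1)
  have h3 : w + 1 = (e + 1) * (w / (e + 1) + 1) := by rw [mul_add]; omega
  rw [h3]
  exact ⟨Nat.mul_mod_right _ _, Nat.mul_div_cancel_left _ (by omega)⟩

lemma div_mod_succ' {w e : ℕ} (h : ¬ e ≤ w % (e + 1)) :
    (w + 1) % (e + 1) = w % (e + 1) + 1 ∧ (w + 1) / (e + 1) = w / (e + 1) := by
  have h2 := Nat.div_add_mod w (e + 1)
  have h3 : w + 1 = (e + 1) * (w / (e + 1)) + (w % (e + 1) + 1) := by omega
  constructor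
  · rw [h3, Nat.mul_add_mod, Nat.mod_eq_of_lt (by omega)]
  · rw [h3, Nat.mul_add_div (by omega), Nat.div_eq_of_lt (show w % (e + 1) + 1 < e + 1 by omega),
      add_zero]

lemma runs_featureRow (hU : Bounded I o U) (hL : Loaded I o X σ) {r : ℕ} (hr : r < o + I.m)
    (hσ : σ.N 10 0 0 = r) (hprev : ∀ r' < r, ∀ w < I.dim, σ.Q 4 r' w = feature (X r') w) :
    Runs M featureRow σ (budget 1 U 5) fun τ => Same [11, 14, 15] [4] σ τ ∧
      ∀ r' < r + 1, ∀ w < I.dim, τ.Q 4 r' w = feature (X r') w := by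
  have hb := budget_chain_zero hU.U_le
  have hdim := hU.dim_le
  apply Runs.le
  · apply Runs.putR_seq
    apply Runs.putN_seq
    apply Runs.putN_seq
    have hs0 : Same [11, 14, 15] [4] σ (((σ.setQ 4 r 0 1).setN 14 0 0 0).setN 15 0 0 0) :=
      (((Same.refl _ _ σ).setQ (by decide) _ _ _).setN (by decide) _ _ _).setN (by decide) _ _ _
    simp only [NExp.val, RExp.val, hσ, Rat.cast_one]
    refine (Runs.forN (w := [11, 14, 15]) (q := [4]) (n := I.dim) (U := U) (X := 1) (Y := 1)
      (a := 2) (b := 4)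
      (fun w τ => (∀ r' < r, ∀ w < I.dim, τ.Q 4 r' w = feature (X r') w) ∧ τ.Q 4 r 0 = 1 ∧
        (∀ w' < w, τ.Q 4 r w' = feature (X r) w') ∧ τ.N 14 0 0 = w / (d + 1) ∧
        τ.N 15 0 0 = w % (d + 1))
      (by decide) le_rfl hU.U_le le_rfl le_rfl (by omega) ?_ ?_ ?_ (by decide) ?_).post ?_
    · rintro i τ x ⟨h1, h2, h3, h4, h5⟩
      exact ⟨h1, h2, h3, by simpa using h4, by simpa using h5⟩
    · intro τ hs
      simpa [NExp.val] using (hL.same (hs0.trans hs) (by decide) (by decide)).dim_eq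
    · refine ⟨fun r' hr' w hw => ?_, by simp, by simp, by simp, by simp⟩
      have : r' ≠ r := by omega
      simp [this, hprev r' hr' w hw]
    · rintro w τ hw hs hτ ⟨h1, h2, h3, h4, h5⟩
      have hL' := hL.same (hs0.trans hs) (by decide) (by decide)
      have hτ10 : τ.N 10 0 0 = r := by rw [(hs0.trans hs).N 10 (by decide), hσ]
      have hq : τ.Q 4 r (w / (d + 1)) = feature (X r) (w / (d + 1)) := by
        rcases Nat.eq_zero_or_pos w with rfl | hpos
        · rw [Nat.zero_div, h2, feature_zero]
        · exact h3 _ (Nat.div_lt_self hpos (by have := hU.one_le_d; omega))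
      apply Runs.le
      · apply Runs.bind (Post := fun τ' => τ' = τ.setQ 4 r w (feature (X r) w))
        · apply Runs.ite
          · intro ht
            simp only [Test.Holds, NExp.val, h5] at ht
            refine Runs.putR ?_
            simp only [NExp.val, RExp.val, hτ10, hτ, h4, hq]
            rw [feature_rec hU.one_le_d (X r) w, dif_neg (by omega), mul_one]
          · intro ht
            simp only [Test.Holds, NExp.val, h5] at ht
            have hlt := Nat.mod_lt w (show 0 < d + 1 by omega)
            refine Runs.putR ?_
            simp only [NExp.val, RExp.val, hτ10, hτ, h4, h5, hq]
            rw [feature_rec hU.one_le_d (X r) w, dif_pos ⟨by omega, by omega⟩,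
              ← hL'.pts r hr ⟨w % (d + 1) - 1, by omega⟩]
        · rintro τ' rfl
          have hJ1 : ∀ r' < r, ∀ w' < I.dim,
              (τ.setQ 4 r w (feature (X r) w)).Q 4 r' w' = feature (X r') w' := by
            intro r' hr' w' hw'
            have : r' ≠ r := by omega
            simp [this, h1 r' hr' w' hw']
          have hJ2 : (τ.setQ 4 r w (feature (X r) w)).Q 4 r 0 = 1 := by
            by_cases h0 : 0 = w
            · subst h0; simp [feature_zero]
            · simp [h0, h2]
          have hJ3 : ∀ w' < w + 1,
              (τ.setQ 4 r w (feature (X r) w)).Q 4 r w' = feature (X r) w' := by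
            intro w' hw'
            by_cases h0 : w' = w
            · subst h0; simp
            · simp [h0, h3 w' (by omega)]
          have hs1 : Same [11, 14, 15] [4] τ (τ.setQ 4 r w (feature (X r) w)) :=
            (Same.refl _ _ τ).setQ (by decide) _ _ _
          apply Runs.ite
          · intro ht
            simp only [Test.Holds, NExp.val, Mem.setQ_N, h5, hL'.d_eq] at ht
            obtain ⟨e1, e2⟩ := div_mod_succ ht
            apply Runs.putN_seq
            refine Runs.putN ⟨(hs1.setN (by decide) _ _ _).setN (by decide) _ _ _, ?_, hJ1, hJ2,
              hJ3, ?_, ?_⟩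
            · simp [NExp.val, hτ]
            · simp [NExp.val, h4, e2]
            · simp [NExp.val, e1]
          · intro ht
            simp only [Test.Holds, NExp.val, Mem.setQ_N, h5, hL'.d_eq] at ht
            obtain ⟨e1, e2⟩ := div_mod_succ' ht
            refine Runs.putN ⟨hs1.setN (by decide) _ _ _, ?_, hJ1, hJ2, hJ3, ?_, ?_⟩
            · simp [NExp.val, hτ]
            · simp [NExp.val, h4, e2]
            · simp [NExp.val, h5, e1]
      · simp only [Test.cost, RExp.cost, NExp.cost]
        omega
    · rintro τ ⟨hs, h1, h2, h3, -⟩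
      refine ⟨hs0.trans hs, fun r' hr' w hw => ?_⟩
      rcases Nat.lt_succ_iff_lt_or_eq.1 hr' with h | rfl
      · exact h1 r' h w hw
      · exact h3 w hw
  · simp only [RExp.cost, NExp.cost]
    omega

lemma runs_featureTable (hU : Bounded I o U) (hL : Loaded I o X σ) :
    Runs M featureTable σ (budget 1 U 7) fun τ => Same [10, 11, 14, 15] [4] σ τ ∧
      ∀ r < o + I.m, ∀ w < I.dim, τ.Q 4 r w = feature (X r) w := by
  have hb := budget_chain_zero hU.U_le
  have ho := hU.o_le
  refine Runs.forN (w := [10, 11, 14, 15]) (q := [4]) (n := o + I.m) (U := U) (X := 1) (Y := 1)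
    (a := 5) (fun r τ => ∀ r' < r, ∀ w < I.dim, τ.Q 4 r' w = feature (X r') w)
    (by decide) le_rfl hU.U_le le_rfl le_rfl (by omega) (fun _ _ _ h => h) ?_ ?_ (by decide) ?_
  · intro τ hs
    have := hL.same hs (by decide) (by decide)
    simp [NExp.val, this.o_eq, this.m_eq]
  · intro r' hr'
    omega
  · intro r τ hr hs hτ hJ
    refine (runs_featureRow hU (hL.same hs (by decide) (by decide)) hr hτ hJ).post ?_
    rintro τ' ⟨h1, h2⟩
    refine ⟨h1.mono (by decide) (by decide), ?_, h2⟩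
    rw [h1.N 10 (by decide), hτ]

end
end ICF

namespace ICF

/-! ### Setting up the convex program -/

/-- The features of the reference sample. -/
noncomputable def refFeature {d : ℕ} (o : ℕ) (X : ℕ → Pt d) (j w : ℕ) : ℝ := feature (X (o + j)) w

/-- The parameters, the features, and the parts of the convex program that are common to all
classifiers and objectives stand in memory. -/
structure Ready {d : ℕ} (I : Input d) (o : ℕ) (X : ℕ → Pt d) (σ : Mem) : Prop
    extends Loaded I o X σ where
  feat : ∀ r < o + I.m, ∀ w < I.dim, σ.Q 4 r w = feature (X r) w
  -- The last row holds the values of whichever classifier was loaded most recently, hence the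
  -- existential weights.
  rows : ∃ g, ∀ a < 2 * I.m + 1, ∀ b < I.dim + I.m,
    σ.Q 5 a b = chowRow I.dim I.m (refFeature o X) g a b
  rhs : ∀ a < 2 * I.m + 1,
    σ.Q 6 0 a = if a < 2 * I.m then 0 else 2 * I.ε * I.m / (2 * I.R + I.ε)
  quad : ∀ a < I.dim + I.m, ∀ b < I.dim + I.m, σ.Q 7 a b = chowQuad I.dim a b
  γ_eq : σ.Q 8 0 0 = 2 * I.β * I.m
  obj : ∀ b, I.dim ≤ b → b < I.dim + I.m → σ.Q 9 0 b = 0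
  B_eq : σ.Q 23 0 0 = I.B
  Δ_eq : σ.Q 24 0 0 = I.Δ

/-- The constraint matrix while it is being filled. -/
def rowsUpTo (N m : ℕ) (Φ : ℕ → ℕ → ℝ) (j w a b : ℕ) : ℝ :=
  if a < j ∨ (m ≤ a ∧ a < m + j) ∨ ((a = j ∨ a = m + j) ∧ b < w) then chowRow N m Φ 0 a b else 0

lemma rowsUpTo_zero (N m : ℕ) (Φ : ℕ → ℕ → ℝ) (a b : ℕ) : rowsUpTo N m Φ 0 0 a b = 0 := by
  rw [rowsUpTo, if_neg (by omega)]

lemma rowsUpTo_last (N m : ℕ) (Φ : ℕ → ℕ → ℝ) (a b : ℕ) :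
    rowsUpTo N m Φ m 0 a b = chowRow N m Φ 0 a b := by
  unfold rowsUpTo
  split_ifs with h
  · rfl
  · unfold chowRow
    rw [if_neg (by omega), if_neg (by omega)]
    simp

lemma rowsUpTo_succ_right {N m : ℕ} (Φ : ℕ → ℕ → ℝ) {j w : ℕ} (hj : j < m) (hw : w < N) (a b : ℕ) :
    (if a = m + j ∧ b = w then -Φ j w else if a = j ∧ b = w then Φ j w
      else rowsUpTo N m Φ j w a b) = rowsUpTo N m Φ j (w + 1) a b := by
  by_cases h1 : a = m + j ∧ b = w
  · obtain ⟨rfl, rfl⟩ := h1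
    rw [if_pos ⟨rfl, rfl⟩, rowsUpTo, if_pos (by omega), chowRow, if_neg (by omega),
      if_pos (by omega), if_pos hw, Nat.add_sub_cancel_left]
  · rw [if_neg h1]
    by_cases h2 : a = j ∧ b = w
    · obtain ⟨rfl, rfl⟩ := h2
      rw [if_pos ⟨rfl, rfl⟩, rowsUpTo, if_pos (by omega), chowRow, if_pos hj, if_pos hw]
    · rw [if_neg h2]
      unfold rowsUpTo
      refine if_congr ?_ rfl rfl
      omega

/-- From column `N` on, the only nonzero entry in the rows `j` and `m + j` stands in column `N + j`,
so one write per row completes the pair. -/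
lemma rowsUpTo_succ_left {N m : ℕ} (Φ : ℕ → ℕ → ℝ) {j : ℕ} (hj : j < m) (a b : ℕ) :
    (if a = m + j ∧ b = N + j then -1 else if a = j ∧ b = N + j then -1
      else rowsUpTo N m Φ j N a b) = rowsUpTo N m Φ (j + 1) 0 a b := by
  by_cases h1 : a = m + j ∧ b = N + j
  · obtain ⟨rfl, rfl⟩ := h1
    rw [if_pos ⟨rfl, rfl⟩, rowsUpTo, if_pos (by omega), chowRow, if_neg (by omega),
      if_pos (by omega), if_neg (by omega), if_pos (by omega)]
  · rw [if_neg h1]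
    by_cases h2 : a = j ∧ b = N + j
    · obtain ⟨rfl, rfl⟩ := h2
      rw [if_pos ⟨rfl, rfl⟩, rowsUpTo, if_pos (by omega), chowRow, if_pos hj,
        if_neg (by omega), if_pos rfl]
    · rw [if_neg h2]
      unfold rowsUpTo
      by_cases h3 : (a = j ∨ a = m + j) ∧ N ≤ b
      · rw [if_neg (by omega), if_pos (by omega)]
        unfold chowRow
        split_ifs <;> first | rfl | omega
      · refine if_congr ?_ rfl rfl
        omega

/-- Fill the parts of the convex program that do not depend on classifiers or objectives. -/
def setup : Prog :=
  .putR 6 (.lit 0) (.add (nv 23) (nv 23))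
    (.div (.mul (.mul (.lit 2) (rv 22)) (.ofN (nv 23))) (.add (.mul (.lit 2) (rv 20)) (rv 22))) ;;
  setr 8 (.mul (.mul (.lit 2) (rv 21)) (.ofN (nv 23))) ;;
  setr 23 (.mul (.lit 2)
    (.sqrt (.div (.mul (.mul (.mul (.lit 2) (rv 20)) (.ofN (nv 21))) (rv 21)) (rv 22)))) ;;
  setr 24 (.div (.mul (rv 22) (rv 22)) (.mul (rv 23) (.add (.mul (.lit 2) (rv 20)) (rv 22)))) ;;
  forN 12 (nv 23)
    (forN 11 (nv 21)
      (.putR 5 (nv 12) (nv 11) (.get 4 (.add (nv 24) (nv 12)) (nv 11)) ;;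
      .putR 5 (.add (nv 23) (nv 12)) (nv 11)
        (.sub (.lit 0) (.get 4 (.add (nv 24) (nv 12)) (nv 11)))) ;;
    .putR 5 (nv 12) (.add (nv 21) (nv 12)) (.lit (-1)) ;;
    .putR 5 (.add (nv 23) (nv 12)) (.add (nv 21) (nv 12)) (.lit (-1)) ;;
    .putR 7 (.add (nv 21) (nv 12)) (.add (nv 21) (nv 12)) (.lit 1))

section

variable {d : ℕ} {I : Input d} {o U : ℕ} {X : ℕ → Pt d} {σ τ : Mem} {M : Equipment d}

lemma Ready.update (h : Ready I o X σ) {w q : List ℕ} (hs : Same w q σ τ)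
    (hw : ∀ a ∈ ([20, 21, 22, 23, 24] : List ℕ), a ∉ w)
    (hq : ∀ a ∈ ([4, 6, 7, 8, 20, 21, 22, 23, 24] : List ℕ), a ∉ q)
    (pts : ∀ r < o + I.m, ∀ j : Fin d, τ.Q 3 r j = X r j)
    (rows : ∃ g, ∀ a < 2 * I.m + 1, ∀ b < I.dim + I.m,
      τ.Q 5 a b = chowRow I.dim I.m (refFeature o X) g a b)
    (obj : ∀ b, I.dim ≤ b → b < I.dim + I.m → τ.Q 9 0 b = 0) :
    Ready I o X τ := by
  obtain ⟨⟨g1, g2, g3, g4, g5, g6, g7, g8, -⟩, h1, -, h3, h4, h5, -, h7, h8⟩ := h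
  refine ⟨⟨?_, ?_, ?_, ?_, ?_, ?_, ?_, ?_, pts⟩, ?_, rows, ?_, ?_, ?_, obj, ?_, ?_⟩
  · rw [hs.N _ (hw _ (by decide))]; exact g1
  · rw [hs.N _ (hw _ (by decide))]; exact g2
  · rw [hs.N _ (hw _ (by decide))]; exact g3
  · rw [hs.N _ (hw _ (by decide))]; exact g4
  · rw [hs.N _ (hw _ (by decide))]; exact g5
  · rw [hs.Q _ (hq _ (by decide))]; exact g6
  · rw [hs.Q _ (hq _ (by decide))]; exact g7
  · rw [hs.Q _ (hq _ (by decide))]; exact g8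
  · rw [hs.Q _ (hq _ (by decide))]; exact h1
  · rw [hs.Q _ (hq _ (by decide))]; exact h3
  · rw [hs.Q _ (hq _ (by decide))]; exact h4
  · rw [hs.Q _ (hq _ (by decide))]; exact h5
  · rw [hs.Q _ (hq _ (by decide))]; exact h7
  · rw [hs.Q _ (hq _ (by decide))]; exact h8

lemma Ready.same (h : Ready I o X σ) {w q : List ℕ} (hs : Same w q σ τ)
    (hw : ∀ a ∈ ([20, 21, 22, 23, 24] : List ℕ), a ∉ w)
    (hq : ∀ a ∈ ([3, 4, 5, 6, 7, 8, 9, 20, 21, 22, 23, 24] : List ℕ), a ∉ q) :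
    Ready I o X τ := by
  refine h.update hs hw (fun a ha => hq a ?_) ?_ ?_ ?_
  · simp only [List.mem_cons, List.not_mem_nil, or_false] at ha ⊢
    omega
  · rw [hs.Q _ (hq _ (by decide))]; exact h.pts
  · rw [hs.Q _ (hq _ (by decide))]; exact h.rows
  · rw [hs.Q _ (hq _ (by decide))]; exact h.obj

lemma runs_setup_rows (hU : Bounded I o U) (hL : Loaded I o X σ)
    (hfeat : ∀ r < o + I.m, ∀ w < I.dim, σ.Q 4 r w = feature (X r) w) {j : ℕ} (hj : j < I.m)
    (hσ : σ.N 12 0 0 = j)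
    (h5 : ∀ a b, σ.Q 5 a b = rowsUpTo I.dim I.m (refFeature o X) j 0 a b) :
    Runs M (forN 11 (nv 21)
      (.putR 5 (nv 12) (nv 11) (.get 4 (.add (nv 24) (nv 12)) (nv 11)) ;;
      .putR 5 (.add (nv 23) (nv 12)) (nv 11)
        (.sub (.lit 0) (.get 4 (.add (nv 24) (nv 12)) (nv 11))))) σ (budget 1 U 4)
      fun τ => Same [11] [5] σ τ ∧
        ∀ a b, τ.Q 5 a b = rowsUpTo I.dim I.m (refFeature o X) j I.dim a b := by
  have hb := budget_chain_zero hU.U_le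
  have hdim := hU.dim_le
  refine Runs.forN (w := [11]) (q := [5]) (n := I.dim) (U := U) (X := 1) (Y := 1) (a := 2)
    (fun w τ => ∀ a b, τ.Q 5 a b = rowsUpTo I.dim I.m (refFeature o X) j w a b)
    (by decide) le_rfl hU.U_le le_rfl le_rfl (by omega) (fun _ _ _ h => h) ?_ h5 (by decide) ?_
  · intro τ hs
    exact (hL.same hs (by decide) (by decide)).dim_eq
  · intro w τ hw hs hτ hJ
    have hL' := hL.same hs (by decide) (by decide)
    have h12 : τ.N 12 0 0 = j := by rw [hs.N 12 (by decide), hσ]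
    have h4 : τ.Q 4 (o + j) w = refFeature o X j w := by
      rw [hs.Q 4 (by decide), hfeat _ (by omega) _ hw]
      rfl
    apply Runs.le
    · apply Runs.putR_seq
      refine Runs.putR ⟨((Same.refl _ _ τ).setQ (by decide) _ _ _).setQ (by decide) _ _ _, ?_, ?_⟩
      · simp [hτ]
      · intro a b
        rw [← rowsUpTo_succ_right _ hj hw, ← hJ]
        simp [NExp.val, RExp.val, h12, hτ, hL'.m_eq, hL'.o_eq, h4]
    · simp only [RExp.cost, NExp.cost]
      omega

/-- Only nonzero entries are written, which is why the arrays `5`, `6`, `7` and `9` are assumed to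
be blank. -/
lemma runs_setup (hU : Bounded I o U) (hL : Loaded I o X σ)
    (hfeat : ∀ r < o + I.m, ∀ w < I.dim, σ.Q 4 r w = feature (X r) w)
    (h5 : ∀ a b, σ.Q 5 a b = 0) (h6 : ∀ a b, σ.Q 6 a b = 0) (h7 : ∀ a b, σ.Q 7 a b = 0)
    (h9 : ∀ a b, σ.Q 9 a b = 0) :
    Runs M setup σ (budget 1 U 8) fun τ => Same [11, 12] [5, 6, 7, 8, 23, 24] σ τ ∧
      Ready I o X τ := by
  have hb := budget_chain_zero hU.U_le
  have hm := hU.m_le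
  apply Runs.le
  · apply Runs.putR_seq_of_eq 0 (2 * I.m) (2 * I.ε * I.m / (2 * I.R + I.ε)) rfl
      (by simp only [NExp.val, hL.m_eq]; ring)
      (by simp [RExp.val, NExp.val, hL.m_eq, hL.ε_eq, hL.R_eq])
    apply Runs.putR_seq_of_eq 0 0 (2 * I.β * I.m) rfl rfl
      (by simp [RExp.val, NExp.val, hL.m_eq, hL.β_eq])
    apply Runs.putR_seq_of_eq 0 0 I.B rfl rfl
      (by simp [RExp.val, NExp.val, hL.dim_eq, hL.β_eq, hL.R_eq, hL.ε_eq, Input.B, Input.dim])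
    apply Runs.putR_seq_of_eq 0 0 I.Δ rfl rfl
      (by simp [RExp.val, NExp.val, hL.R_eq, hL.ε_eq, Input.Δ, sq])
    obtain ⟨σ₀, hσ₀⟩ : ∃ σ₀, σ₀ = (((σ.setQ 6 0 (2 * I.m)
        (2 * I.ε * I.m / (2 * I.R + I.ε))).setQ 8 0 0 (2 * I.β * I.m)).setQ 23 0 0
        I.B).setQ 24 0 0 I.Δ := ⟨_, rfl⟩
    have hs0 : Same [11, 12] [5, 6, 7, 8, 23, 24] σ σ₀ := by
      rw [hσ₀]
      exact ((((Same.refl _ _ σ).setQ (by decide) _ _ _).setQ (by decide) _ _ _).setQ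
        (by decide) _ _ _).setQ (by decide) _ _ _
    rw [← hσ₀]
    have hL0 := hL.same hs0 (by decide) (by decide)
    refine (Runs.forN (σ := σ₀) (w := [11, 12]) (q := [5, 7]) (n := I.m) (U := U) (X := 1) (Y := 1)
      (a := 5) (b := 7) (fun j τ =>
        (∀ a b, τ.Q 5 a b = rowsUpTo I.dim I.m (refFeature o X) j 0 a b) ∧
        ∀ a b, τ.Q 7 a b = if a = b ∧ I.dim ≤ a ∧ a < I.dim + j then 1 else 0)
      (by decide) le_rfl hU.U_le le_rfl le_rfl (by omega) (fun _ _ _ h => h) ?_ ?_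
      (by decide) ?_).post ?_
    · intro τ hs
      exact (hL0.same hs (by decide) (by decide)).m_eq
    · refine ⟨fun a b => ?_, fun a b => ?_⟩
      · rw [rowsUpTo_zero, hσ₀]
        simp [h5]
      · rw [if_neg (by omega), hσ₀]
        simp [h7]
    · rintro j τ hj hs hτ ⟨hJ5, hJ7⟩
      have hL' := hL0.same hs (by decide) (by decide)
      have hfeat' : ∀ r < o + I.m, ∀ w < I.dim, τ.Q 4 r w = feature (X r) w := by
        rw [hs.Q 4 (by decide), hs0.Q 4 (by decide)]
        exact hfeat
      apply Runs.le
      · apply Runs.bind (runs_setup_rows hU hL' hfeat' hj hτ hJ5)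
        rintro τ₁ ⟨hs1, hτ1⟩
        have hL1 := hL'.same hs1 (by decide) (by decide)
        have h12 : τ₁.N 12 0 0 = j := by rw [hs1.N 12 (by decide), hτ]
        apply Runs.putR_seq
        apply Runs.putR_seq
        refine Runs.putR ⟨(((hs1.mono (by decide) (by decide)).setQ (by decide) _ _ _).setQ
          (by decide) _ _ _).setQ (by decide) _ _ _, ?_, ?_, ?_⟩
        · simp [h12]
        · intro a b
          rw [← rowsUpTo_succ_left _ hj, ← hτ1]
          simp [NExp.val, RExp.val, h12, hL1.m_eq, hL1.dim_eq]
        · intro a b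
          have := hJ7 a b
          rw [← hs1.Q 7 (by decide)] at this
          simp only [Mem.setQ_Q, NExp.val, RExp.val, h12, hL1.dim_eq, Mem.setQ_N, this]
          by_cases hab : a = I.dim + j ∧ b = I.dim + j
          · rw [if_pos ⟨trivial, hab⟩, if_pos (by omega)]; simp
          · rw [if_neg (by tauto), if_neg (by omega), if_neg (by omega)]
            refine if_congr ?_ rfl rfl
            omega
      · simp only [RExp.cost, NExp.cost]
        omega
    · rintro τ ⟨hs, hτ5, hτ7⟩
      have hsτ : Same [11, 12] [5, 6, 7, 8, 23, 24] σ τ :=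
        hs0.trans (hs.mono (by decide) (by decide))
      refine ⟨hsτ, hL.same hsτ (by decide) (by decide), ?_, ⟨0, fun a _ b _ => ?_⟩, ?_, ?_, ?_, ?_,
        ?_, ?_⟩
      · rw [hsτ.Q 4 (by decide)]
        exact hfeat
      · rw [hτ5, rowsUpTo_last]
      · intro a ha
        rw [hs.Q 6 (by decide), hσ₀]
        by_cases h : a < 2 * I.m
        · have : a ≠ 2 * I.m := by omega
          simp [h, this, h6]
        · have : a = 2 * I.m := by omega
          simp [this]
      · intro a ha b hb
        rw [hτ7, chowQuad]
        refine if_congr ?_ rfl rfl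
        omega
      · rw [hs.Q 8 (by decide), hσ₀]; simp
      · intro b _ _
        rw [hsτ.Q 9 (by decide), h9]
      · rw [hs.Q 23 (by decide), hσ₀]; simp
      · rw [hs.Q 24 (by decide), hσ₀]; simp
  · simp only [RExp.cost, NExp.cost]
    omega

end
end ICF

namespace ICF

/-! ### Solving the convex programs, and tameness -/

lemma chowRow_congr {N m : ℕ} (Φ : ℕ → ℕ → ℝ) {g g' : ℕ → ℝ} (h : ∀ j < m, g j = g' j) {a b : ℕ}
    (hb : b < N + m) : chowRow N m Φ g a b = chowRow N m Φ g' a b := by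
  unfold chowRow
  split_ifs
  all_goals first | rfl | exact h _ (by omega)

lemma chowRow_update {N m : ℕ} (Φ : ℕ → ℕ → ℝ) (g G : ℕ → ℝ) {j a b : ℕ} (ha : a < 2 * m + 1)
    (hb : b < N + m) :
    (if a = 2 * m ∧ b = N + j then G j
      else chowRow N m Φ (fun j' => if j' < j then G j' else g j') a b) =
      chowRow N m Φ (fun j' => if j' < j + 1 then G j' else g j') a b := by
  by_cases h : a = 2 * m ∧ b = N + j
  · obtain ⟨rfl, rfl⟩ := h
    rw [if_pos ⟨rfl, rfl⟩, chowRow, if_neg (by omega), if_neg (by omega), if_neg (by omega),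
      Nat.add_sub_cancel_left, if_pos (by omega)]
  · rw [if_neg h]
    unfold chowRow
    by_cases h1 : a < 2 * m ∨ b < N
    · split_ifs <;> first | rfl | omega
    · rw [if_neg (by omega), if_neg (by omega), if_neg (by omega), if_neg (by omega),
        if_neg (by omega), if_neg (by omega)]
      exact if_congr (by omega) rfl rfl

/-- Put the classifier `13` into the last row of the constraint matrix. -/
def loadClassifier : Prog :=
  forN 12 (nv 23)
    (.classify 4 (nv 13) 3 (.add (nv 24) (nv 12)) ;;
    .putR 5 (.add (nv 23) (nv 23)) (.add (nv 21) (nv 12)) (.ofN (nv 4)))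

/-- Solve the convex program in memory. -/
def solveProgram : Prog :=
  .solve (.add (nv 21) (nv 23)) (.add (.add (nv 23) (nv 23)) (.lit 1)) 5 6 7 8 9 10 5

section

variable {d : ℕ} {I : Input d} {o U : ℕ} {X : ℕ → Pt d} {σ τ : Mem} {s : Solver} {e : ℕ}

lemma query_eq (i : Fin I.k) (x : Pt d) :
    (((I.equip s e).query i x : ℕ) : ℝ) = bval (I.f i x) := by
  unfold Equipment.query Input.equip bval
  rw [dif_pos i.2]
  split_ifs <;> simp

lemma runs_loadClassifier (hU : Bounded I o U) (hR : Ready I o X σ) :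
    Runs (I.equip s e) loadClassifier σ (budget 1 U 4) fun τ =>
      Same [4, 12] [5] σ τ ∧ Ready I o X τ ∧
      ∀ a < 2 * I.m + 1, ∀ b < I.dim + I.m, τ.Q 5 a b = chowRow I.dim I.m (refFeature o X)
        (fun j => ((I.equip s e).query (σ.N 13 0 0) (X (o + j)) : ℝ)) a b := by
  have hb := budget_chain_zero hU.U_le
  have hm := hU.m_le
  have hd := hU.d_le
  obtain ⟨g, hg⟩ := hR.rows
  obtain ⟨G, hG⟩ : ∃ G : ℕ → ℝ, G = fun j =>
    ((I.equip s e).query (σ.N 13 0 0) (X (o + j)) : ℝ) := ⟨_, rfl⟩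
  rw [← hG]
  refine (Runs.forN (w := [4, 12]) (q := [5]) (n := I.m) (U := U) (X := 1) (Y := 1) (a := 2)
    (fun j τ => ∀ a < 2 * I.m + 1, ∀ b < I.dim + I.m, τ.Q 5 a b =
      chowRow I.dim I.m (refFeature o X) (fun j' => if j' < j then G j' else g j') a b)
    (by decide) le_rfl hU.U_le le_rfl le_rfl (by omega) (fun _ _ _ h => h) ?_ ?_
    (by decide) ?_).post ?_
  · intro τ hs
    exact (hR.toLoaded.same hs (by decide) (by decide)).m_eq
  · intro a ha b hb
    simpa using hg a ha b hb
  · intro j τ hj hs hτ hJ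
    have hL' := hR.toLoaded.same hs (by decide) (by decide)
    have h13 : τ.N 13 0 0 = σ.N 13 0 0 := by rw [hs.N 13 (by decide)]
    have hpt : (fun t : Fin d => τ.Q 3 (o + j) t) = X (o + j) :=
      funext fun t => hL'.pts _ (by omega) t
    apply Runs.le
    · apply Runs.classify_seq_of_eq (σ.N 13 0 0) (X (o + j)) (by exact h13)
        (by simp only [NExp.val, hL'.o_eq, hτ]; exact hpt)
      refine Runs.putR_of_eq (2 * I.m) (I.dim + j) (G j) ?_ ?_ ?_
        ⟨((Same.refl _ _ τ).setN (by decide) _ _ _).setQ (by decide) _ _ _, ?_, ?_⟩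
      · simp [NExp.val, hL'.m_eq]; ring
      · simp [NExp.val, hL'.dim_eq, hτ]
      · simp [NExp.val, RExp.val, hG]
      · simp [hτ]
      · intro a ha b hb
        rw [← chowRow_update _ _ _ ha hb, ← hJ a ha b hb]
        simp
    · simp only [RExp.cost, NExp.cost]
      omega
  · rintro τ ⟨hs, hJ⟩
    have hJ' : ∀ a < 2 * I.m + 1, ∀ b < I.dim + I.m, τ.Q 5 a b =
        chowRow I.dim I.m (refFeature o X) G a b := by
      intro a ha b hb
      rw [hJ a ha b hb]
      exact chowRow_congr _ (fun j hj => if_pos hj) hb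
    refine ⟨hs, hR.update hs (by decide) (by decide) ?_ ⟨_, hJ'⟩ ?_, hJ'⟩
    · rw [hs.Q 3 (by decide)]; exact hR.pts
    · rw [hs.Q 9 (by decide)]; exact hR.obj

/-- The program works with sums over the reference sample instead of means, so its right sides carry
a factor `|S|`. -/
lemma chowFeasible_iff (hI : I.Admissible) (hX : ∀ j : Fin I.m, X (o + j) = I.S j) (i : Fin I.k)
    (c : Fin I.dim → ℝ) :
    ChowFeasible I.dim I.m (refFeature o X)
      (fun j => ((I.equip s e).query i (X (o + j)) : ℝ))
      (2 * I.ε * I.m / (2 * I.R + I.ε)) (2 * I.β * I.m) c ↔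
      CoefFeasible I.R I.β I.ε (I.f i) I.S c := by
  have hm : (0 : ℝ) < I.m := by exact_mod_cast hI.2.2.2.1
  have hlin : ∀ j : Fin I.m, ∑ w : Fin I.dim, refFeature o X j w * c w = lin c (I.S j) := fun j => by
    rw [lin, ← hX]
    exact Finset.sum_congr rfl fun w _ => mul_comm _ _
  unfold ChowFeasible CoefFeasible
  simp only [hlin, query_eq, hX]
  rw [div_le_iff₀ hm, div_le_iff₀ hm, and_comm, div_mul_eq_mul_div]

lemma programAt_eq (hR : Ready I o X σ) {g : ℕ → ℝ}
    (hg : ∀ a < 2 * I.m + 1, ∀ b < I.dim + I.m,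
      σ.Q 5 a b = chowRow I.dim I.m (refFeature o X) g a b) :
    Equipment.programAt σ (I.dim + I.m) (2 * I.m + 1) 5 6 7 8 9 =
      chowProgram I.dim I.m (refFeature o X) g (2 * I.ε * I.m / (2 * I.R + I.ε))
        (2 * I.β * I.m) (fun w => σ.Q 9 0 w) := by
  unfold Equipment.programAt chowProgram
  congr 1
  · funext a b
    exact hg a a.2 b b.2
  · funext a
    exact hR.rhs a a.2
  · funext a b
    exact hR.quad a a.2 b b.2
  · exact hR.γ_eq
  · funext b
    by_cases h : (b : ℕ) < I.dim
    · simp [h]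
    · simp [h, hR.obj b (by omega) b.2]

/-- With at most `U` variables and at most `U` constraints, the program is described by at most `U ^
3` numbers. The exponent `3 * e` in all later bounds originates here. -/
lemma programAt_size_le (hU : Bounded I o U) (σ : Mem) :
    (Equipment.programAt σ (I.dim + I.m) (2 * I.m + 1) 5 6 7 8 9).size ^ e ≤
      budget 1 U (3 * e) := by
  unfold budget
  rw [one_mul, pow_mul]
  refine Nat.pow_le_pow_left ?_ e
  unfold ConvexProgram.size Equipment.programAt
  have h1 := hU.dim_le
  have h2 := hU.m_le
  have h3 := hU.U_le
  simp only
  calc (2 * I.m + 1) * (I.dim + I.m) + (2 * I.m + 1) + (I.dim + I.m) * (I.dim + I.m) + 1 +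
        (I.dim + I.m) ≤ U * U + U + U * U + 1 + U := by
        have a1 : I.dim + I.m ≤ U := by omega
        gcongr
    _ ≤ 64 * (U * U) := by nlinarith
    _ ≤ U * (U * U) := by gcongr
    _ = U ^ 3 := by ring

lemma runs_solveProgram (hI : I.Admissible) (hU : Bounded I o U) (hR : Ready I o X σ)
    (hX : ∀ j : Fin I.m, X (o + j) = I.S j) (i : Fin I.k)
    (hg : ∀ a < 2 * I.m + 1, ∀ b < I.dim + I.m, σ.Q 5 a b = chowRow I.dim I.m (refFeature o X)
      (fun j => ((I.equip s e).query i (X (o + j)) : ℝ)) a b) :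
    Runs (I.equip s e) solveProgram σ (budget 1 U (3 * e + 1)) fun τ => Same [5] [10] σ τ ∧
      ((τ.N 5 0 0 = 1 ∧
        CoefFeasible I.R I.β I.ε (I.f i) I.S (fun w : Fin I.dim => τ.Q 10 0 w) ∧
        ∀ c : Fin I.dim → ℝ, CoefFeasible I.R I.β I.ε (I.f i) I.S c →
          ∑ w : Fin I.dim, σ.Q 9 0 w * c w ≤ ∑ w : Fin I.dim, σ.Q 9 0 w * τ.Q 10 0 w) ∨
      (τ.N 5 0 0 = 0 ∧ ∀ B : ℝ, ∃ c : Fin I.dim → ℝ,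
        CoefFeasible I.R I.β I.ε (I.f i) I.S c ∧ B < ∑ w : Fin I.dim, σ.Q 9 0 w * c w)) := by
  have hnv : (NExp.add (nv 21) (nv 23)).val σ = I.dim + I.m := by
    simp [NExp.val, hR.dim_eq, hR.m_eq]
  have hnc : (NExp.add (.add (nv 23) (nv 23)) (.lit 1)).val σ = 2 * I.m + 1 := by
    simp [NExp.val, hR.m_eq]; ring
  have hε := hI.2.2.2.2.2.2.2.1
  have hRpos := hI.2.2.2.2.2.1
  have hβ := hI.2.2.2.2.2.2.1
  have hex := Equipment.Exec.solve (M := I.equip s e) σ (.add (nv 21) (nv 23))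
    (.add (.add (nv 23) (nv 23)) (.lit 1)) 5 6 7 8 9 10 5
  rw [hnv, hnc] at hex
  refine ⟨_, _, hex, ?_, ?_⟩
  · have h1 := programAt_size_le (e := e) hU σ
    have h2 : (I.equip s e).e = e := rfl
    have h3 := (budget_chain le_rfl hU.U_le (3 * e) (X := 1)).1
    have h4 := (budget_chain le_rfl hU.U_le (3 * e) (X := 1)).2.1
    rw [h2]
    simp only [NExp.cost]
    omega
  · rw [programAt_eq hR hg]
    have hg0 : ∀ j, (0 : ℝ) ≤ ((I.equip s e).query i (X (o + j)) : ℝ) := fun j => Nat.cast_nonneg _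
    have hsol : (I.equip s e).solver = s := rfl
    unfold Equipment.afterSolve
    rw [hsol]
    split
    · rename_i y hy
      refine ⟨((Same.refl _ _ σ).setRow (by decide) _).setN (by decide) _ _ _, Or.inl ?_⟩
      obtain ⟨h1, h2⟩ := Solver.answer_some s hg0 (y := y) hy
      have hval : ∀ w : Fin I.dim,
          ((σ.setRow 10 y).setN 5 0 0 1).Q 10 0 w = y (Fin.castAdd I.m w) := fun w => by
        have : (w : ℕ) < I.dim + I.m := by omega
        simp only [Mem.setN_Q, Mem.setRow]
        rw [dif_pos ⟨trivial, trivial, this⟩]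
        rfl
      refine ⟨by simp, ?_, fun c hc => ?_⟩
      · simp only [hval]
        exact (chowFeasible_iff hI hX i _).1 h1
      · simp only [hval]
        exact h2 c ((chowFeasible_iff hI hX i _).2 hc)
    · rename_i hy
      refine ⟨(Same.refl _ _ σ).setN (by decide) _ _ _, Or.inr ⟨by simp, fun B => ?_⟩⟩
      have hRε : 0 < 2 * I.R + I.ε := by linarith
      obtain ⟨c, hc1, hc2⟩ := Solver.answer_none s hg0 (by positivity) (by positivity) hy B
      exact ⟨c, (chowFeasible_iff hI hX i _).1 hc1, hc2⟩

/-! ### Tameness -/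

/-- Clear the scalar `6` if the classifier `13` shows that the point in row `10`, where its value is
`1`, is not tame. -/
def tameCheck : Prog :=
  loadClassifier ;;
  forN 11 (nv 21) (.putR 9 (.lit 0) (nv 11) (.get 4 (nv 10) (nv 11))) ;;
  solveProgram ;;
  dot 9 (.lit 0) 10 (.lit 0) (nv 21) ;;
  -- A missing optimum means that the values at the point are unbounded over the feasible set, so
  -- the point is not tame. Otherwise the optimal value is compared with `B`.
  .ite (.leN (.lit 1) (nv 5)) (.ite (.leR (rv 14) (rv 23)) .skip (setn 6 (.lit 0)))
    (setn 6 (.lit 0))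

/-- The scalar `6` tells whether the point in row `10` is tame. -/
def tameTest : Prog :=
  setn 6 (.lit 1) ;;
  forN 13 (nv 22)
    -- A classifier that vanishes at the point cannot witness a failure of tameness, because `B ≥
    -- 0`.
    (.classify 4 (nv 13) 3 (nv 10) ;; .ite (.leN (.lit 1) (nv 4)) tameCheck .skip)

/-- One classifier does not witness that `x` fails to be tame. -/
def TameFor (I : Input d) (i : Fin I.k) (x : Pt d) : Prop :=
  ∀ c : Fin I.dim → ℝ, CoefFeasible I.R I.β I.ε (I.f i) I.S c → bval (I.f i x) * |lin c x| ≤ I.B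

lemma CoefFeasible.neg {N m : ℕ} {R β ε : ℝ} {g : Pt d → Bool} {S : Fin m → Pt d} {c : Fin N → ℝ}
    (hc : CoefFeasible R β ε g S c) : CoefFeasible R β ε g S (-c) := by
  have : ∀ x : Pt d, lin (-c) x = -lin c x := fun x => by simp [lin]
  simpa [CoefFeasible, this] using hc

/-- The feasible set is symmetric under `c ↦ -c`, so maximizing the linear value also maximizes its
absolute value, and one program per classifier is enough. -/
lemma tameFor_iff {i : Fin I.k} {x : Pt d} (hx : I.f i x = true) {c : Fin I.dim → ℝ}
    (hc : CoefFeasible I.R I.β I.ε (I.f i) I.S c)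
    (hmax : ∀ c' : Fin I.dim → ℝ, CoefFeasible I.R I.β I.ε (I.f i) I.S c' → lin c' x ≤ lin c x) :
    TameFor I i x ↔ lin c x ≤ I.B := by
  unfold TameFor
  simp only [hx, bval, if_true, one_mul]
  refine ⟨fun h => (le_abs_self _).trans (h c hc), fun h c' hc' => ?_⟩
  refine abs_le'.2 ⟨(hmax c' hc').trans h, ?_⟩
  have h1 := hmax _ hc'.neg
  have h2 : lin (-c') x = -lin c' x := by simp [lin]
  linarith

lemma runs_objective_row (hU : Bounded I o U) (hR : Ready I o X σ) {r : ℕ} (hr : r < o + I.m)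
    (hσ : σ.N 10 0 0 = r) {M : Equipment d} :
    Runs M (forN 11 (nv 21) (.putR 9 (.lit 0) (nv 11) (.get 4 (nv 10) (nv 11)))) σ (budget 1 U 3)
      fun τ => Same [11] [9] σ τ ∧ Ready I o X τ ∧
        ∀ w < I.dim, τ.Q 9 0 w = feature (X r) w := by
  have hb := budget_chain_zero hU.U_le
  have hdim := hU.dim_le
  refine (Runs.forN (w := [11]) (q := [9]) (n := I.dim) (U := U) (X := 1) (Y := 1) (a := 1)
    (fun w τ => (∀ w' < w, τ.Q 9 0 w' = feature (X r) w') ∧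
      ∀ b, I.dim ≤ b → b < I.dim + I.m → τ.Q 9 0 b = 0)
    (by decide) le_rfl hU.U_le le_rfl le_rfl (by omega) (fun _ _ _ h => h) ?_
    ⟨by simp, hR.obj⟩ (by decide) ?_).post ?_
  · intro τ hs
    exact (hR.toLoaded.same hs (by decide) (by decide)).dim_eq
  · rintro w τ hw hs hτ ⟨h1, h2⟩
    have h10 : τ.N 10 0 0 = r := by rw [hs.N 10 (by decide), hσ]
    have h4 : τ.Q 4 r w = feature (X r) w := by rw [hs.Q 4 (by decide), hR.feat r hr w hw]
    apply Runs.le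
    · refine Runs.putR ⟨(Same.refl _ _ τ).setQ (by decide) _ _ _, hτ, ?_, ?_⟩
      · intro w' hw'
        by_cases h : w' = w
        · subst h; simp [NExp.val, RExp.val, hτ, h10, h4]
        · simp [NExp.val, hτ, h, h1 w' (by omega)]
      · intro b hb1 hb2
        have : b ≠ w := by omega
        simp [NExp.val, hτ, this, h2 b hb1 hb2]
    · simp only [RExp.cost, NExp.cost]
      omega
  · rintro τ ⟨hs, h1, h2⟩
    refine ⟨hs, hR.update hs (by decide) (by decide) ?_ ?_ h2, h1⟩
    · rw [hs.Q 3 (by decide)]; exact hR.pts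
    · rw [hs.Q 5 (by decide)]; exact hR.rows

open Classical in
lemma runs_tameCheck (hI : I.Admissible) (hU : Bounded I o U) (hR : Ready I o X σ)
    (hX : ∀ j : Fin I.m, X (o + j) = I.S j) {r : ℕ} (hr : r < o + I.m) (hσ : σ.N 10 0 0 = r)
    (i : Fin I.k) (hi : σ.N 13 0 0 = i) (hf : I.f i (X r) = true) :
    Runs (I.equip s e) tameCheck σ (budget 1 U (3 * e + 5)) fun τ =>
      Same [4, 5, 6, 11, 12] [5, 9, 10, 14] σ τ ∧ Ready I o X τ ∧
      τ.N 6 0 0 = if TameFor I i (X r) then σ.N 6 0 0 else 0 := by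
  have hb := budget_chain_zero hU.U_le
  have hbe := budget_chain (X := 1) le_rfl hU.U_le (3 * e)
  have hb4 : budget 1 U 4 ≤ budget 1 U (3 * e + 4) := budget_mono hU.U_le (by omega)
  have hdim := hU.dim_le
  apply Runs.le
  · apply Runs.bind (runs_loadClassifier hU hR)
    rintro τ₂ ⟨hs2, hR2, hrow2⟩
    rw [hi] at hrow2
    apply Runs.bind (runs_objective_row hU hR2 hr (by rw [hs2.N 10 (by decide), hσ]))
    rintro τ₃ ⟨hs3, hR3, hobj3⟩
    rw [← hs3.Q 5 (by decide)] at hrow2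
    apply Runs.bind (runs_solveProgram hI hU hR3 hX i hrow2)
    rintro τ₄ ⟨hs4, hsol⟩
    have hR4 := hR3.same hs4 (by decide) (by decide)
    apply Runs.bind (runs_dot (n := I.dim) (U := U) (len := nv 21) hU.U_le (by omega) (by decide)
      (by decide) (fun _ _ => rfl) (fun _ _ => rfl)
      (fun τ h => (hR4.toLoaded.same h (by decide) (by decide)).dim_eq) (by decide) (by decide))
    rintro τ₅ ⟨hs5, hdot⟩
    have hR5 := hR4.same hs5 (by decide) (by decide)
    have hall : Same [4, 5, 6, 11, 12] [5, 9, 10, 14] σ τ₅ :=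
      (((hs2.mono (by decide) (by decide)).trans (hs3.mono (by decide) (by decide))).trans
        (hs4.mono (by decide) (by decide))).trans (hs5.mono (by decide) (by decide))
    have hτ6 : τ₅.N 6 0 0 = σ.N 6 0 0 := by
      rw [hs5.N 6 (by decide), hs4.N 6 (by decide), hs3.N 6 (by decide), hs2.N 6 (by decide)]
    have hlin : ∀ c : Fin I.dim → ℝ, ∑ w : Fin I.dim, τ₃.Q 9 0 w * c w = lin c (X r) := fun c => by
      rw [lin]
      exact Finset.sum_congr rfl fun w _ => by rw [hobj3 w w.2, mul_comm]
    have hset0 : ¬ TameFor I i (X r) → Runs (I.equip s e) (setn 6 (.lit 0)) τ₅ 4 fun τ =>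
        Same [4, 5, 6, 11, 12] [5, 9, 10, 14] σ τ ∧ Ready I o X τ ∧
        τ.N 6 0 0 = if TameFor I i (X r) then σ.N 6 0 0 else 0 := fun hnot => by
      refine Runs.putN_of_eq 0 0 0 rfl rfl rfl ⟨hall.setN (by decide) _ _ _,
        hR5.same ((Same.refl [6] [] τ₅).setN (by decide) _ _ _) (by decide) (by decide), ?_⟩
      rw [if_neg hnot]
      simp
    apply Runs.ite (c₁ := 12) (c₂ := 4)
    · intro ht
      simp only [Test.Holds, NExp.val] at ht
      rw [hs5.N 5 (by decide)] at ht
      rcases hsol with ⟨-, hfeas, hmax⟩ | ⟨hflag, -⟩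
      · simp only [hlin] at hmax
        have hval : τ₅.Q 14 0 0 = lin (fun w : Fin I.dim => τ₄.Q 10 0 w) (X r) := by
          rw [hdot, Finset.sum_range, ← hlin]
          simp only [NExp.val]
          rw [hs4.Q 9 (by decide)]
        have hiff := tameFor_iff hf hfeas hmax
        rw [← hval] at hiff
        apply Runs.ite (c₁ := 1) (c₂ := 4)
        · intro ht2
          simp only [Test.Holds, RExp.val, NExp.val, hR5.B_eq] at ht2
          refine Runs.skip ⟨hall, hR5, ?_⟩
          rw [hτ6, if_pos (hiff.2 ht2)]
        · intro ht2
          simp only [Test.Holds, RExp.val, NExp.val, hR5.B_eq] at ht2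
          exact hset0 fun h => ht2 (hiff.1 h)
      · omega
    · intro ht
      simp only [Test.Holds, NExp.val] at ht
      rw [hs5.N 5 (by decide)] at ht
      rcases hsol with ⟨hflag, -⟩ | ⟨-, hunb⟩
      · omega
      · refine hset0 fun h => ?_
        obtain ⟨c, hc1, hc2⟩ := hunb I.B
        rw [hlin] at hc2
        have := h c hc1
        simp only [hf, bval, if_true, one_mul] at this
        linarith [le_abs_self (lin c (X r))]
  · simp only [Test.cost, NExp.cost]
    omega

open Classical in
lemma runs_tameTest (hI : I.Admissible) (hU : Bounded I o U) (hR : Ready I o X σ)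
    (hX : ∀ j : Fin I.m, X (o + j) = I.S j) {r : ℕ} (hr : r < o + I.m) (hσ : σ.N 10 0 0 = r) :
    Runs (I.equip s e) tameTest σ (budget I.k U (3 * e + 9)) fun τ =>
      Same [4, 5, 6, 11, 12, 13] [5, 9, 10, 14] σ τ ∧ Ready I o X τ ∧
      τ.N 6 0 0 = if I.Tame (X r) then 1 else 0 := by
  have hk : 1 ≤ I.k := hI.2.2.1
  have hb := budget_chain_zero hU.U_le
  have hbe := budget_chain (X := 1) le_rfl hU.U_le (3 * e)
  have hbk := budget_chain hk hU.U_le (3 * e)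
  have hb1 : budget 1 U 1 ≤ budget 1 U (3 * e + 1) := budget_mono hU.U_le (by omega)
  have hd := hU.d_le
  have hB : 0 ≤ I.B := (Input.B_pos hI).le
  apply Runs.le
  · apply Runs.putN_seq_of_eq 0 0 1 rfl rfl rfl
    have hs0 : Same [4, 5, 6, 11, 12, 13] [5, 9, 10, 14] σ (σ.setN 6 0 0 1) :=
      (Same.refl _ _ σ).setN (by decide) _ _ _
    have hR0 : Ready I o X (σ.setN 6 0 0 1) :=
      hR.same ((Same.refl [6] [] σ).setN (by decide) 0 0 1) (by decide) (by decide)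
    refine (Runs.forN (w := [4, 5, 6, 11, 12, 13]) (q := [5, 9, 10, 14]) (n := I.k) (U := U)
      (X := I.k) (Y := 1) (a := 3 * e + 6) (b := 3 * e + 8)
      (fun i τ => Ready I o X τ ∧ τ.N 6 0 0 =
        if ∀ i' : Fin I.k, (i' : ℕ) < i → TameFor I i' (X r) then 1 else 0)
      (by decide) (by omega) hU.U_le hk le_rfl ?_ ?_ ?_ ⟨hR0, by simp⟩ (by decide) ?_).post ?_
    · have := hU.U_le
      nlinarith
    · rintro i τ x ⟨h1, h2⟩
      exact ⟨h1.same ((Same.refl [13] [] τ).setN (by decide) 0 0 x) (by decide) (by decide),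
        by simpa using h2⟩
    · intro τ hs
      rw [← hR0.k_eq]
      simp only [NExp.val]
      rw [hs.N 22 (by decide)]
    · rintro i τ hi hs hτ ⟨hRτ, hJ⟩
      have h10 : τ.N 10 0 0 = r := by rw [hs.N 10 (by decide)]; simpa using hσ
      have hpt : (fun t : Fin d => τ.Q 3 r t) = X r := funext fun t => hRτ.pts r hr t
      have hstep : (∀ i' : Fin I.k, (i' : ℕ) < i + 1 → TameFor I i' (X r)) ↔
          (∀ i' : Fin I.k, (i' : ℕ) < i → TameFor I i' (X r)) ∧ TameFor I ⟨i, hi⟩ (X r) := by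
        refine ⟨fun h => ⟨fun i' hi' => h i' (by omega), h ⟨i, hi⟩ (by simp)⟩, fun h i' hi' => ?_⟩
        rcases Nat.lt_succ_iff_lt_or_eq.1 hi' with h' | h'
        · exact h.1 i' h'
        · have : i' = ⟨i, hi⟩ := Fin.ext h'
          rw [this]
          exact h.2
      have hquery : (((I.equip s e).query i (X r) : ℕ) : ℝ) = bval (I.f ⟨i, hi⟩ (X r)) :=
        query_eq (s := s) (e := e) (⟨i, hi⟩ : Fin I.k) (X r)
      obtain ⟨τ₁, hτ₁⟩ : ∃ τ₁, τ₁ = τ.setN 4 0 0 ((I.equip s e).query i (X r)) := ⟨_, rfl⟩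
      have hs1 : Same [4] [] τ τ₁ := by
        rw [hτ₁]
        exact (Same.refl _ _ τ).setN (by decide) _ _ _
      have hR1 := hRτ.same hs1 (by decide) (by decide)
      have h4 : τ₁.N 4 0 0 = (I.equip s e).query i (X r) := by rw [hτ₁]; simp
      have h13 : τ₁.N 13 0 0 = i := by rw [hs1.N 13 (by decide), hτ]
      apply Runs.le
      · apply Runs.classify_seq_of_eq i (X r) (by exact hτ)
          (by simp only [NExp.val, h10]; exact hpt)
        rw [← hτ₁]
        apply Runs.ite (c₂ := 1)
        · intro ht
          simp only [Test.Holds, NExp.val, h4] at ht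
          have hft : I.f ⟨i, hi⟩ (X r) = true := by
            by_contra hf
            rw [bval, if_neg hf] at hquery
            have : (I.equip s e).query i (X r) = 0 := by exact_mod_cast hquery
            omega
          refine (runs_tameCheck hI hU hR1 hX hr (by rw [hs1.N 10 (by decide), h10]) ⟨i, hi⟩ h13
            hft).post ?_
          rintro τ₂ ⟨hs2, hR2, h6⟩
          refine ⟨(hs1.mono (by decide) (by decide)).trans (hs2.mono (by decide) (by decide)), ?_,
            hR2, ?_⟩
          · rw [hs2.N 13 (by decide), h13]
          · rw [h6, hs1.N 6 (by decide), hJ]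
            by_cases h : TameFor I ⟨i, hi⟩ (X r)
            · rw [if_pos h]
              exact if_congr (by rw [hstep]; exact (and_iff_left h).symm) rfl rfl
            · rw [if_neg h, if_neg fun h' => h (hstep.1 h').2]
        · intro ht
          simp only [Test.Holds, NExp.val, h4] at ht
          have hft : bval (I.f ⟨i, hi⟩ (X r)) = 0 := by
            rw [← hquery]
            have : (I.equip s e).query i (X r) = 0 := by omega
            exact_mod_cast this
          have htame : TameFor I ⟨i, hi⟩ (X r) := fun c _ => by
            rw [hft, zero_mul]
            exact hB
          refine Runs.skip ⟨hs1.mono (by decide) (by decide), h13, hR1, ?_⟩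
          rw [hs1.N 6 (by decide), hJ]
          exact if_congr (by rw [hstep]; exact (and_iff_left htame).symm) rfl rfl
      · simp only [Test.cost, NExp.cost]
        omega
    · rintro τ ⟨hs, hRτ, hJ⟩
      refine ⟨hs0.trans hs, hRτ, ?_⟩
      rw [hJ]
      refine if_congr ?_ rfl rfl
      rw [Input.tame_iff_coef hI.1 (N := I.dim) rfl]
      exact ⟨fun h i c hc => h i i.2 c hc, fun h i _ c hc => h i c hc⟩
  · simp only [NExp.cost]
    omega

end
end ICF

namespace ICF

/-! ### Maximizing the Chow objective -/

/-- The objective for the polynomial with coefficients `c`. -/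
noncomputable def coefObjective {d : ℕ} (I : Input d) (T : Finset (Fin I.n)) (i : Fin I.k)
    (c : Fin I.dim → ℝ) : ℝ :=
  (∑ j ∈ T, bval (I.f i (I.S' j)) * lin c (I.S' j)) / I.n

/-- The weights `1/|S'|` of the points of `T`, and `-R/|S|` of the points of `S`. -/
noncomputable def weight {d : ℕ} (I : Input d) (T : Finset (Fin I.n)) (r : ℕ) : ℝ :=
  -- One array serves both uses: restricted to the test rows it weights the objective, and summed
  -- over all rows it turns the threshold condition into a comparison of one tail sum with `Δ`.
  if h : r < I.n then (if (⟨r, h⟩ : Fin I.n) ∈ T then 1 / I.n else 0) else -(I.R / I.m)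

/-- The test sample and the reference sample are stored, and the current set `T` is given by
weights in the array `11`. -/
structure Alive {d : ℕ} (I : Input d) (X : ℕ → Pt d) (T : Finset (Fin I.n)) (σ : Mem) : Prop
    extends Ready I I.n X σ where
  weights : ∀ r < I.n + I.m, σ.Q 11 0 r = weight I T r

/-- Objective vector for the classifier `13`. -/
def objectiveRow : Prog :=
  forN 11 (nv 21) (.putR 9 (.lit 0) (nv 11) (.lit 0)) ;;
  forN 10 (nv 24)
    (.classify 4 (nv 13) 3 (nv 10) ;;
    forN 11 (nv 21) (.putR 9 (.lit 0) (nv 11) (.add (.get 9 (.lit 0) (nv 11))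
      (.mul (.mul (.get 11 (.lit 0) (nv 10)) (.ofN (nv 4))) (.get 4 (nv 10) (nv 11))))))

/-- Maximize the objective for the classifier `13`, and update the best value `15`, the
coefficients in the array `17` and the classifier `7`. -/
def improve : Prog :=
  loadClassifier ;; objectiveRow ;; solveProgram ;; dot 9 (.lit 0) 10 (.lit 0) (nv 21) ;;
  .ite (.leR (rv 14) (rv 15)) .skip
    (setr 15 (rv 14) ;; setn 7 (nv 13) ;;
    forN 11 (nv 21) (.putR 17 (.lit 0) (nv 11) (.get 10 (.lit 0) (nv 11))))

/-- Maximize the objective over all classifiers. -/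
def maximize : Prog := setr 15 (.lit (-1)) ;; forN 13 (nv 22) improve

section

variable {d : ℕ} {I : Input d} {U : ℕ} {X : ℕ → Pt d} {σ τ : Mem} {s : Solver} {e : ℕ}
  {T : Finset (Fin I.n)}

lemma Alive.same (h : Alive I X T σ) {w q : List ℕ} (hs : Same w q σ τ)
    (hw : ∀ a ∈ ([20, 21, 22, 23, 24] : List ℕ), a ∉ w)
    (hq : ∀ a ∈ ([3, 4, 5, 6, 7, 8, 9, 11, 20, 21, 22, 23, 24] : List ℕ), a ∉ q) :
    Alive I X T τ := by
  refine ⟨h.toReady.same hs hw fun a ha => hq a ?_, ?_⟩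
  · simp only [List.mem_cons, List.not_mem_nil, or_false] at ha ⊢
    omega
  · rw [hs.Q _ (hq _ (by decide))]
    exact h.weights

lemma sum_weight (I : Input d) (T : Finset (Fin I.n)) (F : ℕ → ℝ) :
    ∑ r ∈ Finset.range I.n, weight I T r * F r = (∑ j ∈ T, F j) / I.n := by
  rw [Finset.sum_range, Finset.sum_div]
  have : ∀ r : Fin I.n, weight I T r * F r = if r ∈ T then F r / I.n else 0 := fun r => by
    rw [weight, dif_pos r.2]
    split_ifs <;> ring
  simp only [this]
  simp

lemma runs_clear_objective {M : Equipment d} {o : ℕ} (hU : Bounded I o U) (hR : Ready I o X σ) :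
    Runs M (forN 11 (nv 21) (.putR 9 (.lit 0) (nv 11) (.lit 0))) σ (budget 1 U 3) fun τ =>
      Same [11] [9] σ τ ∧ ∀ w < I.dim + I.m, τ.Q 9 0 w = 0 := by
  have hb := budget_chain_zero hU.U_le
  have hdim := hU.dim_le
  refine (Runs.forN (w := [11]) (q := [9]) (n := I.dim) (U := U) (X := 1) (Y := 1) (a := 1)
    (fun w τ => (∀ w' < w, τ.Q 9 0 w' = 0) ∧
      ∀ b, I.dim ≤ b → b < I.dim + I.m → τ.Q 9 0 b = 0)
    (by decide) le_rfl hU.U_le le_rfl le_rfl (by omega) (fun _ _ _ h => h) ?_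
    ⟨by simp, hR.obj⟩ (by decide) ?_).post ?_
  · intro τ hs
    exact (hR.toLoaded.same hs (by decide) (by decide)).dim_eq
  · rintro w τ hw hs hτ ⟨h1, h2⟩
    apply Runs.le
    · refine Runs.putR_of_eq 0 w 0 rfl hτ (by simp [RExp.val])
        ⟨(Same.refl _ _ τ).setQ (by decide) _ _ _, hτ, ?_, ?_⟩
      · intro w' hw'
        by_cases h : w' = w
        · simp [h]
        · simp [h, h1 w' (by omega)]
      · intro b hb1 hb2
        simp [h2 b hb1 hb2]
    · simp only [RExp.cost, NExp.cost]
      omega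
  · rintro τ ⟨hs, h1, h2⟩
    refine ⟨hs, fun w hw => ?_⟩
    by_cases h : w < I.dim
    · exact h1 w h
    · exact h2 w (by omega) hw

lemma runs_objectiveRow {M : Equipment d} (hU : Bounded I I.n U) (hR : Alive I X T σ) :
    Runs M objectiveRow σ (budget 1 U 7) fun τ => Same [4, 10, 11] [9] σ τ ∧ Alive I X T τ ∧
      ∀ w < I.dim, τ.Q 9 0 w = ∑ r ∈ Finset.range I.n,
        weight I T r * ((M.query (σ.N 13 0 0) (X r) : ℝ) * feature (X r) w) := by
  have hb := budget_chain_zero hU.U_le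
  have hdim := hU.dim_le
  have ho := hU.o_le
  have hd := hU.d_le
  obtain ⟨F, hF⟩ : ∃ F : ℕ → ℕ → ℝ, F = fun r w =>
    weight I T r * ((M.query (σ.N 13 0 0) (X r) : ℝ) * feature (X r) w) := ⟨_, rfl⟩
  have hF' : ∀ r w, weight I T r * ((M.query (σ.N 13 0 0) (X r) : ℝ) * feature (X r) w) = F r w :=
    fun r w => by rw [hF]
  simp only [hF']
  apply Runs.le
  · apply Runs.bind (runs_clear_objective hU hR.toReady)
    rintro σ₁ ⟨hs1, hz⟩
    refine (Runs.forN (w := [4, 10, 11]) (q := [9]) (n := I.n) (U := U) (X := 1) (Y := 1) (a := 4)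
      (b := 6) (fun r τ => (∀ w < I.dim, τ.Q 9 0 w = ∑ r' ∈ Finset.range r, F r' w) ∧
        ∀ b, I.dim ≤ b → b < I.dim + I.m → τ.Q 9 0 b = 0)
      (by decide) le_rfl hU.U_le le_rfl le_rfl (by omega) (fun _ _ _ h => h) ?_
      ⟨fun w hw => by simp [hz w (by omega)], fun b _ hb => hz b hb⟩ (by decide) ?_).post ?_
    · intro τ hs
      simp only [NExp.val]
      rw [hs.N 24 (by decide), hs1.N 24 (by decide), hR.o_eq]
    · rintro r τ hr hs hτ ⟨h1, h2⟩
      have hall : Same [4, 10, 11] [9] σ τ := (hs1.mono (by decide) (by decide)).trans hs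
      have hL' := hR.toLoaded.same hall (by decide) (by decide)
      have hpt : (fun t : Fin d => τ.Q 3 r t) = X r := funext fun t => hL'.pts r (by omega) t
      have h13 : τ.N 13 0 0 = σ.N 13 0 0 := by rw [hall.N 13 (by decide)]
      obtain ⟨τ₁, hτ₁⟩ : ∃ τ₁, τ₁ = τ.setN 4 0 0 (M.query (σ.N 13 0 0) (X r)) := ⟨_, rfl⟩
      have ht1 : Same [4] [] τ τ₁ := by
        rw [hτ₁]
        exact (Same.refl _ _ τ).setN (by decide) _ _ _
      have h4 : τ₁.N 4 0 0 = M.query (σ.N 13 0 0) (X r) := by rw [hτ₁]; simp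
      apply Runs.le
      · apply Runs.classify_seq_of_eq (σ.N 13 0 0) (X r) (by exact h13)
          (by simp only [NExp.val, hτ]; exact hpt)
        rw [← hτ₁]
        refine (Runs.forN (w := [11]) (q := [9]) (n := I.dim) (U := U) (X := 1) (Y := 1) (a := 1)
          (b := 3) (fun v τ =>
            (∀ w < I.dim, τ.Q 9 0 w = ∑ r' ∈ Finset.range (if w < v then r + 1 else r), F r' w) ∧
            ∀ b, I.dim ≤ b → b < I.dim + I.m → τ.Q 9 0 b = 0)
          (by decide) le_rfl hU.U_le le_rfl le_rfl (by omega) (fun _ _ _ h => h) ?_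
          ⟨fun w hw => ?_, ?_⟩ (by decide) ?_).post ?_
        · intro υ hu
          simp only [NExp.val]
          rw [hu.N 21 (by decide), ht1.N 21 (by decide), hL'.dim_eq]
        · rw [ht1.Q 9 (by decide), h1 w hw]
          simp
        · rw [ht1.Q 9 (by decide)]
          exact h2
        · rintro v υ hv hu hυ ⟨g1, g2⟩
          have e10 : υ.N 10 0 0 = r := by rw [hu.N 10 (by decide), ht1.N 10 (by decide), hτ]
          have e4 : υ.N 4 0 0 = M.query (σ.N 13 0 0) (X r) := by rw [hu.N 4 (by decide), h4]
          have e11 : υ.Q 11 0 r = weight I T r := by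
            rw [hu.Q 11 (by decide), ht1.Q 11 (by decide), hall.Q 11 (by decide),
              hR.weights r (by omega)]
          have ef : υ.Q 4 r v = feature (X r) v := by
            rw [hu.Q 4 (by decide), ht1.Q 4 (by decide), hall.Q 4 (by decide),
              hR.feat r (by omega) v hv]
          apply Runs.le
          · refine Runs.putR_of_eq 0 v (∑ r' ∈ Finset.range (r + 1), F r' v) rfl hυ ?_
              ⟨(Same.refl _ _ υ).setQ (by decide) _ _ _, hυ, ?_, ?_⟩
            · simp only [RExp.val, NExp.val, e10, e4, hυ, e11, ef, g1 v hv]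
              rw [if_neg (lt_irrefl v), Finset.sum_range_succ, ← hF']
              ring
            · intro w hw
              by_cases h : w = v
              · subst h; simp
              · have : (w < v + 1) ↔ w < v := by omega
                simp [h, g1 w hw, this]
            · intro b hb1 hb2
              have : b ≠ v := by omega
              simp [this, g2 b hb1 hb2]
          · simp only [RExp.cost, NExp.cost]
            omega
        · rintro υ ⟨hu, g1, g2⟩
          refine ⟨(ht1.mono (by decide) (by decide)).trans (hu.mono (by decide) (by decide)), ?_,
            fun w hw => ?_, g2⟩
          · rw [hu.N 10 (by decide), ht1.N 10 (by decide), hτ]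
          · rw [g1 w hw, if_pos hw]
      · simp only [NExp.cost]
        omega
    · rintro τ ⟨hs, h1, h2⟩
      have hall : Same [4, 10, 11] [9] σ τ := (hs1.mono (by decide) (by decide)).trans hs
      refine ⟨hall, ⟨hR.toReady.update hall (by decide) (by decide) ?_ ?_ h2, ?_⟩, h1⟩
      · rw [hall.Q 3 (by decide)]; exact hR.pts
      · rw [hall.Q 5 (by decide)]; exact hR.rows
      · rw [hall.Q 11 (by decide)]; exact hR.weights
  · omega

/-- The best value and coefficients for the classifiers before `i`. -/
def BestUpTo (I : Input d) (T : Finset (Fin I.n)) (i : ℕ) (σ : Mem) : Prop :=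
  (∀ i' : Fin I.k, (i' : ℕ) < i → ∀ c : Fin I.dim → ℝ,
    CoefFeasible I.R I.β I.ε (I.f i') I.S c → coefObjective I T i' c ≤ σ.Q 15 0 0) ∧
  (σ.Q 15 0 0 = -1 ∨ ∃ b : Fin I.k, σ.N 7 0 0 = b ∧
    CoefFeasible I.R I.β I.ε (I.f b) I.S (fun w : Fin I.dim => σ.Q 17 0 w) ∧
    σ.Q 15 0 0 = coefObjective I T b fun w => σ.Q 17 0 w)

lemma BestUpTo.same {i : ℕ} (h : BestUpTo I T i σ) {w q : List ℕ} (hs : Same w q σ τ)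
    (hw : 7 ∉ w) (hq : ∀ a ∈ ([15, 17] : List ℕ), a ∉ q) : BestUpTo I T i τ := by
  unfold BestUpTo
  rw [hs.N 7 hw, hs.Q 15 (hq _ (by decide)), hs.Q 17 (hq _ (by decide))]
  exact h

lemma objective_eq_coef {i : Fin I.k} {p : MvPolynomial (Fin d) ℝ} {c : Fin I.dim → ℝ}
    (h : ∀ x, MvPolynomial.eval x p = lin c x) : I.objective T i p = coefObjective I T i c := by
  simp only [Input.objective, Input.chow, coefObjective, h]

lemma polyOf_mem_feasible (hd : 1 ≤ d) {i : Fin I.k} {c : ℕ → ℝ} :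
    polyOf d I.dim c ∈ I.feasible i ↔
      CoefFeasible I.R I.β I.ε (I.f i) I.S (fun w : Fin I.dim => c w) :=
  I.mem_feasible_iff_coef i _ _ (polyOf_totalDegree hd _) (eval_polyOf_eq_lin c)

lemma coefObjective_le_B (hI : I.Admissible) (hT : T ⊆ I.S₀) {i : Fin I.k} {c : Fin I.dim → ℝ}
    (hc : CoefFeasible I.R I.β I.ε (I.f i) I.S c) : coefObjective I T i c ≤ I.B := by
  rw [← objective_eq_coef (eval_polyOf_extend c)]
  refine I.objective_le_B hI hT ?_
  exact (I.mem_feasible_iff_coef i _ c (polyOf_totalDegree hI.1 _) (eval_polyOf_extend c)).2 hc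

lemma runs_improve (hI : I.Admissible) (hU : Bounded I I.n U) (hR : Alive I X T σ)
    (hX : ∀ j : Fin I.m, X (I.n + j) = I.S j) (hX' : ∀ j : Fin I.n, X j = I.S' j)
    (hT : T ⊆ I.S₀) (i : Fin I.k) (hi : σ.N 13 0 0 = i) (hJ : BestUpTo I T i σ) :
    Runs (I.equip s e) improve σ (budget 1 U (3 * e + 8)) fun τ =>
      Same [4, 5, 7, 10, 11, 12] [5, 9, 10, 14, 15, 17] σ τ ∧ Alive I X T τ ∧
      BestUpTo I T (i + 1) τ := by
  have hb := budget_chain_zero hU.U_le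
  have hbe := budget_chain (X := 1) le_rfl hU.U_le (3 * e)
  have hb7 : budget 1 U 7 ≤ budget 1 U (3 * e + 7) := budget_mono hU.U_le (by omega)
  have hdim := hU.dim_le
  apply Runs.le
  · apply Runs.bind (runs_loadClassifier hU hR.toReady)
    rintro τ₂ ⟨hs2, hR2, hrow2⟩
    rw [hi] at hrow2
    have hA2 : Alive I X T τ₂ := ⟨hR2, by rw [hs2.Q 11 (by decide)]; exact hR.weights⟩
    apply Runs.bind (runs_objectiveRow hU hA2)
    rintro τ₃ ⟨hs3, hA3, hobj3⟩
    rw [← hs3.Q 5 (by decide)] at hrow2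
    apply Runs.bind (runs_solveProgram hI hU hA3.toReady hX i hrow2)
    rintro τ₄ ⟨hs4, hsol⟩
    have hA4 := hA3.same hs4 (by decide) (by decide)
    apply Runs.bind (runs_dot (n := I.dim) (U := U) (len := nv 21) hU.U_le (by omega) (by decide)
      (by decide) (fun _ _ => rfl) (fun _ _ => rfl)
      (fun τ h => (hA4.toLoaded.same h (by decide) (by decide)).dim_eq) (by decide) (by decide))
    rintro τ₅ ⟨hs5, hdot⟩
    have hA5 := hA4.same hs5 (by decide) (by decide)
    have hall : Same [4, 5, 10, 11, 12] [5, 9, 10, 14] σ τ₅ :=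
      (((hs2.mono (by decide) (by decide)).trans (hs3.mono (by decide) (by decide))).trans
        (hs4.mono (by decide) (by decide))).trans (hs5.mono (by decide) (by decide))
    have hJ5 := hJ.same hall (by decide) (by decide)
    have hobj : ∀ c : Fin I.dim → ℝ,
        ∑ w : Fin I.dim, τ₃.Q 9 0 w * c w = coefObjective I T i c := fun c => by
      have e1 : ∀ w : Fin I.dim, τ₃.Q 9 0 w = ∑ r ∈ Finset.range I.n,
          weight I T r * (((I.equip s e).query i (X r) : ℝ) * feature (X r) w) := fun w => by
        rw [hobj3 w w.2, hs2.N 13 (by decide), hi]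
      simp only [e1, Finset.sum_mul]
      rw [Finset.sum_comm]
      have e2 : ∀ r, ∑ w : Fin I.dim, weight I T r *
          (((I.equip s e).query i (X r) : ℝ) * feature (X r) w) * c w =
          weight I T r * (((I.equip s e).query i (X r) : ℝ) * lin c (X r)) := fun r => by
        rw [lin, Finset.mul_sum, Finset.mul_sum]
        exact Finset.sum_congr rfl fun w _ => by ring
      simp only [e2]
      rw [sum_weight, coefObjective]
      congr 1
      refine Finset.sum_congr rfl fun j _ => ?_
      rw [query_eq, hX']
    -- The outcome without optimum is excluded: on tame points the objective is bounded by `B`.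
    obtain ⟨hfeas, hmax⟩ : CoefFeasible I.R I.β I.ε (I.f i) I.S
        (fun w : Fin I.dim => τ₄.Q 10 0 w) ∧ ∀ c : Fin I.dim → ℝ,
        CoefFeasible I.R I.β I.ε (I.f i) I.S c →
          coefObjective I T i c ≤ coefObjective I T i fun w => τ₄.Q 10 0 w := by
      rcases hsol with ⟨-, h1, h2⟩ | ⟨-, hunb⟩
      · simp only [hobj] at h2
        exact ⟨h1, h2⟩
      · obtain ⟨c, hc1, hc2⟩ := hunb I.B
        rw [hobj] at hc2
        exact absurd (coefObjective_le_B hI hT hc1) (not_le.2 hc2)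
    have hval : τ₅.Q 14 0 0 = coefObjective I T i fun w => τ₄.Q 10 0 w := by
      rw [hdot, Finset.sum_range, ← hobj]
      simp only [NExp.val]
      rw [hs4.Q 9 (by decide)]
    have hext : ∀ v : ℝ, τ₅.Q 15 0 0 ≤ v → (coefObjective I T i fun w => τ₄.Q 10 0 w) ≤ v →
        ∀ i' : Fin I.k, (i' : ℕ) < i + 1 → ∀ c : Fin I.dim → ℝ,
        CoefFeasible I.R I.β I.ε (I.f i') I.S c → coefObjective I T i' c ≤ v := by
      intro v h1 h2 i' hi' c hc
      rcases Nat.lt_succ_iff_lt_or_eq.1 hi' with h | h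
      · exact (hJ5.1 i' h c hc).trans h1
      · obtain rfl : i' = i := Fin.ext h
        exact (hmax c hc).trans h2
    apply Runs.ite (c₁ := 1) (c₂ := budget 1 U 4)
    · intro ht
      simp only [Test.Holds, RExp.val, NExp.val, hval] at ht
      exact Runs.skip ⟨hall.mono (by decide) (by decide), hA5, hext _ le_rfl ht, hJ5.2⟩
    · intro ht
      simp only [Test.Holds, RExp.val, NExp.val, hval, not_le] at ht
      have h13 : τ₅.N 13 0 0 = i := by rw [hall.N 13 (by decide), hi]
      apply Runs.le
      · apply Runs.putR_seq_of_eq 0 0 (coefObjective I T i fun w => τ₄.Q 10 0 w) rfl rfl (by exact hval)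
        apply Runs.putN_seq_of_eq 0 0 i rfl rfl (by exact h13)
        obtain ⟨τ₆, hτ₆⟩ : ∃ τ₆, τ₆ = (τ₅.setQ 15 0 0
          (coefObjective I T i fun w => τ₄.Q 10 0 w)).setN 7 0 0 i := ⟨_, rfl⟩
        have hs6 : Same [7] [15] τ₅ τ₆ := by
          rw [hτ₆]
          exact ((Same.refl _ _ τ₅).setQ (by decide) _ _ _).setN (by decide) _ _ _
        rw [← hτ₆]
        have hA6 := hA5.same hs6 (by decide) (by decide)
        refine (Runs.forN (w := [11]) (q := [17]) (n := I.dim) (U := U) (X := 1) (Y := 1) (a := 1)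
          (b := 3) (fun v τ => ∀ w < v, τ.Q 17 0 w = τ₄.Q 10 0 w)
          (by decide) le_rfl hU.U_le le_rfl le_rfl (by omega) (fun _ _ _ h => h) ?_
          (by simp) (by decide) ?_).post ?_
        · intro υ hu
          exact (hA6.toLoaded.same hu (by decide) (by decide)).dim_eq
        · intro v υ hv hu hυ h1
          have e10 : υ.Q 10 = τ₄.Q 10 := by
            rw [hu.Q 10 (by decide), hs6.Q 10 (by decide), hs5.Q 10 (by decide)]
          apply Runs.le
          · refine Runs.putR_of_eq 0 v (τ₄.Q 10 0 v) rfl hυ (by simp [RExp.val, NExp.val, hυ, e10])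
              ⟨(Same.refl _ _ υ).setQ (by decide) _ _ _, hυ, ?_⟩
            intro w hw
            by_cases h : w = v
            · simp [h]
            · simp [h, h1 w (by omega)]
          · simp only [RExp.cost, NExp.cost]
            omega
        · rintro υ ⟨hu, h17⟩
          have h15 : υ.Q 15 0 0 = coefObjective I T i fun w => τ₄.Q 10 0 w := by
            rw [hu.Q 15 (by decide), hτ₆]; simp
          have hc17 : (fun w : Fin I.dim => υ.Q 17 0 w) = fun w : Fin I.dim => τ₄.Q 10 0 w :=
            funext fun w => h17 w w.2
          refine ⟨((hall.mono (by decide) (by decide)).trans (hs6.mono (by decide)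
            (by decide))).trans (hu.mono (by decide) (by decide)),
            hA6.same hu (by decide) (by decide), ?_, Or.inr ⟨i, ?_, ?_, ?_⟩⟩
          · rw [h15]
            exact hext _ ht.le le_rfl
          · rw [hu.N 7 (by decide), hτ₆]; simp
          · rw [hc17]; exact hfeas
          · rw [h15, hc17]
      · simp only [RExp.cost, NExp.cost]
        omega
  · simp only [Test.cost, RExp.cost, NExp.cost]
    omega

lemma runs_maximize (hI : I.Admissible) (hU : Bounded I I.n U) (hR : Alive I X T σ)
    (hX : ∀ j : Fin I.m, X (I.n + j) = I.S j) (hX' : ∀ j : Fin I.n, X j = I.S' j)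
    (hT : T ⊆ I.S₀) :
    Runs (I.equip s e) maximize σ (budget I.k U (3 * e + 11)) fun τ =>
      Same [4, 5, 7, 10, 11, 12, 13] [5, 9, 10, 14, 15, 17] σ τ ∧ Alive I X T τ ∧
      ∃ i : Fin I.k, τ.N 7 0 0 = i ∧ I.IsSolution T i (polyOf d I.dim (τ.Q 17 0)) ∧
        τ.Q 15 0 0 = I.objective T i (polyOf d I.dim (τ.Q 17 0)) := by
  have hk : 1 ≤ I.k := hI.2.2.1
  have hbk : 64 * budget I.k U (3 * e + 10) ≤ budget I.k U (3 * e + 11) := budget_step _ hU.U_le _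
  have hpos := budget_pos hk hU.U_le (3 * e + 10)
  apply Runs.le
  · apply Runs.putR_seq_of_eq 0 0 (-1) rfl rfl (by simp [RExp.val])
    have hs0 : Same [] [15] σ (σ.setQ 15 0 0 (-1)) := (Same.refl _ _ σ).setQ (by decide) _ _ _
    have hA0 := hR.same hs0 (by decide) (by decide)
    refine (Runs.forN (w := [4, 5, 7, 10, 11, 12, 13]) (q := [5, 9, 10, 14, 15, 17]) (n := I.k)
      (U := U) (X := I.k) (Y := 1) (a := 3 * e + 8) (b := 3 * e + 10)
      (fun i τ => Alive I X T τ ∧ BestUpTo I T i τ)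
      (by decide) (by omega) hU.U_le hk le_rfl ?_ ?_ ?_ ⟨hA0, by simp, by simp⟩
      (by decide) ?_).post ?_
    · have := hU.U_le
      nlinarith
    · rintro i τ x ⟨h1, h2⟩
      have hs := (Same.refl [13] [] τ).setN (by decide : 13 ∈ [13]) 0 0 x
      exact ⟨h1.same hs (by decide) (by decide), h2.same hs (by decide) (by decide)⟩
    · intro τ hs
      rw [← hA0.k_eq]
      simp only [NExp.val]
      rw [hs.N 22 (by decide)]
    · rintro i τ hi hs hτ ⟨hA, hJ⟩
      refine (runs_improve hI hU hA hX hX' hT ⟨i, hi⟩ hτ hJ).post ?_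
      rintro υ ⟨hu, hAu, hJu⟩
      exact ⟨hu.mono (by decide) (by decide), by rw [hu.N 13 (by decide), hτ], hAu, hJu⟩
    · rintro τ ⟨hs, hA, hmax, hJ⟩
      refine ⟨(hs0.mono (by decide) (by decide)).trans hs, hA, ?_⟩
      -- The zero polynomial is feasible with objective `0`, so the initial value `-1` has been
      -- replaced by that of an actual maximizer.
      have h0 : 0 ≤ τ.Q 15 0 0 := by
        have := hmax ⟨0, hk⟩ hk (fun _ => 0) <|
          (I.mem_feasible_iff_coef _ 0 _ (by simp) (fun x => by simp [lin])).1
            (I.zero_mem_feasible hI _)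
        simpa [coefObjective, lin] using this
      rcases hJ with hJ | ⟨b, h7, hfeas, hv⟩
      · rw [hJ] at h0
        norm_num at h0
      · have hv' : τ.Q 15 0 0 = I.objective T b (polyOf d I.dim (τ.Q 17 0)) := by
          rw [hv, objective_eq_coef (eval_polyOf_eq_lin (τ.Q 17 0))]
        refine ⟨b, h7, ⟨(polyOf_mem_feasible hI.1).2 hfeas, fun i' q hq => ?_⟩, hv'⟩
        obtain ⟨c, hc⟩ := Input.exists_coef hI.1 (N := I.dim) rfl hq.1
        rw [← hv', objective_eq_coef hc]
        exact hmax i' i'.2 c ((I.mem_feasible_iff_coef i' q c hq.1 hc).1 hq)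
  · simp only [RExp.cost, NExp.cost]
    omega

end
end ICF

namespace ICF

/-! ### The filtering step -/

/-- Values `f(x) |p(x)|` of the points, for the classifier `7` and the coefficients in the array
`17`, followed by a zero. -/
def chowValues : Prog :=
  forN 10 (.add (nv 24) (nv 23))
    (.classify 4 (nv 7) 3 (nv 10) ;; dot 4 (nv 10) 17 (.lit 0) (nv 21) ;;
    .putR 12 (.lit 0) (nv 10) (.mul (.ofN (nv 4)) (.sqrt (.mul (rv 14) (rv 14))))) ;;
  .putR 12 (.lit 0) (.add (nv 24) (nv 23)) (.lit 0)

/-- The total weight of the points with a value above that of row `17`. -/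
def exceed : Prog :=
  setr 18 (.lit 0) ;;
  forN 10 (.add (nv 24) (nv 23))
    (.ite (.leR (.get 12 (.lit 0) (nv 10)) (.get 12 (.lit 0) (nv 17))) .skip
      (setr 18 (.add (rv 18) (.get 11 (.lit 0) (nv 10)))))

/-- Find the threshold, and put it into the real scalar `16`. -/
def findThreshold : Prog :=
  -- A negative value marks that no threshold has been found; genuine candidates are nonnegative.
  setr 16 (.lit (-1)) ;;
  forN 17 (.add (.add (nv 24) (nv 23)) (.lit 1))
    (exceed ;;
    .ite (.leR (rv 24) (rv 18))
      (.ite (.conj (.leR (.lit 0) (rv 16)) (.leR (rv 16) (.get 12 (.lit 0) (nv 17)))) .skip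
        (setr 16 (.get 12 (.lit 0) (nv 17))))
      .skip)

/-- Store the filter number `25`. -/
def storeFilter : Prog :=
  .putN 1 (.lit 0) (.add (.lit 5) (nv 25)) (nv 7) ;;
  forN 11 (nv 21) (.putR 3 (.add (.add (nv 24) (nv 23)) (nv 25)) (nv 11)
    (.get 17 (.lit 0) (nv 11))) ;;
  .putR 3 (.add (.add (nv 24) (nv 23)) (nv 25)) (nv 21) (rv 16) ;;
  setn 25 (.add (nv 25) (.lit 1))

/-- Drop the points above the threshold. -/
def dropPoints : Prog :=
  forN 10 (nv 24) (.ite (.leR (.get 12 (.lit 0) (nv 10)) (rv 16)) .skip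
    (.putR 11 (.lit 0) (nv 10) (.lit 0)))

/-- The filters `L` stand in the rows of the array `3` after the points. -/
def Stored {d : ℕ} (I : Input d) (o : ℕ) (L : List (Fin I.k × MvPolynomial (Fin d) ℝ × ℝ))
    (σ : Mem) : Prop :=
  σ.N 25 0 0 = L.length ∧ ∀ q f, L[q]? = some f → σ.N 1 0 (5 + q) = f.1 ∧
    f.2.1 = polyOf d I.dim (σ.Q 3 (o + I.m + q)) ∧ σ.Q 3 (o + I.m + q) I.dim = f.2.2

section

variable {d : ℕ} {I : Input d} {U : ℕ} {X : ℕ → Pt d} {σ τ : Mem} {s : Solver} {e : ℕ}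
  {T : Finset (Fin I.n)}

lemma Stored.same {o : ℕ} {L : List (Fin I.k × MvPolynomial (Fin d) ℝ × ℝ)} (h : Stored I o L σ)
    {w q : List ℕ} (hs : Same w q σ τ) (hw : ∀ a ∈ ([1, 25] : List ℕ), a ∉ w) (hq : 3 ∉ q) :
    Stored I o L τ := by
  unfold Stored
  rw [hs.N 25 (hw _ (by decide)), hs.N 1 (hw _ (by decide)), hs.Q 3 hq]
  exact h

/-- What `chowValues` computes. -/
noncomputable def chowValue (I : Input d) (X : ℕ → Pt d) (i : Fin I.k)
    (p : MvPolynomial (Fin d) ℝ) (r : ℕ) : ℝ :=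
  if r < I.n + I.m then I.absChow i p (X r) else 0

lemma polyOf_congr {N : ℕ} {c c' : ℕ → ℝ} (h : ∀ w < N, c w = c' w) :
    polyOf d N c = polyOf d N c' :=
  Finset.sum_congr rfl fun w hw => by rw [h w (Finset.mem_range.1 hw)]

/-- With these weights the tail sum is the test frequency minus `R` times the reference frequency.
-/
lemma sum_exceed (I : Input d) (T : Finset (Fin I.n)) (G : ℕ → ℝ) (θ : ℝ) :
    ∑ r ∈ Finset.range (I.n + I.m), (if G r ≤ θ then 0 else weight I T r) =
      ((T.filter fun j : Fin I.n => θ < G j).card : ℝ) / I.n -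
        I.R * (((Finset.univ.filter fun j : Fin I.m => θ < G (I.n + j)).card : ℝ) / I.m) := by
  rw [Finset.sum_range_add]
  have e1 : ∀ r, (if G r ≤ θ then 0 else weight I T r) =
      weight I T r * (if θ < G r then 1 else 0) := fun r => by
    by_cases h : G r ≤ θ
    · rw [if_pos h, if_neg (not_lt.2 h), mul_zero]
    · rw [if_neg h, if_pos (not_le.1 h), mul_one]
  have e2 : ∑ j ∈ Finset.range I.m, (if G (I.n + j) ≤ θ then 0 else weight I T (I.n + j)) =
      -(I.R / I.m) * ∑ j : Fin I.m, (if θ < G (I.n + j) then 1 else 0) := by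
    rw [Finset.sum_range, Finset.mul_sum]
    refine Finset.sum_congr rfl fun j _ => ?_
    rw [e1, weight, dif_neg (by omega)]
  rw [e2]
  simp only [e1]
  rw [sum_weight, Finset.sum_boole, Finset.sum_boole]
  ring

lemma mem_thresholdSet_iff {i : Fin I.k} {p : MvPolynomial (Fin d) ℝ}
    (hX : ∀ j : Fin I.m, X (I.n + j) = I.S j) (hX' : ∀ j : Fin I.n, X j = I.S' j) {θ : ℝ}
    (hθ : 0 ≤ θ) :
    θ ∈ I.thresholdSet T i p ↔ I.Δ ≤ ∑ r ∈ Finset.range (I.n + I.m),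
      (if chowValue I X i p r ≤ θ then 0 else weight I T r) := by
  classical
  rw [sum_exceed, Input.thresholdSet, Set.mem_ofPred_eq]
  have e1 : ∀ j : Fin I.n, chowValue I X i p j = I.absChow i p (I.S' j) := fun j => by
    rw [chowValue, if_pos (by omega), hX']
  have e2 : ∀ j : Fin I.m, chowValue I X i p (I.n + j) = I.absChow i p (I.S j) := fun j => by
    rw [chowValue, if_pos (by omega), hX]
  simp only [e1, e2]
  constructor
  · rintro ⟨-, h⟩
    have : I.Δ ≤ _ := le_sub_iff_add_le'.2 h
    convert this
  · intro h
    refine ⟨hθ, ?_⟩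
    have := le_sub_iff_add_le'.1 h
    convert this

lemma chowValue_nonneg (i : Fin I.k) (p : MvPolynomial (Fin d) ℝ) (r : ℕ) :
    0 ≤ chowValue I X i p r := by
  unfold chowValue
  split_ifs
  · exact I.absChow_nonneg i p _
  · exact le_rfl

lemma candidates_eq_chowValue {i : Fin I.k} {p : MvPolynomial (Fin d) ℝ}
    (hX : ∀ j : Fin I.m, X (I.n + j) = I.S j) (hX' : ∀ j : Fin I.n, X j = I.S' j) {c : ℝ}
    (hc : c ∈ I.candidates i p) : ∃ r < I.n + I.m + 1, c = chowValue I X i p r := by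
  classical
  unfold Input.candidates at hc
  simp only [Finset.mem_insert, Finset.mem_union, Finset.mem_image, Finset.mem_univ,
    true_and] at hc
  rcases hc with rfl | ⟨j, rfl⟩ | ⟨j, rfl⟩
  -- The entry behind both samples stands for the candidate `0`.
  · exact ⟨I.n + I.m, by omega, by rw [chowValue, if_neg (by omega)]⟩
  · exact ⟨I.n + j, by omega, by rw [chowValue, if_pos (by omega), hX]⟩
  · exact ⟨j, by omega, by rw [chowValue, if_pos (by omega), hX']⟩

lemma runs_chowValues (hU : Bounded I I.n U) (hR : Alive I X T σ) (i : Fin I.k)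
    (hi : σ.N 7 0 0 = i) :
    Runs (I.equip s e) chowValues σ (budget 1 U 8) fun τ =>
      Same [4, 10, 11] [12, 14] σ τ ∧ ∀ r < I.n + I.m + 1,
        τ.Q 12 0 r = chowValue I X i (polyOf d I.dim (σ.Q 17 0)) r := by
  have hb := budget_chain_zero hU.U_le
  have hdim := hU.dim_le
  have ho := hU.o_le
  have hd := hU.d_le
  obtain ⟨G, hG⟩ : ∃ G, G = chowValue I X i (polyOf d I.dim (σ.Q 17 0)) := ⟨_, rfl⟩
  rw [← hG]
  apply Runs.le
  · refine Runs.bind (c₂ := 40) (Runs.forN (w := [4, 10, 11]) (q := [12, 14]) (n := I.n + I.m) (U := U)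
      (X := 1) (Y := 1) (a := 5) (b := 7) (fun r τ => ∀ r' < r, τ.Q 12 0 r' = G r')
      (by decide) le_rfl hU.U_le le_rfl le_rfl (by omega) (fun _ _ _ h => h) ?_
      (by simp) (by decide) ?_) ?_
    · intro τ hs
      have := hR.toLoaded.same hs (by decide) (by decide)
      simp [NExp.val, this.o_eq, this.m_eq]
    · intro r τ hr hs hτ hJ
      have hA := hR.same hs (by decide) (by decide)
      have hpt : (fun t : Fin d => τ.Q 3 r t) = X r := funext fun t => hA.pts r hr t
      have h7 : τ.N 7 0 0 = i := by rw [hs.N 7 (by decide), hi]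
      obtain ⟨τ₁, hτ₁⟩ : ∃ τ₁, τ₁ = τ.setN 4 0 0 ((I.equip s e).query i (X r)) := ⟨_, rfl⟩
      have ht1 : Same [4] [] τ τ₁ := by
        rw [hτ₁]
        exact (Same.refl _ _ τ).setN (by decide) _ _ _
      have hA1 := hA.same ht1 (by decide) (by decide)
      apply Runs.le
      · apply Runs.classify_seq_of_eq i (X r) (by exact h7)
          (by simp only [NExp.val, hτ]; exact hpt)
        rw [← hτ₁]
        apply Runs.bind (runs_dot (n := I.dim) (U := U) (len := nv 21) hU.U_le (by omega)
          (by decide) (by decide)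
          (fun υ h => by simp only [NExp.val]; rw [h.N 10 (by decide)]) (fun _ _ => rfl)
          (fun υ h => (hA1.toLoaded.same h (by decide) (by decide)).dim_eq) (by decide)
          (by decide))
        rintro τ₂ ⟨ht2, hdot⟩
        have h10 : τ₁.N 10 0 0 = r := by rw [ht1.N 10 (by decide), hτ]
        have h17 : τ₁.Q 17 = σ.Q 17 := by rw [ht1.Q 17 (by decide), hs.Q 17 (by decide)]
        have hval : τ₂.Q 14 0 0 =
            MvPolynomial.eval (X r) (polyOf d I.dim (σ.Q 17 0)) := by
          rw [hdot, eval_polyOf]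
          refine Finset.sum_congr rfl fun w hw => ?_
          simp only [NExp.val, h10, h17]
          rw [hA1.feat r hr w (Finset.mem_range.1 hw), mul_comm]
        have h4 : τ₂.N 4 0 0 = (I.equip s e).query i (X r) := by
          rw [ht2.N 4 (by decide), hτ₁]; simp
        have h10' : τ₂.N 10 0 0 = r := by rw [ht2.N 10 (by decide), h10]
        refine Runs.putR_of_eq 0 r (G r) rfl h10' ?_
          ⟨((ht1.mono (by decide) (by decide)).trans (ht2.mono (by decide) (by decide))).setQ
            (by decide) _ _ _, h10', ?_⟩
        · simp only [RExp.val, NExp.val, h4, hval, query_eq, Real.sqrt_mul_self_eq_abs]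
          rw [hG, chowValue, if_pos hr, Input.absChow]
        · intro r' hr'
          by_cases h : r' = r
          · simp [h]
          · rw [Mem.setQ_Q, if_neg (by omega), ht2.Q 12 (by decide), ht1.Q 12 (by decide),
              hJ r' (by omega)]
      · simp only [RExp.cost, NExp.cost]
        omega
    · rintro τ ⟨hs, hJ⟩
      have hL := hR.toLoaded.same hs (by decide) (by decide)
      refine (Runs.putR_of_eq 0 (I.n + I.m) 0 rfl (by simp [NExp.val, hL.o_eq, hL.m_eq])
        (by simp [RExp.val]) ⟨hs.setQ (by decide) _ _ _, fun r hr => ?_⟩).le (by decide)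
      by_cases h : r = I.n + I.m
      · subst h
        simp [hG, chowValue]
      · simp [h, hJ r (by omega)]
  · omega

lemma runs_exceed {M : Equipment d} (hU : Bounded I I.n U) (hR : Alive I X T σ) {G : ℕ → ℝ}
    (hG : ∀ r < I.n + I.m + 1, σ.Q 12 0 r = G r) {c : ℕ} (hc : c < I.n + I.m + 1)
    (hσ : σ.N 17 0 0 = c) :
    Runs M exceed σ (budget 1 U 4) fun τ => Same [10] [18] σ τ ∧
      τ.Q 18 0 0 = ∑ r ∈ Finset.range (I.n + I.m), (if G r ≤ G c then 0 else weight I T r) := by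
  have hb := budget_chain_zero hU.U_le
  have ho := hU.o_le
  apply Runs.le
  · apply Runs.putR_seq_of_eq 0 0 0 rfl rfl (by simp [RExp.val])
    have hs0 : Same [10] [18] σ (σ.setQ 18 0 0 0) := (Same.refl _ _ σ).setQ (by decide) _ _ _
    refine (Runs.forN (w := [10]) (q := [18]) (n := I.n + I.m) (U := U)
      (X := 1) (Y := 1) (a := 1) (b := 3) (fun r τ => τ.Q 18 0 0 =
        ∑ r' ∈ Finset.range r, (if G r' ≤ G c then 0 else weight I T r'))
      (by decide) le_rfl hU.U_le le_rfl le_rfl (by omega) (fun _ _ _ h => h) ?_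
      (by simp) (by decide) ?_).post ?_
    · intro τ hs
      have := hR.toLoaded.same (hs0.trans hs) (by decide) (by decide)
      simp [NExp.val, this.o_eq, this.m_eq]
    · intro r τ hr hs hτ hJ
      have hall := hs0.trans hs
      have h12 : τ.Q 12 = σ.Q 12 := hall.Q 12 (by decide)
      have h11 : τ.Q 11 0 r = weight I T r := by rw [hall.Q 11 (by decide), hR.weights r hr]
      have h17 : τ.N 17 0 0 = c := by rw [hall.N 17 (by decide), hσ]
      apply Runs.le
      · apply Runs.ite (c₁ := 1)
        · intro ht
          simp only [Test.Holds, RExp.val, NExp.val, hτ, h12, h17, hG r (by omega), hG c hc] at ht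
          refine Runs.skip ⟨Same.refl _ _ _, hτ, ?_⟩
          rw [Finset.sum_range_succ, if_pos ht, add_zero, hJ]
        · intro ht
          simp only [Test.Holds, RExp.val, NExp.val, hτ, h12, h17, hG r (by omega), hG c hc] at ht
          refine Runs.putR_of_eq 0 0 _ rfl rfl rfl ⟨(Same.refl _ _ _).setQ (by decide) _ _ _, hτ, ?_⟩
          rw [Finset.sum_range_succ, if_neg ht]
          simp [RExp.val, NExp.val, hJ, hτ, h11]
      · simp only [Test.cost, RExp.cost, NExp.cost]
        omega
    · rintro τ ⟨hs, hJ⟩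
      exact ⟨hs0.trans hs, hJ⟩
  · simp only [RExp.cost, NExp.cost]
    omega

/-- The scan keeps the least candidate that satisfies the threshold condition. It is least among all
reals by the rounding in `Input.exists_candidate`, and at least one exists by
`Input.thresholdSet_nonempty`. -/
lemma runs_findThreshold {M : Equipment d} (hI : I.Admissible) (hU : Bounded I I.n U)
    (hR : Alive I X T σ)
    (hX : ∀ j : Fin I.m, X (I.n + j) = I.S j) (hX' : ∀ j : Fin I.n, X j = I.S' j)
    (hT : T ⊆ I.S₀) {i : Fin I.k} {p : MvPolynomial (Fin d) ℝ} (hp : p ∈ I.feasible i)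
    (hgt : I.ε < I.objective T i p)
    (hG : ∀ r < I.n + I.m + 1, σ.Q 12 0 r = chowValue I X i p r) :
    Runs M findThreshold σ (budget 1 U 8) fun τ => Same [10, 17] [16, 18] σ τ ∧
      I.IsThreshold T i p (τ.Q 16 0 0) := by
  have hb := budget_chain_zero hU.U_le
  have ho := hU.o_le
  obtain ⟨G, hGdef⟩ : ∃ G, G = chowValue I X i p := ⟨_, rfl⟩
  have hG0 : ∀ r, 0 ≤ G r := fun r => by rw [hGdef]; exact chowValue_nonneg i p r
  have hmem : ∀ r, G r ∈ I.thresholdSet T i p ↔ I.Δ ≤ ∑ r' ∈ Finset.range (I.n + I.m),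
      (if G r' ≤ G r then 0 else weight I T r') := fun r => by
    rw [mem_thresholdSet_iff hX hX' (hG0 r), hGdef]
  rw [← hGdef] at hG
  apply Runs.le
  · apply Runs.putR_seq_of_eq 0 0 (-1) rfl rfl (by simp [RExp.val])
    have hs0 : Same [10, 17] [16, 18] σ (σ.setQ 16 0 0 (-1)) :=
      (Same.refl _ _ σ).setQ (by decide) _ _ _
    refine (Runs.forN (w := [10, 17]) (q := [16, 18]) (n := I.n + I.m + 1) (U := U)
      (X := 1) (Y := 1) (a := 5) (b := 7) (fun c τ =>
        (τ.Q 16 0 0 = -1 ∧ ∀ c' < c, G c' ∉ I.thresholdSet T i p) ∨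
        (τ.Q 16 0 0 ∈ I.thresholdSet T i p ∧
          ∀ c' < c, G c' ∈ I.thresholdSet T i p → τ.Q 16 0 0 ≤ G c'))
      (by decide) le_rfl hU.U_le le_rfl le_rfl (by omega) (fun _ _ _ h => h) ?_
      (Or.inl (by simp)) (by decide) ?_).post ?_
    · intro τ hs
      have := hR.toLoaded.same (hs0.trans hs) (by decide) (by decide)
      simp [NExp.val, this.o_eq, this.m_eq]
    · intro c τ hc hs hτ hJ
      have hall := hs0.trans hs
      apply Runs.le
      · apply Runs.bind (runs_exceed hU (hR.same hall (by decide) (by decide))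
          (by rw [hall.Q 12 (by decide)]; exact hG) hc hτ)
        rintro τ₁ ⟨hs1, h18⟩
        have h17 : τ₁.N 17 0 0 = c := by rw [hs1.N 17 (by decide), hτ]
        have hJ1 : τ₁.Q 16 = τ.Q 16 := hs1.Q 16 (by decide)
        have h24 : τ₁.Q 24 0 0 = I.Δ := by
          rw [hs1.Q 24 (by decide), hall.Q 24 (by decide), hR.Δ_eq]
        have h12 : τ₁.Q 12 0 c = G c := by
          rw [hs1.Q 12 (by decide), hall.Q 12 (by decide), hG c hc]
        have hs1' : Same [10, 17] [16, 18] τ τ₁ := hs1.mono (by decide) (by decide)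
        rw [← hJ1] at hJ
        have hlast : ∀ {Q : ℝ → Prop}, (∀ c' < c, Q (G c')) → Q (G c) → ∀ c' < c + 1, Q (G c') := by
          intro Q h1 h2 c' hc'
          rcases Nat.lt_succ_iff_lt_or_eq.1 hc' with h | rfl
          · exact h1 c' h
          · exact h2
        apply Runs.ite (c₁ := 30) (c₂ := 1)
        · intro ht
          simp only [Test.Holds, RExp.val, NExp.val, h24, h18, ← hmem] at ht
          apply Runs.le
          · apply Runs.ite (c₁ := 1)
            · intro ht2
              simp only [Test.Holds, RExp.val, NExp.val, h17, h12, Rat.cast_zero] at ht2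
              refine Runs.skip ⟨hs1', h17, Or.inr ?_⟩
              rcases hJ with ⟨h, -⟩ | ⟨h1, h2⟩
              · rw [h] at ht2
                norm_num at ht2
              · exact ⟨h1, hlast (Q := fun x => x ∈ I.thresholdSet T i p → _ ≤ x) h2
                  fun _ => ht2.2⟩
            · intro ht2
              simp only [Test.Holds, RExp.val, NExp.val, h17, h12, Rat.cast_zero] at ht2
              refine Runs.putR_of_eq 0 0 (G c) rfl rfl (by simp [RExp.val, NExp.val, h17, h12])
                ⟨hs1'.setQ (by decide) _ _ _, h17, Or.inr ?_⟩
              have h16 : (τ₁.setQ 16 0 0 (G c)).Q 16 0 0 = G c := by simp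
              rw [h16]
              refine ⟨ht, hlast (Q := fun x => x ∈ I.thresholdSet T i p → _ ≤ x) ?_
                fun _ => le_rfl⟩
              rcases hJ with ⟨-, h⟩ | ⟨h1, h2⟩
              · exact fun c' hc' h' => absurd h' (h c' hc')
              · intro c' hc' h'
                refine le_trans ?_ (h2 c' hc' h')
                by_contra hcon
                exact ht2 ⟨h1.1, (not_le.1 hcon).le⟩
          · simp only [Test.cost, RExp.cost, NExp.cost]
            omega
        · intro ht
          simp only [Test.Holds, RExp.val, NExp.val, h24, h18, ← hmem] at ht
          refine Runs.skip ⟨hs1', h17, ?_⟩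
          rcases hJ with ⟨h1, h2⟩ | ⟨h1, h2⟩
          · exact Or.inl ⟨h1, hlast (Q := fun x => x ∉ I.thresholdSet T i p) h2 ht⟩
          · exact Or.inr ⟨h1, hlast (Q := fun x => x ∈ I.thresholdSet T i p → _ ≤ x) h2
              fun h => absurd h ht⟩
      · simp only [Test.cost, RExp.cost, NExp.cost]
        omega
    · rintro τ ⟨hs, hJ⟩
      refine ⟨hs0.trans hs, ?_⟩
      have hcand : ∀ θ ∈ I.thresholdSet T i p, ∃ c < I.n + I.m + 1, G c ≤ θ ∧
          G c ∈ I.thresholdSet T i p := by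
        intro θ hθ
        obtain ⟨c, hc1, hc2, hc3⟩ := Input.exists_candidate hθ
        obtain ⟨r, hr, rfl⟩ := candidates_eq_chowValue hX hX' hc1
        exact ⟨r, hr, by rw [hGdef]; exact hc2, by rw [hGdef]; exact hc3⟩
      rcases hJ with ⟨-, h2⟩ | ⟨h1, h2⟩
      · obtain ⟨θ, hθ⟩ := Input.thresholdSet_nonempty hI hT hp hgt
        obtain ⟨c, hc, -, hc'⟩ := hcand θ hθ
        exact absurd hc' (h2 c hc)
      · refine ⟨h1, fun θ hθ => ?_⟩
        obtain ⟨c, hc, hle, hc'⟩ := hcand θ hθ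
        exact (h2 c hc hc').trans hle
  · simp only [RExp.cost, NExp.cost]
    omega

/-- Filters share the array `3` with the points and occupy the rows behind them, with the threshold
in column `I.dim`; the proof therefore has to check that earlier rows are untouched. -/
lemma runs_storeFilter {M : Equipment d} (hU : Bounded I I.n U) (hR : Alive I X T σ)
    {L : List (Fin I.k × MvPolynomial (Fin d) ℝ × ℝ)} (hL : Stored I I.n L σ) {i : Fin I.k}
    (hi : σ.N 7 0 0 = i) :
    Runs M storeFilter σ (budget 1 U 4) fun τ => Same [1, 11, 25] [3] σ τ ∧
      Alive I X T τ ∧ Stored I I.n (L ++ [(i, polyOf d I.dim (σ.Q 17 0), σ.Q 16 0 0)]) τ := by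
  have hb := budget_chain_zero hU.U_le
  have hdim := hU.dim_le
  apply Runs.le
  · apply Runs.putN_seq_of_eq 0 (5 + L.length) i rfl (by simp [NExp.val, hL.1]) (by exact hi)
    obtain ⟨σ₁, hσ₁⟩ : ∃ σ₁, σ₁ = σ.setN 1 0 (5 + L.length) i := ⟨_, rfl⟩
    have hs1 : Same [1] [] σ σ₁ := by
      rw [hσ₁]
      exact (Same.refl _ _ σ).setN (by decide) _ _ _
    rw [← hσ₁]
    have hA1 := hR.same hs1 (by decide) (by decide)
    have h25 : σ₁.N 25 0 0 = L.length := by rw [hs1.N 25 (by decide), hL.1]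
    refine Runs.bind (c₂ := 40) (Runs.forN (w := [11]) (q := [3]) (n := I.dim) (U := U)
      (X := 1) (Y := 1) (a := 1) (b := 3) (fun w τ =>
        (∀ r, r ≠ I.n + I.m + L.length → τ.Q 3 r = σ.Q 3 r) ∧
        ∀ w' < w, τ.Q 3 (I.n + I.m + L.length) w' = σ.Q 17 0 w')
      (by decide) le_rfl hU.U_le le_rfl le_rfl (by omega) (fun _ _ _ h => h) ?_
      ⟨fun r _ => by rw [hs1.Q 3 (by decide)], by simp⟩ (by decide) ?_) ?_
    · intro τ hs
      simp only [NExp.val]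
      rw [hs.N 21 (by decide), hA1.dim_eq]
    · rintro w τ hw hs hτ ⟨h1, h2⟩
      have e : τ.Q 17 = σ.Q 17 := by rw [hs.Q 17 (by decide), hs1.Q 17 (by decide)]
      apply Runs.le
      · refine Runs.putR_of_eq (I.n + I.m + L.length) w (σ.Q 17 0 w) ?_ hτ ?_
          ⟨(Same.refl _ _ τ).setQ (by decide) _ _ _, hτ, ?_, ?_⟩
        · simp only [NExp.val]
          rw [hs.N 24 (by decide), hs.N 23 (by decide), hs.N 25 (by decide), hA1.o_eq, hA1.m_eq,
            h25]
        · simp [RExp.val, NExp.val, hτ, e]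
        · intro r hr
          rw [← h1 r hr]
          funext w'
          simp [hr]
        · intro w' hw'
          by_cases h : w' = w
          · simp [h]
          · simp [h, h2 w' (by omega)]
      · simp only [RExp.cost, NExp.cost]
        omega
    · rintro τ ⟨hs, h1, h2⟩
      have e24 : τ.N 24 0 0 = I.n := by rw [hs.N 24 (by decide), hA1.o_eq]
      have e23 : τ.N 23 0 0 = I.m := by rw [hs.N 23 (by decide), hA1.m_eq]
      have e21 : τ.N 21 0 0 = I.dim := by rw [hs.N 21 (by decide), hA1.dim_eq]
      have e25 : τ.N 25 0 0 = L.length := by rw [hs.N 25 (by decide), h25]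
      have e16 : τ.Q 16 = σ.Q 16 := by rw [hs.Q 16 (by decide), hs1.Q 16 (by decide)]
      have e1 : τ.N 1 = σ₁.N 1 := hs.N 1 (by decide)
      refine (Runs.putR_seq_of_eq (I.n + I.m + L.length) I.dim (σ.Q 16 0 0)
        (by simp [NExp.val, e24, e23, e25]) (by exact e21) (by simp [RExp.val, NExp.val, e16])
        (Runs.putN_of_eq 0 0 (L.length + 1) rfl rfl (by simp [NExp.val, e25]) ?_)).le (by decide)
      have hrow : ∀ r, r ≠ I.n + I.m + L.length →
          ((τ.setQ 3 (I.n + I.m + L.length) I.dim (σ.Q 16 0 0)).setN 25 0 0 (L.length + 1)).Q 3 r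
            = σ.Q 3 r := by
        intro r hr
        rw [← h1 r hr]
        funext w
        simp [hr]
      have hall : Same [1, 11, 25] [3] σ
          ((τ.setQ 3 (I.n + I.m + L.length) I.dim (σ.Q 16 0 0)).setN 25 0 0 (L.length + 1)) :=
        (((hs1.mono (by decide) (by decide)).trans (hs.mono (by decide) (by decide))).setQ
          (by decide) _ _ _).setN (by decide) _ _ _
      refine ⟨hall, ⟨hR.toReady.update hall (by decide) (by decide) ?_ ?_ ?_, ?_⟩, ?_, ?_⟩
      · intro r hr j
        rw [hrow r (by omega)]
        exact hR.pts r hr j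
      · rw [hall.Q 5 (by decide)]; exact hR.rows
      · rw [hall.Q 9 (by decide)]; exact hR.obj
      · rw [hall.Q 11 (by decide)]; exact hR.weights
      · simp
      · intro q f hf
        rcases lt_trichotomy q L.length with hq | rfl | hq
        · rw [List.getElem?_append_left hq] at hf
          rw [hrow _ (by omega)]
          obtain ⟨g1, g2⟩ := hL.2 q f hf
          refine ⟨?_, g2⟩
          have : q ≠ L.length := by omega
          simp [e1, hσ₁, this, g1]
        · rw [List.getElem?_concat_length, Option.some.injEq] at hf
          subst hf
          refine ⟨by simp [e1, hσ₁], polyOf_congr fun w hw => ?_, by simp⟩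
          have : w ≠ I.dim := by omega
          simp [this, h2 w hw]
        · rw [List.getElem?_eq_none (by simp; omega)] at hf
          exact absurd hf (by simp)
  · simp only [NExp.cost]
    omega

lemma runs_dropPoints {M : Equipment d} (hU : Bounded I I.n U) (hR : Alive I X T σ)
    (hX' : ∀ j : Fin I.n, X j = I.S' j) {i : Fin I.k} {p : MvPolynomial (Fin d) ℝ}
    (hG : ∀ r < I.n + I.m + 1, σ.Q 12 0 r = chowValue I X i p r) :
    Runs M dropPoints σ (budget 1 U 3) fun τ => Same [10] [11] σ τ ∧
      Alive I X (I.filtered T i p (σ.Q 16 0 0)) τ := by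
  have hb := budget_chain_zero hU.U_le
  have ho := hU.o_le
  have hW : ∀ (r : ℕ) (hr : r < I.n), weight I (I.filtered T i p (σ.Q 16 0 0)) r =
      if chowValue I X i p r ≤ σ.Q 16 0 0 then weight I T r else 0 := by
    intro r hr
    have e : chowValue I X i p r = I.absChow i p (I.S' ⟨r, hr⟩) := by
      rw [chowValue, if_pos (by omega), ← hX']
    unfold weight
    rw [dif_pos hr, dif_pos hr, e]
    simp only [Input.filtered, Finset.mem_filter]
    split_ifs <;> first | rfl | tauto
  refine (Runs.forN (w := [10]) (q := [11]) (n := I.n) (U := U) (X := 1) (Y := 1) (a := 1)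
    (fun r τ => ∀ r' < I.n + I.m, τ.Q 11 0 r' =
      if r' < r then weight I (I.filtered T i p (σ.Q 16 0 0)) r' else weight I T r')
    (by decide) le_rfl hU.U_le le_rfl le_rfl (by omega) (fun _ _ _ h => h) ?_
    (by simpa using hR.weights) (by decide) ?_).post ?_
  · intro τ hs
    exact (hR.toLoaded.same hs (by decide) (by decide)).o_eq
  · intro r τ hr hs hτ hJ
    have h12 : τ.Q 12 0 r = chowValue I X i p r := by rw [hs.Q 12 (by decide), hG r (by omega)]
    have h16 : τ.Q 16 = σ.Q 16 := hs.Q 16 (by decide)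
    apply Runs.le
    · apply Runs.ite (c₁ := 1)
      · intro ht
        simp only [Test.Holds, RExp.val, NExp.val, hτ, h12, h16] at ht
        refine Runs.skip ⟨Same.refl _ _ _, hτ, fun r' hr' => ?_⟩
        rw [hJ r' hr']
        by_cases h : r' = r
        · subst h
          rw [if_neg (lt_irrefl _), if_pos (by omega), hW r' hr, if_pos ht]
        · exact if_congr (by omega) rfl rfl
      · intro ht
        simp only [Test.Holds, RExp.val, NExp.val, hτ, h12, h16] at ht
        refine Runs.putR_of_eq 0 r 0 rfl hτ (by simp [RExp.val])
          ⟨(Same.refl _ _ _).setQ (by decide) _ _ _, hτ, fun r' hr' => ?_⟩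
        by_cases h : r' = r
        · subst h
          rw [if_pos (by omega), hW r' hr, if_neg ht]
          simp
        · rw [Mem.setQ_Q, if_neg (by omega), hJ r' hr']
          exact if_congr (by omega) rfl rfl
    · simp only [Test.cost, RExp.cost, NExp.cost]
      omega
  · rintro τ ⟨hs, hJ⟩
    refine ⟨hs, hR.toReady.same hs (by decide) (by decide), fun r hr => ?_⟩
    rw [hJ r hr]
    split_ifs with h
    · rfl
    · simp only [weight, dif_neg h]

end
end ICF

namespace ICF

/-! ### The main loop -/

/-- One iteration; the scalar `9` tells whether the loop is left. -/
def icfStep : Prog :=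
  maximize ;;
  .ite (.leR (rv 15) (rv 22)) (setn 9 (.lit 1))
    (chowValues ;; findThreshold ;; storeFilter ;; dropPoints)

/-- The main loop. -/
def icfLoop : Prog := .loop (.leN (nv 9) (.lit 0)) icfStep

section

variable {d : ℕ} {I : Input d} {U : ℕ} {X : ℕ → Pt d} {σ τ : Mem} {s : Solver} {e : ℕ}
  {T : Finset (Fin I.n)} {L : List (Fin I.k × MvPolynomial (Fin d) ℝ × ℝ)}

lemma runs_icfStep (hI : I.Admissible) (hU : Bounded I I.n U) (hR : Alive I X T σ)
    (hX : ∀ j : Fin I.m, X (I.n + j) = I.S j) (hX' : ∀ j : Fin I.n, X j = I.S' j)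
    (hT : T ⊆ I.S₀) (hL : Stored I I.n L σ) (h9 : σ.N 9 0 0 = 0) :
    Runs (I.equip s e) icfStep σ (budget I.k U (3 * e + 12)) fun τ =>
      ∃ i p, I.IsSolution T i p ∧
        ((I.objective T i p ≤ I.ε ∧ τ.N 9 0 0 = 1 ∧ Alive I X T τ ∧ Stored I I.n L τ) ∨
        (I.ε < I.objective T i p ∧ τ.N 9 0 0 = 0 ∧ ∃ θ, I.IsThreshold T i p θ ∧
          Alive I X (I.filtered T i p θ) τ ∧ Stored I I.n (L ++ [(i, p, θ)]) τ)) := by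
  have hk : 1 ≤ I.k := hI.2.2.1
  have hb := budget_chain_zero hU.U_le
  have hbk : 64 * budget I.k U (3 * e + 11) ≤ budget I.k U (3 * e + 12) :=
    budget_step _ hU.U_le _
  have hb8 : budget 1 U 8 ≤ budget I.k U (3 * e + 11) :=
    (budget_mono hU.U_le (by omega)).trans (budget_one_le hk)
  apply Runs.le
  · apply Runs.bind (runs_maximize hI hU hR hX hX' hT)
    rintro τ₁ ⟨hs1, hA1, i, hi, hsol, hobj⟩
    have hL1 := hL.same hs1 (by decide) (by decide)
    have h91 : τ₁.N 9 0 0 = 0 := by rw [hs1.N 9 (by decide), h9]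
    apply Runs.ite (c₁ := 4)
    · intro ht
      simp only [Test.Holds, RExp.val, NExp.val, hobj, hA1.ε_eq] at ht
      have hs2 : Same [9] [] τ₁ (τ₁.setN 9 0 0 1) := (Same.refl _ _ τ₁).setN (by decide) _ _ _
      exact Runs.putN_of_eq 0 0 1 rfl rfl rfl ⟨i, _, hsol, Or.inl ⟨ht, by simp,
        hA1.same hs2 (by decide) (by decide), hL1.same hs2 (by decide) (by decide)⟩⟩
    · intro ht
      simp only [Test.Holds, RExp.val, NExp.val, hobj, hA1.ε_eq, not_le] at ht
      apply Runs.bind (runs_chowValues hU hA1 i hi)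
      rintro τ₂ ⟨hs2, hG2⟩
      have hA2 := hA1.same hs2 (by decide) (by decide)
      apply Runs.bind (runs_findThreshold hI hU hA2 hX hX' hT hsol.1 ht hG2)
      rintro τ₃ ⟨hs3, hthr⟩
      have hA3 := hA2.same hs3 (by decide) (by decide)
      have hL3 := (hL1.same hs2 (by decide) (by decide)).same hs3 (by decide) (by decide)
      have hi3 : τ₃.N 7 0 0 = i := by rw [hs3.N 7 (by decide), hs2.N 7 (by decide), hi]
      have h17 : τ₃.Q 17 = τ₁.Q 17 := by rw [hs3.Q 17 (by decide), hs2.Q 17 (by decide)]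
      apply Runs.bind (runs_storeFilter hU hA3 hL3 hi3)
      rintro τ₄ ⟨hs4, hA4, hL4⟩
      have hG4 : ∀ r < I.n + I.m + 1, τ₄.Q 12 0 r =
          chowValue I X i (polyOf d I.dim (τ₁.Q 17 0)) r := by
        rw [hs4.Q 12 (by decide), hs3.Q 12 (by decide)]
        exact hG2
      refine (runs_dropPoints hU hA4 hX' hG4).post ?_
      rintro τ₅ ⟨hs5, hA5⟩
      rw [hs4.Q 16 (by decide)] at hA5
      rw [h17] at hL4
      refine ⟨i, _, hsol, Or.inr ⟨ht, ?_, _, hthr, hA5, hL4.same hs5 (by decide) (by decide)⟩⟩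
      rw [hs5.N 9 (by decide), hs4.N 9 (by decide), hs3.N 9 (by decide), hs2.N 9 (by decide), h91]
  · simp only [Test.cost, RExp.cost, NExp.cost]
    omega

/-- Induction on a bound `c` for the number of surviving points, which each filtering step decreases
strictly. For `c = 0` no such step is possible, so the next iteration must leave the loop. -/
lemma runs_icfLoop (hI : I.Admissible) (hU : Bounded I I.n U)
    (hX : ∀ j : Fin I.m, X (I.n + j) = I.S j) (hX' : ∀ j : Fin I.n, X j = I.S' j)
    (c : ℕ) : ∀ (T : Finset (Fin I.n)) (L : List (Fin I.k × MvPolynomial (Fin d) ℝ × ℝ)) (σ : Mem),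
    T.card ≤ c → T ⊆ I.S₀ → Alive I X T σ → Stored I I.n L σ → σ.N 9 0 0 = 0 →
    Runs (I.equip s e) icfLoop σ ((c + 1) * (budget I.k U (3 * e + 12) + 5) + 5) fun τ =>
      ∃ L', I.Loop T L' ∧ Loaded I I.n X τ ∧ Stored I I.n (L ++ L') τ := by
  have hend : ∀ (T : Finset (Fin I.n)) (L : List (Fin I.k × MvPolynomial (Fin d) ℝ × ℝ))
      (σ : Mem), Alive I X T σ → Stored I I.n L σ → σ.N 9 0 0 = 1 → (∃ i p, I.IsSolution T i p ∧
      I.objective T i p ≤ I.ε) → Runs (I.equip s e) icfLoop σ 5 fun τ =>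
      ∃ L', I.Loop T L' ∧ Loaded I I.n X τ ∧ Stored I I.n (L ++ L') τ := by
    rintro T L σ hA hL h9 ⟨i, p, hsol, hle⟩
    refine Runs.loop_exit ?_ ⟨[], .halt T i p hsol hle, hA.toLoaded, by simpa using hL⟩
    simp [Test.Holds, NExp.val, h9]
  induction c with
  | zero =>
    intro T L σ hc hT hA hL h9
    have hht : (Test.leN (nv 9) (.lit 0)).Holds σ := by simp [Test.Holds, NExp.val, h9]
    refine (Runs.loop_succ (c₂ := 5) hht (runs_icfStep hI hU hA hX hX' hT hL h9) ?_).le ?_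
    · rintro τ ⟨i, p, hsol, ⟨hle, h9', hA', hL'⟩ | ⟨hgt, h9', θ, hθ, -⟩⟩
      · exact hend T L τ hA' hL' h9' ⟨i, p, hsol, hle⟩
      · have := Input.filtered_card_lt hI hθ
        omega
    · simp only [Test.cost, NExp.cost]
      omega
  | succ c ih =>
    intro T L σ hc hT hA hL h9
    have hht : (Test.leN (nv 9) (.lit 0)).Holds σ := by simp [Test.Holds, NExp.val, h9]
    refine (Runs.loop_succ (c₂ := (c + 1) * (budget I.k U (3 * e + 12) + 5) + 5) hht
      (runs_icfStep hI hU hA hX hX' hT hL h9) ?_).le ?_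
    · rintro τ ⟨i, p, hsol, ⟨hle, h9', hA', hL'⟩ | ⟨hgt, h9', θ, hθ, hA', hL'⟩⟩
      · exact (hend T L τ hA' hL' h9' ⟨i, p, hsol, hle⟩).le (by omega)
      · have hlt := Input.filtered_card_lt hI hθ
        refine (ih (I.filtered T i p θ) _ τ (by omega) ((Finset.filter_subset _ _).trans hT) hA' hL'
          h9').post ?_
        rintro υ ⟨L', hloop, hLo, hSt⟩
        exact ⟨(i, p, θ) :: L', .step T i p θ L' hsol hgt hθ hloop, hLo, by simpa using hSt⟩
    · simp only [Test.cost, NExp.cost]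
      have : (c + 1 + 1) * (budget I.k U (3 * e + 12) + 5) =
          (c + 1) * (budget I.k U (3 * e + 12) + 5) + (budget I.k U (3 * e + 12) + 5) := by ring
      omega

end

/-! ### The description of the selector -/

/-- Write the description. -/
def writeDesc : Prog :=
  .putN 1 (.lit 0) (.lit 0) (nv 20) ;; .putN 1 (.lit 0) (.lit 1) (nv 21) ;;
  .putN 1 (.lit 0) (.lit 2) (nv 22) ;; .putN 1 (.lit 0) (.lit 3) (nv 23) ;;
  .putN 1 (.lit 0) (.lit 4) (nv 25) ;;
  .putR 1 (.lit 0) (.lit 0) (rv 20) ;; .putR 1 (.lit 0) (.lit 1) (rv 21) ;;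
  .putR 1 (.lit 0) (.lit 2) (rv 22) ;;
  setn 16 (.lit 3) ;;
  forN 10 (.add (nv 23) (nv 25)) (forN 11 (.add (nv 21) (.lit 1))
    (.putR 1 (.lit 0) (nv 16) (.get 3 (.add (nv 24) (nv 10)) (nv 11)) ;;
    setn 16 (.add (nv 16) (.lit 1)))) ;;
  setn 0 (.add (.lit 5) (nv 25)) ;; .putN 0 (.lit 0) (.lit 1) (nv 16)

/-- `D` describes the reference sample, the parameters, and the filters `L`. -/
structure Describes {d : ℕ} (I : Input d) (L : List (Fin I.k × MvPolynomial (Fin d) ℝ × ℝ))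
    (D : Desc) : Prop where
  nats_length : D.nats.length = 5 + L.length
  reals_length : D.reals.length = 3 + (I.m + L.length) * (I.dim + 1)
  d_eq : D.nats.getD 0 0 = d
  dim_eq : D.nats.getD 1 0 = I.dim
  k_eq : D.nats.getD 2 0 = I.k
  m_eq : D.nats.getD 3 0 = I.m
  t_eq : D.nats.getD 4 0 = L.length
  R_eq : D.reals.getD 0 0 = I.R
  β_eq : D.reals.getD 1 0 = I.β
  ε_eq : D.reals.getD 2 0 = I.ε
  pts : ∀ (j : Fin I.m) (i : Fin d), D.reals.getD (3 + (j * (I.dim + 1) + i)) 0 = I.S j i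
  filters : ∀ q f, L[q]? = some f → D.nats.getD (5 + q) 0 = f.1 ∧
    f.2.1 = polyOf d I.dim (fun w => D.reals.getD (3 + ((I.m + q) * (I.dim + 1) + w)) 0) ∧
    D.reals.getD (3 + ((I.m + q) * (I.dim + 1) + I.dim)) 0 = f.2.2

section

variable {d : ℕ} {I : Input d} {o U : ℕ} {X : ℕ → Pt d} {σ τ : Mem} {M : Equipment d}
  {L : List (Fin I.k × MvPolynomial (Fin d) ℝ × ℝ)}

lemma div_mod_flat (r : ℕ) {w N : ℕ} (hw : w < N + 1) :
    (r * (N + 1) + w) / (N + 1) = r ∧ (r * (N + 1) + w) % (N + 1) = w := by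
  constructor
  · rw [mul_comm, Nat.mul_add_div (by omega), Nat.div_eq_of_lt hw, add_zero]
  · rw [mul_comm, Nat.mul_add_mod, Nat.mod_eq_of_lt hw]

lemma flat_lt {r w N R : ℕ} (hw : w < N + 1) (hr : r < R) : r * (N + 1) + w < R * (N + 1) := by
  calc r * (N + 1) + w < (r + 1) * (N + 1) := by rw [Nat.succ_mul]; omega
    _ ≤ R * (N + 1) := Nat.mul_le_mul_right _ hr

lemma Mem.desc_nats_getD {j : ℕ} (hj : j < σ.N 0 0 0) : σ.desc.nats.getD j 0 = σ.N 1 0 j := by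
  rw [List.getD_eq_getElem _ _ (by simpa [Mem.desc] using hj)]
  simp [Mem.desc]

lemma Mem.desc_reals_getD {j : ℕ} (hj : j < σ.N 0 0 1) : σ.desc.reals.getD j 0 = σ.Q 1 0 j := by
  rw [List.getD_eq_getElem _ _ (by simpa [Mem.desc] using hj)]
  simp [Mem.desc]

/-- The write position is a running counter, since the machine does not multiply naturals. The
invariant speaks of flat positions, which are decoded by division by `I.dim + 1` at the end. -/
lemma runs_writeTable (hU : Bounded I o U) (hR : Loaded I o X σ) {t : ℕ} (ht : σ.N 25 0 0 = t)
    (htU : I.m + t ≤ U) (h16 : σ.N 16 0 0 = 3) :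
    Runs M (forN 10 (.add (nv 23) (nv 25)) (forN 11 (.add (nv 21) (.lit 1))
      (.putR 1 (.lit 0) (nv 16) (.get 3 (.add (nv 24) (nv 10)) (nv 11)) ;;
      setn 16 (.add (nv 16) (.lit 1))))) σ (budget 1 U 5) fun τ => Same [10, 11, 16] [1] σ τ ∧
      τ.N 16 0 0 = 3 + (I.m + t) * (I.dim + 1) ∧ (∀ j < 3, τ.Q 1 0 j = σ.Q 1 0 j) ∧
      ∀ r < I.m + t, ∀ w < I.dim + 1, τ.Q 1 0 (3 + (r * (I.dim + 1) + w)) = σ.Q 3 (o + r) w := by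
  have hb := budget_chain_zero hU.U_le
  have hdim := hU.dim_le
  obtain ⟨F, hF⟩ : ∃ F : ℕ → ℝ, F = fun p => σ.Q 3 (o + p / (I.dim + 1)) (p % (I.dim + 1)) :=
    ⟨_, rfl⟩
  refine (Runs.forN (w := [10, 11, 16]) (q := [1]) (n := I.m + t) (U := U) (X := 1) (Y := 1)
    (a := 3) (fun r τ => τ.N 16 0 0 = 3 + r * (I.dim + 1) ∧ (∀ j < 3, τ.Q 1 0 j = σ.Q 1 0 j) ∧
      ∀ p < r * (I.dim + 1), τ.Q 1 0 (3 + p) = F p)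
    (by decide) le_rfl hU.U_le le_rfl le_rfl (by omega) ?_ ?_ ⟨by simpa using h16, by simp, by simp⟩
    (by decide) ?_).post ?_
  · rintro i τ x ⟨h1, h2⟩
    exact ⟨by simpa using h1, h2⟩
  · intro τ hs
    simp only [NExp.val]
    rw [hs.N 23 (by decide), hs.N 25 (by decide), hR.m_eq, ht]
  · rintro r τ hr hs hτ ⟨h1, h2, h3⟩
    refine (Runs.forN (w := [11, 16]) (q := [1]) (n := I.dim + 1) (U := U) (X := 1) (Y := 1)
      (a := 1) (fun w τ => τ.N 16 0 0 = 3 + (r * (I.dim + 1) + w) ∧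
        (∀ j < 3, τ.Q 1 0 j = σ.Q 1 0 j) ∧ ∀ p < r * (I.dim + 1) + w, τ.Q 1 0 (3 + p) = F p)
      (by decide) le_rfl hU.U_le le_rfl le_rfl (by omega) ?_ ?_ ⟨by simpa using h1, h2, h3⟩
      (by decide) ?_).post ?_
    · rintro i τ x ⟨h1, h2⟩
      exact ⟨by simpa using h1, h2⟩
    · intro υ hu
      simp only [NExp.val]
      rw [hu.N 21 (by decide), hs.N 21 (by decide), hR.dim_eq]
    · rintro w υ hw hu hυ ⟨g1, g2, g3⟩
      have e3 : υ.Q 3 = σ.Q 3 := by rw [hu.Q 3 (by decide), hs.Q 3 (by decide)]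
      have e24 : υ.N 24 0 0 = o := by rw [hu.N 24 (by decide), hs.N 24 (by decide), hR.o_eq]
      have e10 : υ.N 10 0 0 = r := by rw [hu.N 10 (by decide), hτ]
      apply Runs.le
      · apply Runs.putR_seq_of_eq 0 (3 + (r * (I.dim + 1) + w)) (F (r * (I.dim + 1) + w)) rfl
          (by exact g1)
          (by
            rw [hF]
            simp only [RExp.val, NExp.val, e24, e10, hυ, e3, div_mod_flat r hw])
        refine Runs.putN_of_eq 0 0 (3 + (r * (I.dim + 1) + (w + 1))) rfl rfl
          (by simp only [NExp.val, Mem.setQ_N, g1]; ring)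
          ⟨((Same.refl _ _ υ).setQ (by decide) _ _ _).setN (by decide) _ _ _, by simp [hυ],
            by simp, ?_, ?_⟩
        · intro j hj
          have : j ≠ 3 + (r * (I.dim + 1) + w) := by omega
          simp [this, g2 j hj]
        · intro p hp
          by_cases h : p = r * (I.dim + 1) + w
          · simp [h]
          · simp [h, g3 p (by omega)]
      · simp only [RExp.cost, NExp.cost]
        omega
    · rintro υ ⟨hu, g1, g2, g3⟩
      refine ⟨hu.mono (by decide) (by decide), by rw [hu.N 10 (by decide), hτ], ?_, g2, ?_⟩
      · rw [g1]; ring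
      · intro p hp
        rw [Nat.succ_mul] at hp
        exact g3 p hp
  · rintro τ ⟨hs, h1, h2, h3⟩
    refine ⟨hs, h1, h2, fun r hr w hw => ?_⟩
    rw [h3 _ (flat_lt hw hr), hF]
    simp only [div_mod_flat r hw]

/-- Tameness needs only the parameters and the reference sample, and the filters are explicit, so
the test sample is not written. -/
lemma runs_writeDesc (hU : Bounded I o U) (hd : d ≤ I.dim) (hR : Loaded I o X σ)
    (hX : ∀ j : Fin I.m, X (o + j) = I.S j) (hL : Stored I o L σ) (ht : I.m + L.length ≤ U) :
    Runs M writeDesc σ (budget 1 U 6) fun τ => Describes I L τ.desc := by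
  have hb := budget_chain_zero hU.U_le
  apply Runs.le
  · apply Runs.putN_seq_of_eq 0 0 d rfl rfl (by exact hR.d_eq)
    apply Runs.putN_seq_of_eq 0 1 I.dim rfl rfl (by simp [NExp.val, hR.dim_eq])
    apply Runs.putN_seq_of_eq 0 2 I.k rfl rfl (by simp [NExp.val, hR.k_eq])
    apply Runs.putN_seq_of_eq 0 3 I.m rfl rfl (by simp [NExp.val, hR.m_eq])
    apply Runs.putN_seq_of_eq 0 4 L.length rfl rfl (by simp [NExp.val, hL.1])
    apply Runs.putR_seq_of_eq 0 0 I.R rfl rfl (by simp [RExp.val, NExp.val, hR.R_eq])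
    apply Runs.putR_seq_of_eq 0 1 I.β rfl rfl (by simp [RExp.val, NExp.val, hR.β_eq])
    apply Runs.putR_seq_of_eq 0 2 I.ε rfl rfl (by simp [RExp.val, NExp.val, hR.ε_eq])
    apply Runs.putN_seq_of_eq 0 0 3 rfl rfl rfl
    obtain ⟨σ₁, hσ₁⟩ : ∃ σ₁, σ₁ = ((((((((σ.setN 1 0 0 d).setN 1 0 1 I.dim).setN 1 0 2 I.k).setN
      1 0 3 I.m).setN 1 0 4 L.length).setQ 1 0 0 I.R).setQ 1 0 1 I.β).setQ 1 0 2 I.ε).setN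
      16 0 0 3 := ⟨_, rfl⟩
    have hs1 : Same [1, 16] [1] σ σ₁ := by
      rw [hσ₁]
      exact (((((((((Same.refl _ _ σ).setN (by decide) _ _ _).setN (by decide) _ _ _).setN
        (by decide) _ _ _).setN (by decide) _ _ _).setN (by decide) _ _ _).setQ
        (by decide) _ _ _).setQ (by decide) _ _ _).setQ (by decide) _ _ _).setN (by decide) _ _ _
    rw [← hσ₁]
    have hR1 := hR.same hs1 (by decide) (by decide)
    have h25 : σ₁.N 25 0 0 = L.length := by rw [hs1.N 25 (by decide), hL.1]
    apply Runs.bind (runs_writeTable hU hR1 h25 ht (by rw [hσ₁]; simp))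
    rintro τ ⟨hs, h16, hq, htab⟩
    have h25' : τ.N 25 0 0 = L.length := by rw [hs.N 25 (by decide), h25]
    apply Runs.putN_seq_of_eq 0 0 (5 + L.length) rfl rfl (by simp [NExp.val, h25'])
    refine Runs.putN_of_eq 0 1 (3 + (I.m + L.length) * (I.dim + 1)) rfl rfl
      (by simp [NExp.val, h16]) ?_
    obtain ⟨υ, hυ⟩ : ∃ υ, υ = (τ.setN 0 0 0 (5 + L.length)).setN 0 0 1
      (3 + (I.m + L.length) * (I.dim + 1)) := ⟨_, rfl⟩
    rw [← hυ]
    have hn : υ.N 0 0 0 = 5 + L.length := by rw [hυ]; simp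
    have hr : υ.N 0 0 1 = 3 + (I.m + L.length) * (I.dim + 1) := by rw [hυ]; simp
    have hN1 : ∀ j < 5 + L.length, υ.desc.nats.getD j 0 = σ₁.N 1 0 j := fun j hj => by
      rw [Mem.desc_nats_getD (by omega), hυ, ← hs.N 1 (by decide)]
      simp
    have hQ1 : ∀ j < 3, υ.desc.reals.getD j 0 = σ₁.Q 1 0 j := fun j hj => by
      rw [Mem.desc_reals_getD (by omega), hυ, ← hq j hj]
      simp
    have hQ2 : ∀ r < I.m + L.length, ∀ w < I.dim + 1,
        υ.desc.reals.getD (3 + (r * (I.dim + 1) + w)) 0 = σ.Q 3 (o + r) w := fun r hr' w hw => by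
      have := flat_lt hw hr'
      rw [Mem.desc_reals_getD (by omega), ← hs1.Q 3 (by decide), ← htab r hr' w hw, hυ]
      simp
    refine ⟨?_, ?_, ?_, ?_, ?_, ?_, ?_, ?_, ?_, ?_, ?_, ?_⟩
    · simp [Mem.desc, hn]
    · simp [Mem.desc, hr]
    · rw [hN1 0 (by omega), hσ₁]; simp
    · rw [hN1 1 (by omega), hσ₁]; simp
    · rw [hN1 2 (by omega), hσ₁]; simp
    · rw [hN1 3 (by omega), hσ₁]; simp
    · rw [hN1 4 (by omega), hσ₁]; simp
    · rw [hQ1 0 (by omega), hσ₁]; simp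
    · rw [hQ1 1 (by omega), hσ₁]; simp
    · rw [hQ1 2 (by omega), hσ₁]; simp
    · intro j i
      rw [hQ2 j (by omega) i (by omega), hR.pts _ (by omega) i, hX]
    · intro q f hf
      have hq : q < L.length := by
        by_contra hcon
        rw [List.getElem?_eq_none (by omega)] at hf
        exact absurd hf (by simp)
      obtain ⟨g1, g2, g3⟩ := hL.2 q f hf
      refine ⟨?_, ?_, ?_⟩
      · rw [hN1 _ (by omega), ← g1, hσ₁]
        simp [show 5 + q ≠ 4 by omega, show 5 + q ≠ 3 by omega, show 5 + q ≠ 2 by omega,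
          show 5 + q ≠ 1 by omega]
      · rw [g2]
        refine polyOf_congr fun w hw => ?_
        rw [hQ2 _ (by omega) w (by omega), add_assoc]
      · rw [hQ2 _ (by omega) _ (by omega), ← g3, add_assoc]
  · simp only [RExp.cost, NExp.cost]
    omega

end
end ICF

namespace ICF

/-! ### The filtering program -/

/-- Copy points from the array `a` to the array `3`. -/
def copyPoints (a : ℕ) (rows off : NExp) : Prog :=
  forN 10 rows (forN 11 (nv 20) (.putR 3 (.add off (nv 10)) (nv 11) (.get a (nv 10) (nv 11))))

/-- The scalar `21` becomes the number of monomials. -/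
def countMonomials : Prog :=
  -- The power `(d + 1) ^ deg` is built by repeated addition: each round adds the old value `d`
  -- times to itself.
  setn 21 (.lit 1) ;;
  forN 10 (.get 0 (.lit 0) (.lit 1))
    (setn 12 (nv 21) ;; forN 11 (nv 20) (setn 21 (.add (nv 21) (nv 12))))

/-- Bring the input to the layout of `Loaded`. -/
def loadInput : Prog :=
  setn 20 (.get 0 (.lit 0) (.lit 0)) ;; setn 22 (.get 0 (.lit 0) (.lit 2)) ;;
  setn 23 (.get 0 (.lit 0) (.lit 3)) ;; setn 24 (.get 0 (.lit 0) (.lit 4)) ;;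
  setr 20 (.get 0 (.lit 0) (.lit 0)) ;; setr 21 (.get 0 (.lit 0) (.lit 1)) ;;
  setr 22 (.get 0 (.lit 0) (.lit 2)) ;;
  countMonomials ;; copyPoints 2 (nv 24) (.lit 0) ;; copyPoints 1 (nv 23) (nv 24)

/-- Weights that represent the tame points. -/
def initWeights : Prog :=
  forN 10 (nv 24)
    (tameTest ;;
    .ite (.leN (.lit 1) (nv 6)) (.putR 11 (.lit 0) (nv 10) (.div (.lit 1) (.ofN (nv 24))))
      (.putR 11 (.lit 0) (nv 10) (.lit 0))) ;;
  forN 10 (nv 23) (.putR 11 (.lit 0) (.add (nv 24) (nv 10))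
    (.sub (.lit 0) (.div (rv 20) (.ofN (nv 23)))))

/-- Iterative Chow filtering. -/
def icfProgram : Prog :=
  loadInput ;; featureTable ;; setup ;; initWeights ;; icfLoop ;; writeDesc

section

variable {d : ℕ} {I : Input d} {o U : ℕ} {X : ℕ → Pt d} {σ τ : Mem} {s : Solver} {e : ℕ}
  {M : Equipment d}

lemma runs_copyPoints {a c n : ℕ} {rows off : NExp} (hU : 64 ≤ U) (ha : a ≠ 3) (hnU : n ≤ U)
    (hdU : d ≤ U) (hd : σ.N 20 0 0 = d) (hrows : ∀ τ, Same [10, 11] [3] σ τ → rows.val τ = n)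
    (hoff : ∀ τ, Same [10, 11] [3] σ τ → off.val τ = c) (hc : rows.cost ≤ 16)
    (hc' : off.cost ≤ 16) :
    Runs M (copyPoints a rows off) σ (budget 1 U 5) fun τ => Same [10, 11] [3] σ τ ∧
      (∀ r < c, τ.Q 3 r = σ.Q 3 r) ∧ ∀ r < n, ∀ j < d, τ.Q 3 (c + r) j = σ.Q a r j := by
  have hb := budget_chain_zero hU
  refine Runs.forN (w := [10, 11]) (q := [3]) (n := n) (U := U) (X := 1) (Y := 1)
    (a := 3) (fun r τ => (∀ r < c, τ.Q 3 r = σ.Q 3 r) ∧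
      ∀ r' < r, ∀ j < d, τ.Q 3 (c + r') j = σ.Q a r' j)
    (by decide) le_rfl hU le_rfl le_rfl (by omega) (fun _ _ _ h => h) hrows ⟨by simp, by simp⟩ hc ?_
  rintro r τ hr hs hτ ⟨h1, h2⟩
  refine (Runs.forN (w := [11]) (q := [3]) (n := d) (U := U) (X := 1) (Y := 1)
    (a := 1) (fun j τ => (∀ r < c, τ.Q 3 r = σ.Q 3 r) ∧
      (∀ r' < r, ∀ j < d, τ.Q 3 (c + r') j = σ.Q a r' j) ∧ ∀ j' < j, τ.Q 3 (c + r) j' = σ.Q a r j')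
    (by decide) le_rfl hU le_rfl le_rfl (by omega) (fun _ _ _ h => h) ?_ ⟨h1, h2, by simp⟩
    (by decide) ?_).post ?_
  · intro υ hu
    simp only [NExp.val]
    rw [hu.N 20 (by decide), hs.N 20 (by decide), hd]
  · rintro j υ hj hu hυ ⟨g1, g2, g3⟩
    have hall : Same [10, 11] [3] σ υ := hs.trans (hu.mono (by decide) (by decide))
    have e10 : υ.N 10 0 0 = r := by rw [hu.N 10 (by decide), hτ]
    have ea : υ.Q a = σ.Q a := hall.Q a (by simpa using ha)
    apply Runs.le
    · refine Runs.putR_of_eq (c + r) j (σ.Q a r j) (by simp [NExp.val, hoff υ hall, e10]) hυ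
        (by simp [RExp.val, NExp.val, e10, hυ, ea])
        ⟨(Same.refl _ _ υ).setQ (by decide) _ _ _, hυ, ?_, ?_, ?_⟩
      · intro r' hr'
        rw [← g1 r' hr']
        funext j'
        have : r' ≠ c + r := by omega
        simp [this]
      · intro r' hr' j' hj'
        have : r' ≠ r := by omega
        simp [this, g2 r' hr' j' hj']
      · intro j' hj'
        by_cases h : j' = j
        · simp [h]
        · simp [h, g3 j' (by omega)]
    · simp only [RExp.cost, NExp.cost]
      omega
  · rintro υ ⟨hu, g1, g2, g3⟩
    refine ⟨hu.mono (by decide) (by decide), by rw [hu.N 10 (by decide), hτ], g1, ?_⟩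
    intro r' hr' j hj
    rcases Nat.lt_succ_iff_lt_or_eq.1 hr' with h | rfl
    · exact g2 r' h j hj
    · exact g3 j hj

lemma runs_countMonomials (hU : Bounded I o U) (hd : σ.N 20 0 0 = d) (hl : σ.N 0 0 1 = I.deg) :
    Runs M countMonomials σ (budget 1 U 7) fun τ => Same [10, 11, 12, 21] [] σ τ ∧
      τ.N 21 0 0 = I.dim := by
  have hb := budget_chain_zero hU.U_le
  have hdU := hU.d_le
  have hlU := hU.deg_le
  apply Runs.le
  · apply Runs.putN_seq_of_eq 0 0 1 rfl rfl rfl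
    have hs0 : Same [10, 11, 12, 21] [] σ (σ.setN 21 0 0 1) :=
      (Same.refl _ _ σ).setN (by decide) _ _ _
    refine (Runs.forN (w := [10, 11, 12, 21]) (q := []) (n := I.deg) (U := U) (X := 1) (Y := 1)
      (a := 4) (b := 6) (fun r τ => τ.N 21 0 0 = (d + 1) ^ r)
      (by decide) le_rfl hU.U_le le_rfl le_rfl (by omega) (fun _ _ _ h => by simpa using h) ?_
      (by simp) (by decide) ?_).post ?_
    · intro τ hs
      simp only [NExp.val]
      rw [hs.N 0 (by decide)]
      simpa using hl
    · intro r τ hr hs hτ hJ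
      apply Runs.le
      · apply Runs.putN_seq_of_eq 0 0 ((d + 1) ^ r) rfl rfl (by exact hJ)
        have hs1 : Same [12] [] τ (τ.setN 12 0 0 ((d + 1) ^ r)) :=
          (Same.refl _ _ τ).setN (by decide) _ _ _
        refine (Runs.forN (w := [11, 21]) (q := []) (n := d) (U := U) (X := 1) (Y := 1)
          (a := 1) (b := 3) (fun j τ => τ.N 21 0 0 = (j + 1) * (d + 1) ^ r)
          (by decide) le_rfl hU.U_le le_rfl le_rfl (by omega) (fun _ _ _ h => by simpa using h) ?_
          (by simp [hJ]) (by decide) ?_).post ?_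
        · intro υ hu
          simp only [NExp.val]
          rw [hu.N 20 (by decide), hs1.N 20 (by decide), hs.N 20 (by decide)]
          simpa using hd
        · intro j υ hj hu hυ g
          have e12 : υ.N 12 0 0 = (d + 1) ^ r := by rw [hu.N 12 (by decide)]; simp
          apply Runs.le
          · refine Runs.putN_of_eq 0 0 ((j + 1 + 1) * (d + 1) ^ r) rfl rfl
              (by simp only [NExp.val, g, e12]; ring)
              ⟨(Same.refl _ _ υ).setN (by decide) _ _ _, by simp [hυ], by simp⟩
          · simp only [NExp.cost]
            omega
        · rintro υ ⟨hu, g⟩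
          refine ⟨(hs1.mono (by decide) (by decide)).trans (hu.mono (by decide) (by decide)), ?_, ?_⟩
          · rw [hu.N 10 (by decide), hs1.N 10 (by decide), hτ]
          · rw [g, pow_succ, mul_comm]
      · simp only [NExp.cost]
        omega
    · rintro τ ⟨hs, hJ⟩
      exact ⟨hs0.trans hs, hJ⟩
  · simp only [NExp.cost]
    omega

/-- The test sample followed by the reference sample. -/
noncomputable def samplePoint (I : Input d) (r : ℕ) : Pt d :=
  if h : r < I.n then I.S' ⟨r, h⟩ else if h : r - I.n < I.m then I.S ⟨r - I.n, h⟩ else 0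

lemma samplePoint_test (j : Fin I.n) : samplePoint I j = I.S' j := by
  rw [samplePoint, dif_pos j.2]

lemma samplePoint_reference (j : Fin I.m) : samplePoint I (I.n + j) = I.S j := by
  rw [samplePoint, dif_neg (by omega), dif_pos (by simp)]
  congr
  simp

lemma runs_loadInput (hU : Bounded I I.n U) :
    Runs M loadInput I.mem (budget 1 U 8) fun τ =>
      Same [10, 11, 12, 20, 21, 22, 23, 24] [3, 20, 21, 22] I.mem τ ∧
      Loaded I I.n (samplePoint I) τ := by
  have hb := budget_chain_zero hU.U_le
  have ho := hU.o_le
  have hd := hU.d_le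
  apply Runs.le
  · apply Runs.putN_seq_of_eq 0 0 d rfl rfl (by simp [NExp.val, Input.mem])
    apply Runs.putN_seq_of_eq 0 0 I.k rfl rfl (by simp [NExp.val, Input.mem])
    apply Runs.putN_seq_of_eq 0 0 I.m rfl rfl (by simp [NExp.val, Input.mem])
    apply Runs.putN_seq_of_eq 0 0 I.n rfl rfl (by simp [NExp.val, Input.mem])
    apply Runs.putR_seq_of_eq 0 0 I.R rfl rfl (by simp [RExp.val, NExp.val, Input.mem])
    apply Runs.putR_seq_of_eq 0 0 I.β rfl rfl (by simp [RExp.val, NExp.val, Input.mem])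
    apply Runs.putR_seq_of_eq 0 0 I.ε rfl rfl (by simp [RExp.val, NExp.val, Input.mem])
    obtain ⟨σ, hσ⟩ : ∃ σ, σ = ((((((I.mem.setN 20 0 0 d).setN 22 0 0 I.k).setN 23 0 0 I.m).setN
      24 0 0 I.n).setQ 20 0 0 I.R).setQ 21 0 0 I.β).setQ 22 0 0 I.ε := ⟨_, rfl⟩
    have hs0 : Same [20, 22, 23, 24] [20, 21, 22] I.mem σ := by
      rw [hσ]
      exact (((((((Same.refl _ _ I.mem).setN (by decide) _ _ _).setN (by decide) _ _ _).setN
        (by decide) _ _ _).setN (by decide) _ _ _).setQ (by decide) _ _ _).setQ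
        (by decide) _ _ _).setQ (by decide) _ _ _
    rw [← hσ]
    apply Runs.bind (runs_countMonomials hU (by rw [hσ]; simp)
      (by rw [hs0.N 0 (by decide)]; simp [Input.mem]))
    rintro τ₁ ⟨hs1, h21⟩
    have e20 : τ₁.N 20 0 0 = d := by rw [hs1.N 20 (by decide), hσ]; simp
    have e22 : τ₁.N 22 0 0 = I.k := by rw [hs1.N 22 (by decide), hσ]; simp
    have e23 : τ₁.N 23 0 0 = I.m := by rw [hs1.N 23 (by decide), hσ]; simp
    have e24 : τ₁.N 24 0 0 = I.n := by rw [hs1.N 24 (by decide), hσ]; simp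
    apply Runs.bind (runs_copyPoints (n := I.n) (c := 0) (U := U) hU.U_le (by decide) (by omega)
      (by omega) e20 (fun υ hu => by simp only [NExp.val]; rw [hu.N 24 (by decide), e24])
      (fun _ _ => rfl) (by decide) (by decide))
    rintro τ₂ ⟨hs2, -, hcopy2⟩
    refine (runs_copyPoints (n := I.m) (c := I.n) (U := U) hU.U_le (by decide) (by omega)
      (by omega) (by rw [hs2.N 20 (by decide), e20])
      (fun υ hu => by simp only [NExp.val]; rw [hu.N 23 (by decide), hs2.N 23 (by decide), e23])
      (fun υ hu => by simp only [NExp.val]; rw [hu.N 24 (by decide), hs2.N 24 (by decide), e24])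
      (by decide) (by decide)).post ?_
    rintro τ₃ ⟨hs3, hkeep, hcopy3⟩
    have hs13 : Same [10, 11] [3] τ₁ τ₃ := hs2.trans hs3
    refine ⟨((hs0.mono (by decide) (by decide)).trans (hs1.mono (by decide) (by decide))).trans
      (hs13.mono (by decide) (by decide)), ?_, ?_, ?_, ?_, ?_, ?_, ?_, ?_, ?_⟩
    · rw [hs13.N 20 (by decide), e20]
    · rw [hs13.N 21 (by decide), h21]
    · rw [hs13.N 22 (by decide), e22]
    · rw [hs13.N 23 (by decide), e23]
    · rw [hs13.N 24 (by decide), e24]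
    · rw [hs13.Q 20 (by decide), hs1.Q 20 (by decide), hσ]; simp
    · rw [hs13.Q 21 (by decide), hs1.Q 21 (by decide), hσ]; simp
    · rw [hs13.Q 22 (by decide), hs1.Q 22 (by decide), hσ]; simp
    · intro r hr j
      by_cases h : r < I.n
      · have := hcopy2 r h j j.2
        rw [zero_add] at this
        rw [hkeep r h, this, hs1.Q 2 (by decide), hs0.Q 2 (by decide), samplePoint, dif_pos h]
        simp [Input.mem, h]
      · obtain ⟨r', rfl⟩ : ∃ r', r = I.n + r' := ⟨r - I.n, by omega⟩
        have h' : r' < I.m := by omega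
        have := samplePoint_reference (I := I) ⟨r', h'⟩
        simp only at this
        rw [hcopy3 r' h' j j.2, hs2.Q 1 (by decide), hs1.Q 1 (by decide), hs0.Q 1 (by decide), this]
        simp [Input.mem, h']
  · simp only [RExp.cost, NExp.cost]
    omega

lemma runs_initWeights (hI : I.Admissible) (hU : Bounded I I.n U) (hR : Ready I I.n X σ)
    (hX : ∀ j : Fin I.m, X (I.n + j) = I.S j) (hX' : ∀ j : Fin I.n, X j = I.S' j) :
    Runs (I.equip s e) initWeights σ (budget I.k U (3 * e + 13)) fun τ =>
      Same [4, 5, 6, 10, 11, 12, 13] [5, 9, 10, 11, 14] σ τ ∧ Alive I X I.S₀ τ := by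
  classical
  have hk : 1 ≤ I.k := hI.2.2.1
  have hb := budget_chain_zero hU.U_le
  have hbk := budget_chain hk hU.U_le (3 * e + 9)
  have h1k : budget 1 U 3 ≤ budget I.k U (3 * e + 9) :=
    (budget_mono hU.U_le (by omega)).trans (budget_one_le hk)
  have ho := hU.o_le
  apply Runs.le
  -- Here `Y = k`: each tameness test already carries the factor `k`, which is passed on, and the
  -- rounds are absorbed by `U`.
  · apply Runs.bind (Runs.forN (w := [4, 5, 6, 10, 11, 12, 13]) (q := [5, 9, 10, 11, 14])
      (n := I.n) (U := U) (X := I.k) (Y := I.k) (a := 3 * e + 10) (b := 3 * e + 12)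
      (fun r τ => Ready I I.n X τ ∧ ∀ r' < r, τ.Q 11 0 r' = weight I I.S₀ r')
      (by decide) le_rfl hU.U_le hk hk (by rw [mul_comm]; exact Nat.mul_le_mul_left _ (by omega))
      ?_ ?_ ⟨hR, by simp⟩ (by decide) ?_)
    · rintro τ ⟨hs, hRτ, hJ⟩
      refine (Runs.forN (w := [10]) (q := [11]) (n := I.m) (U := U) (X := 1) (Y := 1) (a := 1)
        (b := 3) (fun r τ => ∀ r' < I.n + r, τ.Q 11 0 r' = weight I I.S₀ r')
        (by decide) le_rfl hU.U_le le_rfl le_rfl (by omega) (fun _ _ _ h => h) ?_ hJ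
        (by decide) ?_).post ?_
      · intro υ hu
        simp only [NExp.val]
        rw [hu.N 23 (by decide), hRτ.m_eq]
      · intro r υ hr hu hυ g
        have hRυ := hRτ.toLoaded.same hu (by decide) (by decide)
        apply Runs.le
        · refine Runs.putR_of_eq 0 (I.n + r) (-(I.R / I.m)) rfl
            (by simp [NExp.val, hRυ.o_eq, hυ])
            (by simp [RExp.val, NExp.val, hRυ.R_eq, hRυ.m_eq])
            ⟨(Same.refl _ _ υ).setQ (by decide) _ _ _, hυ, fun r' hr' => ?_⟩
          by_cases h : r' = I.n + r
          · subst h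
            simp [weight]
          · simp [h, g r' (by omega)]
        · simp only [RExp.cost, NExp.cost]
          omega
      · rintro υ ⟨hu, g⟩
        exact ⟨hs.trans (hu.mono (by decide) (by decide)),
          hRτ.same hu (by decide) (by decide), g⟩
    · rintro r τ x ⟨h1, h2⟩
      exact ⟨h1.same ((Same.refl [10] [] τ).setN (by decide) 0 0 x) (by decide) (by decide), h2⟩
    · intro τ hs
      simp only [NExp.val]
      rw [hs.N 24 (by decide), hR.o_eq]
    · rintro r τ hr hs hτ ⟨hRτ, hJ⟩
      apply Runs.le
      · apply Runs.bind (runs_tameTest hI hU hRτ hX (by omega) hτ)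
        rintro υ ⟨hu, hRυ, h6⟩
        have hυ : υ.N 10 0 0 = r := by rw [hu.N 10 (by decide), hτ]
        have hx : X r = I.S' ⟨r, hr⟩ := hX' ⟨r, hr⟩
        have hmem : (⟨r, hr⟩ : Fin I.n) ∈ I.S₀ ↔ I.Tame (X r) := by
          simp [Input.S₀, hx]
        have hfin : ∀ v : ℝ, v = weight I I.S₀ r →
            (Same [4, 5, 6, 10, 11, 12, 13] [5, 9, 10, 11, 14] τ (υ.setQ 11 0 r v) ∧
            (υ.setQ 11 0 r v).N 10 0 0 = r ∧ Ready I I.n X (υ.setQ 11 0 r v) ∧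
            ∀ r' < r + 1, (υ.setQ 11 0 r v).Q 11 0 r' = weight I I.S₀ r') := by
          rintro v rfl
          refine ⟨(hu.mono (by decide) (by decide)).setQ (by decide) _ _ _, hυ,
            hRυ.same ((Same.refl [] [11] υ).setQ (by decide) _ _ _) (by decide) (by decide),
            fun r' hr' => ?_⟩
          by_cases h : r' = r
          · simp [h]
          · rw [Mem.setQ_Q, if_neg (by omega), hu.Q 11 (by decide), hJ r' (by omega)]
        apply Runs.ite
        · intro ht
          simp only [Test.Holds, NExp.val, h6] at ht
          have htame : I.Tame (X r) := by
            by_contra hcon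
            rw [if_neg hcon] at ht
            omega
          refine Runs.putR_of_eq 0 r (1 / I.n) rfl hυ
            (by simp [RExp.val, NExp.val, hRυ.o_eq]) (hfin _ ?_)
          rw [weight, dif_pos hr, if_pos (hmem.2 htame)]
        · intro ht
          simp only [Test.Holds, NExp.val, h6] at ht
          have htame : ¬ I.Tame (X r) := by
            intro hcon
            rw [if_pos hcon] at ht
            omega
          refine Runs.putR_of_eq 0 r 0 rfl hυ (by simp [RExp.val]) (hfin _ ?_)
          rw [weight, dif_pos hr, if_neg fun h => htame (hmem.1 h)]
      · simp only [Test.cost, RExp.cost, NExp.cost]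
        have h2 : 64 * budget I.k U (3 * e + 9) ≤ budget I.k U (3 * e + 10) := budget_step _ hU.U_le _
        omega
  · have h2 : 64 * budget I.k U (3 * e + 12) ≤ budget I.k U (3 * e + 13) := budget_step _ hU.U_le _
    have h3 : budget I.k U (3 * e + 9) ≤ budget I.k U (3 * e + 12) := budget_mono hU.U_le (by omega)
    omega

lemma runs_icfProgram (hI : I.Admissible) (hU : Bounded I I.n U) :
    Runs (I.equip s e) icfProgram I.mem (budget I.k U (3 * e + 15)) fun τ =>
      ∃ L, I.Loop I.S₀ L ∧ Describes I L τ.desc := by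
  have hk : 1 ≤ I.k := hI.2.2.1
  have hb := budget_chain_zero hU.U_le
  have ho := hU.o_le
  have hdim : d ≤ I.dim := by
    have : (d + 1) ^ 1 ≤ (d + 1) ^ I.deg := Nat.pow_le_pow_right (by omega) hI.2.1
    rw [pow_one] at this
    unfold Input.dim
    omega
  apply Runs.le
  · apply Runs.bind (runs_loadInput hU)
    rintro τ₁ ⟨hs1, hL1⟩
    apply Runs.bind (runs_featureTable hU hL1)
    rintro τ₂ ⟨hs2, hfeat⟩
    have hall : Same [10, 11, 12, 14, 15, 20, 21, 22, 23, 24] [3, 4, 20, 21, 22] I.mem τ₂ :=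
      (hs1.mono (by decide) (by decide)).trans (hs2.mono (by decide) (by decide))
    -- All cells outside the input are initially zero, and the arrays of the convex program have not
    -- been used so far.
    have hz : ∀ a, a ∉ ([0, 1, 2, 3, 4, 20, 21, 22] : List ℕ) → ∀ i j, τ₂.Q a i j = 0 := by
      intro a ha i j
      simp only [List.mem_cons, List.not_mem_nil, or_false, not_or] at ha
      rw [hall.Q a (by simp only [List.mem_cons, List.not_mem_nil, or_false]; omega)]
      simp [Input.mem, ha]
    apply Runs.bind (runs_setup hU (hL1.same hs2 (by decide) (by decide)) hfeat
      (hz 5 (by decide)) (hz 6 (by decide)) (hz 7 (by decide)) (hz 9 (by decide)))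
    rintro τ₃ ⟨hs3, hR3⟩
    apply Runs.bind (runs_initWeights hI hU hR3 samplePoint_reference samplePoint_test)
    rintro τ₄ ⟨hs4, hA4⟩
    have hN4 : ∀ a ∈ ([9, 25] : List ℕ), τ₄.N a 0 0 = 0 := by
      intro a ha
      simp only [List.mem_cons, List.not_mem_nil, or_false] at ha
      rw [hs4.N a (by simp only [List.mem_cons, List.not_mem_nil, or_false]; omega),
        hs3.N a (by simp only [List.mem_cons, List.not_mem_nil, or_false]; omega),
        hall.N a (by simp only [List.mem_cons, List.not_mem_nil, or_false]; omega)]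
      have : a ≠ 0 := by omega
      simp [Input.mem, this]
    apply Runs.bind (runs_icfLoop hI hU samplePoint_reference samplePoint_test I.n I.S₀ [] τ₄
      (by simpa using Finset.card_le_univ I.S₀) le_rfl hA4 ⟨hN4 25 (by decide), by simp⟩
      (hN4 9 (by decide)))
    rintro τ₅ ⟨L, hloop, hLo, hSt⟩
    have hlen := hloop.length_le_card hI
    have hcard : I.S₀.card ≤ I.n := by simpa using Finset.card_le_univ I.S₀
    exact (runs_writeDesc hU hdim hLo samplePoint_reference hSt
      (by rw [List.nil_append]; omega)).post fun υ hυ => ⟨L, hloop, hυ⟩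
  · have h1 : 64 * budget I.k U (3 * e + 14) ≤ budget I.k U (3 * e + 15) := budget_step _ hU.U_le _
    have h2 : 64 * budget I.k U (3 * e + 13) ≤ budget I.k U (3 * e + 14) := budget_step _ hU.U_le _
    have h3 : 64 * budget I.k U (3 * e + 12) ≤ budget I.k U (3 * e + 13) := budget_step _ hU.U_le _
    have h4 : budget 1 U 8 ≤ budget I.k U (3 * e + 12) :=
      (budget_mono hU.U_le (by omega)).trans (budget_one_le hk)
    have h5 : (I.n + 1) * (budget I.k U (3 * e + 12) + 5) ≤ 6 * budget I.k U (3 * e + 13) := by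
      have h6 := budget_pos hk hU.U_le (3 * e + 12)
      calc (I.n + 1) * (budget I.k U (3 * e + 12) + 5)
          ≤ U * (6 * budget I.k U (3 * e + 12)) := Nat.mul_le_mul (by omega) (by omega)
        _ = 6 * budget I.k U (3 * e + 13) := by unfold budget; ring
    omega

end
end ICF

namespace ICF

/-! ### The evaluation program -/

/-- Read the points and filters of a description. -/
def readTable : Prog :=
  forN 10 (.add (nv 23) (nv 25)) (forN 11 (.add (nv 21) (.lit 1))
    (.putR 3 (.add (nv 24) (nv 10)) (nv 11) (.get 1 (.lit 0) (nv 16)) ;;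
    setn 16 (.add (nv 16) (.lit 1))))

/-- Bring the description to the layout of `Loaded`, with the given point in row `0`. -/
def readDesc : Prog :=
  setn 20 (.get 1 (.lit 0) (.lit 0)) ;; setn 21 (.get 1 (.lit 0) (.lit 1)) ;;
  setn 22 (.get 1 (.lit 0) (.lit 2)) ;; setn 23 (.get 1 (.lit 0) (.lit 3)) ;;
  setn 25 (.get 1 (.lit 0) (.lit 4)) ;; setn 24 (.lit 1) ;;
  setr 20 (.get 1 (.lit 0) (.lit 0)) ;; setr 21 (.get 1 (.lit 0) (.lit 1)) ;;
  setr 22 (.get 1 (.lit 0) (.lit 2)) ;; setn 16 (.lit 3) ;;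
  copyPoints 0 (.lit 1) (.lit 0) ;; readTable

/-- Clear the scalar `6` if some filter rejects the point in row `0`. -/
def checkFilters : Prog :=
  forN 17 (nv 25)
    (.classify 4 (.get 1 (.lit 0) (.add (.lit 5) (nv 17))) 3 (.lit 0) ;;
    dot 4 (.lit 0) 3 (.add (.add (nv 24) (nv 23)) (nv 17)) (nv 21) ;;
    .ite (.leR (.mul (.ofN (nv 4)) (.sqrt (.mul (rv 14) (rv 14))))
      (.get 3 (.add (.add (nv 24) (nv 23)) (nv 17)) (nv 21))) .skip (setn 6 (.lit 0)))

/-- Evaluation of the selector. -/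
def evProgram : Prog :=
  readDesc ;; featureTable ;; setup ;; setn 10 (.lit 0) ;; tameTest ;; checkFilters ;; setn 0 (nv 6)

section

variable {d : ℕ} {I : Input d} {o U : ℕ} {σ τ : Mem} {s : Solver} {e : ℕ}
  {M : Equipment d} {L : List (Fin I.k × MvPolynomial (Fin d) ℝ × ℝ)}

/-- The point to be classified followed by the reference sample. -/
noncomputable def evalPoint (I : Input d) (x : Pt d) (r : ℕ) : Pt d :=
  if r = 0 then x else if h : r - 1 < I.m then I.S ⟨r - 1, h⟩ else 0

lemma evalPoint_reference (x : Pt d) (j : Fin I.m) : evalPoint I x (1 + j) = I.S j := by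
  rw [evalPoint, if_neg (by omega), dif_pos (by simp)]
  congr
  simp

/-- The number `t` of filters is not bounded in terms of `U`, since it also depends on `R`, `β` and
`ε`. It therefore enters the cost as the prefactor `t + 1`. -/
lemma runs_readTable {N m t : ℕ} (hU : 64 ≤ U) (hN : N + 1 ≤ U) (hm : m + 1 ≤ U)
    (h21 : σ.N 21 0 0 = N) (h23 : σ.N 23 0 0 = m) (h24 : σ.N 24 0 0 = 1) (h25 : σ.N 25 0 0 = t)
    (h16 : σ.N 16 0 0 = 3) :
    Runs M readTable σ (budget (t + 1) U 5) fun τ => Same [10, 11, 16] [3] σ τ ∧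
      τ.Q 3 0 = σ.Q 3 0 ∧
      ∀ r < m + t, ∀ w < N + 1, τ.Q 3 (1 + r) w = σ.Q 1 0 (3 + (r * (N + 1) + w)) := by
  have hb := budget_chain_zero hU
  refine (Runs.forN (w := [10, 11, 16]) (q := [3]) (n := m + t) (U := U) (X := t + 1) (Y := 1)
    (a := 3) (fun r τ => τ.N 16 0 0 = 3 + r * (N + 1) ∧ τ.Q 3 0 = σ.Q 3 0 ∧
      ∀ r' < r, ∀ w < N + 1, τ.Q 3 (1 + r') w = σ.Q 1 0 (3 + (r' * (N + 1) + w)))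
    (by decide) le_rfl hU (by omega) le_rfl (by nlinarith) ?_ ?_ ⟨by simpa using h16, rfl, by simp⟩
    (by decide) ?_).post ?_
  · rintro i τ x ⟨h1, h2⟩
    exact ⟨by simpa using h1, h2⟩
  · intro τ hs
    simp only [NExp.val]
    rw [hs.N 23 (by decide), hs.N 25 (by decide), h23, h25]
  · rintro r τ hr hs hτ ⟨h1, h2, h3⟩
    refine (Runs.forN (w := [11, 16]) (q := [3]) (n := N + 1) (U := U) (X := 1) (Y := 1)
      (a := 1) (fun v τ => τ.N 16 0 0 = 3 + (r * (N + 1) + v) ∧ τ.Q 3 0 = σ.Q 3 0 ∧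
        (∀ r' < r, ∀ w < N + 1, τ.Q 3 (1 + r') w = σ.Q 1 0 (3 + (r' * (N + 1) + w))) ∧
        ∀ w < v, τ.Q 3 (1 + r) w = σ.Q 1 0 (3 + (r * (N + 1) + w)))
      (by decide) le_rfl hU le_rfl le_rfl (by omega) ?_ ?_ ⟨by simpa using h1, h2, h3, by simp⟩
      (by decide) ?_).post ?_
    · rintro i τ x ⟨h1, h2⟩
      exact ⟨by simpa using h1, h2⟩
    · intro υ hu
      simp only [NExp.val]
      rw [hu.N 21 (by decide), hs.N 21 (by decide), h21]
    · rintro v υ hv hu hυ ⟨g1, g2, g3, g4⟩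
      have e1 : υ.Q 1 = σ.Q 1 := by rw [hu.Q 1 (by decide), hs.Q 1 (by decide)]
      have e24 : υ.N 24 0 0 = 1 := by rw [hu.N 24 (by decide), hs.N 24 (by decide), h24]
      have e10 : υ.N 10 0 0 = r := by rw [hu.N 10 (by decide), hτ]
      apply Runs.le
      · apply Runs.putR_seq_of_eq (1 + r) v (σ.Q 1 0 (3 + (r * (N + 1) + v)))
          (by simp [NExp.val, e24, e10]) (by exact hυ) (by simp only [RExp.val, NExp.val, g1, e1])
        refine Runs.putN_of_eq 0 0 (3 + (r * (N + 1) + (v + 1))) rfl rfl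
          (by simp only [NExp.val, Mem.setQ_N, g1]; ring)
          ⟨((Same.refl _ _ υ).setQ (by decide) _ _ _).setN (by decide) _ _ _, by simp [hυ],
            by simp, ?_, ?_, ?_⟩
        · rw [← g2]
          funext w
          simp [show 0 ≠ 1 + r by omega]
        · intro r' hr' w hw
          have : r' ≠ r := by omega
          simp [this, g3 r' hr' w hw]
        · intro w hw
          by_cases h : w = v
          · simp [h]
          · simp [h, g4 w (by omega)]
      · simp only [RExp.cost, NExp.cost]
        omega
    · rintro υ ⟨hu, g1, g2, g3, g4⟩
      refine ⟨hu.mono (by decide) (by decide), by rw [hu.N 10 (by decide), hτ], ?_, g2, ?_⟩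
      · rw [g1]; ring
      · intro r' hr' w hw
        rcases Nat.lt_succ_iff_lt_or_eq.1 hr' with h | rfl
        · exact g3 r' h w hw
        · exact g4 w hw
  · rintro τ ⟨hs, -, h2, h3⟩
    exact ⟨hs, h2, h3⟩

lemma runs_readDesc (hU : Bounded I 1 U) (hdim : d ≤ I.dim) {D : Desc} (hD : Describes I L D)
    (x : Pt d) :
    Runs M readDesc (D.mem x) (budget (L.length + 1) U 6) fun τ =>
      Same [10, 11, 16, 20, 21, 22, 23, 24, 25] [3, 20, 21, 22] (D.mem x) τ ∧
      Loaded I 1 (evalPoint I x) τ ∧ Stored I 1 L τ := by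
  have hb := budget_chain_zero hU.U_le
  have hbt : 64 * budget (L.length + 1) U 5 ≤ budget (L.length + 1) U 6 := budget_step _ hU.U_le _
  have hpos := budget_pos (show 1 ≤ L.length + 1 by omega) hU.U_le 5
  have h1t : budget 1 U 5 ≤ budget (L.length + 1) U 5 := budget_one_le (by omega)
  have hdimU := hU.dim_le
  have hd := hU.d_le
  have hN : ∀ j, (D.mem x).N 1 0 j = D.nats.getD j 0 := fun j => by simp [Desc.mem]
  have hQ : ∀ j, (D.mem x).Q 1 0 j = D.reals.getD j 0 := fun j => by simp [Desc.mem]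
  apply Runs.le
  · apply Runs.putN_seq_of_eq 0 0 d rfl rfl (by simp only [NExp.val, hN, hD.d_eq])
    apply Runs.putN_seq_of_eq 0 0 I.dim rfl rfl (by simp [NExp.val, hN, hD.dim_eq,
      -List.getD_eq_getElem?_getD])
    apply Runs.putN_seq_of_eq 0 0 I.k rfl rfl (by simp [NExp.val, hN, hD.k_eq,
      -List.getD_eq_getElem?_getD])
    apply Runs.putN_seq_of_eq 0 0 I.m rfl rfl (by simp [NExp.val, hN, hD.m_eq,
      -List.getD_eq_getElem?_getD])
    apply Runs.putN_seq_of_eq 0 0 L.length rfl rfl (by simp [NExp.val, hN, hD.t_eq,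
      -List.getD_eq_getElem?_getD])
    apply Runs.putN_seq_of_eq 0 0 1 rfl rfl rfl
    apply Runs.putR_seq_of_eq 0 0 I.R rfl rfl (by simp [RExp.val, NExp.val, hQ, hD.R_eq,
      -List.getD_eq_getElem?_getD])
    apply Runs.putR_seq_of_eq 0 0 I.β rfl rfl (by simp [RExp.val, NExp.val, hQ, hD.β_eq,
      -List.getD_eq_getElem?_getD])
    apply Runs.putR_seq_of_eq 0 0 I.ε rfl rfl (by simp [RExp.val, NExp.val, hQ, hD.ε_eq,
      -List.getD_eq_getElem?_getD])
    apply Runs.putN_seq_of_eq 0 0 3 rfl rfl rfl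
    obtain ⟨σ, hσ⟩ : ∃ σ, σ = (((((((((((D.mem x).setN 20 0 0 d).setN 21 0 0 I.dim).setN
      22 0 0 I.k).setN 23 0 0 I.m).setN 25 0 0 L.length).setN 24 0 0 1).setQ 20 0 0 I.R).setQ
      21 0 0 I.β).setQ 22 0 0 I.ε).setN 16 0 0 3) := ⟨_, rfl⟩
    have hs0 : Same [16, 20, 21, 22, 23, 24, 25] [20, 21, 22] (D.mem x) σ := by
      rw [hσ]
      exact ((((((((((Same.refl _ _ (D.mem x)).setN (by decide) _ _ _).setN (by decide) _ _ _).setN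
        (by decide) _ _ _).setN (by decide) _ _ _).setN (by decide) _ _ _).setN
        (by decide) _ _ _).setQ (by decide) _ _ _).setQ (by decide) _ _ _).setQ
        (by decide) _ _ _).setN (by decide) _ _ _
    rw [← hσ]
    apply Runs.bind (runs_copyPoints (n := 1) (c := 0) (U := U) hU.U_le (by decide) (by omega)
      (by omega) (by rw [hσ]; simp) (fun _ _ => rfl) (fun _ _ => rfl) (by decide) (by decide))
    rintro τ₁ ⟨hs1, -, hcopy⟩
    refine (runs_readTable (N := I.dim) (m := I.m) (t := L.length) hU.U_le (by omega) (by omega)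
      (by rw [hs1.N 21 (by decide), hσ]; simp) (by rw [hs1.N 23 (by decide), hσ]; simp)
      (by rw [hs1.N 24 (by decide), hσ]; simp) (by rw [hs1.N 25 (by decide), hσ]; simp)
      (by rw [hs1.N 16 (by decide), hσ]; simp)).post ?_
    rintro τ₂ ⟨hs2, hzero, htab⟩
    have hs12 : Same [10, 11, 16] [3] σ τ₂ := (hs1.mono (by decide) (by decide)).trans hs2
    have htab' : ∀ r < I.m + L.length, ∀ w < I.dim + 1,
        τ₂.Q 3 (1 + r) w = D.reals.getD (3 + (r * (I.dim + 1) + w)) 0 := by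
      intro r hr w hw
      rw [htab r hr w hw, hs1.Q 1 (by decide), hs0.Q 1 (by decide), hQ]
    refine ⟨(hs0.mono (by decide) (by decide)).trans (hs12.mono (by decide) (by decide)),
      ⟨?_, ?_, ?_, ?_, ?_, ?_, ?_, ?_, ?_⟩, ?_, ?_⟩
    · rw [hs12.N 20 (by decide), hσ]; simp
    · rw [hs12.N 21 (by decide), hσ]; simp
    · rw [hs12.N 22 (by decide), hσ]; simp
    · rw [hs12.N 23 (by decide), hσ]; simp
    · rw [hs12.N 24 (by decide), hσ]; simp
    · rw [hs12.Q 20 (by decide), hσ]; simp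
    · rw [hs12.Q 21 (by decide), hσ]; simp
    · rw [hs12.Q 22 (by decide), hσ]; simp
    · intro r hr j
      rcases Nat.eq_zero_or_pos r with rfl | hpos
      · have := hcopy 0 one_pos j j.2
        rw [zero_add] at this
        rw [hzero, this, hs0.Q 0 (by decide), evalPoint, if_pos rfl]
        simp [Desc.mem]
      · obtain ⟨r', rfl⟩ : ∃ r', r = 1 + r' := ⟨r - 1, by omega⟩
        have h' : r' < I.m := by omega
        have h1 := evalPoint_reference (I := I) x ⟨r', h'⟩
        have h2 := hD.pts ⟨r', h'⟩ j
        simp only at h1 h2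
        rw [htab' r' (by omega) j (by omega), h2, h1]
    · rw [hs12.N 25 (by decide), hσ]; simp
    · intro q f hf
      have hq : q < L.length := by
        by_contra hcon
        rw [List.getElem?_eq_none (by omega)] at hf
        exact absurd hf (by simp)
      obtain ⟨g1, g2, g3⟩ := hD.filters q f hf
      refine ⟨?_, ?_, ?_⟩
      · rw [hs12.N 1 (by decide), hs0.N 1 (by decide), hN, g1]
      · rw [g2]
        refine polyOf_congr fun w hw => ?_
        rw [add_assoc, htab' _ (by omega) w (by omega)]
      · rw [add_assoc, htab' _ (by omega) _ (by omega), g3]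
  · simp only [RExp.cost, NExp.cost]
    omega

open Classical in
lemma runs_checkFilters {X : ℕ → Pt d} (hU : Bounded I o U) (ho : 1 ≤ o) (hR : Ready I o X σ)
    (hL : Stored I o L σ) {P : Prop} (hP : σ.N 6 0 0 = if P then 1 else 0) :
    Runs (I.equip s e) checkFilters σ (budget (L.length + 1) U 7) fun τ =>
      τ.N 6 0 0 = if P ∧ ∀ f ∈ L, I.absChow f.1 f.2.1 (X 0) ≤ f.2.2 then 1 else 0 := by
  have hb := budget_chain_zero hU.U_le
  have hdim := hU.dim_le
  have hd := hU.d_le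
  have hoU := hU.o_le
  refine (Runs.forN (w := [4, 6, 11, 17]) (q := [14]) (n := L.length) (U := U)
    (X := L.length + 1) (Y := 1) (a := 5) (fun q τ => τ.N 6 0 0 =
      if P ∧ ∀ q' < q, ∀ f, L[q']? = some f → I.absChow f.1 f.2.1 (X 0) ≤ f.2.2 then 1 else 0)
    (by decide) le_rfl hU.U_le (by omega) le_rfl ?_ ?_ ?_ ?_ (by decide) ?_).post ?_
  · have := hU.U_le
    nlinarith
  · intro i τ x h
    simpa using h
  · intro τ hs
    simp only [NExp.val]
    rw [hs.N 25 (by decide), hL.1]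
  · simpa using hP
  · intro q τ hq hs hτ hJ
    have hRτ := hR.same hs (by decide) (by decide)
    have hLτ := hL.same hs (by decide) (by decide)
    obtain ⟨f, hf⟩ : ∃ f, L[q]? = some f := ⟨_, List.getElem?_eq_getElem hq⟩
    obtain ⟨g1, g2, g3⟩ := hLτ.2 q f hf
    have hpt : (fun t : Fin d => τ.Q 3 0 t) = X 0 := funext fun t => hRτ.pts 0 (by omega) t
    obtain ⟨τ₁, hτ₁⟩ : ∃ τ₁, τ₁ = τ.setN 4 0 0 ((I.equip s e).query f.1 (X 0)) := ⟨_, rfl⟩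
    have hs1 : Same [4] [] τ τ₁ := by
      rw [hτ₁]
      exact (Same.refl _ _ τ).setN (by decide) _ _ _
    have hR1 := hRτ.same hs1 (by decide) (by decide)
    have hrow : ∀ υ, Same [4, 11] [14] τ υ →
        (NExp.add (.add (nv 24) (nv 23)) (nv 17)).val υ = o + I.m + q := fun υ h => by
      simp only [NExp.val]
      rw [h.N 24 (by decide), h.N 23 (by decide), h.N 17 (by decide), hRτ.o_eq, hRτ.m_eq, hτ]
    have hs1' : Same [4, 11] [14] τ τ₁ := hs1.mono (by decide) (by decide)
    have hstep : (P ∧ ∀ q' < q + 1, ∀ f, L[q']? = some f → I.absChow f.1 f.2.1 (X 0) ≤ f.2.2) ↔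
        (P ∧ ∀ q' < q, ∀ f, L[q']? = some f → I.absChow f.1 f.2.1 (X 0) ≤ f.2.2) ∧
          I.absChow f.1 f.2.1 (X 0) ≤ f.2.2 := by
      constructor
      · rintro ⟨h1, h2⟩
        exact ⟨⟨h1, fun q' hq' => h2 q' (by omega)⟩, h2 q (by omega) f hf⟩
      · rintro ⟨⟨h1, h2⟩, h3⟩
        refine ⟨h1, fun q' hq' f' hf' => ?_⟩
        rcases Nat.lt_succ_iff_lt_or_eq.1 hq' with h | rfl
        · exact h2 q' h f' hf'
        · rw [hf, Option.some.injEq] at hf'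
          rw [← hf']
          exact h3
    apply Runs.le
    · apply Runs.classify_seq_of_eq f.1 (X 0) (by simp only [NExp.val, hτ]; exact g1) (by exact hpt)
      rw [← hτ₁]
      apply Runs.bind (runs_dot (n := I.dim) (U := U) (len := nv 21) hU.U_le (by omega)
        (by decide) (by decide) (fun _ _ => rfl)
        (fun υ h => by rw [hrow τ₁ hs1', hrow υ (hs1'.trans (h.mono (by decide) (by decide)))])
        (fun υ h => (hR1.toLoaded.same h (by decide) (by decide)).dim_eq) (by decide)
        (by decide))
      rintro τ₂ ⟨hs2, hdot⟩
      have hs12 : Same [4, 11] [14] τ τ₂ := hs1'.trans (hs2.mono (by decide) (by decide))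
      have hval : τ₂.Q 14 0 0 = MvPolynomial.eval (X 0) f.2.1 := by
        rw [hdot, g2, eval_polyOf]
        refine Finset.sum_congr rfl fun w hw => ?_
        rw [hrow τ₁ hs1', hs1.Q 3 (by decide), mul_comm]
        congr 1
        exact hR1.feat 0 (by omega) w (Finset.mem_range.1 hw)
      have h4 : τ₂.N 4 0 0 = (I.equip s e).query f.1 (X 0) := by
        rw [hs2.N 4 (by decide), hτ₁]; simp
      have hrow2 := hrow τ₂ hs12
      have h21 : τ₂.N 21 0 0 = I.dim := by rw [hs12.N 21 (by decide), hRτ.dim_eq]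
      have hthr : τ₂.Q 3 (o + I.m + q) I.dim = f.2.2 := by rw [hs12.Q 3 (by decide), g3]
      have h17 : τ₂.N 17 0 0 = q := by rw [hs12.N 17 (by decide), hτ]
      have h6 : τ₂.N 6 0 0 = τ.N 6 0 0 := by rw [hs12.N 6 (by decide)]
      have htest : (Test.leR (.mul (.ofN (nv 4)) (.sqrt (.mul (rv 14) (rv 14))))
          (.get 3 (.add (.add (nv 24) (nv 23)) (nv 17)) (nv 21))).Holds τ₂ ↔
          I.absChow f.1 f.2.1 (X 0) ≤ f.2.2 := by
        simp only [Test.Holds, RExp.val]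
        rw [hrow2]
        simp only [NExp.val, h4, hval, query_eq, Real.sqrt_mul_self_eq_abs, h21, hthr]
        rfl
      apply Runs.ite (c₁ := 1)
      · intro ht
        refine Runs.skip ⟨hs12.mono (by decide) (by decide), h17, ?_⟩
        rw [h6, hJ]
        exact if_congr (by rw [hstep, and_iff_left (htest.1 ht)]) rfl rfl
      · intro ht
        refine Runs.putN_of_eq 0 0 0 rfl rfl rfl
          ⟨(hs12.mono (by decide) (by decide)).setN (by decide) _ _ _, by simp [h17], ?_⟩
        rw [if_neg fun h => ht (htest.2 (hstep.1 h).2)]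
        simp
    · simp only [Test.cost, RExp.cost, NExp.cost]
      omega
  · rintro τ ⟨-, hJ⟩
    rw [hJ]
    refine if_congr (and_congr_right fun _ => ?_) rfl rfl
    constructor
    · intro h f hf
      obtain ⟨q, hq⟩ := List.mem_iff_getElem?.1 hf
      by_cases hlt : q < L.length
      · exact h q hlt f hq
      · rw [List.getElem?_eq_none (by omega)] at hq
        exact absurd hq (by simp)
    · exact fun h q _ f hf => h f (List.mem_iff_getElem?.2 ⟨q, hf⟩)

-- The routines of the filtering program are reused with the single point `x` in place of the test
-- sample. Hence `U` only has to dominate the reference sample and the dimension.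
open Classical in
lemma runs_evProgram (hI : I.Admissible) (hU : Bounded I 1 U) {D : Desc} (hD : Describes I L D)
    (x : Pt d) :
    Runs (I.equip s e) evProgram (D.mem x) (budget (I.k * (L.length + 1)) U (3 * e + 10)) fun τ =>
      τ.N 0 0 0 =
        if I.Tame x ∧ ∀ f ∈ L, I.absChow f.1 f.2.1 x ≤ f.2.2 then 1 else 0 := by
  have hk : 1 ≤ I.k := hI.2.2.1
  have hb := budget_chain_zero hU.U_le
  have hdim : d ≤ I.dim := by
    have : (d + 1) ^ 1 ≤ (d + 1) ^ I.deg := Nat.pow_le_pow_right (by omega) hI.2.1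
    rw [pow_one] at this
    unfold Input.dim
    omega
  apply Runs.le
  · apply Runs.bind (runs_readDesc hU hdim hD x)
    rintro τ₁ ⟨hs1, hL1, hS1⟩
    apply Runs.bind (runs_featureTable hU hL1)
    rintro τ₂ ⟨hs2, hfeat⟩
    have hall : Same [10, 11, 14, 15, 16, 20, 21, 22, 23, 24, 25] [3, 4, 20, 21, 22] (D.mem x) τ₂ :=
      (hs1.mono (by decide) (by decide)).trans (hs2.mono (by decide) (by decide))
    have hz : ∀ a, a ∉ ([0, 1, 3, 4, 20, 21, 22] : List ℕ) → ∀ i j, τ₂.Q a i j = 0 := by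
      intro a ha i j
      simp only [List.mem_cons, List.not_mem_nil, or_false, not_or] at ha
      rw [hall.Q a (by simp only [List.mem_cons, List.not_mem_nil, or_false]; omega)]
      simp [Desc.mem, ha]
    have hS2 := hS1.same hs2 (by decide) (by decide)
    apply Runs.bind (runs_setup hU (hL1.same hs2 (by decide) (by decide)) hfeat
      (hz 5 (by decide)) (hz 6 (by decide)) (hz 7 (by decide)) (hz 9 (by decide)))
    rintro τ₃ ⟨hs3, hR3⟩
    have hS3 := hS2.same hs3 (by decide) (by decide)
    apply Runs.putN_seq_of_eq 0 0 0 rfl rfl rfl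
    have hs4 : Same [10] [] τ₃ (τ₃.setN 10 0 0 0) := (Same.refl _ _ τ₃).setN (by decide) _ _ _
    apply Runs.bind (runs_tameTest hI hU (hR3.same hs4 (by decide) (by decide))
      (evalPoint_reference x) (r := 0) (by omega) (by simp))
    rintro τ₅ ⟨hs5, hR5, h6⟩
    apply Runs.bind (runs_checkFilters hU le_rfl hR5
      ((hS3.same hs4 (by decide) (by decide)).same hs5 (by decide) (by decide)) h6)
    intro τ₆ h6'
    refine Runs.putN_of_eq 0 0 _ rfl rfl (by exact h6') ?_
    simp [evalPoint]
  · simp only [NExp.cost]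
    have ht : 1 ≤ L.length + 1 := by omega
    have hkt : 1 ≤ I.k * (L.length + 1) := Nat.mul_pos hk ht
    have h1 : 64 * budget (I.k * (L.length + 1)) U (3 * e + 9) ≤
        budget (I.k * (L.length + 1)) U (3 * e + 10) := budget_step _ hU.U_le _
    have h2 : budget I.k U (3 * e + 9) ≤ budget (I.k * (L.length + 1)) U (3 * e + 9) :=
      Nat.mul_le_mul_right _ (Nat.le_mul_of_pos_right _ ht)
    have h3 : budget (L.length + 1) U 7 ≤ budget (I.k * (L.length + 1)) U (3 * e + 9) :=
      (budget_mono hU.U_le (by omega)).trans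
        (Nat.mul_le_mul_right _ (Nat.le_mul_of_pos_left _ hk))
    have h4 : budget (L.length + 1) U 6 ≤ budget (L.length + 1) U 7 := budget_mono hU.U_le (by omega)
    have h5 : budget 1 U 8 ≤ budget (I.k * (L.length + 1)) U (3 * e + 9) :=
      (budget_mono hU.U_le (by omega)).trans (budget_one_le hkt)
    omega

end
end ICF

namespace ICF

/-! ### Running time -/

section

variable {d : ℕ} {I : Input d}

lemma Input.dim_bounds (hI : I.Admissible) : 1 ≤ I.dim ∧ d + 1 ≤ I.dim ∧ I.deg ≤ I.dim := by
  have h1 : (d + 1) ^ 1 ≤ (d + 1) ^ I.deg := Nat.pow_le_pow_right (by omega) hI.2.1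
  have h2 : I.deg < (d + 1) ^ I.deg := Nat.lt_pow_self (by have := hI.1; omega)
  rw [pow_one] at h1
  unfold Input.dim
  omega

lemma bounded_of_le {o P : ℕ} (hI : I.Admissible) (hdim : I.dim ≤ P) (hm : I.m ≤ P)
    (ho : o ≤ P) : Bounded I o (64 * P) := by
  have := I.dim_bounds hI
  constructor <;> first | exact hI.1 | omega

/-- With `Γ` the square root on the right, `(ε²/R)² Γ² = Rβ/ε`, so that `B = 2 √(2 N) (ε²/R) Γ ≤ 3 N
(ε²/R) Γ` for `N = I.dim`. Together with `1/Δ = B (2R + ε)/ε²` and `2R + ε ≤ 3R` this gives the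
constant `9`. -/
lemma inv_Δ_le (hI : I.Admissible) :
    1 / I.Δ ≤ 9 * I.dim * √(I.β * I.R ^ 3 / I.ε ^ 5) := by
  obtain ⟨-, -, -, -, -, hR, hβ, hε, hε1⟩ := id hI
  have hdim : (1 : ℝ) ≤ I.dim := by exact_mod_cast (I.dim_bounds hI).1
  have hdeq : ((d : ℝ) + 1) ^ I.deg = I.dim := by simp [Input.dim]
  have hR0 : 0 < I.R := by linarith
  obtain ⟨Γ, hΓ⟩ : ∃ Γ, Γ = √(I.β * I.R ^ 3 / I.ε ^ 5) := ⟨_, rfl⟩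
  have hΓ0 : 0 ≤ Γ := by rw [hΓ]; positivity
  have hΓsq : Γ ^ 2 = I.β * I.R ^ 3 / I.ε ^ 5 := by rw [hΓ]; exact Real.sq_sqrt (by positivity)
  have hB : I.B ≤ 3 * I.dim * (I.ε ^ 2 / I.R) * Γ := by
    unfold Input.B
    rw [hdeq]
    have : √(2 * I.R * I.dim * I.β / I.ε) ≤ 3 / 2 * I.dim * (I.ε ^ 2 / I.R) * Γ := by
      refine Real.sqrt_le_iff.2 ⟨by positivity, ?_⟩
      have e : (3 / 2 * I.dim * (I.ε ^ 2 / I.R) * Γ) ^ 2 =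
          9 / 4 * (I.dim : ℝ) ^ 2 * (I.R * I.β / I.ε) := by
        rw [mul_pow, hΓsq]
        field_simp
        ring
      have e2 : 2 * I.R * I.dim * I.β / I.ε = 2 * (I.dim : ℝ) * (I.R * I.β / I.ε) := by ring
      rw [e, e2]
      have : 0 < I.R * I.β / I.ε := by positivity
      have hsq : (I.dim : ℝ) ≤ (I.dim : ℝ) ^ 2 := le_self_pow₀ hdim two_ne_zero
      exact mul_le_mul_of_nonneg_right (by linarith) this.le
    linarith
  have hinv : 1 / I.Δ = I.B * (2 * I.R + I.ε) / I.ε ^ 2 := by rw [Input.Δ, one_div_div]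
  rw [hinv, ← hΓ, div_le_iff₀ (by positivity)]
  calc I.B * (2 * I.R + I.ε) ≤ 3 * I.dim * (I.ε ^ 2 / I.R) * Γ * (3 * I.R) := by
        have := Input.B_pos hI
        gcongr
        linarith
    _ = 9 * I.dim * Γ * I.ε ^ 2 := by field_simp; ring

lemma Loop.length_succ_le (hI : I.Admissible) {T : Finset (Fin I.n)}
    {L : List (Fin I.k × MvPolynomial (Fin d) ℝ × ℝ)} (hL : I.Loop T L) :
    ((L.length + 1 : ℕ) : ℝ) ≤ 9 * I.dim * (1 + √(I.β * I.R ^ 3 / I.ε ^ 5)) := by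
  have h1 := (hL.length_le_inv hI).trans (inv_Δ_le hI)
  have hdim : (1 : ℝ) ≤ I.dim := by exact_mod_cast (I.dim_bounds hI).1
  push_cast
  linarith

lemma Describes.length_le (hI : I.Admissible) {L : List (Fin I.k × MvPolynomial (Fin d) ℝ × ℝ)}
    {D : Desc} (hD : Describes I L D) : D.length ≤ 10 * ((L.length + 1) * (I.m * I.dim)) := by
  have hdim := (I.dim_bounds hI).1
  have hm : 1 ≤ I.m := hI.2.2.2.1
  unfold Desc.length
  rw [hD.nats_length, hD.reals_length]
  have e1 : L.length + 1 ≤ (L.length + 1) * (I.m * I.dim) :=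
    Nat.le_mul_of_pos_right _ (Nat.mul_pos hm hdim)
  have e2 : I.m + L.length ≤ I.m * (L.length + 1) := by
    have := Nat.le_mul_of_pos_left L.length hm
    rw [mul_add]
    omega
  have e3 : (I.m + L.length) * (I.dim + 1) ≤ 2 * ((L.length + 1) * (I.m * I.dim)) :=
    calc _ ≤ (I.m * (L.length + 1)) * (2 * I.dim) := Nat.mul_le_mul e2 (by omega)
      _ = _ := by ring
  omega

lemma mul_pow_le_mul_pow {x c : ℝ} {a C : ℕ} (hx : 1 ≤ x) (hc : c ≤ C) (ha : a ≤ C) :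
    c * x ^ a ≤ C * x ^ C :=
  mul_le_mul hc (pow_le_pow_right₀ hx ha) (by positivity) (by positivity)

end

open Classical in
theorem running_time : ∃ icf ev : Prog, ∀ e : ℕ, ∃ C : ℕ, ∀ (d : ℕ) (I : Input d)
    (solver : Solver), I.Admissible → ∃ (T : ℕ) (σ : Mem) (s : Pt d → Bool),
      (I.equip solver e).Exec icf I.mem T σ ∧
      (T : ℝ) ≤ (I.k : ℝ) * (C * ((I.m : ℝ) * (I.n : ℝ) * ((d : ℝ) + 1) ^ I.deg) ^ C) ∧
      I.IsOutput s ∧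
      (σ.desc.length : ℝ) ≤ (I.k : ℝ) * (1 + √(I.β * I.R ^ 3 / I.ε ^ 5)) *
        (C * ((I.m : ℝ) * ((d : ℝ) + 1) ^ I.deg) ^ C) ∧
      Computes (I.equip solver e) ev σ.desc s
        ((I.k : ℝ) * (1 + √(I.β * I.R ^ 3 / I.ε ^ 5)) *
          (C * ((I.m : ℝ) * ((d : ℝ) + 1) ^ I.deg) ^ C)) := by
  -- One number serves as factor and as exponent. The power of `64` comes from `U = 64 * P`, where
  -- `P` is the product of the sizes, and `90` is `10` from the length of the description times `9`
  -- from the number of filters.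
  refine ⟨icfProgram, evProgram, fun e => ⟨90 * 64 ^ (3 * e + 15), fun d I solver hI => ?_⟩⟩
  obtain ⟨hdim1, -, -⟩ := I.dim_bounds hI
  have hk : 1 ≤ I.k := hI.2.2.1
  have hm : 1 ≤ I.m := hI.2.2.2.1
  have hn : 1 ≤ I.n := hI.2.2.2.2.1
  have hdeq : ((d : ℝ) + 1) ^ I.deg = I.dim := by simp [Input.dim]
  rw [hdeq]
  obtain ⟨C, hC⟩ : ∃ C, C = 90 * 64 ^ (3 * e + 15) := ⟨_, rfl⟩
  rw [← hC]
  have hCa : 3 * e + 16 ≤ C := by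
    have : 3 * e + 15 < 64 ^ (3 * e + 15) := Nat.lt_pow_self (by norm_num)
    omega
  have hCr : (90 * 64 ^ (3 * e + 15) : ℝ) ≤ C := by rw [hC]; push_cast; exact le_rfl
  have hkr : (1 : ℝ) ≤ I.k := by exact_mod_cast hk
  have hmr : (1 : ℝ) ≤ I.m := by exact_mod_cast hm
  have hnr : (1 : ℝ) ≤ I.n := by exact_mod_cast hn
  have hdr : (1 : ℝ) ≤ I.dim := by exact_mod_cast hdim1
  have hmd : (1 : ℝ) ≤ I.m * I.dim := one_le_mul_of_one_le_of_one_le hmr hdr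
  have hU : Bounded I I.n (64 * (I.m * I.n * I.dim)) := by
    refine bounded_of_le hI ?_ ?_ ?_
    · exact Nat.le_mul_of_pos_left _ (Nat.mul_pos hm hn)
    · exact (Nat.le_mul_of_pos_right _ hn).trans (Nat.le_mul_of_pos_right _ hdim1)
    · exact (Nat.le_mul_of_pos_left _ hm).trans (Nat.le_mul_of_pos_right _ hdim1)
  have hU' : Bounded I 1 (64 * (I.m * I.dim)) :=
    bounded_of_le hI (Nat.le_mul_of_pos_left _ hm) (Nat.le_mul_of_pos_right _ hdim1)
      (Nat.mul_pos hm hdim1)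
  obtain ⟨T, σ, hex, hT, L, hloop, hD⟩ := runs_icfProgram (s := solver) (e := e) hI hU
  have hlen := Loop.length_succ_le hI hloop
  obtain ⟨Γ, hΓ⟩ : ∃ Γ, Γ = √(I.β * I.R ^ 3 / I.ε ^ 5) := ⟨_, rfl⟩
  rw [← hΓ] at hlen ⊢
  have hΓ0 : 0 ≤ Γ := by rw [hΓ]; positivity
  refine ⟨T, σ, fun x => decide (I.Tame x ∧ ∀ q ∈ L, I.absChow q.1 q.2.1 x ≤ q.2.2), hex, ?_,
    ⟨L, hloop, hloop.length_le_card hI, fun x => decide_eq_true_iff⟩, ?_, fun x => ?_⟩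
  · have h1 : (1 : ℝ) ≤ I.m * I.n * I.dim := one_le_mul_of_one_le_of_one_le
      (one_le_mul_of_one_le_of_one_le hmr hnr) hdr
    calc (T : ℝ) ≤ (budget I.k (64 * (I.m * I.n * I.dim)) (3 * e + 15) : ℕ) := by exact_mod_cast hT
      _ = I.k * (64 ^ (3 * e + 15) * (I.m * I.n * I.dim : ℝ) ^ (3 * e + 15)) := by
        unfold budget
        push_cast
        rw [mul_pow]
      _ ≤ _ := by
        refine mul_le_mul_of_nonneg_left (mul_pow_le_mul_pow h1 (le_trans ?_ hCr) (by omega))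
          (by positivity)
        have : (0 : ℝ) < 64 ^ (3 * e + 15) := by positivity
        linarith
  · have h1 := hD.length_le hI
    calc (σ.desc.length : ℝ) ≤ 10 * (((L.length + 1 : ℕ) : ℝ) * (I.m * I.dim)) := by
          exact_mod_cast h1
      _ ≤ 10 * (9 * I.dim * (1 + Γ) * (I.m * I.dim)) := by gcongr
      _ = 1 * (1 + Γ) * (90 * ((1 * I.dim) * (I.m * I.dim))) := by ring
      _ ≤ I.k * (1 + Γ) * (90 * ((I.m * I.dim) * (I.m * I.dim))) := by gcongr
      _ = I.k * (1 + Γ) * (90 * (I.m * I.dim : ℝ) ^ 2) := by ring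
      _ ≤ _ := by
        refine mul_le_mul_of_nonneg_left (mul_pow_le_mul_pow hmd (le_trans ?_ hCr) (by omega))
          (by positivity)
        have : (1 : ℝ) ≤ 64 ^ (3 * e + 15) := one_le_pow₀ (by norm_num)
        linarith
  · obtain ⟨T', τ, hex', hT', hout⟩ := runs_evProgram (s := solver) (e := e) hI hU' hD x
    refine ⟨T', τ, hex', ?_, by rw [hout]; simp only [decide_eq_true_eq]⟩
    calc (T' : ℝ) ≤ (budget (I.k * (L.length + 1)) (64 * (I.m * I.dim)) (3 * e + 10) : ℕ) := by
          exact_mod_cast hT'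
      _ = I.k * ((L.length + 1 : ℕ) : ℝ) *
          (64 ^ (3 * e + 10) * (I.m * I.dim : ℝ) ^ (3 * e + 10)) := by
        unfold budget
        push_cast
        rw [mul_pow]
      _ ≤ I.k * (9 * I.dim * (1 + Γ)) *
          (64 ^ (3 * e + 10) * (I.m * I.dim : ℝ) ^ (3 * e + 10)) := by gcongr
      _ = I.k * (1 + Γ) * (9 * 64 ^ (3 * e + 10) *
          ((1 * I.dim) * (I.m * I.dim : ℝ) ^ (3 * e + 10))) := by ring
      _ ≤ I.k * (1 + Γ) * (9 * 64 ^ (3 * e + 10) *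
          ((I.m * I.dim) * (I.m * I.dim : ℝ) ^ (3 * e + 10))) := by gcongr
      _ = I.k * (1 + Γ) * (9 * 64 ^ (3 * e + 10) * (I.m * I.dim : ℝ) ^ (3 * e + 11)) := by ring
      _ ≤ _ := by
        refine mul_le_mul_of_nonneg_left (mul_pow_le_mul_pow hmd (le_trans ?_ hCr) (by omega))
          (by positivity)
        have : (64 : ℝ) ^ (3 * e + 10) ≤ 64 ^ (3 * e + 15) :=
          pow_le_pow_right₀ (by norm_num) (by omega)
        have : (0 : ℝ) < 64 ^ (3 * e + 10) := by positivity
        linarith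

end ICF

/-! ### Assembly of the running time and the guarantees -/

theorem theorem1 :
    -- running time: one program for the algorithm and one that evaluates the returned selector
    (∃ icf ev : ICF.Prog, ∀ e : ℕ, ∃ C : ℕ, ∀ (d : ℕ) (I : ICF.Input d) (solver : ICF.Solver),
      I.Admissible →
      ∃ (T : ℕ) (σ : ICF.Mem) (s : ICF.Pt d → Bool),
        (I.equip solver e).Exec icf I.mem T σ ∧
        (T : ℝ) ≤ (I.k : ℝ) * (C * ((I.m : ℝ) * (I.n : ℝ) * ((d : ℝ) + 1) ^ I.deg) ^ C) ∧
        I.IsOutput s ∧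
        (σ.desc.length : ℝ) ≤ (I.k : ℝ) * (1 + √(I.β * I.R ^ 3 / I.ε ^ 5)) *
          (C * ((I.m : ℝ) * ((d : ℝ) + 1) ^ I.deg) ^ C) ∧
        ICF.Computes (I.equip solver e) ev σ.desc s
          ((I.k : ℝ) * (1 + √(I.β * I.R ^ 3 / I.ε ^ 5)) *
            (C * ((I.m : ℝ) * ((d : ℝ) + 1) ^ I.deg) ^ C))) ∧
    -- guarantees for whatever selector the algorithm returns
    (∃ C : ℕ, ∀ (d ℓ k : ℕ) (A R β ε δ : ℝ) (f : Fin k → ICF.Pt d → Bool)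
      (D D' : MeasureTheory.Measure (ICF.Pt d))
      [MeasureTheory.IsProbabilityMeasure D] [MeasureTheory.IsProbabilityMeasure D']
      (m n : ℕ),
      1 ≤ d → 1 ≤ ℓ → 1 ≤ k → 1 ≤ A → 1 < R → 0 < β → 0 < ε → ε < 1 → 0 < δ → δ < 1 →
      (∀ i, Measurable (f i)) → ICF.Hypercontractive A D → 1 ≤ m → 1 ≤ n →
      C * (R + β + A ^ ℓ + ((d : ℝ) + 1) ^ ℓ + 1 / ε + Real.log (k / δ) ^ ℓ) ^ C ≤ (m : ℝ) →
      C * (R + β + A ^ ℓ + ((d : ℝ) + 1) ^ ℓ + 1 / ε + Real.log (k / δ) ^ ℓ) ^ C ≤ (n : ℝ) →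
      (∀ p : Fin k → MvPolynomial (Fin d) ℝ, (∀ i, (p i).totalDegree ≤ ℓ) →
        (∀ i, ∫ x, MvPolynomial.eval x (p i) ^ 2 ∂D ≤ β) →
        ((MeasureTheory.Measure.pi fun _ : Fin m => D).prod
            (MeasureTheory.Measure.pi fun _ : Fin n => D'))
          {ω | ¬ ∀ s : ICF.Pt d → Bool,
            (ICF.Input.mk ℓ k m n R β ε f ω.1 ω.2).IsOutput s →
            ∀ i, MeasureTheory.Integrable
                (fun x => ICF.bval (f i x) * MvPolynomial.eval x (p i) * ICF.bval (s x)) D' ∧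
              ∫ x, ICF.bval (f i x) * MvPolynomial.eval x (p i) * ICF.bval (s x) ∂D' ≤
                (R + ε) * (1 + ε) * (∫ x, ICF.bval (f i x) * |MvPolynomial.eval x (p i)| ∂D)
                  + 2 * ε}
          ≤ ENNReal.ofReal δ) ∧
      ((MeasureTheory.Measure.pi fun _ : Fin m => D).prod
          (MeasureTheory.Measure.pi fun _ : Fin n => D'))
        {ω | ¬ ∀ s : ICF.Pt d → Bool,
          (ICF.Input.mk ℓ k m n R β ε f ω.1 ω.2).IsOutput s →
          D.real {x | s x = false} ≤ min ((1 + ε) / R) ((ICF.tvDist D D' + ε) / (R - 1))}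
        ≤ ENNReal.ofReal δ) := by
  -- The sum of the parameters plays the role of `Q`. As factor and exponent coincide, `80 * Q ^ 80
  -- ≤ m` is assumed, of which only `Q ^ 80 ≤ m` is used.
  refine ⟨?_, 80, ?_⟩
  · exact ICF.running_time
  · intro d ℓ k A R β ε δ f D D' _ _ m n hd hl hk hA hR hβ hε hε1 hδ hδ1 hf hD _ _ hm hn
    have h := ICF.Scale.of_sum hd hl hk hA hR hβ hε hε1 hδ hδ1
    have hpow := pow_nonneg h.Q_pos.le 80
    push_cast at hm hn
    have hm' := (le_mul_of_one_le_left hpow (by norm_num)).trans hm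
    have hn' := (le_mul_of_one_le_left hpow (by norm_num)).trans hn
    exact ⟨fun p hp hpβ => ICF.chow_guarantee h hm' hn' hf hD p hp hpβ,
      ICF.rejection_guarantee h hm' hn' hf hD⟩
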